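/- Let $k,\ell$ be integers with $0\le \ell\le 2k-1$. Graphs are finite multigraphs, possibly with loops. A graph is $(k,\ell)$-sparse if each of its subgraphs with $n'$ vertices and $m'\ge 1$ edges satisfies $m'\le kn'-\ell$; a sparse graph with $n$ vertices and exactly $kn-\ell$ edges is tight. A map-graph is a graph that has an orientation with out-degree exactly one at every vertex. A $(k,\ell)$-maps-and-trees is an edge-disjoint union of $\ell$ spanning trees and $k-\ell$ map-graphs. An $\ell\mathsf{T}k$ decomposition is a decomposition into $\ell$ edge-disjoint (not necessarily spanning) trees such that each vertex is in exactly $k$ of them; it is proper if every subgraph $G'$ having an edge or at least two vertices contains at least $\ell$ tree-pieces, i.e. connected components of the subgraphs that the trees induce in $G'$. The $(k,\ell)$-pebble game with colors starts with no edges and one pebble of each color $c_1,\dots,c_k$ on each of $n$ vertices. Its moves are as follows. Add-edge: if there are at least $\ell+1$ pebbles on $\{v,w\}$ and there is one on $v$, add the directed edge $vw$ and move a pebble from $v$ onto it. Pebble-slide: if there is a pebble $p$ on $w$ and $vw$ is an edge, replace $vw$ by $wv$, put the pebble that was on $vw$ on $v$, and put $p$ on $wv$. An edge has the color of the pebble on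 it. A construction, i.e. a finite sequence of moves, is canonical if every add-edge move covers the new edge with a color present on both ends (which are then distinct) if there is one, and otherwise with the highest numbered color present on the ends, and no pebble-slide creates a monochromatic cycle, i.e. a cycle in some color that was not a cycle in that color before. There is an algorithm (a random access machine program with unit-cost operations) that for all such $k,\ell$ and every graph $G$ with $n$ vertices and $m$ edges finds a canonical $(k,\ell)$-pebble game construction of a maximum-size $(k,\ell)$-sparse subgraph $H$ of $G$ with $V(H)=V(G)$, and outputs the moves and the final configuration ($H$ with its orientation, its coloring and the positions of the remaining pebbles). For fixed $k,\ell$ it runs in time $O(n^2+m)$, hence in time $O(n^2)$ if $m=O(n^2)$, and in space $O(n^2)$ including the output but not the read-only input, with all numbers of size $O(n^2+m)$. The color classes of $H$ are a decomposition of $H$ into $k$ edge-disjoint $(1,0)$-sparse graphs such that every subgraph of $H$ with an edge or at least two vertices contains at least $\ell$ tree-pieces, i.e. connected components without a cycle of the color classes restricted to the subgraph. The colors $c_1,\dots,c_\ell$ are forests if $\ell\le k$, and all colors are forests if $k\le\ell$. If $H$ is tight, then: (a) for $0\le\ell\le k$, the color classes are a $(k,\ell)$-maps-and-trees decomposition of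 $H$, in which the colors $c_1,\dots,c_\ell$ are the spanning trees and the other colors are the map-graphs; (b) for $k\le\ell\le 2k-1$, the monochromatic connected components of $H$ (single vertices included) form a proper $\ell\mathsf{T}k$ decomposition of $H$. -/

import Mathlib

namespace PebbleGame

/-! ## Multigraphs

A finite multigraph, loops and parallel edges allowed, with vertex set `V` and edge set `E` is given
by its end map `ends : E → Sym2 V`.  Subgraphs are given by finsets of vertices and of edges. -/

section Multigraph

variable {V E : Type*}

/-- The edges in `F` lying inside the vertex set `U`. -/
noncomputable def spanned (ends : E → Sym2 V) (F : Finset E) (U : Finset V) : Finset E :=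
  open Classical in F.filter fun e => ∀ x ∈ ends e, x ∈ U

/-- `(U, F')` is a subgraph of the graph with edge set `F`. -/
def IsSubgraph (ends : E → Sym2 V) (F : Finset E) (U : Finset V) (F' : Finset E) : Prop :=
  F' ⊆ F ∧ ∀ e ∈ F', ∀ x ∈ ends e, x ∈ U

/-- `(k, ℓ)`-sparsity: each subgraph that has an edge has at most `k n' - ℓ` edges, where `n'` is
its number of vertices. -/
def IsSparse (ends : E → Sym2 V) (k ℓ : ℕ) (F : Finset E) : Prop :=
  ∀ (U : Finset V) (F' : Finset E), IsSubgraph ends F U F' → F'.Nonempty →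
    F'.card + ℓ ≤ k * U.card

/-- `(k, ℓ)`-tightness of the graph with vertex set `V` and edge set `F`. -/
def IsTight [Fintype V] (ends : E → Sym2 V) (k ℓ : ℕ) (F : Finset E) : Prop :=
  IsSparse ends k ℓ F ∧ F.card + ℓ = k * Fintype.card V

/-- A sparse edge set with the maximum number of edges. -/
def IsMaximumSparse (ends : E → Sym2 V) (k ℓ : ℕ) (F : Finset E) : Prop :=
  IsSparse ends k ℓ F ∧ ∀ F' : Finset E, IsSparse ends k ℓ F' → F'.card ≤ F.card

/-- `x` and `y` are joined by a walk using edges in `F` (of any orientation). -/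
def Linked (ends : E → Sym2 V) (F : Finset E) (x y : V) : Prop :=
  Relation.ReflTransGen (fun a b => ∃ e ∈ F, ends e = s(a, b)) x y

/-- `C` is the edge set of a cycle `v 0, f 0, v 1, f 1, …, v r, f r, v 0` with distinct vertices and
distinct edges.  A loop is a cycle with one edge and two parallel edges form a cycle.  The index
`i + 1` wraps around in `Fin (r + 1)`. -/
def IsCycle (ends : E → Sym2 V) (C : Finset E) : Prop :=
  ∃ (r : ℕ) (v : Fin (r + 1) → V) (f : Fin (r + 1) → E),
    Function.Injective v ∧ Function.Injective f ∧
    (∀ i, ends (f i) = s(v i, v (i + 1))) ∧ (∀ e, e ∈ C ↔ ∃ i, f i = e)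

/-- `F` has no cycles. -/
def IsForest (ends : E → Sym2 V) (F : Finset E) : Prop :=
  ∀ C : Finset E, C ⊆ F → ¬ IsCycle ends C

/-- The graph with vertex set `T` and edge set `A` is a tree (possibly a single vertex). -/
structure IsTree (ends : E → Sym2 V) (T : Finset V) (A : Finset E) : Prop where
  nonempty : T.Nonempty
  inside : ∀ e ∈ A, ∀ x ∈ ends e, x ∈ T
  connected : ∀ x ∈ T, ∀ y ∈ T, Linked ends A x y
  acyclic : IsForest ends A

/-- The graph with vertex set `V` and edge set `F` is a map-graph: it has an orientation (a choice
of a tail among the ends of each edge) with out-degree exactly one at each vertex. -/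
def IsMapGraph (ends : E → Sym2 V) (F : Finset E) : Prop :=
  ∃ tail : E → V, (∀ e ∈ F, tail e ∈ ends e) ∧ ∀ x : V, ∃! e, e ∈ F ∧ tail e = x

/-- The vertex sets of the connected components of the graph with vertex set `U` and edge set `F`,
where all edges in `F` lie inside `U`. -/
noncomputable def pieces (ends : E → Sym2 V) (U : Finset V) (F : Finset E) :
    Finset (Finset V) :=
  open Classical in U.image fun x => U.filter fun y => Linked ends F x y

/-- The connected components without cycles. -/
noncomputable def treePieces (ends : E → Sym2 V) (U : Finset V) (F : Finset E) :
    Finset (Finset V) :=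
  open Classical in (pieces ends U F).filter fun T => IsForest ends (spanned ends F T)

/-- The parts `part i` (`i < k`) are a decomposition of the graph `(V, F)` into `ℓ` spanning trees
(the first `ℓ` parts) and `k - ℓ` map-graphs (the other parts), all edge-disjoint. -/
structure IsMapsAndTrees [Fintype V] (ends : E → Sym2 V) (F : Finset E) (k ℓ : ℕ)
    (part : Fin k → Finset E) : Prop where
  disjoint : Pairwise fun i j => Disjoint (part i) (part j)
  cover : ∀ e, e ∈ F ↔ ∃ i, e ∈ part i
  tree : ∀ i : Fin k, (i : ℕ) < ℓ → IsTree ends Finset.univ (part i)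
  map : ∀ i : Fin k, ℓ ≤ (i : ℕ) → IsMapGraph ends (part i)

/-- The `ℓ` graphs `(T j, A j)` are a proper `ℓTk` decomposition of the graph `(V, F)`: they are
edge-disjoint trees that cover `F`, each vertex is in exactly `k` of them, and each subgraph
`(U, F')`, other than a single vertex without edges or the empty graph, contains at least `ℓ` pieces
of the trees. -/
structure IsProperTreeDecomposition (ends : E → Sym2 V) (F : Finset E) (k ℓ : ℕ)
    (T : Fin ℓ → Finset V) (A : Fin ℓ → Finset E) : Prop where
  tree : ∀ j, IsTree ends (T j) (A j)
  disjoint : Pairwise fun i j => Disjoint (A i) (A j)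
  cover : ∀ e, e ∈ F ↔ ∃ j, e ∈ A j
  multiplicity : ∀ x : V, Nat.card {j : Fin ℓ // x ∈ T j} = k
  proper : open Classical in ∀ (U : Finset V) (F' : Finset E), IsSubgraph ends F U F' →
    (F'.Nonempty ∨ 2 ≤ U.card) → ℓ ≤ ∑ j, (pieces ends (T j ∩ U) (A j ∩ F')).card

/-- The parts `part i` (`i < k`) are a decomposition of the graph with edge set `F` into `k`
edge-disjoint `(1, 0)`-sparse subgraphs such that each subgraph `(U, F')`, other than a single vertex
without edges or the empty graph, contains at least `ℓ` tree-pieces. -/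
structure IsPebbleDecomposition (ends : E → Sym2 V) (F : Finset E) (k ℓ : ℕ)
    (part : Fin k → Finset E) : Prop where
  disjoint : Pairwise fun i j => Disjoint (part i) (part j)
  cover : ∀ e, e ∈ F ↔ ∃ i, e ∈ part i
  sparse : ∀ i, IsSparse ends 1 0 (part i)
  pieces_le : open Classical in ∀ (U : Finset V) (F' : Finset E), IsSubgraph ends F U F' →
    (F'.Nonempty ∨ 2 ≤ U.card) → ℓ ≤ ∑ i, (treePieces ends U (part i ∩ F')).card

end Multigraph

/-! ## The pebble game with colors

The player builds a directed graph `H` whose underlying graph is a subgraph of the input graph.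
The `k` colors are the elements of `Fin k`, numbered in increasing order. -/

section Game

variable {V E : Type*} {k : ℕ}

/-- A configuration of the game: `edge e` is `none` if `e` is not in `H`, and it is `some (v, w, i)`
if `e` is in `H`, directed from `v` to `w`, with a pebble of color `i` on it; `peb v i` is the number
of pebbles of color `i` on the vertex `v`. -/
@[ext] structure Config (V E : Type*) (k : ℕ) where
  edge : E → Option (V × V × Fin k)
  peb : V → Fin k → ℕ

/-- No edges, and one pebble of each color on each vertex. -/
def Config.initial (V E : Type*) (k : ℕ) : Config V E k where
  edge _ := none
  peb _ _ := 1

/-- The edges of `H`. -/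
noncomputable def Config.edges [Fintype E] (c : Config V E k) : Finset E :=
  open Classical in Finset.univ.filter fun e => c.edge e ≠ none

/-- The edge `e` is in `H` and has color `i`. -/
def Config.HasColor (c : Config V E k) (i : Fin k) (e : E) : Prop :=
  ∃ v w, c.edge e = some (v, w, i)

/-- The edges of `H` of color `i`. -/
noncomputable def Config.colorClass [Fintype E] (c : Config V E k) (i : Fin k) : Finset E :=
  open Classical in Finset.univ.filter fun e => c.HasColor i e

/-- The number of pebbles on the vertex set `{v, w}` (a single vertex if `v = w`). -/
def Config.pebOn [DecidableEq V] (c : Config V E k) (v w : V) : ℕ :=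
  ∑ x ∈ ({v, w} : Finset V), ∑ i, c.peb x i

/-- `add e v i`: add the edge `e`, directed out of `v`, covered with a pebble of color `i` from `v`.
`slide e w i`: reverse the edge `e`, whose head is `w`, using a pebble of color `i` on `w`. -/
inductive Move (V E : Type*) (k : ℕ)
  | add (e : E) (v : V) (i : Fin k)
  | slide (e : E) (w : V) (i : Fin k)

/-- Remove one pebble of color `i` from `v`. -/
def takePebble [DecidableEq V] (peb : V → Fin k → ℕ) (v : V) (i : Fin k) : V → Fin k → ℕ :=
  Function.update peb v (Function.update (peb v) i (peb v i - 1))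

/-- Put one pebble of color `i` on `v`. -/
def putPebble [DecidableEq V] (peb : V → Fin k → ℕ) (v : V) (i : Fin k) : V → Fin k → ℕ :=
  Function.update peb v (Function.update (peb v) i (peb v i + 1))

/-- Canonical choice of the color `i` in an add-edge move: a color that is on both (distinct) ends if
there is one, and otherwise the highest numbered color present on the ends. -/
def CanonicalColor (c : Config V E k) (v w : V) (i : Fin k) : Prop :=
  (v ≠ w ∧ 0 < c.peb v i ∧ 0 < c.peb w i) ∨
  ((¬ ∃ j, v ≠ w ∧ 0 < c.peb v j ∧ 0 < c.peb w j) ∧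
    ∀ j, (0 < c.peb v j ∨ 0 < c.peb w j) → j ≤ i)

/-- Every monochromatic cycle of `c'` has been a cycle of the same color in `c`. -/
def NoCycleCreated (ends : E → Sym2 V) (c c' : Config V E k) : Prop :=
  ∀ (C : Finset E) (i : Fin k), IsCycle ends C →
    (∀ e ∈ C, c'.HasColor i e) → ∀ e ∈ C, c.HasColor i e

/-- The canonical moves of the `(k, ℓ)`-pebble game with colors on edges of the given graph. -/
inductive CanonicalStep [DecidableEq V] [DecidableEq E] (ends : E → Sym2 V) (ℓ : ℕ) :
    Config V E k → Move V E k → Config V E k → Prop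
  | add (c : Config V E k) (e : E) (v w : V) (i : Fin k)
      (h_ends : ends e = s(v, w)) (h_new : c.edge e = none)
      (h_peb : ℓ + 1 ≤ c.pebOn v w) (h_pos : 0 < c.peb v i)
      (h_canonical : CanonicalColor c v w i) :
      CanonicalStep ends ℓ c (.add e v i)
        { edge := Function.update c.edge e (some (v, w, i))
          peb := takePebble c.peb v i }
  | slide (c : Config V E k) (e : E) (v w : V) (i j : Fin k)
      (h_edge : c.edge e = some (v, w, j)) (h_pos : 0 < c.peb w i)
      (h_canonical : NoCycleCreated ends c
        { edge := Function.update c.edge e (some (w, v, i))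
          peb := putPebble (takePebble c.peb w i) v j }) :
      CanonicalStep ends ℓ c (.slide e w i)
        { edge := Function.update c.edge e (some (w, v, i))
          peb := putPebble (takePebble c.peb w i) v j }

/-- The list of moves leads from `c` to `c'` by canonical moves. -/
def CanonicalPlay [DecidableEq V] [DecidableEq E] (ends : E → Sym2 V) (ℓ : ℕ) :
    Config V E k → List (Move V E k) → Config V E k → Prop
  | c, [], c' => c = c'
  | c, mv :: mvs, c' => ∃ d, CanonicalStep ends ℓ c mv d ∧ CanonicalPlay ends ℓ d mvs c'

/-- The list of moves is a canonical pebble game construction with final configuration `c`. -/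
def IsCanonicalConstruction [DecidableEq V] [DecidableEq E] (ends : E → Sym2 V) (ℓ : ℕ)
    (mvs : List (Move V E k)) (c : Config V E k) : Prop :=
  CanonicalPlay ends ℓ (Config.initial V E k) mvs c

end Game

/-! ## Random access machines

Structured programs for a random access machine with finitely many registers in use, a memory of
cells `0, 1, 2, …` that hold `0` at the start, a read-only input and an output tape.  Each elementary
command and each test takes one unit of time. -/

section Machine

/-- Programs.  In `arith`, `load`, …, the arguments are names of registers. -/
inductive Prog
  | skip
  /-- `r := v` for a constant `v` -/
  | const (r v : ℕ)
  /-- `r := a + b` -/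
  | add (r a b : ℕ)
  /-- `r := a - b`, or `0` if `a < b` -/
  | sub (r a b : ℕ)
  /-- `r := a * b` -/
  | mul (r a b : ℕ)
  /-- `r := input[a]`, or `0` beyond the end of the input -/
  | input (r a : ℕ)
  /-- `r := memory[a]` -/
  | load (r a : ℕ)
  /-- `memory[a] := b` -/
  | store (a b : ℕ)
  /-- append `a` to the output -/
  | emit (a : ℕ)
  | seq (p q : Prog)
  /-- `if a < b then p else q` -/
  | ifLt (a b : ℕ) (p q : Prog)
  /-- `while a < b do p` -/
  | whileLt (a b : ℕ) (p : Prog)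

/-- The state of the machine, together with its use of resources up to now: `time` is the number of
elementary commands and tests, `space` is the least number such that all the memory cells that have
been read or written have addresses below it, and `peak` is the largest number that has been written
to a register (so memory, addresses and output are bounded by it, too). -/
@[ext] structure State where
  reg : ℕ → ℕ
  mem : ℕ → ℕ
  out : List ℕ
  time : ℕ
  space : ℕ
  peak : ℕ

/-- All registers and memory cells are zero, and the output is empty. -/
def State.start : State where
  reg _ := 0
  mem _ := 0
  out := []
  time := 0
  space := 0
  peak := 0

/-- Pass one unit of time. -/
def State.tick (s : State) : State := { s with time := s.time + 1 }

/-- Write `v` to the register `r`. -/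
def State.setReg (s : State) (r v : ℕ) : State :=
  { s with reg := Function.update s.reg r v, peak := max s.peak v }

/-- Write `v` to the memory cell `a`. -/
def State.setMem (s : State) (a v : ℕ) : State :=
  { s with mem := Function.update s.mem a v }

/-- Record an access to the memory cell `a`. -/
def State.touch (s : State) (a : ℕ) : State := { s with space := max s.space (a + 1) }

/-- Append `v` to the output. -/
def State.write (s : State) (v : ℕ) : State := { s with out := s.out ++ [v] }

/-- `Exec inp p s s'`: on the input `inp`, the program `p`, started in the state `s`, halts in the
state `s'`. -/
inductive Exec (inp : List ℕ) : Prog → State → State → Prop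
  | skip (s : State) : Exec inp .skip s s.tick
  | const (s : State) (r v : ℕ) : Exec inp (.const r v) s (s.tick.setReg r v)
  | add (s : State) (r a b : ℕ) :
      Exec inp (.add r a b) s (s.tick.setReg r (s.reg a + s.reg b))
  | sub (s : State) (r a b : ℕ) :
      Exec inp (.sub r a b) s (s.tick.setReg r (s.reg a - s.reg b))
  | mul (s : State) (r a b : ℕ) :
      Exec inp (.mul r a b) s (s.tick.setReg r (s.reg a * s.reg b))
  | input (s : State) (r a : ℕ) :
      Exec inp (.input r a) s (s.tick.setReg r (inp.getD (s.reg a) 0))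
  | load (s : State) (r a : ℕ) :
      Exec inp (.load r a) s ((s.tick.touch (s.reg a)).setReg r (s.mem (s.reg a)))
  | store (s : State) (a b : ℕ) :
      Exec inp (.store a b) s ((s.tick.touch (s.reg a)).setMem (s.reg a) (s.reg b))
  | emit (s : State) (a : ℕ) : Exec inp (.emit a) s (s.tick.write (s.reg a))
  | seq {p q : Prog} {s s' s'' : State} (hp : Exec inp p s s') (hq : Exec inp q s' s'') :
      Exec inp (.seq p q) s s''
  | if_true {a b : ℕ} {p q : Prog} {s s' : State} (h : s.reg a < s.reg b)
      (hp : Exec inp p s.tick s') : Exec inp (.ifLt a b p q) s s'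
  | if_false {a b : ℕ} {p q : Prog} {s s' : State} (h : ¬ s.reg a < s.reg b)
      (hq : Exec inp q s.tick s') : Exec inp (.ifLt a b p q) s s'
  | while_true {a b : ℕ} {p : Prog} {s s' s'' : State} (h : s.reg a < s.reg b)
      (hp : Exec inp p s.tick s') (hw : Exec inp (.whileLt a b p) s' s'') :
      Exec inp (.whileLt a b p) s s''
  | while_false {a b : ℕ} {p : Prog} {s : State} (h : ¬ s.reg a < s.reg b) :
      Exec inp (.whileLt a b p) s s.tick

end Machine

/-! ## Input and output -/

section Encoding

variable {n m k : ℕ}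

/-- The multigraph with vertices `0, …, n - 1` and the given list of edges. -/
def endsOf (edge : Fin m → Fin n × Fin n) : Fin m → Sym2 (Fin n) :=
  fun e => s((edge e).1, (edge e).2)

/-- The input `k, ℓ, n, m` followed by the two ends of each edge. -/
def encodeInput (k ℓ : ℕ) (edge : Fin m → Fin n × Fin n) : List ℕ :=
  [k, ℓ, n, m] ++ (List.ofFn edge).flatMap fun p => [(p.1 : ℕ), (p.2 : ℕ)]

/-- Moves are written as `0, e, v, i` (add-edge) or `1, e, w, i` (pebble-slide). -/
def encodeMove : Move (Fin n) (Fin m) k → List ℕ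
  | .add e v i => [0, (e : ℕ), (v : ℕ), (i : ℕ)]
  | .slide e w i => [1, (e : ℕ), (w : ℕ), (i : ℕ)]

/-- `out` is a complete description of the configuration `c`: it lists, in some order and each of
them once, the edges `e` of `H` with tail `v` and color `i`, as `2, e, v, i`, and then, again in some
order, the pebbles of color `i` on vertices `v`, as `3, v, i, 0`. -/
def DescribesConfig (c : Config (Fin n) (Fin m) k) (out : List ℕ) : Prop :=
  ∃ (L : List (Fin m × Fin n × Fin k)) (Q : List (Fin n × Fin k)),
    L.Nodup ∧
    (∀ e v i, (e, v, i) ∈ L ↔ ∃ w, c.edge e = some (v, w, i)) ∧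
    (∀ v i, Q.count (v, i) = c.peb v i) ∧
    out = (L.flatMap fun t => [2, (t.1 : ℕ), (t.2.1 : ℕ), (t.2.2 : ℕ)]) ++
      Q.flatMap fun t => [3, (t.1 : ℕ), (t.2 : ℕ), 0]

end Encoding

end PebbleGame

/-! The combinatorial half rests on one invariant: in each configuration of the game, every slot,
that is, every pair of a vertex and a color, holds either one pebble or one outgoing edge
(`Config.IsValid`). Counting the slots of a vertex set `U` gives `k |U|` as the number of edges
spanned by `U` plus the number of free slots, those without an edge that stays inside `U`
(`card_spanned_add_card_freeSlots`). Pebbles are free slots, so `ℓ + 1` pebbles on the ends of a new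
edge keep the graph sparse.

In a color class every vertex has at most one outgoing edge. So a monochromatic cycle is directed
(`IsCycle.mem_of_closed`) and avoids the vertices with a pebble of its color. An edge added in a
color present on both ends thus closes no cycle. If there is no such color, then `ℓ + 1` pebbles
have distinct colors and the highest one is not among the first `ℓ`. This gives the forests
(`Config.IsGood.step`). A connected graph has at least as many edges as vertices, or one less if it
is a tree. Summing this over the components of each color inside a subgraph and comparing with
sparsity gives the `ℓ` tree-pieces. If `H` is tight, exactly `ℓ` pebbles remain, and each component
of a forest color contains exactly one pebble of this color (`exists_root`, `root_unique`). This
yields both decompositions.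

The algorithmic half has two main points. The first is to bring a pebble to an end of the new edge
by canonical slides in linear time. A backward search from the pebbles gives a path from the end to
a pebble, but sliding along this path may create cycles. Instead, slots are labeled and stamped:
from each vertex of the path in turn, the outgoing edges of each color are followed until a labeled
slot or a pebble is met. The pebble then goes back to slots of smaller stamps, either along an edge
of its own color or, where a walk of this color began, along the path edge, whose tail belongs to a
set that the edges of this color do not leave (`IsSliding.slide`). Neither kind of slide closes a
cycle.

The second point is that `O(n)` attempts to add an edge suffice, although there may be far more
edges. For each vertex `v` the ends `w` are scanned, and those known to share a tight set with `v`
are stamped and skipped. A failed attempt for `v ≠ w` yields the largest tight set that contains `v`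
and `w`, namely the vertices that the search has not visited. It contains a neighbor of `v` in `H`
that was not stamped before (`IsScan.stamp`), so failures are charged to pairs of neighbors, of
which there are at most twice as many as edges of `H`. Of parallel edges only `2 k + 1` are kept.
The result is of maximum size because the ends of each missing edge lie in a tight set
(`IsSparse.isMaximumSparse`).

For the machine, a small language with arrays is given weakest preconditions that bound the time as
well, and `Cmd.wp_sound` transfers them to compiled programs. -/

namespace PebbleGame
open Finset

/-! ### Sparse edge sets and tight vertex sets -/

section Sparsity

variable {V E : Type*} {ends : E → Sym2 V} {k ℓ : ℕ} {F F' : Finset E} {U U₁ U₂ : Finset V}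

theorem mem_spanned {e : E} : e ∈ spanned ends F U ↔ e ∈ F ∧ ∀ x ∈ ends e, x ∈ U := by
  classical simp [spanned]

theorem spanned_subset : spanned ends F U ⊆ F := fun _ he => (mem_spanned.1 he).1

theorem isSubgraph_spanned : IsSubgraph ends F U (spanned ends F U) :=
  ⟨spanned_subset, fun _ he => (mem_spanned.1 he).2⟩

theorem IsSubgraph.subset_spanned (h : IsSubgraph ends F U F') : F' ⊆ spanned ends F U :=
  fun e he => mem_spanned.2 ⟨h.1 he, h.2 e he⟩

theorem spanned_mono (h : F ⊆ F') : spanned ends F U ⊆ spanned ends F' U :=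
  fun _ he => mem_spanned.2 ⟨h (mem_spanned.1 he).1, (mem_spanned.1 he).2⟩

/-- Among the subgraphs on a given vertex set the induced one has the most edges, so the others need
not be tested. -/
theorem isSparse_iff : IsSparse ends k ℓ F ↔
    ∀ U, (spanned ends F U).Nonempty → (spanned ends F U).card + ℓ ≤ k * U.card := by
  refine ⟨fun h U hU => h U _ isSubgraph_spanned hU, fun h U F' hs hne => ?_⟩
  have := h U (hne.mono hs.subset_spanned)
  have := card_le_card hs.subset_spanned
  omega

theorem IsSparse.le_of_mem (hF : IsSparse ends k ℓ F) {e : E} (he : e ∈ F)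
    (hU : ∀ x ∈ ends e, x ∈ U) : (spanned ends F U).card + ℓ ≤ k * U.card :=
  isSparse_iff.1 hF U ⟨e, mem_spanned.2 ⟨he, hU⟩⟩

/-- The bound on `ℓ` takes care of sets that span no edge, about which sparsity says nothing. -/
theorem IsSparse.card_le (hF : IsSparse ends k ℓ F) (h : ℓ ≤ k * U.card) :
    (spanned ends F U).card + ℓ ≤ k * U.card := by
  rcases (spanned ends F U).eq_empty_or_nonempty with h0 | h0
  · simpa [h0] using h
  · exact isSparse_iff.1 hF U h0

/-- The vertex set `U` spans at least `k |U| - ℓ` edges of `F`. -/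
def IsTightSet (ends : E → Sym2 V) (k ℓ : ℕ) (F : Finset E) (U : Finset V) : Prop :=
  k * U.card ≤ (spanned ends F U).card + ℓ

theorem IsTightSet.mono (h : IsTightSet ends k ℓ F U) (hF : F ⊆ F') : IsTightSet ends k ℓ F' U := by
  have := card_le_card (spanned_mono (ends := ends) (U := U) hF)
  unfold IsTightSet at *
  omega

/-- Supermodularity: an edge inside both sets lies inside the intersection, while the union may gain
edges between the two sets. -/
theorem card_spanned_add_le [DecidableEq V] :
    (spanned ends F U₁).card + (spanned ends F U₂).card ≤
      (spanned ends F (U₁ ∪ U₂)).card + (spanned ends F (U₁ ∩ U₂)).card := by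
  classical
  rw [← card_union_add_card_inter]
  refine add_le_add (card_le_card fun e he => ?_) (card_le_card fun e he => ?_)
  · simp only [mem_union, mem_spanned] at he ⊢
    rcases he with he | he
    · exact ⟨he.1, fun x hx => .inl (he.2 x hx)⟩
    · exact ⟨he.1, fun x hx => .inr (he.2 x hx)⟩
  · simp only [mem_inter, mem_spanned] at he ⊢
    exact ⟨he.1.1, fun x hx => ⟨he.1.2 x hx, he.2.2 x hx⟩⟩

/-- The number of spanned edges is supermodular and `k |U|` is modular. As the intersection spans at
most `k |U₁ ∩ U₂| - ℓ` edges, enough of them are left for the union. -/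
theorem IsTightSet.union [DecidableEq V] (hF : IsSparse ends k ℓ F) (h₁ : IsTightSet ends k ℓ F U₁)
    (h₂ : IsTightSet ends k ℓ F U₂) (h : ℓ ≤ k * (U₁ ∩ U₂).card) :
    IsTightSet ends k ℓ F (U₁ ∪ U₂) := by
  have h3 := hF.card_le h
  have h4 := card_spanned_add_le (ends := ends) (F := F) (U₁ := U₁) (U₂ := U₂)
  have h5 : k * (U₁ ∪ U₂).card + k * (U₁ ∩ U₂).card = k * U₁.card + k * U₂.card := by
    rw [← mul_add, ← mul_add, card_union_add_card_inter]
  unfold IsTightSet at *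
  omega

/-- A sparse edge set is of maximum size if the ends of each other edge lie in a tight set. -/
theorem IsSparse.isMaximumSparse [Fintype V] (hF : IsSparse ends k ℓ F)
    (h : ∀ e ∉ F, ∃ U, IsTightSet ends k ℓ F U ∧ ∀ x ∈ ends e, x ∈ U) :
    IsMaximumSparse ends k ℓ F := by
  classical
  refine ⟨hF, fun F' hF' => ?_⟩
  -- Tight sets that span no edge of the competitor `F'` are left out: there the sparsity of `F'`
  -- gives no bound, and for `k ≤ ℓ` even single vertices count as tight.
  let T : Finset (Finset V) :=
    univ.filter fun U => IsTightSet ends k ℓ F U ∧ (spanned ends F' U).Nonempty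
  let B : Finset (Finset V) := T.filter fun U => ∀ U' ∈ T, U ⊆ U' → U = U'
  have hmax : ∀ U ∈ T, ∃ U' ∈ B, U ⊆ U' := by
    intro U hU
    obtain ⟨U', hUU', hU'⟩ := T.exists_le_maximal hU
    refine ⟨U', mem_filter.2 ⟨hU'.1, fun W hW hUW => ?_⟩, hUU'⟩
    exact le_antisymm hUW (hU'.2 hW hUW)
  -- If two maximal sets share an edge of a sparse `G`, then the intersection `I` satisfies `ℓ ≤ k
  -- |I|`. So the union is tight, and by maximality both sets equal it.
  have hdisj : ∀ G : Finset E, IsSparse ends k ℓ G → Set.PairwiseDisjoint (B : Set (Finset V))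
      (fun U => spanned ends G U) := by
    intro G hG U hU W hW hne
    rw [Function.onFun, Finset.disjoint_left]
    intro e heU heW
    have hU' := mem_filter.1 hU
    have hW' := mem_filter.1 hW
    have hUT := (mem_filter.1 hU'.1).2
    have hWT := (mem_filter.1 hW'.1).2
    have hle : ℓ ≤ k * (U ∩ W).card := by
      have := hG.le_of_mem (mem_spanned.1 heU).1 (U := U ∩ W) fun x hx =>
        mem_inter.2 ⟨(mem_spanned.1 heU).2 x hx, (mem_spanned.1 heW).2 x hx⟩
      omega
    have huT : U ∪ W ∈ T := by
      refine mem_filter.2 ⟨mem_univ _, hUT.1.union hF hWT.1 hle, ?_⟩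
      obtain ⟨f, hf⟩ := hUT.2
      rw [mem_spanned] at hf
      exact ⟨f, mem_spanned.2 ⟨hf.1, fun x hx => mem_union_left _ (hf.2 x hx)⟩⟩
    exact hne ((hU'.2 _ huT subset_union_left).trans (hW'.2 _ huT subset_union_right).symm)
  let S : Finset E → Finset E := fun G => B.biUnion fun U => spanned ends G U
  have hsplit : ∀ G : Finset E, G.card = (S G).card + (G \ S G).card := by
    intro G
    have : S G ⊆ G := biUnion_subset.2 fun U _ => spanned_subset
    rw [add_comm, card_sdiff_add_card_eq_card this]
  rw [hsplit F', hsplit F]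
  -- Inside the blocks `F'` obeys a bound that `F` attains. An edge of `F'` outside of all blocks
  -- belongs to `F`, as otherwise its ends would lie in a tight set and hence in a block.
  refine add_le_add ?_ (card_le_card fun e he => ?_)
  · rw [card_biUnion (hdisj F' hF'), card_biUnion (hdisj F hF)]
    refine sum_le_sum fun U hU => ?_
    have hUT := (mem_filter.1 (mem_filter.1 hU).1).2
    have := isSparse_iff.1 hF' U hUT.2
    have := hUT.1
    unfold IsTightSet at this
    omega
  · rw [mem_sdiff] at he ⊢
    have hnot : ∀ U, IsTightSet ends k ℓ F U → ¬ ∀ x ∈ ends e, x ∈ U := by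
      intro U hU hx
      obtain ⟨U', hU', hUU'⟩ := hmax U
        (mem_filter.2 ⟨mem_univ _, hU, ⟨e, mem_spanned.2 ⟨he.1, hx⟩⟩⟩)
      exact he.2 (mem_biUnion.2 ⟨U', hU', mem_spanned.2 ⟨he.1, fun x h => hUU' (hx x h)⟩⟩)
    refine ⟨by_contra fun heF => ?_, fun heS => ?_⟩
    · obtain ⟨U, hU, hx⟩ := h e heF
      exact hnot U hU hx
    · obtain ⟨U, hU, heU⟩ := mem_biUnion.1 heS
      exact hnot U (mem_filter.1 (mem_filter.1 hU).1).2.1 (mem_spanned.1 heU).2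

end Sparsity

/-! ### Connected components and tree-pieces -/

section Pieces

variable {V E : Type*} {ends : E → Sym2 V} {F F' : Finset E} {U T : Finset V}

theorem Linked.symm {x y : V} (h : Linked ends F x y) : Linked ends F y x := by
  induction h with
  | refl => exact .refl
  | tail _ hbc ih =>
    obtain ⟨e, he, hab⟩ := hbc
    exact .head ⟨e, he, hab.trans Sym2.eq_swap⟩ ih

/-- A connected vertex set spans at least one more edge for each vertex outside of a given
nonempty subset. -/
theorem card_add_card_spanned_le [DecidableEq V] (hT : ∀ x ∈ T, ∀ y ∈ T, Linked ends F x y)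
    (hF : ∀ e ∈ F, ∀ x ∈ ends e, x ∈ T) {S : Finset V} (hS : S.Nonempty) (hST : S ⊆ T) :
    T.card + (spanned ends F S).card ≤ F.card + S.card := by
  classical
  induction hn : (T \ S).card generalizing S with
  | zero =>
    have : S = T := by
      rw [card_eq_zero, sdiff_eq_empty_iff_subset] at hn
      exact hST.antisymm hn
    subst this
    have := card_le_card (spanned_subset (ends := ends) (F := F) (U := S))
    omega
  | succ n ih =>
    obtain ⟨y, hy⟩ : (T \ S).Nonempty := by rw [← card_pos]; omega
    obtain ⟨x, hx⟩ := hS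
    rw [mem_sdiff] at hy
    -- A walk from `S` to the outside has an edge that leaves `S`. Its far end is the next vertex to
    -- be included in `S`.
    have key : ∀ z, Linked ends F x z → z ∉ S → ∃ a b e, a ∈ S ∧ b ∉ S ∧ e ∈ F ∧ ends e = s(a, b) := by
      intro z hz
      induction hz with
      | refl => exact fun h => absurd hx h
      | @tail b c hab hbc ih' =>
        intro hc
        by_cases hb : b ∈ S
        · obtain ⟨e, he, h⟩ := hbc
          exact ⟨b, c, e, hb, hc, he, h⟩
        · exact ih' hb
    obtain ⟨a, b, e, ha, hb, he, hab⟩ := key y (hT x (hST hx) y hy.1) hy.2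
    have hbT : b ∈ T := hF e he b (by simp [hab])
    have h1 := ih (S := insert b S) (insert_nonempty _ _) (insert_subset hbT hST) (by
      have : T \ insert b S = (T \ S).erase b := by ext z; simp; tauto
      rw [this, card_erase_of_mem (by simp [hbT, hb]), hn]; rfl)
    rw [card_insert_of_notMem hb] at h1
    have h2 : (insert e (spanned ends F S)).card ≤ (spanned ends F (insert b S)).card := by
      refine card_le_card (insert_subset ?_ fun f hf => ?_)
      · refine mem_spanned.2 ⟨he, fun z hz => ?_⟩
        rw [hab, Sym2.mem_iff] at hz
        rcases hz with rfl | rfl <;> simp [ha]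
      · rw [mem_spanned] at hf ⊢
        exact ⟨hf.1, fun z hz => mem_insert_of_mem (hf.2 z hz)⟩
    rw [card_insert_of_notMem] at h2
    · omega
    · intro h
      exact hb ((mem_spanned.1 h).2 b (by simp [hab]))

theorem mem_pieces : T ∈ pieces ends U F ↔
    ∃ x ∈ U, ∀ y, y ∈ T ↔ y ∈ U ∧ Linked ends F x y := by
  classical
  simp only [pieces, mem_image, Finset.ext_iff, mem_filter]
  exact ⟨fun ⟨x, hx, h⟩ => ⟨x, hx, fun y => (h y).symm⟩, fun ⟨x, hx, h⟩ => ⟨x, hx, fun y => (h y).symm⟩⟩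

theorem eq_of_mem_pieces {T' : Finset V} (hT : T ∈ pieces ends U F) (hT' : T' ∈ pieces ends U F)
    {z : V} (hz : z ∈ T) (hz' : z ∈ T') : T = T' := by
  obtain ⟨x, hx, h⟩ := mem_pieces.1 hT
  obtain ⟨x', hx', h'⟩ := mem_pieces.1 hT'
  have h1 := ((h z).1 hz).2
  have h2 := ((h' z).1 hz').2
  ext y
  rw [h, h']
  exact ⟨fun hy => ⟨hy.1, (h2.trans h1.symm).trans hy.2⟩, fun hy => ⟨hy.1, (h1.trans h2.symm).trans hy.2⟩⟩

theorem exists_mem_pieces {x : V} (hx : x ∈ U) : ∃ T ∈ pieces ends U F, x ∈ T := by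
  classical
  exact ⟨U.filter fun y => Linked ends F x y, mem_image_of_mem _ hx, mem_filter.2 ⟨hx, .refl⟩⟩

/-- A walk never leaves the component of its start, so restricting the edges to the component loses
no connection. -/
theorem linked_spanned (hF : ∀ e ∈ F, ∀ x ∈ ends e, x ∈ U) (hT : T ∈ pieces ends U F) {x y : V}
    (hx : x ∈ T) (h : Linked ends F x y) : y ∈ T ∧ Linked ends (spanned ends F T) x y := by
  induction h with
  | refl => exact ⟨hx, .refl⟩
  | @tail b c _ hbc ih =>
    obtain ⟨e, he, hbc⟩ := hbc
    obtain ⟨r, hr, hT'⟩ := mem_pieces.1 hT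
    have hc : c ∈ T := (hT' c).2 ⟨hF e he c (by simp [hbc]), ((hT' b).1 ih.1).2.tail ⟨e, he, hbc⟩⟩
    refine ⟨hc, ih.2.tail ⟨e, mem_spanned.2 ⟨he, fun z hz => ?_⟩, hbc⟩⟩
    rw [hbc, Sym2.mem_iff] at hz
    rcases hz with rfl | rfl
    exacts [ih.1, hc]

theorem linked_of_mem_pieces (hF : ∀ e ∈ F, ∀ x ∈ ends e, x ∈ U) (hT : T ∈ pieces ends U F)
    {x y : V} (hx : x ∈ T) (hy : y ∈ T) : Linked ends (spanned ends F T) x y := by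
  obtain ⟨r, hr, hT'⟩ := mem_pieces.1 hT
  exact (linked_spanned hF hT hx (((hT' x).1 hx).2.symm.trans ((hT' y).1 hy).2)).2

/-- A connected graph has at least as many edges as vertices, or it is a tree, where it has at most
one edge less. -/
theorem card_le_of_mem_pieces (hF : ∀ e ∈ F, ∀ x ∈ ends e, x ∈ U) (hT : T ∈ pieces ends U F) :
    T.card ≤ (spanned ends F T).card +
      (open Classical in if IsForest ends (spanned ends F T) then 1 else 0) := by
  classical
  have hin : ∀ e ∈ spanned ends F T, ∀ x ∈ ends e, x ∈ T := fun e he => (mem_spanned.1 he).2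
  have hc : ∀ x ∈ T, ∀ y ∈ T, Linked ends (spanned ends F T) x y :=
    fun x hx y hy => linked_of_mem_pieces hF hT hx hy
  split_ifs with h
  · obtain ⟨r, hr, hT'⟩ := mem_pieces.1 hT
    have hrT : r ∈ T := (hT' r).2 ⟨hr, .refl⟩
    have := card_add_card_spanned_le hc hin (singleton_nonempty r) (singleton_subset_iff.2 hrT)
    simp only [card_singleton] at this
    omega
  -- A cycle has as many edges as vertices. Growing the component from the vertices of a cycle, with
  -- one edge for each further vertex, gives at least as many edges as vertices.
  · unfold IsForest at h
    push Not at h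
    obtain ⟨C, hC, r, v, f, hv, hf, hends, hCf⟩ := h
    have hsub : univ.image v ⊆ T := by
      intro x hx
      obtain ⟨i, _, rfl⟩ := mem_image.1 hx
      exact hin (f i) (hC ((hCf _).2 ⟨i, rfl⟩)) _ (by simp [hends])
    have h1 := card_add_card_spanned_le hc hin (univ_nonempty.image v) hsub
    have h2 : (univ.image f).card ≤ (spanned ends (spanned ends F T) (univ.image v)).card := by
      refine card_le_card fun e he => ?_
      obtain ⟨i, _, rfl⟩ := mem_image.1 he
      refine mem_spanned.2 ⟨hC ((hCf _).2 ⟨i, rfl⟩), fun x hx => ?_⟩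
      rw [hends, Sym2.mem_iff] at hx
      rcases hx with rfl | rfl <;> simp
    rw [card_image_of_injective _ hv] at h1
    rw [card_image_of_injective _ hf] at h2
    omega

/-- Only a tree-piece may have fewer edges than vertices, and then only one fewer. The components
cover `U` and share no edges, so these bounds can be added up. -/
theorem card_le_card_treePieces_add (hF : ∀ e ∈ F, ∀ x ∈ ends e, x ∈ U) :
    U.card ≤ (treePieces ends U F).card + F.card := by
  classical
  have h1 : U.card ≤ ∑ T ∈ pieces ends U F, T.card := by
    refine le_trans (card_le_card fun x hx => ?_) card_biUnion_le
    obtain ⟨T, hT, hx⟩ := exists_mem_pieces (ends := ends) (F := F) hx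
    exact mem_biUnion.2 ⟨T, hT, hx⟩
  have h2 : ∑ T ∈ pieces ends U F, (spanned ends F T).card ≤ F.card := by
    rw [← card_biUnion]
    · exact card_le_card (biUnion_subset.2 fun T _ => spanned_subset)
    · intro T hT T' hT' hne
      rw [Function.onFun, Finset.disjoint_left]
      intro e he he'
      obtain ⟨x, hx⟩ : ∃ x, x ∈ ends e := ⟨_, Sym2.out_fst_mem _⟩
      exact hne (eq_of_mem_pieces hT hT' ((mem_spanned.1 he).2 x hx) ((mem_spanned.1 he').2 x hx))
  have h3 := sum_le_sum fun T (hT : T ∈ pieces ends U F) => card_le_of_mem_pieces hF hT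
  rw [sum_add_distrib, ← card_filter] at h3
  have h4 : (treePieces ends U F).card =
      ((pieces ends U F).filter fun T => IsForest ends (spanned ends F T)).card := by
    unfold treePieces; congr!
  omega

theorem card_le_card_pieces_add (hF : ∀ e ∈ F, ∀ x ∈ ends e, x ∈ U) :
    U.card ≤ (pieces ends U F).card + F.card := by
  have h1 := card_le_card_treePieces_add hF
  have h2 : (treePieces ends U F).card ≤ (pieces ends U F).card := by
    classical
    exact card_le_card (filter_subset _ _)
  omega

end Pieces

/-! ### Cycles in graphs with out-degree at most one -/

section Cycles

variable {V E : Type*} {ends : E → Sym2 V}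

/-- Induction around a cycle: adding one repeatedly leads from `i` to every index. -/
theorem forall_of_forall_succ {r : ℕ} {p : Fin (r + 1) → Prop} (h : ∀ i, p i → p (i + 1))
    {i : Fin (r + 1)} (hi : p i) (j : Fin (r + 1)) : p j := by
  have key : ∀ t : ℕ, p (i + Fin.ofNat (r + 1) t) := by
    intro t
    induction t with
    | zero => simpa using hi
    | succ t ih =>
      have := h _ ih
      convert this using 1
      ext
      simp [Fin.val_add, add_assoc]
  have := key (j - i).val
  simpa using this

/-- If the edges of a cycle have distinct tails, then it is a directed cycle, and a set that contains
a vertex of the cycle and the heads of all edges with tails in the set contains the tails of all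
edges. -/
theorem IsCycle.mem_of_closed {C : Finset E} (hC : IsCycle ends C) {tl hd : E → V}
    (hends : ∀ e ∈ C, ends e = s(tl e, hd e)) (hinj : ∀ e ∈ C, ∀ e' ∈ C, tl e = tl e' → e = e')
    {S : V → Prop} (hS : ∀ e ∈ C, S (tl e) → S (hd e)) {e₀ : E} (he₀ : e₀ ∈ C) {x : V}
    (hx : x ∈ ends e₀) (hxS : S x) : ∀ e ∈ C, S (tl e) := by
  obtain ⟨r, v, f, hv, hf, hvf, hCf⟩ := hC
  have hfC : ∀ i, f i ∈ C := fun i => (hCf _).2 ⟨i, rfl⟩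
  have h1 : ∀ i, (tl (f i) = v i ∧ hd (f i) = v (i + 1)) ∨ (tl (f i) = v (i + 1) ∧ hd (f i) = v i) := by
    intro i
    have := (hends _ (hfC i)).symm.trans (hvf i)
    simpa [Sym2.eq_iff] using this
  have hxv : ∃ i, S (v i) := by
    obtain ⟨i, rfl⟩ := (hCf _).1 he₀
    rw [hvf, Sym2.mem_iff] at hx
    rcases hx with rfl | rfl
    exacts [⟨_, hxS⟩, ⟨_, hxS⟩]
  obtain ⟨i₀, hi₀⟩ := hxv
  have hall : ∀ i, S (v i) := by
    -- If one edge points forward, then all do: a backward edge followed by a forward one would have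
    -- the same tail, and so be the same edge. Otherwise all edges point backward, and membership in
    -- `S` is passed on in the other direction.
    by_cases hcase : ∃ i, tl (f i) = v i
    · obtain ⟨i₁, hi₁⟩ := hcase
      have hback : ∀ i, tl (f (i + 1)) = v (i + 1) → tl (f i) = v i := by
        intro i hi
        rcases h1 i with h | h
        · exact h.1
        · have := hf (hinj _ (hfC i) _ (hfC (i + 1)) (h.1.trans hi.symm))
          rw [h.1, ← this]
      have hid : ∀ i, tl (f i) = v i := by
        by_contra hcon
        push Not at hcon
        obtain ⟨j, hj⟩ := hcon
        exact forall_of_forall_succ (p := fun i => tl (f i) ≠ v i)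
          (fun i hi h => hi (hback i h)) hj i₁ hi₁
      refine fun j => forall_of_forall_succ (p := fun i => S (v i)) (fun i hi => ?_) hi₀ j
      have h2 := hS _ (hfC i) (by rw [hid]; exact hi)
      rcases h1 i with h | h
      · rwa [h.2] at h2
      · have := hv ((hid i).symm.trans h.1)
        rwa [← this]
    · push Not at hcase
      have hsw : ∀ i, tl (f i) = v (i + 1) ∧ hd (f i) = v i := fun i =>
        (h1 i).resolve_left fun h => hcase i h.1
      by_contra hcon
      push Not at hcon
      obtain ⟨j, hj⟩ := hcon
      refine forall_of_forall_succ (p := fun i => ¬ S (v i)) (fun i hi h => hi ?_) hj i₀ hi₀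
      have := hS _ (hfC i) (by rw [(hsw i).1]; exact h)
      rwa [(hsw i).2] at this
  intro e he
  obtain ⟨i, rfl⟩ := (hCf _).1 he
  rcases h1 i with h | h <;> rw [h.1] <;> exact hall _

/-- A map `g` of a finite set to itself along edges has a cycle. -/
theorem exists_isCycle_of_succ [Finite V] [Nonempty V] {P : V → Prop} {g : V → V} {f : V → E} {x : V}
    (hx : P x) (hg : ∀ x, P x → P (g x)) (hf : ∀ x, P x → ends (f x) = s(x, g x))
    (hinj : ∀ x y, P x → P y → f x = f y → x = y) :
    ∃ C : Finset E, IsCycle ends C ∧ ∀ e ∈ C, ∃ x, P x ∧ f x = e := by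
  classical
  have hit : ∀ t y, P y → P (g^[t] y) := by
    intro t
    induction t with
    | zero => exact fun y h => h
    | succ t ih => exact fun y h => by rw [Function.iterate_succ_apply]; exact ih _ (hg _ h)
  -- The orbit of `x` runs into a periodic point. The iterates over one minimal period are distinct
  -- and trace the cycle.
  obtain ⟨y, hy, hper⟩ : ∃ y, P y ∧ y ∈ Function.periodicPts g := by
    obtain ⟨a, b, hne, hab⟩ := Finite.exists_ne_map_eq_of_infinite fun t : ℕ => g^[t] x
    wlog hlt : a < b generalizing a b
    · exact this b a hne.symm hab.symm (by omega)
    refine ⟨g^[a] x, hit _ _ hx, Function.mk_mem_periodicPts (n := b - a) (by omega) ?_⟩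
    rw [Function.IsPeriodicPt, Function.IsFixedPt, ← Function.iterate_add_apply]
    rw [show b - a + a = b by omega]
    exact hab.symm
  have hpos := Function.minimalPeriod_pos_of_mem_periodicPts hper
  obtain ⟨r, hr⟩ : ∃ r, Function.minimalPeriod g y = r + 1 := ⟨_, (Nat.sub_add_cancel hpos).symm⟩
  have hvinj : Function.Injective fun i : Fin (r + 1) => g^[(i : ℕ)] y := by
    intro i j hij
    have := Function.iterate_injOn_Iio_minimalPeriod (f := g) (x := y)
      (by simp [hr, i.2] : (i : ℕ) ∈ _) (by simp [hr, j.2] : (j : ℕ) ∈ _) hij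
    exact Fin.ext this
  refine ⟨univ.image fun i : Fin (r + 1) => f (g^[(i : ℕ)] y),
    ⟨r, fun i => g^[(i : ℕ)] y, fun i => f (g^[(i : ℕ)] y), hvinj, ?_, ?_, by simp⟩, ?_⟩
  · exact fun i j hij => hvinj (hinj _ _ (hit _ _ hy) (hit _ _ hy) hij)
  · intro i
    have h3 : (i + 1 : Fin (r + 1)).val = ((i : ℕ) + 1) % (r + 1) := by
      simp [Fin.val_add]
    have h4 : ∀ t, g^[t % (r + 1)] y = g^[t] y := by
      intro t
      rw [← hr, Function.iterate_mod_minimalPeriod_eq]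
    simp only [h3, h4]
    rw [hf _ (hit _ _ hy), ← Function.iterate_succ_apply' g]
  · intro e he
    obtain ⟨i, _, rfl⟩ := mem_image.1 he
    exact ⟨_, hit _ _ hy, rfl⟩

end Cycles

end PebbleGame

namespace PebbleGame
open Finset

/-! ### Invariants of the pebble game -/

section Game

variable {V E : Type*} {k ℓ : ℕ} {ends : E → Sym2 V} {c c' : Config V E k}

/-- Each vertex has, for each color, either a pebble or an outgoing edge of this color. -/
structure Config.IsValid (ends : E → Sym2 V) (c : Config V E k) : Prop where
  peb_le : ∀ x i, c.peb x i ≤ 1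
  peb_eq_zero : ∀ e x y i, c.edge e = some (x, y, i) → c.peb x i = 0
  unique : ∀ e e' x y y' i, c.edge e = some (x, y, i) → c.edge e' = some (x, y', i) → e = e'
  exists_edge : ∀ x i, c.peb x i = 0 → ∃ e y, c.edge e = some (x, y, i)
  ends_eq : ∀ e x y i, c.edge e = some (x, y, i) → ends e = s(x, y)

/-- The tail of an edge. -/
noncomputable def Config.tail (ends : E → Sym2 V) (c : Config V E k) (e : E) : V :=
  match c.edge e with
  | some (x, _, _) => x
  | none => (ends e).out.1

/-- The head of an edge. -/
noncomputable def Config.head (ends : E → Sym2 V) (c : Config V E k) (e : E) : V :=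
  match c.edge e with
  | some (_, y, _) => y
  | none => (ends e).out.1

theorem Config.tail_eq {e x y i} (h : c.edge e = some (x, y, i)) : c.tail ends e = x := by
  simp [Config.tail, h]

theorem Config.head_eq {e x y i} (h : c.edge e = some (x, y, i)) : c.head ends e = y := by
  simp [Config.head, h]

theorem Config.mem_edges_iff_ne [Fintype E] {e : E} : e ∈ c.edges ↔ c.edge e ≠ none := by
  rw [Config.edges, mem_filter]
  simp

theorem Config.mem_edges [Fintype E] {e : E} : e ∈ c.edges ↔ ∃ x y i, c.edge e = some (x, y, i) := by
  rw [Config.mem_edges_iff_ne]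
  simp [Option.ne_none_iff_exists']

theorem Config.mem_colorClass [Fintype E] {i : Fin k} {e : E} :
    e ∈ c.colorClass i ↔ ∃ x y, c.edge e = some (x, y, i) := by
  classical
  rw [Config.colorClass, mem_filter]
  simp [Config.HasColor]

theorem mem_edges_iff_exists_colorClass [Fintype E] {e : E} :
    e ∈ c.edges ↔ ∃ i, e ∈ c.colorClass i := by
  simp only [Config.mem_edges, Config.mem_colorClass]
  exact ⟨fun ⟨x, y, i, h⟩ => ⟨i, x, y, h⟩, fun ⟨i, x, y, h⟩ => ⟨x, y, i, h⟩⟩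

theorem Config.colorClass_subset [Fintype E] (i : Fin k) : c.colorClass i ⊆ c.edges :=
  fun _ he => mem_edges_iff_exists_colorClass.2 ⟨i, he⟩

theorem Config.disjoint_colorClass [Fintype E] :
    Pairwise fun i j => Disjoint (c.colorClass i) (c.colorClass j) := by
  intro i j hij
  rw [Finset.disjoint_left]
  intro e hi hj
  obtain ⟨x, y, h⟩ := Config.mem_colorClass.1 hi
  obtain ⟨x', y', h'⟩ := Config.mem_colorClass.1 hj
  rw [h] at h'
  simp at h'
  exact hij h'.2.2

theorem mem_spanned_edges [Fintype E] (hc : c.IsValid ends) {U : Finset V} {e : E} :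
    e ∈ spanned ends c.edges U ↔ ∃ x y i, c.edge e = some (x, y, i) ∧ x ∈ U ∧ y ∈ U := by
  rw [mem_spanned, Config.mem_edges]
  constructor
  · rintro ⟨⟨x, y, i, h⟩, hU⟩
    rw [hc.ends_eq _ _ _ _ h] at hU
    exact ⟨x, y, i, h, hU x (by simp), hU y (by simp)⟩
  · rintro ⟨x, y, i, h, hx, hy⟩
    refine ⟨⟨x, y, i, h⟩, fun z hz => ?_⟩
    rw [hc.ends_eq _ _ _ _ h, Sym2.mem_iff] at hz
    rcases hz with rfl | rfl <;> assumption

/-- A slot is a pair of a vertex and a color. The free slots of `U` are those without an outgoing edge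
to `U`. -/
noncomputable def Config.freeSlots (c : Config V E k) (U : Finset V) : Finset (V × Fin k) :=
  open Classical in
  (U ×ˢ univ).filter fun p => ¬ ∃ e y, c.edge e = some (p.1, y, p.2) ∧ y ∈ U

/-- The pebbles on `U`. -/
noncomputable def Config.pebbles (c : Config V E k) (U : Finset V) : Finset (V × Fin k) :=
  open Classical in (U ×ˢ univ).filter fun p => c.peb p.1 p.2 ≠ 0

theorem Config.mem_freeSlots {U : Finset V} {p : V × Fin k} :
    p ∈ c.freeSlots U ↔ p.1 ∈ U ∧ ∀ e y, c.edge e = some (p.1, y, p.2) → y ∉ U := by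
  simp [Config.freeSlots]

theorem Config.mem_pebbles {U : Finset V} {p : V × Fin k} :
    p ∈ c.pebbles U ↔ p.1 ∈ U ∧ c.peb p.1 p.2 ≠ 0 := by
  simp [Config.pebbles]

/-- An edge occupies exactly one slot, at its tail. So the slots of `U` with an outgoing edge that
stays in `U` correspond to the spanned edges, and the other slots of `U` are the free ones. -/
theorem card_spanned_add_card_freeSlots [Fintype E] (hc : c.IsValid ends) (U : Finset V) :
    (spanned ends c.edges U).card + (c.freeSlots U).card = k * U.card := by
  classical
  have h1 := card_filter_add_card_filter_not (s := U ×ˢ (univ : Finset (Fin k)))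
    (fun p => ∃ e y, c.edge e = some (p.1, y, p.2) ∧ y ∈ U)
  have h2 : (spanned ends c.edges U).card =
      ((U ×ˢ (univ : Finset (Fin k))).filter
        fun p => ∃ e y, c.edge e = some (p.1, y, p.2) ∧ y ∈ U).card := by
    symm
    refine card_bij (fun p hp => (mem_filter.1 hp).2.choose) ?_ ?_ ?_
    · intro p hp
      obtain ⟨y, hy, hyU⟩ := (mem_filter.1 hp).2.choose_spec
      exact (mem_spanned_edges hc).2 ⟨_, _, _, hy, (mem_product.1 (mem_filter.1 hp).1).1, hyU⟩
    · intro p hp q hq hpq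
      obtain ⟨y, hy, _⟩ := (mem_filter.1 hp).2.choose_spec
      obtain ⟨z, hz, _⟩ := (mem_filter.1 hq).2.choose_spec
      rw [hpq, hz] at hy
      simp at hy
      exact Prod.ext hy.1.symm hy.2.2.symm
    · intro e he
      obtain ⟨x, y, i, h, hx, hy⟩ := (mem_spanned_edges hc).1 he
      have hp : (x, i) ∈ (U ×ˢ (univ : Finset (Fin k))).filter
          fun p => ∃ e y, c.edge e = some (p.1, y, p.2) ∧ y ∈ U :=
        mem_filter.2 ⟨by simp [hx], e, y, h, hy⟩
      refine ⟨(x, i), hp, ?_⟩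
      obtain ⟨z, hz, _⟩ := (mem_filter.1 hp).2.choose_spec
      exact hc.unique _ _ _ _ _ _ hz h
  rw [card_product, card_univ, Fintype.card_fin, mul_comm] at h1
  rw [h2, ← h1, Config.freeSlots]
  congr!

theorem Config.IsValid.pebbles_subset (hc : c.IsValid ends) {U U' : Finset V} (h : U' ⊆ U) :
    c.pebbles U' ⊆ c.freeSlots U := by
  intro p hp
  rw [Config.mem_pebbles] at hp
  refine Config.mem_freeSlots.2 ⟨h hp.1, fun e y he => ?_⟩
  exact absurd (hc.peb_eq_zero _ _ _ _ he) hp.2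

theorem card_pebbles_eq_sum (hc : c.IsValid ends) (U : Finset V) :
    (c.pebbles U).card = ∑ x ∈ U, ∑ i, c.peb x i := by
  classical
  rw [Config.pebbles, card_filter, sum_product]
  refine sum_congr rfl fun x _ => sum_congr rfl fun i _ => ?_
  have := hc.peb_le x i
  simp only
  split_ifs <;> omega

theorem card_pebbles_pair [DecidableEq V] (hc : c.IsValid ends) (v w : V) :
    (c.pebbles {v, w}).card = c.pebOn v w :=
  card_pebbles_eq_sum hc _

/-- A vertex set that no edge leaves spans as many edges as possible for its pebbles. -/
theorem card_spanned_of_closed [Fintype E] (hc : c.IsValid ends) {U U' : Finset V}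
    (hclosed : ∀ e x y i, c.edge e = some (x, y, i) → x ∈ U → y ∈ U) (hUU' : U' ⊆ U)
    (hpeb : ∀ x ∈ U, ∀ i, c.peb x i ≠ 0 → x ∈ U') :
    (spanned ends c.edges U).card + (c.pebbles U').card = k * U.card := by
  rw [← card_spanned_add_card_freeSlots hc]
  congr 2
  refine (hc.pebbles_subset hUU').antisymm fun p hp => ?_
  rw [Config.mem_freeSlots] at hp
  have h0 : c.peb p.1 p.2 ≠ 0 := by
    intro h0
    obtain ⟨e, y, he⟩ := hc.exists_edge _ _ h0
    exact hp.2 e y he (hclosed _ _ _ _ he hp.1)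
  exact Config.mem_pebbles.2 ⟨hpeb _ hp.1 _ h0, h0⟩

/-- No edge leaves a tight set, and it has no other pebbles than those on a subset with `ℓ` pebbles. -/
theorem IsTightSet.closed [Fintype E] (hc : c.IsValid ends) {U U' : Finset V}
    (hU : IsTightSet ends k ℓ c.edges U) (hUU' : U' ⊆ U) (hcard : ℓ ≤ (c.pebbles U').card) :
    (∀ e x y i, c.edge e = some (x, y, i) → x ∈ U → y ∈ U) ∧
      ∀ x ∈ U, ∀ i, c.peb x i ≠ 0 → x ∈ U' := by
  have h1 := card_spanned_add_card_freeSlots hc U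
  unfold IsTightSet at hU
  -- A tight set has at most `ℓ` free slots, and the pebbles on `U'` already account for all of
  -- them.
  have h2 : c.pebbles U' = c.freeSlots U :=
    eq_of_subset_of_card_le (hc.pebbles_subset hUU') (by omega)
  constructor
  · intro e x y i h hx
    by_contra hy
    have h3 : (x, i) ∈ c.freeSlots U := by
      refine Config.mem_freeSlots.2 ⟨hx, fun e' y' h' => ?_⟩
      have := hc.unique _ _ _ _ _ _ h h'
      subst this
      simp only [h] at h'
      simp at h'
      rwa [← h']
    rw [← h2, Config.mem_pebbles] at h3
    exact h3.2 (hc.peb_eq_zero _ _ _ _ h)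
  · intro x hx i hi
    have h3 : (x, i) ∈ c.pebbles U := Config.mem_pebbles.2 ⟨hx, hi⟩
    have h4 := hc.pebbles_subset subset_rfl h3
    rw [← h2, Config.mem_pebbles] at h4
    exact h4.1

/-- A monochromatic cycle does not pass through a vertex from where edges of its color lead only to
a set that does not contain the tail of an edge of the cycle. -/
theorem Config.IsValid.closed_cycle (hc : c.IsValid ends) {C : Finset E} (hC : IsCycle ends C)
    {i : Fin k} (hi : ∀ e ∈ C, c.HasColor i e) {S : V → Prop}
    (hS : ∀ e x y, c.edge e = some (x, y, i) → S x → S y) {e₀ x₀ y₀}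
    (he₀ : e₀ ∈ C) (h₀ : c.edge e₀ = some (x₀, y₀, i)) (hy₀ : S y₀) : S x₀ := by
  have := hC.mem_of_closed (tl := c.tail ends) (hd := c.head ends) (S := S) ?_ ?_ ?_ he₀
    (x := y₀) (by simp [hc.ends_eq _ _ _ _ h₀]) hy₀ e₀ he₀
  · rwa [Config.tail_eq h₀] at this
  · intro e he
    obtain ⟨x, y, h⟩ := hi e he
    rw [Config.tail_eq h, Config.head_eq h, hc.ends_eq _ _ _ _ h]
  · intro e he e' he' heq
    obtain ⟨x, y, h⟩ := hi e he
    obtain ⟨x', y', h'⟩ := hi e' he'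
    rw [Config.tail_eq h, Config.tail_eq h'] at heq
    subst heq
    exact hc.unique _ _ _ _ _ _ h h'
  · intro e he hSe
    obtain ⟨x, y, h⟩ := hi e he
    rw [Config.tail_eq h] at hSe
    rw [Config.head_eq h]
    exact hS _ _ _ h hSe

set_option linter.unusedSectionVars false

variable [DecidableEq V] [DecidableEq E]

/-- The configuration after an add-edge move. -/
def Config.addEdge (c : Config V E k) (e : E) (v w : V) (i : Fin k) : Config V E k where
  edge := Function.update c.edge e (some (v, w, i))
  peb := takePebble c.peb v i

/-- The configuration after a pebble-slide move. -/
def Config.slideEdge (c : Config V E k) (e : E) (v w : V) (i j : Fin k) : Config V E k where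
  edge := Function.update c.edge e (some (w, v, i))
  peb := putPebble (takePebble c.peb w i) v j

theorem takePebble_apply (peb : V → Fin k → ℕ) (v : V) (i : Fin k) (x : V) (j : Fin k) :
    takePebble peb v i x j = if x = v ∧ j = i then peb v i - 1 else peb x j := by
  unfold takePebble
  by_cases hx : x = v
  · subst hx
    by_cases hj : j = i
    · subst hj; simp
    · simp [hj]
  · simp [hx]

theorem putPebble_apply (peb : V → Fin k → ℕ) (v : V) (i : Fin k) (x : V) (j : Fin k) :
    putPebble peb v i x j = if x = v ∧ j = i then peb v i + 1 else peb x j := by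
  unfold putPebble
  by_cases hx : x = v
  · subst hx
    by_cases hj : j = i
    · subst hj; simp
    · simp [hj]
  · simp [hx]

theorem Config.IsValid.addEdge (hc : c.IsValid ends) {e v w i} (h_ends : ends e = s(v, w))
    (h_new : c.edge e = none) (h_pos : 0 < c.peb v i) : (c.addEdge e v w i).IsValid ends where
  peb_le x j := by
    have := hc.peb_le x j
    simp only [Config.addEdge, takePebble_apply]
    split_ifs with h
    · obtain ⟨rfl, rfl⟩ := h; omega
    · exact this
  peb_eq_zero f x y j := by
    simp only [Config.addEdge, takePebble_apply, Function.update_apply]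
    split_ifs with hf h h
    · have := hc.peb_le v i
      omega
    · intro h'; simp at h'; exact absurd ⟨h'.1.symm, h'.2.2.symm⟩ h
    · have := hc.peb_le v i
      omega
    · exact hc.peb_eq_zero f x y j
  unique f f' x y y' j := by
    simp only [Config.addEdge, Function.update_apply]
    split_ifs with hf hf' hf'
    · intros; exact hf.trans hf'.symm
    · intro h h'
      simp at h
      obtain ⟨rfl, rfl, rfl⟩ := h
      have := hc.peb_eq_zero _ _ _ _ h'
      omega
    · intro h' h
      simp at h
      obtain ⟨rfl, rfl, rfl⟩ := h
      have := hc.peb_eq_zero _ _ _ _ h'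
      omega
    · exact hc.unique f f' x y y' j
  exists_edge x j := by
    simp only [Config.addEdge, takePebble_apply, Function.update_apply]
    by_cases h : x = v ∧ j = i
    · obtain ⟨rfl, rfl⟩ := h
      exact fun _ => ⟨e, w, by simp⟩
    · rw [if_neg h]
      intro h0
      obtain ⟨f, y, hf⟩ := hc.exists_edge x j h0
      refine ⟨f, y, ?_⟩
      rw [if_neg, hf]
      rintro rfl
      rw [h_new] at hf
      simp at hf
  ends_eq f x y j := by
    simp only [Config.addEdge, Function.update_apply]
    split_ifs with hf
    · subst hf
      intro h; simp at h
      rw [h_ends, h.1, h.2.1]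
    · exact hc.ends_eq f x y j

theorem Config.IsValid.slideEdge (hc : c.IsValid ends) {e v w i j}
    (h_edge : c.edge e = some (v, w, j)) (h_pos : 0 < c.peb w i) :
    (c.slideEdge e v w i j).IsValid ends := by
  have hne : ¬ (v = w ∧ j = i) := by
    rintro ⟨rfl, rfl⟩
    have := hc.peb_eq_zero _ _ _ _ h_edge
    omega
  have hpv := hc.peb_eq_zero _ _ _ _ h_edge
  have hpw := hc.peb_le w i
  refine ⟨fun x j' => ?_, fun f x y j' => ?_, fun f f' x y y' j' => ?_, fun x j' => ?_,
    fun f x y j' => ?_⟩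
  · have := hc.peb_le x j'
    simp only [Config.slideEdge, putPebble_apply, takePebble_apply, if_neg hne]
    split_ifs <;> omega
  · simp only [Config.slideEdge, putPebble_apply, takePebble_apply, Function.update_apply, if_neg hne]
    by_cases hf : f = e
    · rw [if_pos hf]
      intro h; simp at h
      obtain ⟨rfl, rfl, rfl⟩ := h
      rw [if_neg (fun h => hne ⟨h.1.symm, h.2.symm⟩)]
      simp; omega
    · rw [if_neg hf]
      intro h
      have h0 := hc.peb_eq_zero _ _ _ _ h
      rw [if_neg, h0]
      · split_ifs <;> omega
      · rintro ⟨rfl, rfl⟩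
        exact hf (hc.unique _ _ _ _ _ _ h h_edge)
  · simp only [Config.slideEdge, Function.update_apply]
    split_ifs with hf hf' hf'
    · intros; exact hf.trans hf'.symm
    · intro h h'
      simp at h
      obtain ⟨rfl, rfl, rfl⟩ := h
      have := hc.peb_eq_zero _ _ _ _ h'
      omega
    · intro h' h
      simp at h
      obtain ⟨rfl, rfl, rfl⟩ := h
      have := hc.peb_eq_zero _ _ _ _ h'
      omega
    · exact hc.unique f f' x y y' j'
  · simp only [Config.slideEdge, putPebble_apply, takePebble_apply, Function.update_apply, if_neg hne]
    by_cases h1 : x = v ∧ j' = j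
    · simp [if_pos h1]
    · rw [if_neg h1]
      by_cases h2 : x = w ∧ j' = i
      · obtain ⟨rfl, rfl⟩ := h2
        exact fun _ => ⟨e, v, by simp⟩
      · rw [if_neg h2]
        intro h0
        obtain ⟨f, y, hf⟩ := hc.exists_edge x j' h0
        refine ⟨f, y, ?_⟩
        rw [if_neg, hf]
        rintro rfl
        rw [h_edge] at hf
        simp at hf
        exact h1 ⟨hf.1.symm, hf.2.2.symm⟩
  · simp only [Config.slideEdge, Function.update_apply]
    split_ifs with hf
    · subst hf
      intro h; simp at h
      obtain ⟨rfl, rfl, rfl⟩ := h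
      rw [hc.ends_eq _ _ _ _ h_edge, Sym2.eq_swap]
    · exact hc.ends_eq f x y j'

theorem Config.edges_addEdge [Fintype E] (e : E) (v w : V) (i : Fin k) :
    (c.addEdge e v w i).edges = insert e c.edges := by
  ext f
  rw [mem_insert, Config.mem_edges_iff_ne, Config.mem_edges_iff_ne]
  by_cases hf : f = e <;> simp [Config.addEdge, hf]

theorem Config.edges_slideEdge [Fintype E] {e : E} {v w : V} {i j : Fin k}
    (h : c.edge e = some (v, w, j)) : (c.slideEdge e v w i j).edges = c.edges := by
  ext f
  rw [Config.mem_edges_iff_ne, Config.mem_edges_iff_ne]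
  by_cases hf : f = e <;> simp [Config.slideEdge, hf, h]

/-- The properties of the configurations in a canonical pebble game. -/
structure Config.IsGood [Fintype E] (ends : E → Sym2 V) (ℓ : ℕ) (c : Config V E k) : Prop where
  valid : c.IsValid ends
  sparse : IsSparse ends k ℓ c.edges
  forest : ∀ i : Fin k, (i : ℕ) < ℓ ∨ k ≤ ℓ → IsForest ends (c.colorClass i)

/-- If `U` contains both ends, then the pebbles on them are at least `ℓ + 1` free slots of `U`. So
`U` spanned at most `k |U| - ℓ - 1` edges before. -/
theorem Config.IsValid.isSparse_addEdge [Fintype E] (hc : c.IsValid ends)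
    (hs : IsSparse ends k ℓ c.edges) {e v w i}
    (h_ends : ends e = s(v, w)) (h_peb : ℓ + 1 ≤ c.pebOn v w) :
    IsSparse ends k ℓ (c.addEdge e v w i).edges := by
  rw [Config.edges_addEdge]
  refine isSparse_iff.2 fun U hU => ?_
  by_cases he : ∀ x ∈ ends e, x ∈ U
  · have h1 : spanned ends (insert e c.edges) U ⊆ insert e (spanned ends c.edges U) := by
      intro f hf
      rw [mem_spanned, mem_insert] at hf
      rw [mem_insert, mem_spanned]
      tauto
    have h2 := (card_le_card h1).trans (card_insert_le _ _)
    have h3 := card_spanned_add_card_freeSlots hc U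
    have h4 : c.pebbles {v, w} ⊆ c.freeSlots U := hc.pebbles_subset (by
      rw [h_ends] at he
      simp [insert_subset_iff, he])
    have h5 := card_le_card h4
    rw [card_pebbles_pair hc] at h5
    omega
  · have h1 : spanned ends (insert e c.edges) U = spanned ends c.edges U := by
      ext f
      rw [mem_spanned, mem_spanned, mem_insert]
      constructor
      · rintro ⟨rfl | h, h'⟩
        exacts [absurd h' he, ⟨h, h'⟩]
      · exact fun h => ⟨.inr h.1, h.2⟩
    rw [h1] at hU ⊢
    exact isSparse_iff.1 hs U hU

/-- Without a common color all pebbles on the ends have different colors; for a loop this holds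
since a vertex has at most one pebble of each color. None of the colors exceeds `i`. -/
theorem CanonicalColor.lt_of_not_common {v w : V} {i : Fin k} (hc : c.IsValid ends)
    (h_no : ¬ ∃ j, v ≠ w ∧ 0 < c.peb v j ∧ 0 < c.peb w j)
    (h : ∀ j, (0 < c.peb v j ∨ 0 < c.peb w j) → j ≤ i) : c.pebOn v w ≤ (i : ℕ) + 1 := by
  rw [Config.pebOn, sum_comm]
  calc _ ≤ ∑ j : Fin k, if j ≤ i then 1 else 0 := by
        refine sum_le_sum fun j _ => ?_
        push Not at h_no
        have h1 := hc.peb_le v j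
        have h2 := hc.peb_le w j
        have h3 := h j
        by_cases hvw : v = w
        · subst hvw
          simp only [mem_singleton, insert_eq_of_mem, sum_singleton]
          split_ifs with hji
          · exact h1
          · by_contra hcon
            exact hji (h3 (.inl (by omega)))
        · rw [sum_pair hvw]
          have h4 := h_no j hvw
          split_ifs with hji
          · omega
          · by_contra hcon
            exact hji (h3 (by omega))
    _ = (i : ℕ) + 1 := by
        rw [← card_filter]
        have : (univ.filter fun j : Fin k => j ≤ i) = Finset.Iic i := by ext; simp
        rw [this, Fin.card_Iic]

/-- Canonical slides create no cycles by definition, so only additions need an argument. In a common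
color, the head `w` keeps its pebble and has no outgoing edge, so no directed cycle enters it.
Otherwise the `ℓ + 1` pebbles force the index of the color to be at least `ℓ`, where cycles are
allowed if `ℓ < k`, and which is impossible if `k ≤ ℓ`. -/
theorem Config.IsGood.step [Fintype E] (hc : c.IsGood ends ℓ) {mv : Move V E k}
    (h : CanonicalStep ends ℓ c mv c') : c'.IsGood ends ℓ := by
  cases h with
  | add e v w i h_ends h_new h_peb h_pos h_can =>
    have hv : (c.addEdge e v w i).IsValid ends := hc.valid.addEdge h_ends h_new h_pos
    refine ⟨hv, hc.valid.isSparse_addEdge hc.sparse h_ends h_peb, fun i₀ hi₀ C hC hcyc => ?_⟩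
    have hcol : ∀ f ∈ C, (c.addEdge e v w i).HasColor i₀ f := fun f hf =>
      Config.mem_colorClass.1 (hC hf)
    by_cases heC : e ∈ C
    · obtain ⟨x, y, hxy⟩ := hcol e heC
      have hself : (c.addEdge e v w i).edge e = some (v, w, i) := by simp [Config.addEdge]
      have hi : i₀ = i := by
        rw [hself] at hxy
        simp at hxy
        exact hxy.2.2.symm
      subst hi
      rcases h_can with ⟨hne, hpv, hpw⟩ | ⟨h_no, h_max⟩
      · have := hv.closed_cycle hcyc hcol (S := fun x => x = w) ?_ heC hself rfl
        · exact hne this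
        · rintro f x y hf rfl
          have := hv.peb_eq_zero _ _ _ _ hf
          simp only [Config.addEdge, takePebble_apply, Ne.symm hne, false_and, if_false] at this
          omega
      · have := CanonicalColor.lt_of_not_common hc.valid h_no h_max
        have := i₀.2
        omega
    · refine hc.forest i₀ hi₀ C (fun f hf => ?_) hcyc
      obtain ⟨x, y, hxy⟩ := hcol f hf
      refine Config.mem_colorClass.2 ⟨x, y, ?_⟩
      rw [← hxy]
      simp only [Config.addEdge]
      rw [Function.update_of_ne]
      rintro rfl
      exact heC hf
  | slide e v w i j h_edge h_pos h_can =>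
    refine ⟨hc.valid.slideEdge h_edge h_pos, ?_, fun i₀ hi₀ C hC hcyc => ?_⟩
    · have := Config.edges_slideEdge (i := i) h_edge
      unfold Config.slideEdge at this
      rw [this]
      exact hc.sparse
    · exact hc.forest i₀ hi₀ C (fun f hf => Config.mem_colorClass.2
        (h_can C i₀ hcyc (fun f hf => Config.mem_colorClass.1 (hC hf)) f hf)) hcyc

theorem Config.isGood_initial [Fintype E] : (Config.initial V E k).IsGood ends ℓ where
  valid := by constructor <;> simp [Config.initial]
  sparse := by
    refine isSparse_iff.2 fun U ⟨e, he⟩ => ?_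
    have := (mem_spanned.1 he).1
    simp [Config.mem_edges, Config.initial] at this
  forest i _ C hC := by
    rintro ⟨r, v, f, -, -, -, h⟩
    have := hC ((h (f 0)).2 ⟨0, rfl⟩)
    simp [Config.mem_colorClass, Config.initial] at this

theorem Config.IsGood.play [Fintype E] {mvs : List (Move V E k)} (hc : c.IsGood ends ℓ)
    (h : CanonicalPlay ends ℓ c mvs c') : c'.IsGood ends ℓ := by
  induction mvs generalizing c with
  | nil => exact (show c = c' from h) ▸ hc
  | cons mv mvs ih =>
    obtain ⟨d, hd, h⟩ := h
    exact ih (hc.step hd) h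

theorem CanonicalPlay.append {c d : Config V E k} {l₁ l₂ : List (Move V E k)}
    (h₁ : CanonicalPlay ends ℓ c l₁ d) (h₂ : CanonicalPlay ends ℓ d l₂ c') :
    CanonicalPlay ends ℓ c (l₁ ++ l₂) c' := by
  induction l₁ generalizing c with
  | nil => exact (show c = d from h₁) ▸ h₂
  | cons mv mvs ih =>
    obtain ⟨a, ha, h⟩ := h₁
    exact ⟨a, ha, ih h⟩

/-- A slide of a pebble of color `i` from `w` over an edge from `v` creates no cycle if `v` lies in a
set that the edges of color `i` do not leave after the slide, and `w` does not. -/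
theorem Config.IsValid.noCycleCreated (hc : c.IsValid ends) {e v w i j}
    (h_edge : c.edge e = some (v, w, j)) (h_pos : 0 < c.peb w i) {S : V → Prop}
    (hS : ∀ f x y, f ≠ e → c.edge f = some (x, y, i) → S x → S y) (hv : S v) (hw : ¬ S w) :
    NoCycleCreated ends c (c.slideEdge e v w i j) := by
  have hc' := hc.slideEdge h_edge h_pos
  intro C i₀ hcyc hcol f hf
  have hself : (c.slideEdge e v w i j).edge e = some (w, v, i) := by simp [Config.slideEdge]
  have hother : ∀ f ≠ e, (c.slideEdge e v w i j).edge f = c.edge f := by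
    intro f hf
    simp [Config.slideEdge, hf]
  by_cases heC : e ∈ C
  · exfalso
    obtain ⟨x, y, hxy⟩ := hcol e heC
    have hi : i₀ = i := by
      rw [hself] at hxy
      simp at hxy
      exact hxy.2.2.symm
    subst hi
    -- A cycle through the reversed edge would lead from its head `v` to its tail `w` without
    -- leaving `S`.
    refine hw (hc'.closed_cycle hcyc hcol ?_ heC hself hv)
    intro f x y hf hx
    by_cases hfe : f = e
    · subst hfe
      rw [hself] at hf
      simp at hf
      rw [← hf.1] at hx
      exact absurd hx hw
    · rw [hother f hfe] at hf
      exact hS f x y hfe hf hx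
  · obtain ⟨x, y, hxy⟩ := hcol f hf
    rw [hother f (by rintro rfl; exact heC hf)] at hxy
    exact ⟨x, y, hxy⟩

end Game
end PebbleGame

namespace PebbleGame
open Finset

/-! ### The decompositions given by the colors -/

section Decomposition

variable {V E : Type*} {k ℓ : ℕ} {ends : E → Sym2 V} {c : Config V E k}

theorem IsForest.mono {F F' : Finset E} (h : IsForest ends F') (hF : F ⊆ F') : IsForest ends F :=
  fun C hC => h C (hC.trans hF)

/-- Sparsity says nothing about edgeless subgraphs. On two or more vertices the inequality `ℓ < 2 *
k` supplies the bound; on one vertex it may fail, as `ℓ` may exceed `k`. -/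
theorem IsSparse.card_add_le_of_subgraph {F F' : Finset E} {U : Finset V} (hF : IsSparse ends k ℓ F)
    (hℓ : ℓ < 2 * k) (h : IsSubgraph ends F U F') (hne : F'.Nonempty ∨ 2 ≤ U.card) :
    F'.card + ℓ ≤ k * U.card := by
  by_cases h0 : F'.Nonempty
  · exact hF U F' h h0
  · rw [not_nonempty_iff_eq_empty] at h0
    subst h0
    have := Nat.mul_le_mul_left k (hne.resolve_left (by simp))
    simp
    omega

/-- This is applied with `a i` vertices, `p i` pieces and `b i` edges in the part `i`, where `x` is
`ℓ`. -/
theorem le_sum_of_cover {ι : Type*} [Fintype ι] {a b p : ι → ℕ} {x y : ℕ} (h : ∀ i, a i ≤ p i + b i)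
    (ha : ∑ i, a i = x + y) (hb : ∑ i, b i ≤ y) : x ≤ ∑ i, p i := by
  have := sum_le_sum fun i (_ : i ∈ univ) => h i
  rw [sum_add_distrib] at this
  omega

theorem sum_card_inter_le {ι : Type*} [Fintype ι] [DecidableEq E] {A : ι → Finset E}
    (h : Pairwise fun i j => Disjoint (A i) (A j)) (F : Finset E) :
    ∑ i, (A i ∩ F).card ≤ F.card := by
  rw [← card_biUnion fun i _ j _ hij => (h hij).mono inter_subset_left inter_subset_left]
  exact card_le_card (biUnion_subset.2 fun i _ => inter_subset_right)

variable [Fintype E]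

/-- A color class is `(1, 0)`-sparse because its edges have distinct tails. For the pieces, each
vertex of `U` is counted once for each color, and `k |U|` exceeds the number of edges by at least
`ℓ`. -/
theorem Config.IsGood.isPebbleDecomposition (hc : c.IsGood ends ℓ) (hℓ : ℓ < 2 * k) :
    IsPebbleDecomposition ends c.edges k ℓ c.colorClass where
  disjoint := Config.disjoint_colorClass
  cover _ := mem_edges_iff_exists_colorClass
  sparse i U F' hF' _ := by
    classical
    rw [add_zero, one_mul]
    refine card_le_card_of_injOn (c.tail ends) (fun e he => ?_) fun e he e' he' heq => ?_
    · obtain ⟨x, y, h⟩ := Config.mem_colorClass.1 (hF'.1 he)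
      rw [Config.tail_eq h]
      exact hF'.2 e he x (by simp [hc.valid.ends_eq _ _ _ _ h])
    · obtain ⟨x, y, h⟩ := Config.mem_colorClass.1 (hF'.1 he)
      obtain ⟨x', y', h'⟩ := Config.mem_colorClass.1 (hF'.1 he')
      rw [Config.tail_eq h, Config.tail_eq h'] at heq
      subst heq
      exact hc.valid.unique _ _ _ _ _ _ h h'
  pieces_le U F' hF' hne := by
    classical
    have h1 := hc.sparse.card_add_le_of_subgraph hℓ hF' hne
    refine le_sum_of_cover (a := fun _ => U.card) (x := ℓ) (y := k * U.card - ℓ)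
      (fun i => card_le_card_treePieces_add (F := c.colorClass i ∩ F') fun e he => ?_) ?_ ?_
    · exact hF'.2 e (mem_inter.1 he).2
    · simp; omega
    · exact (sum_card_inter_le Config.disjoint_colorClass F').trans (by omega)

/-- If no vertex of the component had a pebble of color `i`, then each would have an outgoing edge
of this color, and following these edges would lead around a cycle. -/
theorem exists_root [Finite V] (hc : c.IsValid ends) {i : Fin k}
    (hf : IsForest ends (c.colorClass i)) (x : V) :
    ∃ r, c.peb r i ≠ 0 ∧ Linked ends (c.colorClass i) x r := by
  classical
  by_contra hcon
  push Not at hcon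
  have h0 : ∀ y, Linked ends (c.colorClass i) x y → ∃ p : E × V, c.edge p.1 = some (y, p.2, i) := by
    intro y hy
    obtain ⟨e, z, h⟩ := hc.exists_edge y i (by by_contra h; exact hcon y h hy)
    exact ⟨(e, z), h⟩
  have hxe := (h0 x .refl).choose
  have : Nonempty V := ⟨x⟩
  let q : V → E × V := fun y => if h : Linked ends (c.colorClass i) x y then (h0 y h).choose else hxe
  have hq : ∀ y, Linked ends (c.colorClass i) x y → c.edge (q y).1 = some (y, (q y).2, i) := by
    intro y hy
    simp only [q, dif_pos hy]
    exact (h0 y hy).choose_spec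
  have hmem : ∀ y, Linked ends (c.colorClass i) x y → (q y).1 ∈ c.colorClass i := fun y hy =>
    Config.mem_colorClass.2 ⟨_, _, hq y hy⟩
  obtain ⟨C, hC, h⟩ := exists_isCycle_of_succ (ends := ends)
    (P := fun y => Linked ends (c.colorClass i) x y) (g := fun y => (q y).2)
    (f := fun y => (q y).1) (x := x) .refl
    (fun y hy => hy.tail ⟨(q y).1, hmem y hy, hc.ends_eq _ _ _ _ (hq y hy)⟩)
    (fun y hy => hc.ends_eq _ _ _ _ (hq y hy))
    (fun y z hy hz heq => by
      have h1 := hq y hy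
      have h2 := hq z hz
      rw [heq, h2] at h1
      simp at h1
      exact h1.1.symm)
  refine hf C (fun e he => ?_) hC
  obtain ⟨y, hy, rfl⟩ := h e he
  exact hmem y hy

/-- Each vertex on a walk from `r` has a directed path of color `i` to `r`. If the next edge of the
walk points forward, it must be the first edge of this path, since outgoing edges are unique and `r`
has none; if it points backward, it extends the path. From `r'`, which has no outgoing edge either,
only the trivial path is possible. -/
theorem root_unique (hc : c.IsValid ends) {i : Fin k} {r r' : V} (hr : c.peb r i ≠ 0)
    (hr' : c.peb r' i ≠ 0) (h : Linked ends (c.colorClass i) r r') : r = r' := by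
  let R : V → V → Prop := fun x y => ∃ e, c.edge e = some (x, y, i)
  have key : Relation.ReflTransGen R r' r := by
    induction h with
    | refl => exact .refl
    | @tail b d _ hbd ih =>
      have ih : Relation.ReflTransGen R b r := by
        by_cases hb : c.peb b i ≠ 0
        · exact ih hb
        -- The outer induction hypothesis presupposes a pebble on `b`. If there is none, the
        -- directed path is built by a second induction, which makes no such assumption.
        · clear hr' ih
          rename_i h
          clear hbd hb
          induction h with
          | refl => exact .refl
          | @tail a b _ hab ih =>
            obtain ⟨e, he, hab⟩ := hab
            obtain ⟨x, y, hxy⟩ := Config.mem_colorClass.1 he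
            rw [hc.ends_eq _ _ _ _ hxy, Sym2.eq_iff] at hab
            rcases hab with ⟨rfl, rfl⟩ | ⟨rfl, rfl⟩
            · rcases ih.cases_head with rfl | ⟨z, ⟨f, hz⟩, hzr⟩
              · exact absurd (hc.peb_eq_zero _ _ _ _ hxy) hr
              · have := hc.unique _ _ _ _ _ _ hxy hz
                subst this
                rw [hxy] at hz
                simp at hz
                rwa [hz]
            · exact .head ⟨e, hxy⟩ ih
      obtain ⟨e, he, hab⟩ := hbd
      obtain ⟨x, y, hxy⟩ := Config.mem_colorClass.1 he
      rw [hc.ends_eq _ _ _ _ hxy, Sym2.eq_iff] at hab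
      rcases hab with ⟨rfl, rfl⟩ | ⟨rfl, rfl⟩
      · rcases ih.cases_head with rfl | ⟨z, ⟨f, hz⟩, hzr⟩
        · exact absurd (hc.peb_eq_zero _ _ _ _ hxy) hr
        · have := hc.unique _ _ _ _ _ _ hxy hz
          subst this
          rw [hxy] at hz
          simp at hz
          rwa [hz]
      · exact .head ⟨e, hxy⟩ ih
  rcases key.cases_head with h | ⟨z, ⟨f, hz⟩, _⟩
  · exact h.symm
  · exact absurd (hc.peb_eq_zero _ _ _ _ hz) hr'

variable [Fintype V]

/-- No edge leaves the whole vertex set, so the free slots are exactly the pebbles. -/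
theorem card_pebbles_of_isTight (hc : c.IsValid ends) (ht : IsTight ends k ℓ c.edges) :
    (c.pebbles univ).card = ℓ := by
  have h1 := card_spanned_of_closed hc (U := univ) (U' := univ) (fun _ _ _ _ _ _ => mem_univ _)
    subset_rfl (fun _ _ _ _ => mem_univ _)
  have h2 : spanned ends c.edges univ = c.edges := by ext; simp [mem_spanned]
  rw [h2, card_univ] at h1
  have := ht.2
  omega

/-- Each of the first `ℓ` colors is a forest and needs a pebble, by `exists_root`. Only `ℓ` pebbles
remain, so each of these colors has one and the others have none. One root means one component;
without pebbles every vertex has an outgoing edge, and the game's own orientation is that of a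
map-graph. -/
theorem Config.IsGood.isMapsAndTrees (hc : c.IsGood ends ℓ) (ht : IsTight ends k ℓ c.edges)
    (hℓk : ℓ ≤ k) : IsMapsAndTrees ends c.edges k ℓ c.colorClass := by
  classical
  have hroots : ∀ i : Fin k, Nonempty V →
      (∑ x, c.peb x i) = if (i : ℕ) < ℓ then 1 else 0 := by
    intro i₀ hV
    have h1 : ∀ i : Fin k, (if (i : ℕ) < ℓ then 1 else 0) ≤ ∑ x, c.peb x i := by
      intro i
      split_ifs with hi
      · obtain ⟨x⟩ := hV
        obtain ⟨r, hr, -⟩ := exists_root hc.valid (hc.forest i (.inl hi)) x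
        have := single_le_sum (f := fun x => c.peb x i) (fun _ _ => Nat.zero_le _) (mem_univ r)
        omega
      · exact Nat.zero_le _
    have h2 : ∑ i : Fin k, (if (i : ℕ) < ℓ then 1 else 0) = ∑ i : Fin k, ∑ x, c.peb x i := by
      rw [sum_comm, ← card_pebbles_eq_sum hc.valid, card_pebbles_of_isTight hc.valid ht,
        ← card_filter, Fin.card_filter_val_lt, min_eq_right hℓk]
    exact ((sum_eq_sum_iff_of_le fun i _ => h1 i).1 h2 i₀ (mem_univ _)).symm
  refine ⟨Config.disjoint_colorClass, fun _ => mem_edges_iff_exists_colorClass, fun i hi => ?_,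
    fun i hi => ⟨c.tail ends, fun e he => ?_, fun x => ?_⟩⟩
  · have hforest := hc.forest i (.inl hi)
    have hne : Nonempty V := by
      by_contra hV
      rw [not_nonempty_iff] at hV
      have := ht.2
      simp at this
      omega
    refine ⟨univ_nonempty, fun _ _ _ _ => mem_univ _, fun x _ y _ => ?_, hforest⟩
    obtain ⟨r, hr, hxr⟩ := exists_root hc.valid hforest x
    obtain ⟨r', hr', hyr'⟩ := exists_root hc.valid hforest y
    have : r = r' := by
      by_contra hrr
      have h1 := hroots i hne
      rw [if_pos hi] at h1
      have h2 := sum_le_sum_of_subset (f := fun x => c.peb x i) (subset_univ {r, r'})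
      rw [sum_pair hrr, h1] at h2
      omega
    subst this
    exact hxr.trans hyr'.symm
  · obtain ⟨x, y, h⟩ := Config.mem_colorClass.1 he
    rw [Config.tail_eq h, hc.valid.ends_eq _ _ _ _ h]
    simp
  · have h1 := hroots i ⟨x⟩
    rw [if_neg (by omega), sum_eq_zero_iff] at h1
    obtain ⟨e, y, h⟩ := hc.valid.exists_edge x i (h1 x (mem_univ _))
    refine ⟨e, ⟨Config.mem_colorClass.2 ⟨x, y, h⟩, Config.tail_eq h⟩, ?_⟩
    rintro e' ⟨he', htl⟩
    obtain ⟨x', y', h'⟩ := Config.mem_colorClass.1 he'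
    rw [Config.tail_eq h'] at htl
    subst htl
    exact hc.valid.unique _ _ _ _ _ _ h' h

/-- All colors are forests here, so each monochromatic component contains exactly one pebble of its
color. The `ℓ` remaining pebbles therefore index the components, and a vertex lies in one component
for each color. -/
theorem Config.IsGood.exists_isProperTreeDecomposition (hc : c.IsGood ends ℓ) (hℓ : ℓ < 2 * k)
    (ht : IsTight ends k ℓ c.edges) (hkℓ : k ≤ ℓ) :
    ∃ (color : Fin ℓ → Fin k) (T : Fin ℓ → Finset V),
      (∀ j, T j ∈ pieces ends univ (c.colorClass (color j))) ∧
      IsProperTreeDecomposition ends c.edges k ℓ T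
        (fun j => spanned ends (c.colorClass (color j)) (T j)) := by
  classical
  let p : Fin ℓ ≃ c.pebbles univ := (equivFinOfCardEq (card_pebbles_of_isTight hc.valid ht)).symm
  have hp : ∀ j, c.peb (p j).1.1 (p j).1.2 ≠ 0 := fun j => (Config.mem_pebbles.1 (p j).2).2
  let color : Fin ℓ → Fin k := fun j => (p j).1.2
  let T : Fin ℓ → Finset V := fun j => univ.filter fun y => Linked ends (c.colorClass (color j)) (p j).1.1 y
  have hmemT : ∀ {j x}, x ∈ T j ↔ Linked ends (c.colorClass (color j)) (p j).1.1 x := by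
    intro j x; simp [T]
  have hT : ∀ j, T j ∈ pieces ends univ (c.colorClass (color j)) := fun j =>
    mem_pieces.2 ⟨(p j).1.1, mem_univ _, fun y => by simp [T]⟩
  have hforest : ∀ i, IsForest ends (c.colorClass i) := fun i => hc.forest i (.inr hkℓ)
  have huniv : ∀ i, ∀ e ∈ c.colorClass i, ∀ x ∈ ends e, x ∈ (univ : Finset V) :=
    fun _ _ _ _ _ => mem_univ _
  have hinj : ∀ {i j x}, color i = color j → x ∈ T i → x ∈ T j → i = j := by
    intro i j x hij hi hj
    rw [hmemT] at hi hj
    rw [← hij] at hj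
    have h1 := root_unique hc.valid (hp i) (by rw [show (p i).1.2 = (p j).1.2 from hij]; exact hp j)
      (hi.trans hj.symm)
    exact p.injective (Subtype.ext (Prod.ext h1 hij))
  have hsurj : ∀ i x, ∃ j, color j = i ∧ x ∈ T j := by
    intro i x
    obtain ⟨r, hr, hxr⟩ := exists_root hc.valid (hforest i) x
    refine ⟨p.symm ⟨(r, i), Config.mem_pebbles.2 ⟨mem_univ _, hr⟩⟩, by simp [color], ?_⟩
    rw [hmemT]
    simpa [color] using hxr.symm
  have hdisj : Pairwise fun i j => Disjoint (spanned ends (c.colorClass (color i)) (T i))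
      (spanned ends (c.colorClass (color j)) (T j)) := by
    intro i j hij
    by_cases hcol : color i = color j
    · rw [Finset.disjoint_left]
      intro e he he'
      exact hij (hinj hcol ((mem_spanned.1 he).2 _ (Sym2.out_fst_mem _))
        ((mem_spanned.1 he').2 _ (Sym2.out_fst_mem _)))
    · exact (Config.disjoint_colorClass hcol).mono spanned_subset spanned_subset
  have hmult : ∀ x : V, Nat.card {j : Fin ℓ // x ∈ T j} = k := by
    intro x
    rw [Nat.card_congr (Equiv.ofBijective (fun j : {j : Fin ℓ // x ∈ T j} => color j.1) ⟨?_, ?_⟩)]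
    · simp
    · exact fun i j hij => Subtype.ext (hinj hij i.2 j.2)
    · intro i
      obtain ⟨j, hj, hx⟩ := hsurj i x
      exact ⟨⟨j, hx⟩, hj⟩
  refine ⟨color, T, hT, ⟨fun j => ⟨⟨_, hmemT.2 .refl⟩, fun e he => (mem_spanned.1 he).2,
    fun x hx y hy => linked_of_mem_pieces (huniv _) (hT j) hx hy,
    (hforest _).mono spanned_subset⟩, hdisj, fun e => ⟨fun he => ?_, ?_⟩, hmult, ?_⟩⟩
  · obtain ⟨i, hi⟩ := mem_edges_iff_exists_colorClass.1 he
    obtain ⟨x, y, h⟩ := Config.mem_colorClass.1 hi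
    obtain ⟨j, rfl, hx⟩ := hsurj i x
    refine ⟨j, mem_spanned.2 ⟨hi, fun z hz => ?_⟩⟩
    have hends := hc.valid.ends_eq _ _ _ _ h
    rw [hends, Sym2.mem_iff] at hz
    rcases hz with rfl | rfl
    · exact hx
    · exact hmemT.2 ((hmemT.1 hx).tail ⟨e, hi, hends⟩)
  · rintro ⟨j, hj⟩
    exact Config.colorClass_subset _ (spanned_subset hj)
  · intro U F' hF' hne
    have h1 := hc.sparse.card_add_le_of_subgraph hℓ hF' hne
    -- Incidences of vertices and trees are counted by vertices, each of which is in `k` trees.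
    have h2 : ∑ j, (T j ∩ U).card = k * U.card := by
      have : ∀ j, (T j ∩ U).card = ∑ x ∈ U, if x ∈ T j then 1 else 0 := by
        intro j
        rw [← card_filter, inter_comm, filter_mem_eq_inter]
      simp_rw [this]
      rw [sum_comm]
      have : ∀ x ∈ U, (∑ j, if x ∈ T j then 1 else 0) = k := by
        intro x _
        rw [← card_filter, ← hmult x, Nat.card_eq_fintype_card, Fintype.card_subtype]
      rw [sum_congr rfl this]
      simp [mul_comm]
    refine le_sum_of_cover (a := fun j => (T j ∩ U).card) (x := ℓ) (y := k * U.card - ℓ)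
      (b := fun j => (spanned ends (c.colorClass (color j)) (T j) ∩ F').card)
      (fun j => ?_) ?_ ?_
    · convert card_le_card_pieces_add (ends := ends) (U := T j ∩ U)
        (F := spanned ends (c.colorClass (color j)) (T j) ∩ F') (fun e he x hx => ?_)
      rw [mem_inter] at he ⊢
      exact ⟨(mem_spanned.1 he.1).2 x hx, hF'.2 e he.2 x hx⟩
    · omega
    · convert (sum_card_inter_le hdisj F').trans (show F'.card ≤ k * U.card - ℓ by omega)

end Decomposition
end PebbleGame

namespace PebbleGame

/-! ### A language with expressions and arrays -/

section Language

/-- Abstract machine states: registers, arrays with two indices, output, and a clock. -/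
structure St where
  r : ℕ → ℕ
  A : ℕ → ℕ → ℕ → ℕ
  o : List ℕ
  t : ℕ

/-- The input, a bound on the numbers, and the extents of the arrays. -/
structure Env where
  inp : List ℕ
  M : ℕ
  W : ℕ
  R : ℕ

/-- Expressions. -/
inductive Ex
  | num (v : ℕ)
  | reg (i : ℕ)
  | add (a b : Ex)
  | sub (a b : Ex)
  | mul (a b : Ex)
  | inp (a : Ex)
  | arr (a : ℕ) (x j : Ex)

/-- Commands. -/
inductive Cmd
  | asg (r : ℕ) (e : Ex)
  | sto (a : ℕ) (x j e : Ex)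
  | emi (e : Ex)
  | seq (p q : Cmd)
  | ite (a b : Ex) (p q : Cmd)
  | whl (a b : Ex) (p : Cmd)

/-- Change one entry of an array. -/
def upd (f : ℕ → ℕ → ℕ) (x j v : ℕ) : ℕ → ℕ → ℕ :=
  fun y i => if y = x ∧ i = j then v else f y i

namespace St

/-- Pass one unit of time. -/
def tick (σ : St) : St := { σ with t := σ.t + 1 }

/-- Assign to a register. -/
def setr (σ : St) (i v : ℕ) : St :=
  { σ with r := fun l => if l = i then v else σ.r l, t := σ.t + 1 }

/-- Assign to an array entry. -/
def seta (σ : St) (a x j v : ℕ) : St :=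
  { σ with A := fun b => if b = a then upd (σ.A a) x j v else σ.A b, t := σ.t + 1 }

/-- Append to the output. -/
def emit (σ : St) (v : ℕ) : St := { σ with o := σ.o ++ [v], t := σ.t + 1 }

@[simp] theorem tick_r (σ : St) : σ.tick.r = σ.r := rfl
@[simp] theorem tick_A (σ : St) : σ.tick.A = σ.A := rfl
@[simp] theorem tick_o (σ : St) : σ.tick.o = σ.o := rfl
@[simp] theorem tick_t (σ : St) : σ.tick.t = σ.t + 1 := rfl
@[simp] theorem setr_r (σ : St) (i v l : ℕ) : (σ.setr i v).r l = if l = i then v else σ.r l := rfl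
@[simp] theorem setr_A (σ : St) (i v : ℕ) : (σ.setr i v).A = σ.A := rfl
@[simp] theorem setr_o (σ : St) (i v : ℕ) : (σ.setr i v).o = σ.o := rfl
@[simp] theorem setr_t (σ : St) (i v : ℕ) : (σ.setr i v).t = σ.t + 1 := rfl
@[simp] theorem seta_r (σ : St) (a x j v : ℕ) : (σ.seta a x j v).r = σ.r := rfl
@[simp] theorem seta_A (σ : St) (a x j v b : ℕ) :
    (σ.seta a x j v).A b = if b = a then upd (σ.A a) x j v else σ.A b := rfl
@[simp] theorem seta_o (σ : St) (a x j v : ℕ) : (σ.seta a x j v).o = σ.o := rfl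
@[simp] theorem seta_t (σ : St) (a x j v : ℕ) : (σ.seta a x j v).t = σ.t + 1 := rfl
@[simp] theorem emit_r (σ : St) (v : ℕ) : (σ.emit v).r = σ.r := rfl
@[simp] theorem emit_A (σ : St) (v : ℕ) : (σ.emit v).A = σ.A := rfl
@[simp] theorem emit_o (σ : St) (v : ℕ) : (σ.emit v).o = σ.o ++ [v] := rfl
@[simp] theorem emit_t (σ : St) (v : ℕ) : (σ.emit v).t = σ.t + 1 := rfl

end St

variable (G : Env)

namespace Ex

/-- The value of an expression. -/
def eval (σ : St) : Ex → ℕ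
  | num v => v
  | reg i => σ.r i
  | add a b => a.eval σ + b.eval σ
  | sub a b => a.eval σ - b.eval σ
  | mul a b => a.eval σ * b.eval σ
  | inp a => G.inp.getD (a.eval σ) 0
  | arr a x j => σ.A a (x.eval σ) (j.eval σ)

/-- The expression can be evaluated within the bounds. -/
def ok (σ : St) : Ex → Prop
  | num _ => True
  | reg _ => True
  | add a b => a.ok σ ∧ b.ok σ ∧ a.eval G σ + b.eval G σ ≤ G.M
  | sub a b => a.ok σ ∧ b.ok σ
  | mul a b => a.ok σ ∧ b.ok σ ∧ a.eval G σ * b.eval G σ ≤ G.M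
  | inp a => a.ok σ
  | arr _ x j => x.ok σ ∧ j.ok σ ∧ x.eval G σ < G.R ∧ j.eval G σ < G.W

/-- Constants, registers, and arrays have small numbers. -/
def fit : Ex → Bool
  | num v => v ≤ 16
  | reg i => i < 99
  | add a b => a.fit && b.fit
  | sub a b => a.fit && b.fit
  | mul a b => a.fit && b.fit
  | inp a => a.fit
  | arr a x j => a < 16 && x.fit && j.fit

/-- The time to evaluate the expression. -/
def cost : Ex → ℕ
  | num _ => 1
  | reg _ => 2
  | add a b => a.cost + b.cost + 1
  | sub a b => a.cost + b.cost + 1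
  | mul a b => a.cost + b.cost + 1
  | inp a => a.cost + 1
  | arr _ x j => x.cost + j.cost + 7

/-- From the indices in the registers `d`, `d + 1`, compute the address of an array entry. -/
def address (a d : ℕ) : Prog :=
  -- Register `99` holds the row width `W`. The entry `(x, j)` of the array `a` has the address `16
  -- (x W + j) + a`; as the sixteen arrays are interleaved, no base addresses are needed.
  .seq (.mul d d 99) <| .seq (.add d d (d + 1)) <| .seq (.const (d + 1) 16) <|
    .seq (.mul d d (d + 1)) <| .seq (.const (d + 1) a) (.add d d (d + 1))

/-- Compute the value in the register `d`. -/
def compile (d : ℕ) : Ex → Prog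
  | num v => .const d v
  | reg i => .seq (.const d 0) (.add d d i)
  | add a b => .seq (a.compile d) (.seq (b.compile (d + 1)) (.add d d (d + 1)))
  | sub a b => .seq (a.compile d) (.seq (b.compile (d + 1)) (.sub d d (d + 1)))
  | mul a b => .seq (a.compile d) (.seq (b.compile (d + 1)) (.mul d d (d + 1)))
  | inp a => .seq (a.compile d) (.input d d)
  | arr a x j => .seq (x.compile d) (.seq (j.compile (d + 1)) (.seq (address a d) (.load d d)))

end Ex

namespace Cmd

/-- Weakest preconditions, with an invariant and a time limit for each loop. -/
def wp : Cmd → (St → Prop) → St → Prop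
  | asg r e, Q, σ => e.ok G σ ∧ Q (σ.setr r (e.eval G σ))
  | sto a x j e, Q, σ => x.ok G σ ∧ j.ok G σ ∧ x.eval G σ < G.R ∧ j.eval G σ < G.W ∧ e.ok G σ ∧
      Q (σ.seta a (x.eval G σ) (j.eval G σ) (e.eval G σ))
  | emi e, Q, σ => e.ok G σ ∧ Q (σ.emit (e.eval G σ))
  | seq p q, Q, σ => p.wp (q.wp Q) σ
  | ite a b p q, Q, σ => a.ok G σ ∧ b.ok G σ ∧ (a.eval G σ < b.eval G σ → p.wp Q σ.tick) ∧
      (¬ a.eval G σ < b.eval G σ → q.wp Q σ.tick)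
  -- The limit `τ` replaces a variant: each round takes time, and the invariant keeps the clock at
  -- or below `τ`, so the loop terminates. Time bounds and correctness thus come from the same
  -- proof.
  | whl a b p, Q, σ => ∃ (I : St → Prop) (τ : ℕ), I σ ∧ ∀ σ, I σ → σ.t ≤ τ ∧ a.ok G σ ∧ b.ok G σ ∧
      (a.eval G σ < b.eval G σ → p.wp I σ.tick) ∧ (¬ a.eval G σ < b.eval G σ → Q σ.tick)

/-- The bound `C` on the time of elementary commands is large enough. -/
def fit (C : ℕ) : Cmd → Bool
  | asg r e => r < 99 && e.fit && e.cost + 2 ≤ C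
  | sto a x j e => a < 16 && x.fit && j.fit && e.fit && x.cost + j.cost + e.cost + 7 ≤ C
  | emi e => e.fit && e.cost + 1 ≤ C
  | seq p q => p.fit C && q.fit C
  | ite a b p q => a.fit && b.fit && p.fit C && q.fit C && a.cost + b.cost + 1 ≤ C
  | whl a b p => a.fit && b.fit && p.fit C && a.cost + b.cost + 1 ≤ C

/-- The program for a command. -/
def compile : Cmd → Prog
  -- Registers from `100` on are scratch; commands that fit use only registers below `99`.
  | asg r e => .seq (e.compile 100) (.seq (.const 101 0) (.add r 100 101))
  | sto a x j e => .seq (x.compile 100) (.seq (j.compile 101) (.seq (Ex.address a 100)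
      (.seq (e.compile 101) (.store 100 101))))
  | emi e => .seq (e.compile 100) (.emit 100)
  | seq p q => .seq p.compile q.compile
  | ite a b p q => .seq (a.compile 100) (.seq (b.compile 101) (.ifLt 100 101 p.compile q.compile))
  -- The machine compares registers only, so the two expressions are evaluated before the loop and
  -- again at the end of each round.
  | whl a b p => .seq (a.compile 100) (.seq (b.compile 101)
      (.whileLt 100 101 (.seq p.compile (.seq (a.compile 100) (b.compile 101)))))

variable {G}

theorem wp_mono {c : Cmd} {Q Q' : St → Prop} (h : ∀ σ, Q σ → Q' σ) {σ : St} (hw : c.wp G Q σ) :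
    c.wp G Q' σ := by
  induction c generalizing Q Q' σ with
  | asg r e => exact ⟨hw.1, h _ hw.2⟩
  | sto a x j e => exact ⟨hw.1, hw.2.1, hw.2.2.1, hw.2.2.2.1, hw.2.2.2.2.1, h _ hw.2.2.2.2.2⟩
  | emi e => exact ⟨hw.1, h _ hw.2⟩
  | seq p q ihp ihq => exact ihp (fun σ' h' => ihq h h') hw
  | ite a b p q ihp ihq =>
    exact ⟨hw.1, hw.2.1, fun h' => ihp h (hw.2.2.1 h'), fun h' => ihq h (hw.2.2.2 h')⟩
  | whl a b p ih =>
    obtain ⟨I, τ, hI, hs⟩ := hw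
    refine ⟨I, τ, hI, fun σ hσ => ?_⟩
    obtain ⟨h1, h2, h3, h4, h5⟩ := hs σ hσ
    exact ⟨h1, h2, h3, h4, fun h' => h _ (h5 h')⟩

end Cmd

/-! ### Correctness of the compilation -/

variable {G}

/-- The concrete state represents the abstract state up to time and output. -/
structure Core (G : Env) (s : State) (σ : St) : Prop where
  reg : ∀ i < 99, s.reg i = σ.r i
  width : s.reg 99 = G.W
  mem : ∀ a < 16, ∀ x, ∀ j < G.W, s.mem (16 * (x * G.W + j) + a) = σ.A a x j
  space : s.space ≤ 16 * (G.R * G.W)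
  peak : s.peak ≤ G.M
  reg_le : ∀ i, s.reg i ≤ G.M
  mem_le : ∀ i, s.mem i ≤ G.M

/-- The bounds are large enough. -/
structure Env.IsLarge (G : Env) : Prop where
  const : 16 ≤ G.M
  memory : 16 * (G.R * G.W) ≤ G.M
  input : ∀ i, G.inp.getD i 0 ≤ G.M

theorem Core.setReg {s : State} {σ : St} (h : Core G s σ) {d v : ℕ} (hd : 100 ≤ d)
    (hv : v ≤ G.M) : Core G (s.tick.setReg d v) σ where
  reg i hi := by
    simp only [State.setReg, State.tick]
    rw [Function.update_of_ne (by omega)]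
    exact h.reg i hi
  width := by
    simp only [State.setReg, State.tick]
    rw [Function.update_of_ne (by omega)]
    exact h.width
  mem := h.mem
  space := h.space
  peak := max_le h.peak hv
  reg_le i := by
    simp only [State.setReg, State.tick, Function.update_apply]
    split_ifs
    exacts [hv, h.reg_le i]
  mem_le := h.mem_le

theorem Core.touch {s : State} {σ : St} (h : Core G s σ) {a : ℕ} (ha : a < 16 * (G.R * G.W)) :
    Core G (s.touch a) σ where
  reg := h.reg
  width := h.width
  mem := h.mem
  space := max_le h.space ha
  peak := h.peak
  reg_le := h.reg_le
  mem_le := h.mem_le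

/-- The state `s'` results from `s` in time `T` by a computation with result `v` in the register `d`
that changes no registers below `d`. -/
structure Computes (s s' : State) (d v T : ℕ) : Prop where
  result : s'.reg d = v
  low : ∀ i < d, s'.reg i = s.reg i
  mem : s'.mem = s.mem
  out : s'.out = s.out
  time : s'.time = s.time + T

theorem lt_mul_of_index {W R x j a : ℕ} (hx : x < R) (hj : j < W) (ha : a < 16) :
    16 * (x * W + j) + a < 16 * (R * W) := by
  have : (x + 1) * W ≤ R * W := Nat.mul_le_mul_right _ hx
  rw [add_mul, one_mul] at this
  omega

theorem Ex.address_spec (hG : G.IsLarge) {s : State} {σ : St} (h : Core G s σ) {a d x j : ℕ}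
    (ha : a < 16) (hd : 100 ≤ d) (hx : s.reg d = x) (hj : s.reg (d + 1) = j) (hxR : x < G.R)
    (hjW : j < G.W) : ∃ s', Exec G.inp (Ex.address a d) s s' ∧ Core G s' σ ∧
      Computes s s' d (16 * (x * G.W + j) + a) 6 := by
  have hlt := lt_mul_of_index hxR hjW ha
  have hM := hG.memory
  have h16 := hG.const
  refine ⟨_, .seq (.mul ..) (.seq (.add ..) (.seq (.const ..) (.seq (.mul ..)
    (.seq (.const ..) (.add ..))))), ?_, ?_⟩
  · refine (((((h.setReg hd ?_).setReg hd ?_).setReg (by omega) ?_).setReg hd ?_).setReg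
      (by omega) ?_).setReg hd ?_
    all_goals try simp [State.setReg, State.tick, h.width, hx, hj]
    all_goals omega
  · constructor
    · simp [State.setReg, State.tick, h.width, hx, hj]
      ring
    · intro i hi
      simp only [State.setReg, State.tick, Function.update_apply]
      split_ifs <;> omega
    · rfl
    · rfl
    · simp [State.setReg, State.tick]

/-- Common to sums, differences and products. The first value survives the evaluation of the second
expression, which changes no register below `d + 1`. -/
theorem Ex.compile_binary {s : State} {σ : St} {d : ℕ} (hd : 100 ≤ d) {a b : Ex} {v : ℕ} {p : Prog}
    (ha : ∃ s', Exec G.inp (a.compile d) s s' ∧ Core G s' σ ∧ Computes s s' d (a.eval G σ) a.cost)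
    (hb : ∀ s, Core G s σ → ∃ s', Exec G.inp (b.compile (d + 1)) s s' ∧ Core G s' σ ∧
        Computes s s' (d + 1) (b.eval G σ) b.cost) (hv : v ≤ G.M)
    (hp : ∀ s, s.reg d = a.eval G σ → s.reg (d + 1) = b.eval G σ →
        Exec G.inp p s (s.tick.setReg d v)) :
    ∃ s', Exec G.inp (.seq (a.compile d) (.seq (b.compile (d + 1)) p)) s s' ∧ Core G s' σ ∧
        Computes s s' d v (a.cost + b.cost + 1) := by
  obtain ⟨s₁, hs₁, hc₁, hr₁⟩ := ha
  obtain ⟨s₂, hs₂, hc₂, hr₂⟩ := hb s₁ hc₁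
  refine ⟨_, .seq hs₁ (.seq hs₂ (hp s₂ ?_ hr₂.result)), hc₂.setReg hd hv, ?_⟩
  · rw [hr₂.low d (by omega), hr₁.result]
  · constructor
    · simp [State.setReg]
    · intro i hi
      simp only [State.setReg, State.tick]
      rw [Function.update_of_ne (by omega), hr₂.low i (by omega), hr₁.low i hi]
    · exact hr₂.mem.trans hr₁.mem
    · exact hr₂.out.trans hr₁.out
    · simp [State.setReg, State.tick, hr₂.time, hr₁.time]; ring

/-- The bound on the value is part of the induction: a difference inherits it from its first term,
sums and products have it by `Ex.ok`, and the other values by the bounds on constants, registers,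
input and memory. -/
theorem Ex.compile_spec (hG : G.IsLarge) (e : Ex) (hfit : e.fit = true) {s : State} {σ : St}
    (h : Core G s σ) (hok : e.ok G σ) {d : ℕ} (hd : 100 ≤ d) :
    e.eval G σ ≤ G.M ∧
      ∃ s', Exec G.inp (e.compile d) s s' ∧ Core G s' σ ∧ Computes s s' d (e.eval G σ) e.cost := by
  induction e generalizing s d with
  | num v =>
    simp only [Ex.fit, decide_eq_true_eq] at hfit
    have hv := hfit.trans hG.const
    refine ⟨hv, _, .const .., h.setReg hd hv, ?_⟩
    constructor
    · simp [State.setReg, Ex.eval]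
    · intro i hi
      simp only [State.setReg, State.tick]
      rw [Function.update_of_ne (by omega)]
    · rfl
    · rfl
    · simp [State.setReg, State.tick, Ex.cost]
  | reg i =>
    simp only [Ex.fit, decide_eq_true_eq] at hfit
    have hi : (Ex.reg i).eval G σ ≤ G.M := by
      rw [Ex.eval, ← h.reg i hfit]; exact h.reg_le i
    refine ⟨hi, _, .seq (.const ..) (.add ..), (h.setReg hd (Nat.zero_le _)).setReg hd ?_, ?_⟩
    · simp only [State.setReg, State.tick, Function.update_self]
      rw [Function.update_of_ne (by omega), zero_add]
      exact h.reg_le i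
    · constructor
      · simp only [State.setReg, State.tick, Function.update_self]
        rw [Function.update_of_ne (by omega), zero_add]
        exact h.reg i hfit
      · intro l hl
        simp only [State.setReg, State.tick]
        rw [Function.update_of_ne (by omega), Function.update_of_ne (by omega)]
      · rfl
      · rfl
      · simp [State.setReg, State.tick, Ex.cost]
  | add a b iha ihb =>
    simp only [Ex.fit, Bool.and_eq_true] at hfit
    refine ⟨hok.2.2, Ex.compile_binary hd (iha hfit.1 h hok.1 hd).2
      (fun s hs => (ihb hfit.2 hs hok.2.1 (by omega)).2) hok.2.2 (fun s h1 h2 => ?_)⟩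
    rw [Ex.eval, ← h1, ← h2]; exact .add ..
  | sub a b iha ihb =>
    simp only [Ex.fit, Bool.and_eq_true] at hfit
    have hv : (Ex.sub a b).eval G σ ≤ G.M := (Nat.sub_le _ _).trans (iha hfit.1 h hok.1 hd).1
    refine ⟨hv, Ex.compile_binary hd (iha hfit.1 h hok.1 hd).2
      (fun s hs => (ihb hfit.2 hs hok.2 (by omega)).2) hv (fun s h1 h2 => ?_)⟩
    rw [Ex.eval, ← h1, ← h2]; exact .sub ..
  | mul a b iha ihb =>
    simp only [Ex.fit, Bool.and_eq_true] at hfit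
    refine ⟨hok.2.2, Ex.compile_binary hd (iha hfit.1 h hok.1 hd).2
      (fun s hs => (ihb hfit.2 hs hok.2.1 (by omega)).2) hok.2.2 (fun s h1 h2 => ?_)⟩
    rw [Ex.eval, ← h1, ← h2]; exact .mul ..
  | inp a ih =>
    obtain ⟨_, s₁, hs₁, hc₁, hr₁⟩ := ih hfit h hok hd
    refine ⟨hG.input _, _, .seq hs₁ (.input ..), hc₁.setReg hd (hG.input _), ?_⟩
    constructor
    · simp [State.setReg, hr₁.result, Ex.eval]
    · intro i hi
      simp only [State.setReg, State.tick]
      rw [Function.update_of_ne (by omega), hr₁.low i hi]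
    · exact hr₁.mem
    · exact hr₁.out
    · simp [State.setReg, State.tick, hr₁.time, Ex.cost]; ring
  | arr a x j ihx ihj =>
    simp only [Ex.fit, Bool.and_eq_true, decide_eq_true_eq] at hfit
    obtain ⟨okx, okj, hxR, hjW⟩ := hok
    obtain ⟨_, s₁, hs₁, hc₁, hr₁⟩ := ihx hfit.1.2 h okx hd
    obtain ⟨_, s₂, hs₂, hc₂, hr₂⟩ := ihj hfit.2 hc₁ okj (d := d + 1) (by omega)
    obtain ⟨s₃, hs₃, hc₃, hr₃⟩ := Ex.address_spec hG hc₂ hfit.1.1 hd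
      ((hr₂.low d (by omega)).trans hr₁.result) hr₂.result hxR hjW
    have hval : s₃.mem (s₃.reg d) = (Ex.arr a x j).eval G σ := by
      rw [hr₃.result, hc₃.mem _ hfit.1.1 _ _ hjW]; rfl
    have hlt := lt_mul_of_index hxR hjW hfit.1.1
    refine ⟨hval ▸ hc₃.mem_le _, _, .seq hs₁ (.seq hs₂ (.seq hs₃ (.load ..))), ?_, ?_⟩
    · exact (hc₃.touch (by rw [hr₃.result]; exact hlt)).setReg hd (hc₃.mem_le _)
    · constructor
      · simpa [State.setReg] using hval
      · intro i hi
        simp only [State.setReg, State.tick, State.touch]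
        rw [Function.update_of_ne (by omega), hr₃.low i hi, hr₂.low i (by omega), hr₁.low i hi]
      · exact hr₃.mem.trans (hr₂.mem.trans hr₁.mem)
      · exact hr₃.out.trans (hr₂.out.trans hr₁.out)
      · simp [State.setReg, State.tick, State.touch, hr₃.time, hr₂.time, hr₁.time, Ex.cost]; ring

/-- The concrete state represents the abstract state, where the abstract time is scaled by `C`. -/
structure Rep (G : Env) (C D : ℕ) (s : State) (σ : St) : Prop where
  core : Core G s σ
  out : s.out = σ.o
  time : s.time ≤ C * σ.t + D

/-- The abstract run goes forward in time and outputs at most one number per unit of time. -/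
structure Forward (σ σ' : St) : Prop where
  time : σ.t ≤ σ'.t
  out : σ'.o.length + σ.t ≤ σ'.t + σ.o.length

theorem Forward.trans {σ₁ σ₂ σ₃ : St} (h₁ : Forward σ₁ σ₂) (h₂ : Forward σ₂ σ₃) : Forward σ₁ σ₃ :=
  ⟨h₁.time.trans h₂.time, by have := h₁.out; have := h₂.out; omega⟩

theorem Forward.tick (σ : St) : Forward σ σ.tick := ⟨by simp, by simp; omega⟩

theorem Core.congr {s : State} {σ σ' : St} (h : Core G s σ) (hr : σ'.r = σ.r) (hA : σ'.A = σ.A) :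
    Core G s σ' :=
  ⟨hr ▸ h.reg, h.width, hA ▸ h.mem, h.space, h.peak, h.reg_le, h.mem_le⟩

theorem Core.concreteTick {s : State} {σ : St} (h : Core G s σ) : Core G s.tick σ :=
  ⟨h.reg, h.width, h.mem, h.space, h.peak, h.reg_le, h.mem_le⟩

theorem Cmd.compile_pair (hG : G.IsLarge) {a b : Ex} (hfa : a.fit = true) (hfb : b.fit = true)
    {s : State} {σ : St} (h : Core G s σ) (oka : a.ok G σ) (okb : b.ok G σ) :
    ∃ s₁ s₂, Exec G.inp (a.compile 100) s s₁ ∧ Exec G.inp (b.compile 101) s₁ s₂ ∧ Core G s₂ σ ∧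
      s₂.reg 100 = a.eval G σ ∧ s₂.reg 101 = b.eval G σ ∧ s₂.mem = s.mem ∧ s₂.out = s.out ∧
      s₂.time = s.time + a.cost + b.cost := by
  obtain ⟨_, s₁, hs₁, hc₁, hr₁⟩ := a.compile_spec hG hfa h oka (d := 100) le_rfl
  obtain ⟨_, s₂, hs₂, hc₂, hr₂⟩ := b.compile_spec hG hfb hc₁ okb (d := 101) (by norm_num)
  exact ⟨s₁, s₂, hs₁, hs₂, hc₂, (hr₂.low 100 (by norm_num)).trans hr₁.result, hr₂.result,
    hr₂.mem.trans hr₁.mem, hr₂.out.trans hr₁.out, by rw [hr₂.time, hr₁.time]⟩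

/-- Soundness of weakest preconditions. -/
theorem Cmd.wp_sound (hG : G.IsLarge) {C D : ℕ} (c : Cmd) (hfit : c.fit C = true) {s : State} {σ : St}
    {Q : St → Prop} (h : Rep G C D s σ) (hw : c.wp G Q σ) :
    ∃ s' σ', Exec G.inp c.compile s s' ∧ Rep G C D s' σ' ∧ Forward σ σ' ∧ Q σ' := by
  induction c generalizing s σ Q with
  | asg r e =>
    simp only [Cmd.fit, Bool.and_eq_true, decide_eq_true_eq] at hfit
    obtain ⟨hv, s₁, hs₁, hc₁, hr₁⟩ := e.compile_spec hG hfit.1.2 h.core hw.1 (d := 100) le_rfl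
    refine ⟨_, _, .seq hs₁ (.seq (.const ..) (.add ..)), ⟨?_, ?_, ?_⟩, ⟨?_, ?_⟩, hw.2⟩
    · have hval : ((s₁.tick.setReg 101 0).reg 100 + (s₁.tick.setReg 101 0).reg 101) = e.eval G σ := by
        simp [State.setReg, State.tick, hr₁.result]
      rw [hval]
      constructor
      · intro i hi
        simp only [State.setReg, State.tick, St.setr_r, Function.update_apply]
        rw [if_neg (show i ≠ 101 by omega), hc₁.reg i hi]
      · simp only [State.setReg, State.tick, Function.update_apply]
        rw [if_neg (by omega), if_neg (by omega)]
        exact hc₁.width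
      · exact hc₁.mem
      · exact hc₁.space
      · exact max_le (max_le hc₁.peak (Nat.zero_le _)) hv
      · intro i
        simp only [State.setReg, State.tick, Function.update_apply]
        split_ifs
        exacts [hv, Nat.zero_le _, hc₁.reg_le i]
      · exact hc₁.mem_le
    · exact hr₁.out.trans h.out
    · simp only [State.setReg, State.tick, hr₁.time, St.setr_t, mul_add, mul_one]
      have := h.time
      omega
    · simp
    · simp; omega
  | sto a x j e =>
    simp only [Cmd.fit, Bool.and_eq_true, decide_eq_true_eq] at hfit
    obtain ⟨okx, okj, hxR, hjW, oke, hQ⟩ := hw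
    obtain ⟨⟨⟨⟨ha, hfx⟩, hfj⟩, hfe⟩, hC⟩ := hfit
    obtain ⟨_, s₁, hs₁, hc₁, hr₁⟩ := x.compile_spec hG hfx h.core okx (d := 100) le_rfl
    obtain ⟨_, s₂, hs₂, hc₂, hr₂⟩ := j.compile_spec hG hfj hc₁ okj (d := 101) (by norm_num)
    obtain ⟨s₃, hs₃, hc₃, hr₃⟩ := Ex.address_spec hG hc₂ ha (d := 100) le_rfl
      ((hr₂.low 100 (by norm_num)).trans hr₁.result) hr₂.result hxR hjW
    obtain ⟨hv, s₄, hs₄, hc₄, hr₄⟩ := e.compile_spec hG hfe hc₃ oke (d := 101) (by norm_num)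
    have haddr := (hr₄.low 100 (by norm_num)).trans hr₃.result
    have hlt := lt_mul_of_index hxR hjW ha
    refine ⟨_, _, .seq hs₁ (.seq hs₂ (.seq hs₃ (.seq hs₄ (.store ..)))), ⟨?_, ?_, ?_⟩, ⟨?_, ?_⟩, hQ⟩
    · rw [haddr, hr₄.result]
      constructor
      · exact hc₄.reg
      · exact hc₄.width
      · intro b hb y i hi
        simp only [State.setMem, State.touch, State.tick, St.seta_A, Function.update_apply]
        -- Array, row and column can be recovered from an address by divisions with remainder, so a
        -- store changes no other entry.
        have hinj : 16 * (y * G.W + i) + b = 16 * (x.eval G σ * G.W + j.eval G σ) + a ↔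
            b = a ∧ y = x.eval G σ ∧ i = j.eval G σ := by
          constructor
          · intro heq
            have h1 : b = a := by omega
            have h2 : y * G.W + i = x.eval G σ * G.W + j.eval G σ := by omega
            have h3 := congrArg (· / G.W) h2
            rw [mul_comm y, mul_comm (x.eval G σ), Nat.mul_add_div (by omega),
              Nat.mul_add_div (by omega), Nat.div_eq_of_lt hi, Nat.div_eq_of_lt hjW] at h3
            simp only [add_zero] at h3
            subst h3
            exact ⟨h1, rfl, by omega⟩
          · rintro ⟨rfl, rfl, rfl⟩; rfl
        simp only [hinj]
        by_cases hba : b = a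
        · subst hba
          simp only [true_and, if_true, upd]
          split_ifs
          · rfl
          · exact hc₄.mem b hb y i hi
        · simp only [hba, false_and, if_false]
          exact hc₄.mem b hb y i hi
      · exact max_le hc₄.space hlt
      · exact hc₄.peak
      · exact hc₄.reg_le
      · intro i
        simp only [State.setMem, State.touch, State.tick, Function.update_apply]
        split_ifs
        exacts [hv, hc₄.mem_le i]
    · exact hr₄.out.trans (hr₃.out.trans (hr₂.out.trans (hr₁.out.trans h.out)))
    · simp only [State.setMem, State.touch, State.tick, hr₄.time, hr₃.time, hr₂.time, hr₁.time,
        St.seta_t, mul_add, mul_one]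
      have := h.time
      omega
    · simp
    · simp; omega
  | emi e =>
    simp only [Cmd.fit, Bool.and_eq_true, decide_eq_true_eq] at hfit
    obtain ⟨hv, s₁, hs₁, hc₁, hr₁⟩ := e.compile_spec hG hfit.1 h.core hw.1 (d := 100) le_rfl
    refine ⟨_, _, .seq hs₁ (.emit ..), ⟨?_, ?_, ?_⟩, ⟨?_, ?_⟩, hw.2⟩
    · exact ⟨hc₁.reg, hc₁.width, hc₁.mem, hc₁.space, hc₁.peak, hc₁.reg_le, hc₁.mem_le⟩
    · simp [State.write, State.tick, hr₁.result, hr₁.out, h.out]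
    · simp only [State.write, State.tick, hr₁.time, St.emit_t, mul_add, mul_one]
      have := h.time
      omega
    · simp
    · simp; omega
  | seq p q ihp ihq =>
    simp only [Cmd.fit, Bool.and_eq_true] at hfit
    obtain ⟨s₁, σ₁, hs₁, hr₁, hf₁, hQ₁⟩ := ihp hfit.1 h hw
    obtain ⟨s₂, σ₂, hs₂, hr₂, hf₂, hQ₂⟩ := ihq hfit.2 hr₁ hQ₁
    exact ⟨s₂, σ₂, .seq hs₁ hs₂, hr₂, hf₁.trans hf₂, hQ₂⟩
  | ite a b p q ihp ihq =>
    simp only [Cmd.fit, Bool.and_eq_true, decide_eq_true_eq] at hfit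
    obtain ⟨⟨⟨⟨hfa, hfb⟩, hfp⟩, hfq⟩, hC⟩ := hfit
    obtain ⟨oka, okb, hp, hq⟩ := hw
    obtain ⟨s₁, s₂, hs₁, hs₂, hc, ha, hb, hm, ho, ht⟩ := Cmd.compile_pair hG hfa hfb h.core oka okb
    have hrep : Rep G C D s₂.tick σ.tick := by
      refine ⟨hc.concreteTick.congr rfl rfl, ho.trans h.out, ?_⟩
      have := h.time
      simp only [State.tick, ht, St.tick_t, mul_add, mul_one]
      omega
    by_cases hlt : a.eval G σ < b.eval G σ
    · obtain ⟨s₃, σ₃, hs₃, hr₃, hf₃, hQ₃⟩ := ihp hfp hrep (hp hlt)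
      exact ⟨s₃, σ₃, .seq hs₁ (.seq hs₂ (.if_true (by rw [ha, hb]; exact hlt) hs₃)), hr₃,
        (Forward.tick σ).trans hf₃, hQ₃⟩
    · obtain ⟨s₃, σ₃, hs₃, hr₃, hf₃, hQ₃⟩ := ihq hfq hrep (hq hlt)
      exact ⟨s₃, σ₃, .seq hs₁ (.seq hs₂ (.if_false (by rw [ha, hb]; exact hlt) hs₃)), hr₃,
        (Forward.tick σ).trans hf₃, hQ₃⟩
  | whl a b p ih =>
    simp only [Cmd.fit, Bool.and_eq_true, decide_eq_true_eq] at hfit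
    obtain ⟨⟨⟨hfa, hfb⟩, hfp⟩, hC⟩ := hfit
    obtain ⟨I, τ, hI, hstep⟩ := hw
    -- Induction on a bound `N` for the time left until `τ`. The values for the test are already in
    -- the registers `100` and `101`, and their cost appears in the bound on the time.
    have key : ∀ (N : ℕ) (σ : St) (s : State), I σ → τ ≤ σ.t + N → Core G s σ → s.out = σ.o →
        s.time ≤ C * σ.t + D + a.cost + b.cost → s.reg 100 = a.eval G σ → s.reg 101 = b.eval G σ →
        ∃ s' σ', Exec G.inp (.whileLt 100 101 (.seq p.compile (.seq (a.compile 100) (b.compile 101))))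
          s s' ∧ Rep G C D s' σ' ∧ Forward σ σ' ∧ Q σ' := by
      intro N
      induction N with
      | zero =>
        intro σ s hI hN hc ho ht ha hb
        obtain ⟨hτ, oka, okb, hp, hq⟩ := hstep σ hI
        have hrep : Rep G C D s.tick σ.tick := by
          refine ⟨hc.concreteTick.congr rfl rfl, ho, ?_⟩
          simp only [State.tick, St.tick_t, mul_add, mul_one]
          omega
        -- With no time left, a further round would end after `τ`, against the invariant.
        by_cases hlt : a.eval G σ < b.eval G σ
        · obtain ⟨s₃, σ₃, hs₃, hr₃, hf₃, hI₃⟩ := ih hfp hrep (hp hlt)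
          have h1 := (hstep σ₃ hI₃).1
          have h2 := hf₃.time
          simp only [St.tick_t] at h2
          omega
        · exact ⟨_, _, .while_false (by rw [ha, hb]; exact hlt), hrep, Forward.tick σ, hq hlt⟩
      | succ N ihN =>
        intro σ s hI hN hc ho ht ha hb
        obtain ⟨hτ, oka, okb, hp, hq⟩ := hstep σ hI
        have hrep : Rep G C D s.tick σ.tick := by
          refine ⟨hc.concreteTick.congr rfl rfl, ho, ?_⟩
          simp only [State.tick, St.tick_t, mul_add, mul_one]
          omega
        by_cases hlt : a.eval G σ < b.eval G σ
        · obtain ⟨s₃, σ₃, hs₃, hr₃, hf₃, hI₃⟩ := ih hfp hrep (hp hlt)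
          have h2 := hf₃.time
          simp only [St.tick_t] at h2
          obtain ⟨_, oka', okb', _⟩ := hstep σ₃ hI₃
          obtain ⟨s₄, s₅, hs₄, hs₅, hc₅, ha₅, hb₅, hm₅, ho₅, ht₅⟩ :=
            Cmd.compile_pair hG hfa hfb hr₃.core oka' okb'
          obtain ⟨s₆, σ₆, hs₆, hr₆, hf₆, hQ₆⟩ := ihN σ₃ s₅ hI₃ (by omega) hc₅ (ho₅.trans hr₃.out)
            (by have := hr₃.time; omega) ha₅ hb₅
          exact ⟨s₆, σ₆, .while_true (by rw [ha, hb]; exact hlt) (.seq hs₃ (.seq hs₄ hs₅)) hs₆, hr₆,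
            ((Forward.tick σ).trans hf₃).trans hf₆, hQ₆⟩
        · exact ⟨_, _, .while_false (by rw [ha, hb]; exact hlt), hrep, Forward.tick σ, hq hlt⟩
    obtain ⟨_, oka, okb, _⟩ := hstep σ hI
    obtain ⟨s₁, s₂, hs₁, hs₂, hc, ha, hb, hm, ho, ht⟩ := Cmd.compile_pair hG hfa hfb h.core oka okb
    obtain ⟨s₃, σ₃, hs₃, h₃⟩ := key τ σ s₂ hI (by omega) hc (ho.trans h.out)
      (by have := h.time; omega) ha hb
    exact ⟨s₃, σ₃, .seq hs₁ (.seq hs₂ hs₃), h₃⟩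

/-- `for r := 0, …, b - 1 do p`, where `b` is a register. -/
def Cmd.loop (r b : ℕ) (p : Cmd) : Cmd :=
  .seq (.asg r (.num 0)) (.whl (.reg r) (.reg b) (.seq p (.asg r (.add (.reg r) (.num 1)))))

/-- Rule for loops with a counter. -/
theorem Cmd.wp_loop {r b : ℕ} {p : Cmd} {Q : St → Prop} {σ : St} (N τ : ℕ) (I : ℕ → St → Prop)
    (hN : N ≤ G.M) (hI : ∀ i ≤ N, ∀ σ, I i σ → σ.r r = i → σ.r b = N ∧ σ.t ≤ τ)
    (h0 : I 0 (σ.setr r 0))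
    (hs : ∀ i < N, ∀ σ, I i σ → σ.r r = i → σ.r b = N →
      p.wp G (fun σ' => σ'.r r = i ∧ I (i + 1) (σ'.setr r (i + 1))) σ.tick)
    (hQ : ∀ σ, I N σ → σ.r r = N → Q σ.tick) : (Cmd.loop r b p).wp G Q σ := by
  refine ⟨trivial, fun σ => ∃ i ≤ N, I i σ ∧ σ.r r = i, τ, ⟨0, Nat.zero_le _, h0, by simp [Ex.eval]⟩,
    fun σ ⟨i, hi, hσ, hri⟩ => ?_⟩
  obtain ⟨h1, h2⟩ := hI i hi σ hσ hri
  refine ⟨h2, trivial, trivial, fun hlt => ?_, fun hlt => ?_⟩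
  · simp only [Ex.eval, hri, h1] at hlt
    change Cmd.wp G p _ _
    refine Cmd.wp_mono (fun σ' h' => ?_) (hs i hlt σ hσ hri h1)
    refine ⟨⟨trivial, trivial, ?_⟩, i + 1, hlt, ?_, ?_⟩
    · simp only [Ex.eval, h'.1]; omega
    · simpa [Ex.eval, h'.1] using h'.2
    · simp [Ex.eval, h'.1]
  · simp only [Ex.eval, hri, h1] at hlt
    have : i = N := by omega
    subst this
    exact hQ σ hσ hri

end Language
end PebbleGame

namespace PebbleGame

/-! ### Rules for counting loops, and unchanged registers and arrays -/

section Rules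

variable {G : Env}

/-- Do nothing. -/
def Cmd.skip : Cmd := .asg 98 (.num 0)

/-- Rule for loops with a counter and a bound on the time of each round. -/
theorem Cmd.wp_for {r b : ℕ} {p : Cmd} {Q : St → Prop} {σ : St} (N c : ℕ) (I : ℕ → St → Prop)
    (hN : N ≤ G.M) (hb : σ.r b = N) (hrb : b ≠ r) (h0 : I 0 (σ.setr r 0))
    (hs : ∀ i < N, ∀ σ₁, I i σ₁ → σ₁.r r = i → σ₁.r b = N →
      p.wp G (fun σ' => σ'.r r = i ∧ σ'.r b = N ∧ I (i + 1) (σ'.setr r (i + 1)) ∧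
        σ'.t ≤ σ₁.t + c) σ₁.tick)
    (hQ : ∀ σ₁, I N σ₁ → σ₁.r r = N → σ₁.t ≤ σ.t + 1 + N * (c + 1) → Q σ₁.tick) :
    (Cmd.loop r b p).wp G Q σ := by
  -- A round takes at most `c` for the test and the body, and one more for the increment. The extra
  -- unit pays for the initial value of the counter.
  refine Cmd.wp_loop N (σ.t + 1 + N * (c + 1))
    (fun i σ₁ => I i σ₁ ∧ σ₁.r b = N ∧ σ₁.t ≤ σ.t + 1 + i * (c + 1)) hN ?_ ?_ ?_ ?_
  · intro i hi σ₁ h _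
    have := Nat.mul_le_mul_right (c + 1) hi
    exact ⟨h.2.1, by omega⟩
  · exact ⟨h0, by simp [hrb, hb], by simp⟩
  · intro i hi σ₁ h hr hb
    refine Cmd.wp_mono (fun σ' h' => ⟨h'.1, h'.2.2.1, ?_, ?_⟩) (hs i hi σ₁ h.1 hr hb)
    · simp [hrb, h'.2.1]
    · have := h'.2.2.2
      have := h.2.2
      simp only [St.setr_t, add_mul, one_mul] at *
      omega
  · intro σ₁ h hr
    exact hQ σ₁ h.1 hr h.2.2

/-- Registers below `l` and arrays outside of a list are unchanged. -/
structure Keeps (l : ℕ) (as : List ℕ) (σ σ' : St) : Prop where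
  reg : ∀ i < l, σ'.r i = σ.r i
  arr : ∀ a, a ∉ as → σ'.A a = σ.A a

theorem Keeps.refl (l : ℕ) (as : List ℕ) (σ : St) : Keeps l as σ σ := ⟨fun _ _ => rfl, fun _ _ => rfl⟩

theorem Keeps.trans {l : ℕ} {as : List ℕ} {σ₁ σ₂ σ₃ : St} (h₁ : Keeps l as σ₁ σ₂)
    (h₂ : Keeps l as σ₂ σ₃) : Keeps l as σ₁ σ₃ :=
  ⟨fun i hi => (h₂.reg i hi).trans (h₁.reg i hi), fun a ha => (h₂.arr a ha).trans (h₁.arr a ha)⟩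

theorem Keeps.mono {l l' : ℕ} {as as' : List ℕ} {σ₁ σ₂ : St} (h : Keeps l as σ₁ σ₂) (hl : l' ≤ l)
    (has : as ⊆ as') : Keeps l' as' σ₁ σ₂ :=
  ⟨fun i hi => h.reg i (by omega), fun a ha => h.arr a fun h => ha (has h)⟩

@[simp] theorem keeps_tick {l : ℕ} {as : List ℕ} {σ σ' : St} :
    Keeps l as σ σ'.tick ↔ Keeps l as σ σ' := ⟨fun h => ⟨h.1, h.2⟩, fun h => ⟨h.1, h.2⟩⟩

@[simp] theorem keeps_setr {l : ℕ} {as : List ℕ} {σ σ' : St} {i v : ℕ} (hi : l ≤ i) :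
    Keeps l as σ (σ'.setr i v) ↔ Keeps l as σ σ' := by
  refine ⟨fun h => ⟨fun j hj => ?_, h.2⟩, fun h => ⟨fun j hj => ?_, h.2⟩⟩
  · have := h.1 j hj
    rwa [St.setr_r, if_neg (by omega)] at this
  · rw [St.setr_r, if_neg (by omega)]
    exact h.1 j hj

@[simp] theorem keeps_seta {l : ℕ} {as : List ℕ} {σ σ' : St} {a x j v : ℕ} (ha : a ∈ as) :
    Keeps l as σ (σ'.seta a x j v) ↔ Keeps l as σ σ' := by
  refine ⟨fun h => ⟨h.1, fun b hb => ?_⟩, fun h => ⟨h.1, fun b hb => ?_⟩⟩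
  · have := h.2 b hb
    rwa [St.seta_A, if_neg (by rintro rfl; exact hb ha)] at this
  · rw [St.seta_A, if_neg (by rintro rfl; exact hb ha)]
    exact h.2 b hb

@[simp] theorem keeps_emit {l : ℕ} {as : List ℕ} {σ σ' : St} {v : ℕ} :
    Keeps l as σ (σ'.emit v) ↔ Keeps l as σ σ' := ⟨fun h => ⟨h.1, h.2⟩, fun h => ⟨h.1, h.2⟩⟩

theorem upd_apply (f : ℕ → ℕ → ℕ) (x j v y i : ℕ) :
    upd f x j v y i = if y = x ∧ i = j then v else f y i := rfl

theorem upd_of_ne {f : ℕ → ℕ → ℕ} {x j v y i : ℕ} (h : ¬ (y = x ∧ i = j)) :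
    upd f x j v y i = f y i := if_neg h

@[simp] theorem upd_self (f : ℕ → ℕ → ℕ) (x j v : ℕ) : upd f x j v x j = v := if_pos ⟨rfl, rfl⟩

/-- The parameters are within the bounds. -/
structure Env.IsFor (G : Env) (n m k ℓ : ℕ) : Prop where
  large : G.IsLarge
  width : 2 * k + 2 ≤ G.W
  rows : n ≤ G.R
  pairs : n * n ≤ G.R
  numbers : 16 * (n * n + n * k + n + k + ℓ + m + 1) ≤ G.M

end Rules

/-! ### Lists of ingoing edges -/

section Search

variable {G : Env} {n m k ℓ : ℕ}

local infixr:60 " ;; " => Cmd.seq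
local infix:70 " ≔ " => Cmd.asg
local notation "ρ" => Ex.reg
local notation "♯" => Ex.num

/-- Clear the marks and the lists of ingoing edges. -/
def clearLists : Cmd :=
  .loop 20 2 (.sto 4 (ρ 20) (♯ 0) (♯ 0) ;; .loop 21 0 (.sto 7 (ρ 20) (ρ 21) (♯ 0)))

theorem clearLists_spec (hG : G.IsFor n m k ℓ) {σ : St} (h0 : σ.r 0 = k) (h2 : σ.r 2 = n)
    {Q : St → Prop} (hQ : ∀ σ', Keeps 20 [4, 7] σ σ' → σ'.o = σ.o →
      (∀ x < n, σ'.A 4 x 0 = 0) → (∀ x < n, ∀ i < k, σ'.A 7 x i = 0) →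
      σ'.t ≤ σ.t + 10 * ((n + 1) * (k + 1)) → Q σ') : clearLists.wp G Q σ := by
  have hM := hG.numbers
  have hR := hG.rows
  have hW := hG.width
  refine Cmd.wp_for n (3 * k + 5) (fun x σ' => Keeps 20 [4, 7] σ σ' ∧ σ'.o = σ.o ∧
    (∀ y < x, σ'.A 4 y 0 = 0) ∧ (∀ y < x, ∀ i < k, σ'.A 7 y i = 0)) (by omega) h2 (by norm_num)
    ?_ ?_ ?_
  · simp [Keeps.refl]
  · rintro x hx σ₁ ⟨hk, ho, h4, h7⟩ hr hb
    have hr0 := (hk.reg 0 (by norm_num)).trans h0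
    refine ⟨trivial, trivial, ?_, ?_, trivial, ?_⟩
    · simp [Ex.eval, hr]; omega
    · simp [Ex.eval]; omega
    refine Cmd.wp_for k 2 (fun i σ' => Keeps 20 [4, 7] σ σ' ∧ σ'.o = σ.o ∧ σ'.r 20 = x ∧ σ'.r 2 = n ∧
      (∀ y < x + 1, σ'.A 4 y 0 = 0) ∧
      (∀ y < x, ∀ i < k, σ'.A 7 y i = 0) ∧ (∀ j < i, σ'.A 7 x j = 0)) (by omega) (by simpa using hr0)
      (by norm_num) ?_ ?_ ?_
    · simp [hk, ho, hr, hb, Ex.eval, upd_apply]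
      refine ⟨?_, h7⟩
      intro y hy h; exact h4 y (by omega)
    · rintro i hi σ₂ ⟨hk, ho, hx2, hn, h4, h7, h7'⟩ hr2 hb2
      simp [Cmd.wp, Ex.ok, Ex.eval, hr2, hx2, hk, ho, hn, upd_apply, hb2]
      refine ⟨by omega, by omega, fun y hy => h4 y (by omega), ?_, ?_⟩
      · intro y hy j hj _; exact h7 y hy j hj
      · intro j hj h; exact h7' j (by omega)
    · rintro σ₂ ⟨hk, ho, hx2, hn, h4, h7, h7'⟩ hr2 ht
      simp at ht
      simp [hx2, hn, hk, ho]
      refine ⟨⟨fun y hy => h4 y (by omega), ?_⟩, by omega⟩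
      intro y hy i hi
      rcases Nat.lt_or_eq_of_le hy with h | rfl
      · exact h7 y h i hi
      · exact h7' i hi
  · rintro σ₁ ⟨hk, ho, h4, h7⟩ hr ht
    refine hQ _ (by simpa using hk) ho h4 h7 ?_
    simp only [St.tick_t]
    ring_nf at ht ⊢
    omega

/-- `h` is the head of a linked list with entries `L`, where `nx` gives the links. -/
def ListAt (nx : ℕ → ℕ) : ℕ → List ℕ → Prop
  | h, [] => h = 0
  -- Heads and links are shifted by one, since `0` marks the end of a list.
  | h, u :: L => h = u + 1 ∧ ListAt nx (nx u) L

theorem ListAt.congr {nx nx' : ℕ → ℕ} {L : List ℕ} {h : ℕ} (hL : ListAt nx h L)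
    (hn : ∀ u ∈ L, nx' u = nx u) : ListAt nx' h L := by
  induction L generalizing h with
  | nil => exact hL
  | cons u L ih =>
    refine ⟨hL.1, ?_⟩
    rw [hn u (by simp)]
    exact ih hL.2 fun w hw => hn w (by simp [hw])

/-- The tails below `p` of the edges of color `i` into `x`. -/
def inTails (ED HD : ℕ → ℕ → ℕ) (x i : ℕ) : ℕ → List ℕ
  | 0 => []
  | p + 1 => if 0 < ED p i ∧ HD p i = x then p :: inTails ED HD x i p else inTails ED HD x i p

theorem mem_inTails {ED HD : ℕ → ℕ → ℕ} {x i p u : ℕ} :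
    u ∈ inTails ED HD x i p ↔ u < p ∧ 0 < ED u i ∧ HD u i = x := by
  induction p with
  | zero => simp [inTails]
  | succ p ih =>
    rw [inTails]
    split_ifs with h
    · rw [List.mem_cons, ih]
      constructor
      · rintro (rfl | h')
        exacts [⟨by omega, h⟩, ⟨by omega, h'.2⟩]
      · rintro ⟨h1, h2⟩
        by_cases hu : u = p
        exacts [.inl hu, .inr ⟨by omega, h2⟩]
    · rw [ih]
      constructor
      · rintro ⟨h1, h2⟩
        exact ⟨by omega, h2⟩
      · rintro ⟨h1, h2⟩
        refine ⟨?_, h2⟩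
        rcases Nat.lt_succ_iff_lt_or_eq.1 h1 with h' | rfl
        exacts [h', absurd h2 h]

/-- A vertex has at most one outgoing edge of color `i`, so it occurs in the list of at most one
head. This makes the search linear in `n`. -/
theorem sum_length_inTails_le (ED HD : ℕ → ℕ → ℕ) (n i p : ℕ) :
    ∑ x ∈ Finset.range n, (inTails ED HD x i p).length ≤ p := by
  induction p with
  | zero => simp [inTails]
  | succ p ih =>
    calc _ ≤ ∑ x ∈ Finset.range n, ((inTails ED HD x i p).length + if HD p i = x then 1 else 0) := by
          refine Finset.sum_le_sum fun x _ => ?_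
          rw [inTails]
          split_ifs with h h' h'
          · simp
          · exact absurd h.2 h'
          · omega
          · omega
      _ ≤ p + 1 := by
          rw [Finset.sum_add_distrib, Finset.sum_ite_eq]
          split_ifs <;> omega

/-- Build the lists of ingoing edges. -/
def buildLists : Cmd :=
  .loop 20 2 (.loop 21 0 (.ite (♯ 0) (.arr 0 (ρ 20) (ρ 21))
    (22 ≔ .arr 1 (ρ 20) (ρ 21) ;; .sto 8 (ρ 20) (ρ 21) (.arr 7 (ρ 22) (ρ 21)) ;;
      .sto 7 (ρ 22) (ρ 21) (.add (ρ 20) (♯ 1)))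
    .skip))

/-- The vertex `p` is entered color by color, so the lists of the colors below `i` are one row
ahead. It is put in front of a list, and setting its link destroys nothing because all tails in this
list are below `p`. -/
theorem buildLists_step {ED HD FI NX : ℕ → ℕ → ℕ} {p i j x : ℕ} (hp : 0 < ED p i)
    (h : ListAt (fun u => NX u j) (FI x j) (inTails ED HD x j (if j < i then p + 1 else p))) :
    ListAt (fun u => upd NX p i (FI (HD p i) i) u j) (upd FI (HD p i) i (p + 1) x j)
      (inTails ED HD x j (if j < i + 1 then p + 1 else p)) := by
  by_cases hj : j = i
  · subst hj
    rw [if_neg (by omega)] at h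
    rw [if_pos (by omega)]
    have h' : ListAt (fun u => upd NX p j (FI (HD p j) j) u j) (FI x j) (inTails ED HD x j p) :=
      h.congr fun u hu => upd_of_ne fun h => by
        have := (mem_inTails.1 hu).1
        omega
    rw [inTails]
    by_cases hx : HD p j = x
    · subst hx
      rw [if_pos ⟨hp, rfl⟩]
      refine ⟨by simp, ?_⟩
      simpa using h'
    · rw [if_neg (fun h => hx h.2), upd_of_ne (fun h => hx h.1.symm)]
      exact h'
  · have h1 : (if j < i + 1 then p + 1 else p) = if j < i then p + 1 else p := by
      split_ifs <;> omega
    rw [h1, upd_of_ne (fun h => hj h.2)]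
    exact h.congr fun u _ => upd_of_ne fun h => hj h.2

theorem buildLists_skip {ED HD FI NX : ℕ → ℕ → ℕ} {p i j x : ℕ} (hp : ED p i = 0)
    (h : ListAt (fun u => NX u j) (FI x j) (inTails ED HD x j (if j < i then p + 1 else p))) :
    ListAt (fun u => NX u j) (FI x j) (inTails ED HD x j (if j < i + 1 then p + 1 else p)) := by
  by_cases hj : j = i
  · subst hj
    rw [if_neg (by omega)] at h
    rw [if_pos (by omega), inTails, if_neg (by omega)]
    exact h
  · have h1 : (if j < i + 1 then p + 1 else p) = if j < i then p + 1 else p := by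
      split_ifs <;> omega
    rwa [h1]

theorem buildLists_spec (hG : G.IsFor n m k ℓ) {σ : St} (h0 : σ.r 0 = k) (h2 : σ.r 2 = n)
    (hHD : ∀ x < n, ∀ i < k, 0 < σ.A 0 x i → σ.A 1 x i < n)
    (hFI : ∀ x < n, ∀ i < k, σ.A 7 x i = 0)
    {Q : St → Prop} (hQ : ∀ σ', Keeps 20 [7, 8] σ σ' → σ'.o = σ.o →
      (∀ x < n, ∀ i < k, ListAt (fun u => σ'.A 8 u i) (σ'.A 7 x i)
        (inTails (σ.A 0) (σ.A 1) x i n)) →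
      σ'.t ≤ σ.t + 10 * ((n + 1) * (k + 1)) → Q σ') : buildLists.wp G Q σ := by
  have hM := hG.numbers
  have hR := hG.rows
  have hW := hG.width
  refine Cmd.wp_for n (6 * k + 4) (fun p σ' => Keeps 20 [7, 8] σ σ' ∧ σ'.o = σ.o ∧
    ∀ x < n, ∀ i < k, ListAt (fun u => σ'.A 8 u i) (σ'.A 7 x i) (inTails (σ.A 0) (σ.A 1) x i p))
    (by omega) h2 (by norm_num) ?_ ?_ ?_
  · simp [Keeps.refl]
    intro x hx i hi
    exact hFI x hx i hi
  · rintro p hp σ₁ ⟨hk, ho, hL⟩ hr hb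
    have hr0 := (hk.reg 0 (by norm_num)).trans h0
    refine Cmd.wp_for k 5 (fun i σ' => Keeps 20 [7, 8] σ σ' ∧ σ'.o = σ.o ∧ σ'.r 20 = p ∧ σ'.r 2 = n ∧
      ∀ x < n, ∀ j < k, ListAt (fun u => σ'.A 8 u j) (σ'.A 7 x j)
        (inTails (σ.A 0) (σ.A 1) x j (if j < i then p + 1 else p)))
      (by omega) (by simpa using hr0) (by norm_num) ?_ ?_ ?_
    · simp [hk, ho, hr, hb]
      exact hL
    · rintro i hi σ₂ ⟨hk, ho, hx2, hn, hL⟩ hr2 hb2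
      have hA0 := hk.arr 0 (by simp)
      have hA1 := hk.arr 1 (by simp)
      simp [Cmd.wp, Cmd.skip, Ex.ok, Ex.eval, hr2, hx2, hk, ho, hn, hb2, hA0, hA1]
      refine ⟨⟨by omega, by omega⟩, fun hpos => ?_, fun hzero => ?_⟩
      · have := hHD p hp i hi hpos
        refine ⟨⟨by omega, by omega⟩, by omega, by omega, ⟨by omega, by omega⟩, by omega, by omega,
          by omega, ?_⟩
        intro x hx j hj
        simpa only [Order.lt_add_one_iff] using buildLists_step hpos (hL x hx j hj)
      · intro x hx j hj
        simpa only [Order.lt_add_one_iff] using buildLists_skip hzero (hL x hx j hj)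
    · rintro σ₂ ⟨hk, ho, hx2, hn, hL⟩ hr2 ht
      simp at ht
      simp [hx2, hn, hk, ho]
      refine ⟨?_, by omega⟩
      intro x hx i hi
      have := hL x hx i hi
      rwa [if_pos hi] at this
  · rintro σ₁ ⟨hk, ho, hL⟩ hr ht
    refine hQ _ (by simpa using hk) ho hL ?_
    simp only [St.tick_t]
    ring_nf at ht ⊢
    omega

end Search
end PebbleGame

namespace PebbleGame

/-! ### Visited vertices and the sources of the search -/

section Search

variable {G : Env} {n m k ℓ : ℕ}

local infixr:60 " ;; " => Cmd.seq
local infix:70 " ≔ " => Cmd.asg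
local notation "ρ" => Ex.reg
local notation "♯" => Ex.num

/-- The marks `TW` (`0` for unvisited vertices, `1` for vertices with a pebble, `i + 2` for vertices with
an edge of color `i` to a vertex visited before), the ranks `RK`, and the queue `QU` of a search
that has visited `q` vertices. -/
structure IsVisit (n k v w : ℕ) (ED HD TW RK QU : ℕ → ℕ → ℕ) (q : ℕ) : Prop where
  queue : ∀ j < q, QU j 0 < n ∧ TW (QU j 0) 0 ≠ 0 ∧ RK (QU j 0) 0 = j
  rank : ∀ x < n, TW x 0 ≠ 0 → RK x 0 < q ∧ QU (RK x 0) 0 = x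
  source : ∀ x < n, TW x 0 = 1 → x ≠ v ∧ x ≠ w ∧ ∃ i < k, ED x i = 0
  toward : ∀ x < n, ∀ i, TW x 0 = i + 2 → i < k ∧ 0 < ED x i ∧ HD x i < n ∧ TW (HD x i) 0 ≠ 0 ∧
    RK (HD x i) 0 < RK x 0

/-- The ranks show that no vertex is in the queue twice. -/
theorem IsVisit.le {v w q : ℕ} {ED HD TW RK QU : ℕ → ℕ → ℕ}
    (h : IsVisit n k v w ED HD TW RK QU q) : q ≤ n := by
  have := Finset.card_le_card_of_injOn (s := Finset.range q) (t := Finset.range n) (fun j => QU j 0)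
    (fun j hj => by simpa using (h.queue j (by simpa using hj)).1) (fun i hi j hj hij => by
      have h1 := (h.queue i (by simpa using hi)).2.2
      have h2 := (h.queue j (by simpa using hj)).2.2
      simp only at hij
      rw [hij] at h1
      exact h1.symm.trans h2)
  simpa using this

/-- The new vertex gets the largest rank, so the edge recorded for it leads to a smaller rank. As it
was unvisited, no record of another vertex refers to it. -/
theorem IsVisit.visit {v w q u tag : ℕ} {ED HD TW RK QU : ℕ → ℕ → ℕ}
    (h : IsVisit n k v w ED HD TW RK QU q) (hu : u < n) (h0 : TW u 0 = 0) (ht : tag ≠ 0)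
    (h1 : tag = 1 → u ≠ v ∧ u ≠ w ∧ ∃ i < k, ED u i = 0)
    (h2 : ∀ i, tag = i + 2 → i < k ∧ 0 < ED u i ∧ HD u i < n ∧ TW (HD u i) 0 ≠ 0) :
    IsVisit n k v w ED HD (upd TW u 0 tag) (upd RK u 0 q) (upd QU q 0 u) (q + 1) where
  queue j hj := by
    simp only [upd_apply, and_true]
    by_cases hjq : j = q
    · simp [hjq, hu, ht]
    · obtain ⟨ha, hb, hc⟩ := h.queue j (by omega)
      have hne : QU j 0 ≠ u := fun h => hb (h ▸ h0)
      simp [hjq, hne, ha, hb, hc]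
  rank x hx := by
    simp only [upd_apply, and_true]
    by_cases hxu : x = u
    · simp [hxu]
    · intro hT
      rw [if_neg hxu] at hT
      obtain ⟨ha, hb⟩ := h.rank x hx hT
      rw [if_neg hxu, if_neg (by omega)]
      exact ⟨by omega, hb⟩
  source x hx := by
    simp only [upd_apply, and_true]
    by_cases hxu : x = u
    · subst hxu; simpa using h1
    · rw [if_neg hxu]; exact h.source x hx
  toward x hx i := by
    simp only [upd_apply, and_true]
    by_cases hxu : x = u
    · subst hxu
      rw [if_pos rfl, if_pos rfl]
      intro htag
      obtain ⟨ha, hb, hc, hd⟩ := h2 i htag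
      have hne : HD x i ≠ x := fun h => hd (h.symm ▸ h0)
      rw [if_neg hne, if_neg hne]
      exact ⟨ha, hb, hc, hd, (h.rank _ hc hd).1⟩
    · rw [if_neg hxu, if_neg hxu]
      intro htag
      obtain ⟨ha, hb, hc, hd, he⟩ := h.toward x hx i htag
      have hne : HD x i ≠ u := fun h => hd (h.symm ▸ h0)
      rw [if_neg hne, if_neg hne]
      exact ⟨ha, hb, hc, hd, he⟩

/-- Visit the vertex `x`. -/
def visitCmd (x tag : Ex) : Cmd :=
  .sto 4 x (♯ 0) tag ;; .sto 5 x (♯ 0) (ρ 23) ;; .sto 6 (ρ 23) (♯ 0) x ;; 23 ≔ .add (ρ 23) (♯ 1)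

/-- Visit the vertices outside of `{v, w}` that have pebbles. -/
def visitSources : Cmd :=
  .loop 20 2
    -- The sum of the two truncated differences is positive exactly if the two numbers differ.
    (.ite (♯ 0) (.add (.sub (ρ 20) (ρ 5)) (.sub (ρ 5) (ρ 20)))
      (.ite (♯ 0) (.add (.sub (ρ 20) (ρ 6)) (.sub (ρ 6) (ρ 20)))
        (.loop 21 0 (.ite (.arr 0 (ρ 20) (ρ 21)) (♯ 1)
          (.ite (.arr 4 (ρ 20) (♯ 0)) (♯ 1) (visitCmd (ρ 20) (♯ 1)) .skip) .skip))
        .skip)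
      .skip)

/-- The state of a search. -/
structure IsSearch (n k v w : ℕ) (σ σ' : St) : Prop where
  keeps : Keeps 20 [4, 5, 6] σ σ'
  out : σ'.o = σ.o
  visit : IsVisit n k v w (σ.A 0) (σ.A 1) (σ'.A 4) (σ'.A 5) (σ'.A 6) (σ'.r 23)

theorem IsSearch.congr {v w : ℕ} {σ σ₁ σ₂ : St} (h : IsSearch n k v w σ σ₁)
    (hk : Keeps 20 [4, 5, 6] σ σ₂) (ho : σ₂.o = σ₁.o) (h4 : σ₂.A 4 = σ₁.A 4) (h5 : σ₂.A 5 = σ₁.A 5)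
    (h6 : σ₂.A 6 = σ₁.A 6) (hr : σ₂.r 23 = σ₁.r 23) : IsSearch n k v w σ σ₂ :=
  ⟨hk, ho.trans h.out, by rw [h4, h5, h6, hr]; exact h.visit⟩

theorem visitSources_spec (hG : G.IsFor n m k ℓ) {σ : St} {v w : ℕ} (h0 : σ.r 0 = k) (h2 : σ.r 2 = n)
    (hv : σ.r 5 = v) (hw : σ.r 6 = w) (hvn : v < n) (hwn : w < n) (h23 : σ.r 23 = 0)
    (hTW : ∀ x < n, σ.A 4 x 0 = 0)
    {Q : St → Prop} (hQ : ∀ σ', IsSearch n k v w σ σ' →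
      (∀ x < n, x ≠ v → x ≠ w → (∃ i < k, σ.A 0 x i = 0) → σ'.A 4 x 0 ≠ 0) →
      σ'.t ≤ σ.t + 15 * ((n + 1) * (k + 1)) → Q σ') : visitSources.wp G Q σ := by
  have hM := hG.numbers
  have hR := hG.rows
  have hW := hG.width
  refine Cmd.wp_for n (8 * k + 6) (fun x σ' => IsSearch n k v w σ σ' ∧
    (∀ y < x, y ≠ v → y ≠ w → (∃ i < k, σ.A 0 y i = 0) → σ'.A 4 y 0 ≠ 0))
    (by omega) h2 (by norm_num) ?_ ?_ ?_
  · refine ⟨⟨by simp [Keeps.refl], rfl, ?_⟩, by simp⟩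
    simp only [St.setr_r, St.setr_A, h23]
    norm_num
    refine ⟨by simp, fun x hx h => absurd (hTW x hx) h, fun x hx h => ?_, fun x hx i h => ?_⟩
    · rw [hTW x hx] at h; omega
    · rw [hTW x hx] at h; omega
  · rintro x hx σ₁ ⟨hS, hsrc⟩ hr hb
    have hr0 := (hS.keeps.reg 0 (by norm_num)).trans h0
    have hr5 := (hS.keeps.reg 5 (by norm_num)).trans hv
    have hr6 := (hS.keeps.reg 6 (by norm_num)).trans hw
    have hk := hS.keeps
    have hend : ∀ σ₂ : St, IsSearch n k v w σ σ₂ → (∀ y < x, y ≠ v → y ≠ w →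
        (∃ i < k, σ.A 0 y i = 0) → σ₂.A 4 y 0 ≠ 0) → (x ≠ v → x ≠ w → (∃ i < k, σ.A 0 x i = 0) →
          σ₂.A 4 x 0 ≠ 0) → IsSearch n k v w σ (σ₂.setr 20 (x + 1)) ∧
        (∀ y < x + 1, y ≠ v → y ≠ w → (∃ i < k, σ.A 0 y i = 0) → (σ₂.setr 20 (x + 1)).A 4 y 0 ≠ 0) := by
      intro σ₂ h1 h2 h3
      refine ⟨h1.congr (by simpa using h1.keeps) rfl rfl rfl rfl (by simp), fun y hy => ?_⟩
      rcases Nat.lt_succ_iff_lt_or_eq.1 hy with h | rfl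
      exacts [h2 y h, h3]
    have hskip : ∀ d, (x = v ∨ x = w) → d ≤ 2 → Cmd.skip.wp G (fun σ' => σ'.r 20 = x ∧ σ'.r 2 = n ∧
        (IsSearch n k v w σ (σ'.setr 20 (x + 1)) ∧
        (∀ y < x + 1, y ≠ v → y ≠ w → (∃ i < k, σ.A 0 y i = 0) → (σ'.setr 20 (x + 1)).A 4 y 0 ≠ 0)) ∧
        σ'.t ≤ σ₁.t + (8 * k + 6)) (if d = 1 then σ₁.tick.tick else σ₁.tick.tick.tick) := by
      intro d hxv hd
      refine ⟨trivial, ?_, ?_, hend _ (hS.congr ?_ ?_ ?_ ?_ ?_ ?_) ?_ ?_, ?_⟩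
      all_goals split_ifs <;> simp [hr, hb, hk]
      all_goals first | omega | exact fun y hy h1 h2 j hj h0 => hsrc y hy h1 h2 ⟨j, hj, h0⟩
    refine ⟨trivial, ⟨⟨trivial, trivial⟩, ⟨trivial, trivial⟩, ?_⟩, fun hxv => ?_, fun hxv => ?_⟩
    · simp [Ex.eval, hr, hr5]; omega
    · simp [Ex.eval, hr, hr5] at hxv
      refine ⟨trivial, ⟨⟨trivial, trivial⟩, ⟨trivial, trivial⟩, ?_⟩, fun hxw => ?_, fun hxw => ?_⟩
      · simp [Ex.eval, hr, hr6]; omega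
      · simp [Ex.eval, hr, hr6] at hxw
        refine Cmd.wp_for k 7 (fun i σ' => IsSearch n k v w σ σ' ∧ σ'.r 20 = x ∧ σ'.r 2 = n ∧
          (∀ y < x, y ≠ v → y ≠ w → (∃ i < k, σ.A 0 y i = 0) → σ'.A 4 y 0 ≠ 0) ∧
          ∀ j < i, σ.A 0 x j = 0 → σ'.A 4 x 0 ≠ 0) (by omega) (by simpa using hr0) (by norm_num)
          ?_ ?_ ?_
        · refine ⟨hS.congr (by simpa using hk) rfl rfl rfl rfl (by simp), by simp [hr], by simp [hb],
            hsrc, by simp⟩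
        · rintro i hi σ₂ ⟨hS, hx2, hn, hsrc, hsrc'⟩ hr2 hb2
          have hA0 := hS.keeps.arr 0 (by simp)
          have hk := hS.keeps
          have hcong : ∀ σ₃ : St, σ₃ = σ₂.tick.tick.setr 98 0 ∨ σ₃ = σ₂.tick.tick.tick.setr 98 0 →
              IsSearch n k v w σ (σ₃.setr 21 (i + 1)) := by
            rintro σ₃ (rfl | rfl) <;>
              exact hS.congr (by simpa using hk) rfl rfl rfl rfl (by simp)
          simp only [Cmd.wp, visitCmd, Cmd.skip, Ex.ok, Ex.eval, hA0, hr2, hx2, St.tick_r, St.tick_A]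
          refine ⟨⟨trivial, trivial, by omega, by omega⟩, trivial, fun hED => ⟨⟨trivial, trivial,
            by omega, by omega⟩, trivial, fun hT => ?_, fun hT => ?_⟩, fun hED => ?_⟩
          · have hvis := hS.visit.visit (u := x) (tag := 1) hx (by omega) (by norm_num)
              (fun _ => ⟨by omega, by omega, i, hi, by omega⟩) (fun i hi => by omega)
            have hq := hvis.le
            simp [hx2, hr2, hn, hb2]
            refine ⟨by omega, by omega, by omega, by omega, by omega, by omega, by omega,
              ⟨by simpa using hk, hS.out, ?_⟩, ?_⟩
            · simpa using hvis
            · intro y hy h1 h2 j hj hj'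
              rw [upd_of_ne (by omega)]
              exact hsrc y hy h1 h2 ⟨j, hj, hj'⟩
          · refine ⟨trivial, by simp [hr2], by simp [hb2], ⟨hcong _ (.inr rfl), by simp [hx2],
              by simp [hn], hsrc, fun _ _ _ => ?_⟩, by simp⟩
            simp; omega
          · refine ⟨trivial, by simp [hr2], by simp [hb2], ⟨hcong _ (.inl rfl), by simp [hx2],
              by simp [hn], hsrc, fun j hj h0 => ?_⟩, by simp⟩
            refine hsrc' j ?_ h0
            rcases Nat.lt_succ_iff_lt_or_eq.1 hj with h | rfl
            exacts [h, absurd h0 (by omega)]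
        · rintro σ₂ ⟨hS, hx2, hn, hsrc, hsrc'⟩ hr2 ht
          refine ⟨by simp [hx2], by simp [hn], hend _ (hS.congr (by simpa using hS.keeps) rfl rfl rfl rfl
            (by simp)) hsrc (fun _ _ ⟨j, hj, h⟩ => hsrc' j hj h), ?_⟩
          simp at ht ⊢
          omega
      · simp [Ex.eval, hr, hr6] at hxw
        exact hskip 2 (.inr (by omega)) le_rfl
    · simp [Ex.eval, hr, hr5] at hxv
      exact hskip 1 (.inl (by omega)) (by norm_num)
  · rintro σ₁ ⟨hS, hsrc⟩ hr ht
    refine hQ _ (hS.congr (by simpa using hS.keeps) rfl rfl rfl rfl (by simp)) hsrc ?_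
    simp only [St.tick_t]
    ring_nf at ht ⊢
    omega

end Search
end PebbleGame

namespace PebbleGame

/-! ### Breadth-first search against the direction of the edges -/

section Search

variable {G : Env} {n m k ℓ : ℕ}

local infixr:60 " ;; " => Cmd.seq
local infix:70 " ≔ " => Cmd.asg
local notation "ρ" => Ex.reg
local notation "♯" => Ex.num

/-- Visit the unvisited tails of the edges of a color into a vertex. -/
def scanList : Cmd :=
  22 ≔ .arr 7 (ρ 20) (ρ 21) ;;
  .whl (♯ 0) (ρ 22)
    (25 ≔ .sub (ρ 22) (♯ 1) ;;
      .ite (.arr 4 (ρ 25) (♯ 0)) (♯ 1) (visitCmd (ρ 25) (.add (ρ 21) (♯ 2))) .skip ;;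
      22 ≔ .arr 8 (ρ 25) (ρ 21))

theorem scanList_spec (hG : G.IsFor n m k ℓ) {σ σ₁ : St} {v w x i : ℕ} (hS : IsSearch n k v w σ σ₁)
    (hx : σ₁.r 20 = x) (hi : σ₁.r 21 = i) (hxn : x < n) (hik : i < k) (hvis : σ₁.A 4 x 0 ≠ 0)
    (hL : ListAt (fun u => σ.A 8 u i) (σ.A 7 x i) (inTails (σ.A 0) (σ.A 1) x i n))
    {Q : St → Prop} (hQ : ∀ σ', IsSearch n k v w σ σ' → σ'.r 20 = x → σ'.r 21 = i →
      σ'.r 24 = σ₁.r 24 → σ₁.r 23 ≤ σ'.r 23 →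
      (∀ y, σ₁.A 4 y 0 ≠ 0 → σ'.A 4 y 0 ≠ 0) →
      (∀ u < n, 0 < σ.A 0 u i → σ.A 1 u i = x → σ'.A 4 u 0 ≠ 0) →
      (∀ j < σ₁.r 23, σ'.A 6 j 0 = σ₁.A 6 j 0) →
      σ'.t ≤ σ₁.t + 2 + 8 * (inTails (σ.A 0) (σ.A 1) x i n).length → Q σ') :
    scanList.wp G Q σ₁ := by
  have hM := hG.numbers
  have hR := hG.rows
  have hW := hG.width
  have hA7 := hS.keeps.arr 7 (by simp)
  refine ⟨⟨trivial, trivial, by simp [Ex.eval, hx]; omega, by simp [Ex.eval, hi]; omega⟩,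
    -- The list splits into tails already processed, each with a cost of at most eight, and the
    -- rest, which begins at register `22`.
    fun σ₂ => ∃ done todo, inTails (σ.A 0) (σ.A 1) x i n = done ++ todo ∧
      ListAt (fun u => σ.A 8 u i) (σ₂.r 22) todo ∧ IsSearch n k v w σ σ₂ ∧ σ₂.r 20 = x ∧
      σ₂.r 21 = i ∧ σ₂.r 24 = σ₁.r 24 ∧ σ₁.r 23 ≤ σ₂.r 23 ∧
      (∀ y, σ₁.A 4 y 0 ≠ 0 → σ₂.A 4 y 0 ≠ 0) ∧ (∀ u ∈ done, σ₂.A 4 u 0 ≠ 0) ∧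
      (∀ j < σ₁.r 23, σ₂.A 6 j 0 = σ₁.A 6 j 0) ∧ σ₂.t ≤ σ₁.t + 1 + 8 * done.length,
    σ₁.t + 1 + 8 * (inTails (σ.A 0) (σ.A 1) x i n).length, ?_, ?_⟩
  · refine ⟨[], _, rfl, ?_, hS.congr (by simpa using hS.keeps) rfl rfl rfl rfl (by simp), ?_⟩
    · simpa [Ex.eval, hx, hi, hA7] using hL
    · simp [hx, hi]
  · rintro σ₂ ⟨done, todo, hsplit, hlist, hS, hx, hi, h24, h23, hmono, hdone, hqu, ht⟩
    refine ⟨by rw [hsplit, List.length_append]; omega, trivial, trivial, fun hlt => ?_, fun hlt => ?_⟩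
    · simp only [Ex.eval] at hlt
      obtain _ | ⟨u, todo⟩ := todo
      · exact absurd hlist (by simp [ListAt]; omega)
      obtain ⟨hu, hlist⟩ := hlist
      have hmem : u ∈ inTails (σ.A 0) (σ.A 1) x i n := by rw [hsplit]; simp
      obtain ⟨hun, hpos, hHD⟩ := mem_inTails.1 hmem
      have hsplit' : inTails (σ.A 0) (σ.A 1) x i n = (done ++ [u]) ++ todo := by
        rw [hsplit]; simp
      have hA8 := hS.keeps.arr 8 (by simp)
      have hk := hS.keeps
      have hxv := hmono x hvis
      have hu' : σ₂.r 22 - 1 = u := by omega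
      simp only [Cmd.wp, visitCmd, Cmd.skip, Ex.ok, Ex.eval]
      refine ⟨⟨trivial, trivial⟩, ⟨trivial, trivial, ?_, ?_⟩, trivial, fun hT => ?_, fun hT => ?_⟩
      · simp; omega
      · omega
      · simp [hu'] at hT
        have hvis' := hS.visit.visit (u := u) (tag := i + 2) hun hT (by omega)
          (fun h => by omega) (fun j hj => by
            obtain rfl : j = i := by omega
            exact ⟨hik, hpos, by omega, by rw [hHD]; exact hxv⟩)
        have hq := hvis'.le
        simp [hi, hu']
        refine ⟨by omega, by omega, by omega, by omega, by omega, by omega, by omega, by omega,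
          by omega, done ++ [u], todo, hsplit', by rw [hA8]; exact hlist,
          ⟨by simpa using hk, hS.out, ?_⟩, hx, h24, by omega, ?_, ?_, ?_, ?_⟩
        · simpa using hvis'
        · intro y hy
          simp only [upd_apply, and_true]
          split_ifs
          · simp
          · exact hmono y hy
        · intro y hy
          simp only [upd_apply, and_true]
          split_ifs with h
          · simp
          · rcases List.mem_append.1 hy with h' | h'
            · exact hdone y h'
            · exact absurd (by simpa using h') h
        · intro j hj
          rw [upd_of_ne (by omega)]
          exact hqu j hj
        · simp; omega
      · simp [hu'] at hT
        simp [hi, hu']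
        refine ⟨by omega, done ++ [u], todo, hsplit', by rw [hA8]; exact hlist,
          hS.congr (by simpa using hk) rfl rfl rfl rfl (by simp), hx, h24, h23, hmono, ?_, hqu, ?_⟩
        · intro y hy
          rcases List.mem_append.1 hy with h' | h'
          · exact hdone y h'
          · simp at h'; rw [h']; omega
        · simp; omega
    · simp only [Ex.eval] at hlt
      obtain _ | ⟨u, todo⟩ := todo
      · rw [List.append_nil] at hsplit
        refine hQ _ (hS.congr (by simpa using hS.keeps) rfl rfl rfl rfl (by simp)) hx hi h24 h23 hmono
          (fun u hu h1 h2 => hdone u (hsplit ▸ mem_inTails.2 ⟨hu, h1, h2⟩)) hqu ?_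
        rw [hsplit]
        simp; omega
      · have := hlist.1; omega

/-- Process the queue of visited vertices. -/
def explore : Cmd :=
  24 ≔ ♯ 0 ;; .whl (ρ 24) (ρ 23)
    (20 ≔ .arr 6 (ρ 24) (♯ 0) ;; 24 ≔ .add (ρ 24) (♯ 1) ;; .loop 21 0 scanList)

/-- Since the queue has no repetitions, costs that depend on the vertex only add up to at most their
total over all vertices. The time of the search is bounded in this amortized way. -/
theorem IsVisit.sum_le {v w q : ℕ} {ED HD TW RK QU : ℕ → ℕ → ℕ}
    (h : IsVisit n k v w ED HD TW RK QU q) (f : ℕ → ℕ) :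
    ∑ j ∈ Finset.range q, f (QU j 0) ≤ ∑ x ∈ Finset.range n, f x := by
  rw [← Finset.sum_image (f := f) (g := fun j => QU j 0)]
  · refine Finset.sum_le_sum_of_subset fun x hx => ?_
    obtain ⟨j, hj, rfl⟩ := Finset.mem_image.1 hx
    simpa using (h.queue j (by simpa using hj)).1
  · intro i hi j hj hij
    have h1 := (h.queue i (by simpa using hi)).2.2
    have h2 := (h.queue j (by simpa using hj)).2.2
    simp only at hij
    rw [hij] at h1
    exact h1.symm.trans h2

/-- The time to process a vertex. -/
def exploreCost (ED HD : ℕ → ℕ → ℕ) (n k x : ℕ) : ℕ :=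
  4 * k + 5 + 8 * ∑ i ∈ Finset.range k, (inTails ED HD x i n).length

theorem sum_exploreCost_le (ED HD : ℕ → ℕ → ℕ) (n k : ℕ) :
    ∑ x ∈ Finset.range n, exploreCost ED HD n k x ≤ 20 * (n * (k + 1)) := by
  unfold exploreCost
  rw [Finset.sum_add_distrib, ← Finset.mul_sum, Finset.sum_comm]
  have h1 : ∑ i ∈ Finset.range k, ∑ x ∈ Finset.range n, (inTails ED HD x i n).length ≤ k * n := by
    calc _ ≤ ∑ i ∈ Finset.range k, n := Finset.sum_le_sum fun i _ => sum_length_inTails_le ED HD n i n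
      _ = k * n := by simp
  simp only [Finset.sum_const, Finset.card_range, smul_eq_mul]
  nlinarith

/-- All tails of edges into the vertices before the queue pointer, register `24`, have been visited.
When the pointer reaches the end of the queue, the visited set is closed under going from heads to
tails. -/
theorem explore_spec (hG : G.IsFor n m k ℓ) {σ σ₁ : St} {v w : ℕ} (hS : IsSearch n k v w σ σ₁)
    (h0 : σ.r 0 = k) (hHD : ∀ x < n, ∀ i < k, 0 < σ.A 0 x i → σ.A 1 x i < n)
    (hL : ∀ x < n, ∀ i < k, ListAt (fun u => σ.A 8 u i) (σ.A 7 x i)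
      (inTails (σ.A 0) (σ.A 1) x i n))
    {Q : St → Prop} (hQ : ∀ σ', IsSearch n k v w σ σ' →
      (∀ y, σ₁.A 4 y 0 ≠ 0 → σ'.A 4 y 0 ≠ 0) →
      (∀ u < n, ∀ i < k, 0 < σ.A 0 u i → σ'.A 4 (σ.A 1 u i) 0 ≠ 0 → σ'.A 4 u 0 ≠ 0) →
      σ'.t ≤ σ₁.t + 2 + 20 * (n * (k + 1)) → Q σ') :
    explore.wp G Q σ₁ := by
  have hM := hG.numbers
  have hR := hG.rows
  have hW := hG.width
  have hcost := sum_exploreCost_le (σ.A 0) (σ.A 1) n k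
  refine ⟨trivial, fun σ₂ => IsSearch n k v w σ σ₂ ∧ σ₂.r 24 ≤ σ₂.r 23 ∧
    (∀ y, σ₁.A 4 y 0 ≠ 0 → σ₂.A 4 y 0 ≠ 0) ∧
    (∀ j < σ₂.r 24, ∀ u < n, ∀ i < k, 0 < σ.A 0 u i → σ.A 1 u i = σ₂.A 6 j 0 → σ₂.A 4 u 0 ≠ 0) ∧
    σ₂.t ≤ σ₁.t + 1 + ∑ j ∈ Finset.range (σ₂.r 24), exploreCost (σ.A 0) (σ.A 1) n k (σ₂.A 6 j 0),
    σ₁.t + 1 + 20 * (n * (k + 1)), ?_, ?_⟩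
  · refine ⟨hS.congr (by simpa using hS.keeps) rfl rfl rfl rfl (by simp), ?_, ?_, ?_, ?_⟩ <;>
      simp [Ex.eval]
  · rintro σ₂ ⟨hS, hle, hmono, hcl, ht⟩
    refine ⟨?_, trivial, trivial, fun hlt => ?_, fun hlt => ?_⟩
    · have h1 := hS.visit.sum_le (exploreCost (σ.A 0) (σ.A 1) n k)
      have h2 := Finset.sum_le_sum_of_subset (f := fun j => exploreCost (σ.A 0) (σ.A 1) n k (σ₂.A 6 j 0))
        (Finset.range_subset_range.2 hle)
      omega
    · simp only [Ex.eval] at hlt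
      obtain ⟨hxn, hxT, -⟩ := hS.visit.queue _ hlt
      have hqn := hS.visit.le
      have hr0 := (hS.keeps.reg 0 (by norm_num)).trans h0
      refine ⟨⟨trivial, trivial, ?_, ?_⟩, ⟨trivial, trivial, ?_⟩, ?_⟩
      · simp [Ex.eval]; omega
      · simp [Ex.eval]; omega
      · simp [Ex.eval]; omega
      generalize hx : σ₂.A 6 (σ₂.r 24) 0 = x at *
      refine Cmd.wp_loop k (σ₂.t + exploreCost (σ.A 0) (σ.A 1) n k x)
        (fun i σ₃ => IsSearch n k v w σ σ₃ ∧ σ₃.r 20 = x ∧ σ₃.r 24 = σ₂.r 24 + 1 ∧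
          σ₂.r 23 ≤ σ₃.r 23 ∧ (∀ y, σ₂.A 4 y 0 ≠ 0 → σ₃.A 4 y 0 ≠ 0) ∧
          (∀ j < σ₂.r 23, σ₃.A 6 j 0 = σ₂.A 6 j 0) ∧
          (∀ j < i, ∀ u < n, 0 < σ.A 0 u j → σ.A 1 u j = x → σ₃.A 4 u 0 ≠ 0) ∧
          σ₃.t ≤ σ₂.t + 4 + 4 * i + 8 * ∑ j ∈ Finset.range i, (inTails (σ.A 0) (σ.A 1) x j n).length)
        (by omega) ?_ ?_ ?_ ?_
      · rintro i hi σ₃ ⟨hS, -, -, -, -, -, -, ht⟩ _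
        refine ⟨(hS.keeps.reg 0 (by norm_num)).trans h0, ?_⟩
        have h2 := Finset.sum_le_sum_of_subset (f := fun j => (inTails (σ.A 0) (σ.A 1) x j n).length)
          (Finset.range_subset_range.2 hi)
        unfold exploreCost
        omega
      · refine ⟨hS.congr (by simpa using hS.keeps) rfl rfl rfl rfl (by simp), ?_, ?_, ?_⟩ <;>
          simp [Ex.eval, hx]
      · rintro i hi σ₃ ⟨hS3, hx3, h243, h233, hmono3, hqu3, hcl3, ht3⟩ hr3 -
        refine scanList_spec hG (σ := σ) (σ₁ := σ₃.tick) (i := i) (hS3.congr (by simpa using hS3.keeps) rfl rfl rfl rfl rfl)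
          hx3 hr3 hxn hi (hmono3 _ hxT) (hL x hxn i hi) ?_
        intro σ₄ hS4 hx4 hi4 h244 h234 hmono4 hcl4 hqu4 ht4
        refine ⟨hi4, hS4.congr (by simpa using hS4.keeps) rfl rfl rfl rfl (by simp), by simpa using hx4,
          by simp [h244, h243], by simpa using h233.trans h234, fun y hy => hmono4 y (hmono3 y hy),
          fun j hj => (hqu4 j (lt_of_lt_of_le hj h233)).trans (hqu3 j hj), fun j hj u hu h1 h2 => ?_, ?_⟩
        · rcases Nat.lt_succ_iff_lt_or_eq.1 hj with h | rfl
          · exact hmono4 u (hcl3 j h u hu h1 h2)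
          · exact hcl4 u hu h1 h2
        · rw [Finset.sum_range_succ]
          simp at ht4 ⊢
          omega
      · rintro σ₃ ⟨hS3, hx3, h243, h233, hmono3, hqu3, hcl3, ht3⟩ hr3
        refine ⟨hS3.congr (by simpa using hS3.keeps) rfl rfl rfl rfl (by simp), ?_,
          fun y hy => hmono3 y (hmono y hy), ?_, ?_⟩
        · simp; omega
        · intro j hj u hu i hi h1 h2
          simp only [St.tick_r, h243, St.tick_A] at hj h2 ⊢
          rw [hqu3 j (by omega)] at h2
          rcases Nat.lt_succ_iff_lt_or_eq.1 hj with h | rfl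
          · exact hmono3 u (hcl j h u hu i hi h1 h2)
          · rw [hx] at h2
            exact hcl3 i hi u hu h1 h2
        · simp only [St.tick_r, h243, St.tick_A, St.tick_t]
          rw [Finset.sum_range_succ, hqu3 _ hlt, hx]
          have : ∑ j ∈ Finset.range (σ₂.r 24), exploreCost (σ.A 0) (σ.A 1) n k (σ₃.A 6 j 0) =
              ∑ j ∈ Finset.range (σ₂.r 24), exploreCost (σ.A 0) (σ.A 1) n k (σ₂.A 6 j 0) :=
            Finset.sum_congr rfl fun j hj => by
              rw [hqu3 j (by have := Finset.mem_range.1 hj; omega)]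
          rw [this]
          simp only [exploreCost] at ht ⊢
          omega
    · simp only [Ex.eval] at hlt
      refine hQ _ (hS.congr (by simpa using hS.keeps) rfl rfl rfl rfl rfl) hmono ?_ ?_
      · intro u hu i hi h1 h2
        obtain ⟨h3, h4⟩ := hS.visit.rank _ (hHD u hu i hi h1) h2
        exact hcl _ (by omega) u hu i hi h1 h4.symm
      · have h1 := hS.visit.sum_le (exploreCost (σ.A 0) (σ.A 1) n k)
        have h2 := Finset.sum_le_sum_of_subset
          (f := fun j => exploreCost (σ.A 0) (σ.A 1) n k (σ₂.A 6 j 0)) (Finset.range_subset_range.2 hle)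
        simp only [St.tick_t] at h1 h2 ⊢
        omega

/-- Search for the vertices from where a pebble outside of `{v, w}` can be reached. -/
def search : Cmd := clearLists ;; buildLists ;; 23 ≔ ♯ 0 ;; visitSources ;; explore

/-- The result of a search. -/
structure IsSearchResult (n k v w : ℕ) (ED HD TW RK : ℕ → ℕ → ℕ) : Prop where
  rank_lt : ∀ x < n, TW x 0 ≠ 0 → RK x 0 < n
  source : ∀ x < n, TW x 0 = 1 → x ≠ v ∧ x ≠ w ∧ ∃ i < k, ED x i = 0
  toward : ∀ x < n, ∀ i, TW x 0 = i + 2 → i < k ∧ 0 < ED x i ∧ HD x i < n ∧ TW (HD x i) 0 ≠ 0 ∧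
    RK (HD x i) 0 < RK x 0
  complete : ∀ x < n, x ≠ v → x ≠ w → (∃ i < k, ED x i = 0) → TW x 0 ≠ 0
  closed : ∀ u < n, ∀ i < k, 0 < ED u i → TW (HD u i) 0 ≠ 0 → TW u 0 ≠ 0

theorem search_spec (hG : G.IsFor n m k ℓ) {σ : St} {v w : ℕ} (h0 : σ.r 0 = k) (h2 : σ.r 2 = n)
    (hv : σ.r 5 = v) (hw : σ.r 6 = w) (hvn : v < n) (hwn : w < n)
    (hHD : ∀ x < n, ∀ i < k, 0 < σ.A 0 x i → σ.A 1 x i < n)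
    {Q : St → Prop} (hQ : ∀ σ', Keeps 20 [4, 5, 6, 7, 8] σ σ' → σ'.o = σ.o →
      IsSearchResult n k v w (σ.A 0) (σ.A 1) (σ'.A 4) (σ'.A 5) →
      σ'.t ≤ σ.t + 60 * ((n + 1) * (k + 1)) → Q σ') : search.wp G Q σ := by
  refine clearLists_spec hG h0 h2 fun σ₁ hk₁ ho₁ hTW hFI ht₁ => ?_
  have hA0 := hk₁.arr 0 (by simp)
  have hA1 := hk₁.arr 1 (by simp)
  refine buildLists_spec hG ((hk₁.reg 0 (by norm_num)).trans h0) ((hk₁.reg 2 (by norm_num)).trans h2)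
    (by rw [hA0, hA1]; exact hHD) hFI fun σ₂ hk₂ ho₂ hL ht₂ => ⟨trivial, ?_⟩
  have hk₁₂ : Keeps 20 [4, 7, 8] σ σ₂ :=
    (hk₁.mono le_rfl (by simp)).trans (hk₂.mono le_rfl (by simp))
  have hA0₂ := hk₁₂.arr 0 (by simp)
  have hA1₂ := hk₁₂.arr 1 (by simp)
  have hA4₂ := hk₂.arr 4 (by simp)
  refine visitSources_spec hG (σ := σ₂.setr 23 0) (v := v) (w := w)
    (by simpa using (hk₁₂.reg 0 (by norm_num)).trans h0)
    (by simpa using (hk₁₂.reg 2 (by norm_num)).trans h2)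
    (by simpa using (hk₁₂.reg 5 (by norm_num)).trans hv)
    (by simpa using (hk₁₂.reg 6 (by norm_num)).trans hw) hvn hwn (by simp)
    (by simpa [hA4₂] using hTW) fun σ₃ hS hsrc ht₃ => ?_
  refine explore_spec hG hS (by simpa using (hk₁₂.reg 0 (by norm_num)).trans h0)
    (by simpa [hA0₂, hA1₂] using hHD) (by simpa [hA0, hA1, hA0₂, hA1₂] using hL)
    fun σ₄ hS₄ hmono hcl ht₄ => ?_
  have hvis := hS₄.visit
  have hk₄ := hS₄.keeps
  simp only [St.setr_A, hA0₂, hA1₂] at hvis hsrc hcl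
  refine hQ _ ?_ ?_ ⟨fun x hx hT => (hvis.rank x hx hT).1.trans_le hvis.le, hvis.source, hvis.toward,
    fun x hx h1 h2 h3 => hmono x (hsrc x hx h1 h2 h3), hcl⟩ ?_
  · refine (hk₁₂.mono le_rfl (by simp)).trans ⟨fun i hi => ?_, fun a ha => ?_⟩
    · rw [hk₄.reg i hi, St.setr_r, if_neg (by omega)]
    · rw [hk₄.arr a (by simp at ha ⊢; tauto)]; rfl
  · exact hS₄.out.trans (ho₂.trans ho₁)
  · simp only [St.setr_t] at ht₃
    ring_nf at ht₁ ht₂ ht₃ ht₄ ⊢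
    omega

end Search
end PebbleGame

namespace PebbleGame

/-! ### Labels of slots for canonical slides -/

section Label

variable {G : Env} {n m k ℓ : ℕ}

local infixr:60 " ;; " => Cmd.seq
local infix:70 " ≔ " => Cmd.asg
local notation "ρ" => Ex.reg
local notation "♯" => Ex.num

/-- Labels of slots on a path from `r`, and behind it in the paths of each color. The label `PR z c` is
`0` for unlabeled slots, `1` for a vertex `z` on the path, which has its predecessor on the path and
the color of the edge from there in `PP z`, and `u + 2` if `z` has been reached by the edge of color
`c` out of `u`. The stamp `SN z c` tells the order of the labelling. -/
structure IsLabel (n k r : ℕ) (ED HD PR SN PP : ℕ → ℕ → ℕ) (s : ℕ) : Prop where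
  stamp : ∀ z < n, ∀ c < k, PR z c ≠ 0 → SN z c < s
  pred : ∀ z < n, ∀ c < k, ∀ u, PR z c = u + 2 →
    u < n ∧ PR u c ≠ 0 ∧ SN u c < SN z c ∧ 0 < ED u c ∧ HD u c = z
  start : ∀ z < n, ∀ c < k, PR z c = 1 → z = r ∨
    (PP z 0 < n ∧ PP z 1 < k ∧ 0 < ED (PP z 0) (PP z 1) ∧ HD (PP z 0) (PP z 1) = z ∧
      PR (PP z 0) (PP z 1) ≠ 0 ∧ SN (PP z 0) (PP z 1) < SN z c ∧
      PR (PP z 0) c ≠ 0 ∧ SN (PP z 0) c < SN z c)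
  -- When a walk of color `c` begins at `z`, no edge of this color leaves the set labeled before.
  -- This is why a later slide of color `c` from `z` along the path edge closes no cycle.
  closed : ∀ z < n, ∀ c < k, PR z c = 1 → ∀ x < n, PR x c ≠ 0 → SN x c < SN z c → 0 < ED x c →
    PR (HD x c) c ≠ 0 ∧ SN (HD x c) c < SN z c
  -- Each label uses up an unlabeled slot, so there are at most `n * k` stamps.
  count : s + ((Finset.range n ×ˢ Finset.range k).filter fun p => PR p.1 p.2 = 0).card = n * k

/-- The new label gets the largest stamp, so it does not affect conditions on earlier ones.
Closedness is required only for the label `1`, at the beginning of a walk; within a walk the last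
slot still leads outside. -/
theorem IsLabel.label {r s z c p : ℕ} {ED HD PR SN PP : ℕ → ℕ → ℕ}
    (h : IsLabel n k r ED HD PR SN PP s) (hHD : ∀ x < n, ∀ i < k, 0 < ED x i → HD x i < n)
    (hz : z < n) (hc : c < k) (h0 : PR z c = 0) (hp : p ≠ 0)
    (hpred : ∀ u, p = u + 2 → u < n ∧ PR u c ≠ 0 ∧ 0 < ED u c ∧ HD u c = z)
    (hstart : p = 1 → z = r ∨ (PP z 0 < n ∧ PP z 1 < k ∧ 0 < ED (PP z 0) (PP z 1) ∧
      HD (PP z 0) (PP z 1) = z ∧ PR (PP z 0) (PP z 1) ≠ 0 ∧ PR (PP z 0) c ≠ 0))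
    (hclosed : p = 1 → ∀ x < n, PR x c ≠ 0 → 0 < ED x c → PR (HD x c) c ≠ 0) :
    IsLabel n k r ED HD (upd PR z c p) (upd SN z c s) PP (s + 1) := by
  have hne : ∀ {x i}, PR x i ≠ 0 → ¬ (x = z ∧ i = c) := by
    rintro x i hx ⟨rfl, rfl⟩
    exact hx h0
  have hPR : ∀ {x i}, PR x i ≠ 0 → upd PR z c p x i = PR x i := fun hx => upd_of_ne (hne hx)
  have hSN : ∀ {x i}, PR x i ≠ 0 → upd SN z c s x i = SN x i := fun hx => upd_of_ne (hne hx)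
  have hold : ∀ {x i}, upd PR z c p x i ≠ 0 → ¬ (x = z ∧ i = c) → PR x i ≠ 0 := by
    intro x i hx hxi
    rwa [upd_of_ne hxi] at hx
  refine ⟨fun x hx i hi hxi => ?_, fun x hx i hi u hu => ?_, fun x hx i hi h1 => ?_,
    fun x hx i hi h1 y hy hyi hlt hED => ?_, ?_⟩
  · by_cases hxz : x = z ∧ i = c
    · rw [upd_apply, if_pos hxz]; omega
    · have := hold hxi hxz
      rw [hSN this]
      have := h.stamp x hx i hi this
      omega
  · by_cases hxz : x = z ∧ i = c
    · obtain ⟨rfl, rfl⟩ := hxz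
      rw [upd_self] at hu ⊢
      obtain ⟨h1, h2, h3, h4⟩ := hpred u hu
      rw [hPR h2, hSN h2]
      exact ⟨h1, h2, h.stamp u h1 i hi h2, h3, h4⟩
    · rw [upd_of_ne hxz] at hu ⊢
      obtain ⟨h1, h2, h3, h4⟩ := h.pred x hx i hi u hu
      rw [hPR h2, hSN h2]
      exact ⟨h1, h2, h3, h4⟩
  · by_cases hxz : x = z ∧ i = c
    · obtain ⟨rfl, rfl⟩ := hxz
      rw [upd_self] at h1 ⊢
      refine (hstart h1).imp_right fun ⟨a1, a2, a3, a4, a5, a6⟩ => ?_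
      rw [hPR a5, hSN a5, hPR a6, hSN a6]
      exact ⟨a1, a2, a3, a4, a5, h.stamp _ a1 _ a2 a5, a6, h.stamp _ a1 _ hi a6⟩
    · rw [upd_of_ne hxz] at h1 ⊢
      refine (h.start x hx i hi h1).imp_right fun ⟨a1, a2, a3, a4, a5, a6, a7, a8⟩ => ?_
      rw [hPR a5, hSN a5, hPR a7, hSN a7]
      exact ⟨a1, a2, a3, a4, a5, a6, a7, a8⟩
  · by_cases hxz : x = z ∧ i = c
    · obtain ⟨rfl, rfl⟩ := hxz
      rw [upd_self] at h1 hlt ⊢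
      by_cases hyx : y = x
      · subst hyx
        rw [upd_self] at hlt
        omega
      · have := hold hyi (fun h => hyx h.1)
        have := hclosed h1 y hy this hED
        rw [hPR this, hSN this]
        exact ⟨this, h.stamp _ (hHD y hy i hi hED) i hi this⟩
    · rw [upd_of_ne hxz] at h1 hlt ⊢
      by_cases hyz : y = z ∧ i = c
      · rw [upd_apply, if_pos hyz] at hlt
        have := h.stamp x hx i hi (by omega)
        omega
      · have hy' := hold hyi hyz
        rw [hSN hy'] at hlt
        obtain ⟨a1, a2⟩ := h.closed x hx i hi h1 y hy hy' hlt hED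
        rw [hPR a1, hSN a1]
        exact ⟨a1, a2⟩
  · have h1 : ((Finset.range n ×ˢ Finset.range k).filter fun q => upd PR z c p q.1 q.2 = 0) =
        ((Finset.range n ×ˢ Finset.range k).filter fun q => PR q.1 q.2 = 0).erase (z, c) := by
      ext ⟨x, i⟩
      rw [Finset.mem_filter, Finset.mem_erase, Finset.mem_filter]
      simp only [upd_apply, Prod.mk.injEq, ne_eq]
      by_cases hxz : x = z ∧ i = c
      · simp [hxz, hp]
      · simp [hxz]
    have h2 : (z, c) ∈ (Finset.range n ×ˢ Finset.range k).filter fun q => PR q.1 q.2 = 0 := by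
      simp [hz, hc, h0]
    have h3 := Finset.card_pos.2 ⟨_, h2⟩
    have := h.count
    rw [h1, Finset.card_erase_of_mem h2]
    omega

theorem IsLabel.le {r s : ℕ} {ED HD PR SN PP : ℕ → ℕ → ℕ} (h : IsLabel n k r ED HD PR SN PP s) :
    s ≤ n * k := by have := h.count; omega

/-- Predecessors matter only at vertices with a label `1`, so they may be written later for the
other vertices. -/
theorem IsLabel.congr_path {r s : ℕ} {ED HD PR SN PP PP' : ℕ → ℕ → ℕ}
    (h : IsLabel n k r ED HD PR SN PP s)
    (hP : ∀ z < n, ∀ c < k, PR z c = 1 → PP' z = PP z) : IsLabel n k r ED HD PR SN PP' s :=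
  ⟨h.stamp, h.pred, fun z hz c hc h1 => by rw [hP z hz c hc h1]; exact h.start z hz c hc h1,
    h.closed, h.count⟩

/-- The state of the labelling at the vertex `y` of the path. -/
structure IsLabelAt (n k r : ℕ) (ED HD RK : ℕ → ℕ → ℕ) (y : ℕ) (PR SN PP : ℕ → ℕ → ℕ) (s : ℕ) :
    Prop extends IsLabel n k r ED HD PR SN PP s where
  -- Ranks decrease along the path, so the vertices that it reaches later carry no label `1` yet.
  ranks : ∀ z < n, ∀ c < k, PR z c = 1 → RK y 0 ≤ RK z 0
  here : y = r ∨ (PP y 0 < n ∧ PP y 1 < k ∧ 0 < ED (PP y 0) (PP y 1) ∧ HD (PP y 0) (PP y 1) = y ∧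
    ∀ c < k, PR (PP y 0) c ≠ 0)

/-- All edges of the color of a labeled slot lead to labeled slots. -/
def IsClosedLabel (n k : ℕ) (ED HD PR : ℕ → ℕ → ℕ) : Prop :=
  ∀ z < n, ∀ c < k, PR z c ≠ 0 → 0 < ED z c → PR (HD z c) c ≠ 0

/-- Follow the edges of a color and label the slots. -/
def walk : Cmd :=
  37 ≔ ρ 33 ;; 38 ≔ ♯ 1 ;; 39 ≔ ♯ 1 ;;
  .whl (♯ 0) (ρ 39)
    (.ite (♯ 0) (.arr 9 (ρ 37) (ρ 31)) (39 ≔ ♯ 0)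
      (.sto 9 (ρ 37) (ρ 31) (ρ 38) ;; .sto 10 (ρ 37) (ρ 31) (ρ 32) ;; 32 ≔ .add (ρ 32) (♯ 1) ;;
        .ite (.arr 0 (ρ 37) (ρ 31)) (♯ 1) (39 ≔ ♯ 0)
          (38 ≔ .add (ρ 37) (♯ 2) ;; 37 ≔ .arr 1 (ρ 37) (ρ 31))))

/-- The state of the labelling. -/
structure IsLabelState (n k r : ℕ) (σ : St) (y : ℕ) (σ' : St) : Prop where
  keeps : Keeps 30 [9, 10, 11] σ σ'
  out : σ'.o = σ.o
  label : IsLabelAt n k r (σ.A 0) (σ.A 1) (σ.A 5) y (σ'.A 9) (σ'.A 10) (σ'.A 11) (σ'.r 32)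
  vertex : σ'.r 33 = y

theorem IsLabelState.congr {r y : ℕ} {σ σ₁ σ₂ : St} (h : IsLabelState n k r σ y σ₁)
    (hk : Keeps 30 [9, 10, 11] σ σ₂) (ho : σ₂.o = σ₁.o) (h9 : σ₂.A 9 = σ₁.A 9)
    (h10 : σ₂.A 10 = σ₁.A 10) (h11 : σ₂.A 11 = σ₁.A 11) (h32 : σ₂.r 32 = σ₁.r 32)
    (h33 : σ₂.r 33 = σ₁.r 33) : IsLabelState n k r σ y σ₂ :=
  ⟨hk, ho.trans h.out, by rw [h9, h10, h11, h32]; exact h.label, h33.trans h.vertex⟩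

/-- A walk stops at a labeled slot or at a pebble. Until then at most one labeled slot, the last
one, has its edge leading to an unlabeled slot, so at the end the labels are closed again. The time
is charged to the new stamps, ten units for each. -/
theorem walk_spec (hG : G.IsFor n m k ℓ) {σ σ₁ : St} {r y c : ℕ}
    (hHD : ∀ x < n, ∀ i < k, 0 < σ.A 0 x i → σ.A 1 x i < n)
    (hS : IsLabelState n k r σ y σ₁) (hcl : IsClosedLabel n k (σ.A 0) (σ.A 1) (σ₁.A 9))
    (hy : y < n) (hr : σ₁.r 31 = c) (hc : c < k)
    {Q : St → Prop} (hQ : ∀ σ', IsLabelState n k r σ y σ' →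
      IsClosedLabel n k (σ.A 0) (σ.A 1) (σ'.A 9) → σ'.r 31 = c → σ'.r 34 = σ₁.r 34 →
      σ'.A 9 y c ≠ 0 → (∀ z i, σ₁.A 9 z i ≠ 0 → σ'.A 9 z i ≠ 0) →
      σ'.t + 10 * σ₁.r 32 ≤ σ₁.t + 9 + 10 * σ'.r 32 → Q σ') : walk.wp G Q σ₁ := by
  have hM := hG.numbers
  have hR := hG.rows
  have hW := hG.width
  refine ⟨trivial, trivial, trivial, fun σ₂ => IsLabelState n k r σ y σ₂ ∧ σ₂.r 31 = c ∧
    σ₂.r 34 = σ₁.r 34 ∧ (∀ z i, σ₁.A 9 z i ≠ 0 → σ₂.A 9 z i ≠ 0) ∧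
    σ₂.t + 10 * σ₁.r 32 + 5 * σ₂.r 39 ≤ σ₁.t + 8 + 10 * σ₂.r 32 ∧
    σ₂.r 37 < n ∧ σ₂.r 38 ≠ 0 ∧ (σ₂.r 38 = 1 → σ₂.r 37 = y) ∧ (σ₂.r 38 ≠ 1 → σ₂.A 9 y c ≠ 0) ∧
    (∀ u, σ₂.r 38 = u + 2 → u < n ∧ σ₂.A 9 u c ≠ 0 ∧ 0 < σ.A 0 u c ∧ σ.A 1 u c = σ₂.r 37) ∧
    (∀ z < n, ∀ i < k, σ₂.A 9 z i ≠ 0 → 0 < σ.A 0 z i → σ₂.A 9 (σ.A 1 z i) i ≠ 0 ∨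
      (0 < σ₂.r 39 ∧ i = c ∧ σ₂.r 38 = z + 2 ∧ σ.A 1 z i = σ₂.r 37)) ∧
    (σ₂.r 39 = 0 → σ₂.A 9 y c ≠ 0),
    σ₁.t + 8 + 10 * (n * k), ?_, ?_⟩
  · have hy' := hS.vertex
    refine ⟨hS.congr (by simpa using hS.keeps) rfl rfl rfl rfl (by simp) (by simp), ?_⟩
    simp [Ex.eval, hr, hy, hy']
    refine ⟨by omega, fun z hz i hi h1 h2 => ?_⟩
    have := hcl z hz i hi h1 h2
    simpa using this
  · rintro σ₂ ⟨hS, hr, h34, hmono, ht, hzn, hp0, hp1, hp2, hpred, htot, hgo⟩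
    have hle := hS.label.le
    refine ⟨by omega, trivial, trivial, fun hlt => ?_, fun hlt => ?_⟩
    · simp only [Ex.eval] at hlt
      have hk := hS.keeps
      have hA0 := hk.arr 0 (by simp)
      have hA1 := hk.arr 1 (by simp)
      have hlt9 : 9 ∈ [9, 10, 11] := by simp
      simp only [Cmd.wp, Ex.ok, Ex.eval, St.tick_r, St.tick_A]
      refine ⟨trivial, ⟨trivial, trivial, by omega, by omega⟩, fun hlab => ⟨trivial, ?_⟩,
        fun hlab => ⟨trivial, trivial, by omega, by omega, trivial, trivial, trivial, ?_⟩⟩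
      · refine ⟨hS.congr (by simpa using hS.keeps) rfl rfl rfl rfl (by simp) (by simp), ?_⟩
        simp [hr, h34]
        rw [hr] at hlab
        refine ⟨hmono, by omega, hzn, hp0, hp1, hp2, hpred, fun z hz i hi h1 h2 => ?_, ?_⟩
        · rcases htot z hz i hi h1 h2 with h | ⟨-, rfl, -, h⟩
          · exact h
          · rw [h]; omega
        · by_cases h1 : σ₂.r 38 = 1
          · rw [hp1 h1] at hlab; omega
          · exact hp2 h1
      · rw [hr] at hlab
        have hlab0 : σ₂.A 9 (σ₂.r 37) c = 0 := by omega
        have hnew := hS.label.toIsLabel.label hHD hzn hc hlab0 hp0 hpred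
          (fun h1 => by
            rw [hp1 h1]
            exact hS.label.here.imp_right fun ⟨a1, a2, a3, a4, a5⟩ => ⟨a1, a2, a3, a4, a5 _ a2, a5 _ hc⟩)
          (fun h1 x hx h2 h3 => by
            rcases htot x hx c hc h2 h3 with h | ⟨-, -, h, -⟩
            · exact h
            · omega)
        have hle' := hnew.le
        have hmono2 : ∀ z i, σ₂.A 9 z i ≠ 0 → upd (σ₂.A 9) (σ₂.r 37) c (σ₂.r 38) z i ≠ 0 := by
          intro z i hzi
          rw [upd_apply]
          split_ifs
          exacts [hp0, hzi]
        have hranks : ∀ z < n, ∀ i < k, upd (σ₂.A 9) (σ₂.r 37) c (σ₂.r 38) z i = 1 →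
            σ.A 5 y 0 ≤ σ.A 5 z 0 := by
          intro z hz i hi h1
          rw [upd_apply] at h1
          split_ifs at h1 with h
          · rw [h.1, hp1 h1]
          · exact hS.label.ranks z hz i hi h1
        have hyc : upd (σ₂.A 9) (σ₂.r 37) c (σ₂.r 38) y c ≠ 0 := by
          by_cases h1 : σ₂.r 38 = 1
          · rw [hp1 h1, upd_self, h1]; norm_num
          · exact hmono2 _ _ (hp2 h1)
        have hhere : y = r ∨ (σ₂.A 11 y 0 < n ∧ σ₂.A 11 y 1 < k ∧
            0 < σ.A 0 (σ₂.A 11 y 0) (σ₂.A 11 y 1) ∧ σ.A 1 (σ₂.A 11 y 0) (σ₂.A 11 y 1) = y ∧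
            ∀ i < k, upd (σ₂.A 9) (σ₂.r 37) c (σ₂.r 38) (σ₂.A 11 y 0) i ≠ 0) :=
          hS.label.here.imp_right fun ⟨a1, a2, a3, a4, a5⟩ =>
            ⟨a1, a2, a3, a4, fun i hi => hmono2 _ _ (a5 i hi)⟩
        have htot' : ∀ z < n, ∀ i < k, upd (σ₂.A 9) (σ₂.r 37) c (σ₂.r 38) z i ≠ 0 →
            0 < σ.A 0 z i → upd (σ₂.A 9) (σ₂.r 37) c (σ₂.r 38) (σ.A 1 z i) i ≠ 0 ∨
              (z = σ₂.r 37 ∧ i = c) := by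
          intro z hz i hi h1 h2
          by_cases hzc : z = σ₂.r 37 ∧ i = c
          · exact .inr hzc
          · rw [upd_of_ne hzc] at h1
            rcases htot z hz i hi h1 h2 with h | ⟨-, rfl, -, h⟩
            · exact .inl (hmono2 _ _ h)
            · rw [h, upd_self]; exact .inl hp0
        simp [hr, hA0]
        refine ⟨by omega, by omega, by omega, ⟨by omega, by omega⟩, fun hED => ?_, fun hED => ?_⟩
        · refine ⟨⟨by simpa using hk, hS.out, ⟨?_, ?_, ?_⟩, ?_⟩, h34, fun z i h => hmono2 z i (hmono z i h),
            by omega, hzn, hp0, hp1, fun _ => hyc, ?_, ?_, hyc⟩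
          · simpa using hnew
          · simpa using hranks
          · simpa using hhere
          · simpa using hS.vertex
          · intro u hu
            obtain ⟨a1, a2, a3, a4⟩ := hpred u hu
            exact ⟨a1, hmono2 _ _ a2, a3, a4⟩
          · intro z hz i hi h1 h2
            rcases htot' z hz i hi h1 h2 with h | ⟨rfl, rfl⟩
            · exact h
            · omega
        · have hHDz := hHD _ hzn c hc (by omega)
          simp only [hA1, and_true]
          refine ⟨by omega, ⟨by omega, by omega⟩,
            ⟨by simpa using hk, hS.out, ⟨?_, ?_, ?_⟩, ?_⟩, h34, fun z i h => hmono2 z i (hmono z i h),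
            by omega, hHDz, hyc, ⟨hzn, by simpa using hp0, by omega⟩, ?_, fun _ => hyc⟩
          · simpa using hnew
          · simpa using hranks
          · simpa using hhere
          · simpa using hS.vertex
          · intro z hz i hi h1 h2
            rcases htot' z hz i hi h1 h2 with h | ⟨rfl, rfl⟩
            · exact .inl h
            · exact .inr ⟨by omega, by omega, rfl, rfl⟩
    · simp only [Ex.eval] at hlt
      refine hQ _ (hS.congr (by simpa using hS.keeps) rfl rfl rfl rfl rfl rfl) ?_ hr h34 (hgo (by omega))
        hmono ?_
      · intro z hz i hi h1 h2
        rcases htot z hz i hi h1 h2 with h | ⟨h, -⟩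
        · exact h
        · omega
      · simp; omega

theorem walks_spec (hG : G.IsFor n m k ℓ) {σ σ₁ : St} {r y : ℕ} (h0 : σ.r 0 = k)
    (hHD : ∀ x < n, ∀ i < k, 0 < σ.A 0 x i → σ.A 1 x i < n)
    (hS : IsLabelState n k r σ y σ₁) (hcl : IsClosedLabel n k (σ.A 0) (σ.A 1) (σ₁.A 9))
    (hy : y < n) {Q : St → Prop} (hQ : ∀ σ', IsLabelState n k r σ y σ' →
      IsClosedLabel n k (σ.A 0) (σ.A 1) (σ'.A 9) → σ'.r 34 = σ₁.r 34 →
      (∀ c < k, σ'.A 9 y c ≠ 0) →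
      σ'.t + 10 * σ₁.r 32 ≤ σ₁.t + 2 + 12 * k + 10 * σ'.r 32 → Q σ') :
    (Cmd.loop 31 0 walk).wp G Q σ₁ := by
  have hM := hG.numbers
  refine Cmd.wp_loop k (σ₁.t + 1 + 12 * k + 10 * (n * k)) (fun i σ₂ => IsLabelState n k r σ y σ₂ ∧
    IsClosedLabel n k (σ.A 0) (σ.A 1) (σ₂.A 9) ∧ σ₂.r 34 = σ₁.r 34 ∧ (∀ c < i, σ₂.A 9 y c ≠ 0) ∧
    σ₂.t + 10 * σ₁.r 32 ≤ σ₁.t + 1 + 12 * i + 10 * σ₂.r 32) (by omega) ?_ ?_ ?_ ?_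
  · rintro i hi σ₂ ⟨hS, -, -, -, ht⟩ -
    have := hS.label.le
    exact ⟨(hS.keeps.reg 0 (by norm_num)).trans h0, by omega⟩
  · exact ⟨hS.congr (by simpa using hS.keeps) rfl rfl rfl rfl (by simp) (by simp), hcl, by simp,
      by simp, by simp⟩
  · rintro i hi σ₂ ⟨hS, hcl, h34, hlab, ht⟩ hr -
    refine walk_spec hG (σ₁ := σ₂.tick) hHD (hS.congr (by simpa using hS.keeps) rfl rfl rfl rfl rfl rfl) hcl hy hr hi ?_
    intro σ₃ hS₃ hcl₃ h31₃ h34₃ hlab₃ hmono₃ ht₃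
    refine ⟨h31₃, hS₃.congr (by simpa using hS₃.keeps) rfl rfl rfl rfl (by simp) (by simp), hcl₃,
      by simpa using h34₃.trans h34, fun c hc => ?_, ?_⟩
    · rcases Nat.lt_succ_iff_lt_or_eq.1 hc with h | rfl
      exacts [hmono₃ _ _ (hlab c h), hlab₃]
    · simp at ht₃ ⊢
      omega
  · rintro σ₂ ⟨hS, hcl, h34, hlab, ht⟩ hr
    refine hQ _ (hS.congr (by simpa using hS.keeps) rfl rfl rfl rfl rfl rfl) hcl h34 hlab ?_
    simp; omega

/-- Label slots along the path from the vertex in the register `12`. -/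
def label : Cmd :=
  .loop 30 2 (.loop 31 0 (.sto 9 (ρ 30) (ρ 31) (♯ 0))) ;; 32 ≔ ♯ 0 ;; 33 ≔ ρ 12 ;; 34 ≔ ♯ 1 ;;
  .whl (♯ 0) (ρ 34) (.loop 31 0 walk ;;
    .ite (.arr 4 (ρ 33) (♯ 0)) (♯ 2) (34 ≔ ♯ 0)
      (35 ≔ .sub (.arr 4 (ρ 33) (♯ 0)) (♯ 2) ;; 36 ≔ .arr 1 (ρ 33) (ρ 35) ;;
        .sto 11 (ρ 36) (♯ 0) (ρ 33) ;; .sto 11 (ρ 36) (♯ 1) (ρ 35) ;; 33 ≔ ρ 36))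

theorem clearLabels_spec (hG : G.IsFor n m k ℓ) {σ : St} (h0 : σ.r 0 = k) (h2 : σ.r 2 = n)
    {Q : St → Prop} (hQ : ∀ σ', Keeps 30 [9, 10, 11] σ σ' → σ'.o = σ.o →
      (∀ x < n, ∀ i < k, σ'.A 9 x i = 0) →
      σ'.t ≤ σ.t + 10 * ((n + 1) * (k + 1)) → Q σ') :
    (Cmd.loop 30 2 (.loop 31 0 (.sto 9 (ρ 30) (ρ 31) (♯ 0)))).wp G Q σ := by
  have hM := hG.numbers
  have hR := hG.rows
  have hW := hG.width
  refine Cmd.wp_for n (3 * k + 5) (fun x σ' => Keeps 30 [9, 10, 11] σ σ' ∧ σ'.o = σ.o ∧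
    (∀ y < x, ∀ i < k, σ'.A 9 y i = 0)) (by omega) h2 (by norm_num) ?_ ?_ ?_
  · simp [Keeps.refl]
  · rintro x hx σ₁ ⟨hk, ho, h9⟩ hr hb
    have hr0 := (hk.reg 0 (by norm_num)).trans h0
    refine Cmd.wp_for k 2 (fun i σ' => Keeps 30 [9, 10, 11] σ σ' ∧ σ'.o = σ.o ∧ σ'.r 30 = x ∧
      σ'.r 2 = n ∧ (∀ y < x, ∀ i < k, σ'.A 9 y i = 0) ∧ (∀ j < i, σ'.A 9 x j = 0)) (by omega)
      (by simpa using hr0) (by norm_num) ?_ ?_ ?_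
    · simp [hk, ho, hr, hb]
      exact h9
    · rintro i hi σ₂ ⟨hk, ho, hx2, hn, h7, h7'⟩ hr2 hb2
      simp [Cmd.wp, Ex.ok, Ex.eval, hr2, hx2, hk, ho, hn, upd_apply, hb2]
      refine ⟨by omega, by omega, ?_, ?_⟩
      · intro y hy j hj _; exact h7 y hy j hj
      · intro j hj h; exact h7' j (by omega)
    · rintro σ₂ ⟨hk, ho, hx2, hn, h7, h7'⟩ hr2 ht
      simp at ht
      simp [hx2, hn, hk, ho]
      refine ⟨?_, by omega⟩
      intro y hy i hi
      rcases Nat.lt_or_eq_of_le hy with h | rfl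
      · exact h7 y h i hi
      · exact h7' i hi
  · rintro σ₁ ⟨hk, ho, h9⟩ hr ht
    refine hQ _ (by simpa using hk) ho h9 ?_
    simp only [St.tick_t]
    ring_nf at ht ⊢
    omega

theorem label_spec (hG : G.IsFor n m k ℓ) {σ : St} {v w r : ℕ} (h0 : σ.r 0 = k) (h2 : σ.r 2 = n)
    (h12 : σ.r 12 = r) (hr : r < n)
    (hHD : ∀ x < n, ∀ i < k, 0 < σ.A 0 x i → σ.A 1 x i < n)
    (hT : IsSearchResult n k v w (σ.A 0) (σ.A 1) (σ.A 4) (σ.A 5)) (hTr : σ.A 4 r 0 ≠ 0)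
    {Q : St → Prop} (hQ : ∀ σ' s, Keeps 30 [9, 10, 11] σ σ' → σ'.o = σ.o →
      IsLabel n k r (σ.A 0) (σ.A 1) (σ'.A 9) (σ'.A 10) (σ'.A 11) s →
      σ'.r 33 < n → σ.A 4 (σ'.r 33) 0 = 1 → (∀ c < k, σ'.A 9 (σ'.r 33) c ≠ 0) →
      σ'.t ≤ σ.t + 60 * ((n + 1) * (k + 1)) → Q σ') : label.wp G Q σ := by
  have hM := hG.numbers
  have hR := hG.rows
  have hW := hG.width
  refine clearLabels_spec hG h0 h2 fun σ₁ hk₁ ho₁ h9₁ ht₁ => ⟨trivial, trivial, trivial, ?_⟩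
  refine ⟨fun σ₂ => ∃ y < n, IsLabelState n k r σ y σ₂ ∧ IsClosedLabel n k (σ.A 0) (σ.A 1) (σ₂.A 9) ∧
    σ.A 4 y 0 ≠ 0 ∧ (σ₂.r 34 = 0 → σ.A 4 y 0 = 1 ∧ ∀ c < k, σ₂.A 9 y c ≠ 0) ∧
    -- The rank of the current vertex, together with the flag in register `34`, is a potential that
    -- drops with each vertex of the path and pays `12 k + 12`. The steps of the walks are paid by
    -- the stamps in register `32`.
    σ₂.t + (12 * k + 12) * (σ.A 5 y 0 + σ₂.r 34) ≤
      σ₁.t + 3 + (12 * k + 12) * (σ.A 5 r 0 + 1) + 10 * σ₂.r 32,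
    σ₁.t + 3 + (12 * k + 12) * (σ.A 5 r 0 + 1) + 10 * (n * k), ?_, ?_⟩
  · refine ⟨r, hr, ⟨by simpa using hk₁, ho₁, ⟨⟨?_, ?_, ?_, ?_, ?_⟩, ?_, .inl rfl⟩, ?_⟩, ?_, hTr, ?_, ?_⟩
    · intro z hz c hc h; simp [h9₁ z hz c hc] at h
    · intro z hz c hc u h; simp [h9₁ z hz c hc] at h
    · intro z hz c hc h; simp [h9₁ z hz c hc] at h
    · intro z hz c hc h; simp [h9₁ z hz c hc] at h
    · change 0 + (Finset.filter (fun p : ℕ × ℕ => σ₁.A 9 p.1 p.2 = 0) _).card = _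
      rw [zero_add, Finset.filter_true_of_mem, Finset.card_product, Finset.card_range, Finset.card_range]
      intro p hp
      simp only [Finset.mem_product, Finset.mem_range] at hp
      exact h9₁ _ hp.1 _ hp.2
    · intro z hz c hc h; simp [h9₁ z hz c hc] at h
    · simpa [Ex.eval] using (hk₁.reg 12 (by norm_num)).trans h12
    · intro z hz c hc h; simp [h9₁ z hz c hc] at h
    · simp [Ex.eval]
    · simp [Ex.eval]
  · rintro σ₂ ⟨y, hy, hS, hcl, hTy, hend, ht⟩
    have hle := hS.label.le
    refine ⟨by omega, trivial, trivial, fun hlt => ?_, fun hlt => ?_⟩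
    · simp only [Ex.eval] at hlt
      refine walks_spec hG (σ₁ := σ₂.tick) h0 hHD (hS.congr (by simpa using hS.keeps) rfl rfl rfl rfl rfl rfl) hcl hy ?_
      intro σ₃ hS₃ hcl₃ h34 hlab ht₃
      have hk := hS₃.keeps
      have hA1 := hk.arr 1 (by simp)
      have hA4 := hk.arr 4 (by simp)
      have hy33 := hS₃.vertex
      simp only [St.tick_r, St.tick_t] at h34 ht₃
      have hmul : (12 * k + 12) * (σ.A 5 y 0 + 1) ≤ (12 * k + 12) * (σ.A 5 y 0 + σ₂.r 34) :=
        Nat.mul_le_mul_left _ (by omega)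
      simp only [Cmd.wp, Ex.ok, Ex.eval, St.tick_r, St.tick_A, hA4, hy33]
      refine ⟨⟨trivial, trivial, by omega, by omega⟩, trivial, fun hT1 => ⟨trivial, ?_⟩,
        fun hT2 => ⟨⟨⟨trivial, trivial, by omega, by omega⟩, trivial⟩, ?_⟩⟩
      · refine ⟨y, hy, hS₃.congr (by simpa using hk) rfl rfl rfl rfl (by simp) (by simp), hcl₃, hTy,
          fun _ => ⟨by omega, hlab⟩, ?_⟩
        simp
        rw [mul_add] at hmul
        omega
      · obtain ⟨d, hd⟩ : ∃ d, σ.A 4 y 0 = d + 2 := ⟨σ.A 4 y 0 - 2, by omega⟩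
        obtain ⟨hdk, hED, hHDn, hTx, hrk⟩ := hT.toward y hy d hd
        have hd2 : d + 2 - 2 = d := by omega
        have hL := hS₃.label
        -- The next vertex of the path has a smaller rank than all vertices with a label `1`, so its
        -- predecessor can be written.
        have hPP : ∀ z < n, ∀ c < k, σ₃.A 9 z c = 1 →
            upd (upd (σ₃.A 11) (σ.A 1 y d) 0 y) (σ.A 1 y d) 1 d z = σ₃.A 11 z := by
          intro z hz c hc h1
          have := hL.ranks z hz c hc h1
          have hne : z ≠ σ.A 1 y d := by rintro rfl; omega
          funext i
          rw [upd_of_ne (fun h => hne h.1), upd_of_ne (fun h => hne h.1)]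
        simp [hd, hd2, hA1, hy33]
        refine ⟨⟨by omega, by omega⟩, by omega, by omega, by omega, by omega, _, hHDn,
          ⟨by simpa using hk, hS₃.out, ⟨?_, ?_, ?_⟩, by simp⟩, hcl₃, hTx, by omega, ?_⟩
        · simpa using hL.toIsLabel.congr_path hPP
        · intro z hz c hc h1
          have := hL.ranks z hz c hc (by simpa using h1)
          omega
        · right
          simp [upd_apply, hy, hdk, hED]
          exact hlab
        · rw [h34]
          have hmul' : (12 * k + 12) * (σ.A 5 (σ.A 1 y d) 0 + σ₂.r 34 + 1) ≤
              (12 * k + 12) * (σ.A 5 y 0 + σ₂.r 34) := Nat.mul_le_mul_left _ (by omega)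
          rw [mul_add _ _ 1] at hmul'
          omega
    · simp only [Ex.eval] at hlt
      have h34 : σ₂.r 34 = 0 := by omega
      obtain ⟨hT1, hlab⟩ := hend h34
      have hvy := hS.vertex
      refine hQ _ _ (by simpa using hS.keeps) hS.out hS.label.toIsLabel (by simpa [hvy] using hy)
        (by simpa [hvy] using hT1) (by simpa [hvy] using hlab) ?_
      have h1 := hT.rank_lt r hr hTr
      have h2 : (12 * k + 12) * (σ.A 5 r 0 + 1) ≤ (12 * k + 12) * n := Nat.mul_le_mul_left _ h1
      simp only [St.tick_t]
      ring_nf at ht₁ ht h2 hle ⊢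
      omega

end Label
end PebbleGame

namespace PebbleGame

/-! ### Configurations in memory -/

section Store

variable {n m k ℓ : ℕ}

/-- The arrays hold the configuration: the slot `(x, i)` has a pebble if `ED x i = 0`, and it has the
edge `e` with head `HD x i` if `ED x i = e + 1`. -/
structure IsStored (c : Config (Fin n) (Fin m) k) (ED HD : ℕ → ℕ → ℕ) : Prop where
  peb : ∀ (x : Fin n) (i : Fin k), c.peb x i = if ED x i = 0 then 1 else 0
  edge : ∀ (e : Fin m) (x y : Fin n) (i : Fin k),
    c.edge e = some (x, y, i) ↔ ED x i = e + 1 ∧ HD x i = y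
  le : ∀ x < n, ∀ i < k, ED x i ≤ m
  head : ∀ x < n, ∀ i < k, 0 < ED x i → HD x i < n

variable {c : Config (Fin n) (Fin m) k} {ED HD : ℕ → ℕ → ℕ}

theorem isStored_initial (h : ∀ x < n, ∀ i < k, ED x i = 0) :
    IsStored (Config.initial (Fin n) (Fin m) k) ED HD where
  peb x i := by simp [Config.initial, h x x.2 i i.2]
  edge e x y i := by simp [Config.initial, h x x.2 i i.2]
  le x hx i hi := by simp [h x hx i hi]
  head x hx i hi h' := by rw [h x hx i hi] at h'; omega

theorem IsStored.peb_pos (h : IsStored c ED HD) {x : Fin n} {i : Fin k} :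
    0 < c.peb x i ↔ ED x i = 0 := by
  rw [h.peb]; split_ifs <;> simp [*]

theorem IsStored.peb_ne_zero (h : IsStored c ED HD) {x : Fin n} {i : Fin k} :
    c.peb x i ≠ 0 ↔ ED x i = 0 := by
  rw [h.peb]; split_ifs <;> simp [*]

theorem upd_fin {f : ℕ → ℕ → ℕ} (x y : Fin n) (i j : Fin k) (v : ℕ) :
    upd f x j v y i = if y = x ∧ i = j then v else f y i := by
  simp only [upd_apply, Fin.ext_iff]

theorem IsStored.addEdge (h : IsStored c ED HD) {e : Fin m} {x y : Fin n} {i : Fin k}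
    (hnew : c.edge e = none) (h0 : ED x i = 0) :
    IsStored (c.addEdge e x y i) (upd ED x i (e + 1)) (upd HD x i y) where
  peb z j := by
    simp only [Config.addEdge, takePebble_apply, upd_fin, h.peb, h0]
    split_ifs <;> simp_all
  edge f z y' j := by
    simp only [Config.addEdge, upd_fin, Function.update_apply]
    by_cases hf : f = e
    · subst hf
      have := fun y => h.edge f z y j
      simp only [hnew] at this
      rw [if_pos rfl]
      by_cases hz : z = x ∧ j = i
      · obtain ⟨rfl, rfl⟩ := hz
        simp [Fin.ext_iff]
      · rw [if_neg hz, if_neg hz, ← this]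
        simp only [Option.some.injEq, Prod.mk.injEq, reduceCtorEq, iff_false]
        rintro ⟨rfl, -, rfl⟩
        exact hz ⟨rfl, rfl⟩
    · rw [if_neg hf, h.edge]
      by_cases hz : z = x ∧ j = i
      · obtain ⟨rfl, rfl⟩ := hz
        simp only [h0, and_self, if_true]
        have : (f : ℕ) ≠ e := fun h => hf (Fin.ext h)
        omega
      · rw [if_neg hz, if_neg hz]
  le z hz j hj := by
    rw [upd_apply]
    split_ifs
    exacts [e.2, h.le z hz j hj]
  head z hz j hj := by
    rw [upd_apply, upd_apply]
    split_ifs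
    exacts [fun _ => y.2, h.head z hz j hj]

theorem IsStored.slideEdge (h : IsStored c ED HD) {e : Fin m} {x y : Fin n} {i j : Fin k}
    (he : c.edge e = some (x, y, j)) (h0 : ED y i = 0) :
    IsStored (c.slideEdge e x y i j) (upd (upd ED y i (e + 1)) x j 0) (upd HD y i x) where
  peb z l := by
    have hx := (h.edge e x y j).1 he
    have hne : ¬ (x = y ∧ j = i) := by
      rintro ⟨rfl, rfl⟩; omega
    simp only [Config.slideEdge, putPebble_apply, takePebble_apply, upd_fin, h.peb, h0, if_neg hne]
    split_ifs <;> simp_all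
  edge f z y' l := by
    have hx := (h.edge e x y j).1 he
    have hne : ¬ (y = x ∧ i = j) := by
      rintro ⟨rfl, rfl⟩; omega
    simp only [Config.slideEdge, upd_fin, Function.update_apply]
    by_cases hz : z = x ∧ l = j
    · obtain ⟨rfl, rfl⟩ := hz
      have hne' : ¬ (z = y ∧ l = i) := fun h => hne ⟨h.1.symm, h.2.symm⟩
      simp only [and_self, if_true, if_neg hne']
      split_ifs with hf
      · simp only [Option.some.injEq, Prod.mk.injEq]
        constructor
        · rintro ⟨h1, -, h2⟩; exact absurd ⟨h1, h2⟩ hne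
        · rintro ⟨h1, -⟩; simp at h1
      · rw [h.edge]
        have : (f : ℕ) ≠ e := fun h => hf (Fin.ext h)
        exact iff_of_false (fun h => by omega) (fun h => by simp at h)
    · rw [if_neg hz]
      by_cases hy : z = y ∧ l = i
      · obtain ⟨rfl, rfl⟩ := hy
        simp only [and_self, if_true]
        split_ifs with hf
        · subst hf; simp [Fin.ext_iff]
        · rw [h.edge, h0]
          have : (f : ℕ) ≠ e := fun h => hf (Fin.ext h)
          omega
      · rw [if_neg hy, if_neg hy]
        split_ifs with hf
        · subst hf
          rw [← h.edge f z y' l, he]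
          simp only [Option.some.injEq, Prod.mk.injEq]
          constructor
          · rintro ⟨rfl, -, rfl⟩; exact absurd ⟨rfl, rfl⟩ hy
          · rintro ⟨rfl, -, rfl⟩; exact absurd ⟨rfl, rfl⟩ hz
        · exact h.edge f z y' l
  le z hz l hl := by
    rw [upd_apply, upd_apply]
    split_ifs
    exacts [Nat.zero_le _, e.2, h.le z hz l hl]
  head z hz l hl := by
    rw [upd_apply, upd_apply, upd_apply]
    split_ifs
    exacts [fun h => absurd h (lt_irrefl _), fun h => absurd h (lt_irrefl _), fun _ => x.2,
      h.head z hz l hl]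

/-- One pebble leaves `y` and one arrives at `x`. The equation has both indicators as summands, to
avoid truncated subtraction. -/
theorem pebOn_slideEdge {ends : Fin m → Sym2 (Fin n)} (hc : c.IsValid ends) {e : Fin m}
    {x y : Fin n} {i j : Fin k} (he : c.edge e = some (x, y, j)) (h0 : 0 < c.peb y i)
    (v w : Fin n) : (c.slideEdge e x y i j).pebOn v w + (if y = v ∨ y = w then 1 else 0) =
      c.pebOn v w + (if x = v ∨ x = w then 1 else 0) := by
  have hne : ¬ (x = y ∧ j = i) := by
    rintro ⟨rfl, rfl⟩
    have := hc.peb_eq_zero _ _ _ _ he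
    omega
  have key : ∀ z l, (c.slideEdge e x y i j).peb z l + (if z = y ∧ l = i then 1 else 0) =
      c.peb z l + (if z = x ∧ l = j then 1 else 0) := by
    intro z l
    simp only [Config.slideEdge, putPebble_apply, takePebble_apply, if_neg hne]
    by_cases hz : z = x ∧ l = j
    · obtain ⟨rfl, rfl⟩ := hz
      simp [hne]
    · by_cases hy : z = y ∧ l = i
      · obtain ⟨rfl, rfl⟩ := hy
        rw [if_neg hz, if_neg hz]
        simp; omega
      · simp [hz, hy]
  have hsum : ∀ (z : Fin n) (l : Fin k), (if z = v ∨ z = w then 1 else 0) =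
      ∑ a ∈ ({v, w} : Finset (Fin n)), ∑ b : Fin k, if a = z ∧ b = l then 1 else 0 := by
    intro z l
    have : ∀ a : Fin n, (∑ b : Fin k, if a = z ∧ b = l then 1 else 0) = if a = z then 1 else 0 := by
      intro a
      by_cases ha : a = z <;> simp [ha]
    simp only [this, Finset.sum_ite_eq', Finset.mem_insert, Finset.mem_singleton]
  rw [hsum y i, hsum x j, Config.pebOn, Config.pebOn, ← Finset.sum_add_distrib,
    ← Finset.sum_add_distrib]
  refine Finset.sum_congr rfl fun a _ => ?_
  rw [← Finset.sum_add_distrib, ← Finset.sum_add_distrib]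
  exact Finset.sum_congr rfl fun b _ => key a b

/-- A canonical play from the start leads to the stored configuration, and its moves are the output. -/
structure IsPosition (ends : Fin m → Sym2 (Fin n)) (ℓ : ℕ) (c : Config (Fin n) (Fin m) k)
    (mvs : List (Move (Fin n) (Fin m) k)) (σ : St) : Prop where
  stored : IsStored c (σ.A 0) (σ.A 1)
  play : CanonicalPlay ends ℓ (Config.initial (Fin n) (Fin m) k) mvs c
  out : σ.o = mvs.flatMap encodeMove

theorem IsPosition.isGood {ends : Fin m → Sym2 (Fin n)} {mvs : List (Move (Fin n) (Fin m) k)}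
    {σ : St} (h : IsPosition ends ℓ c mvs σ) : c.IsGood ends ℓ :=
  Config.isGood_initial.play h.play

theorem IsPosition.congr {ends : Fin m → Sym2 (Fin n)} {mvs : List (Move (Fin n) (Fin m) k)}
    {σ σ' : St} (h : IsPosition ends ℓ c mvs σ) (h0 : σ'.A 0 = σ.A 0) (h1 : σ'.A 1 = σ.A 1)
    (ho : σ'.o = σ.o) : IsPosition ends ℓ c mvs σ' :=
  ⟨by rw [h0, h1]; exact h.stored, h.play, ho.trans h.out⟩

theorem IsPosition.step {ends : Fin m → Sym2 (Fin n)} {mvs : List (Move (Fin n) (Fin m) k)}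
    {σ σ' : St} (h : IsPosition ends ℓ c mvs σ) {mv : Move (Fin n) (Fin m) k}
    {c' : Config (Fin n) (Fin m) k} (hs : CanonicalStep ends ℓ c mv c')
    (hst : IsStored c' (σ'.A 0) (σ'.A 1)) (ho : σ'.o = σ.o ++ encodeMove mv) :
    IsPosition ends ℓ c' (mvs ++ [mv]) σ' :=
  ⟨hst, h.play.append ⟨c', hs, rfl⟩, by rw [ho, h.out]; simp⟩

end Store

/-! ### Canonical slides along the labels -/

section Slide

variable {G : Env} {n m k ℓ : ℕ}

local infixr:60 " ;; " => Cmd.seq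
local infix:70 " ≔ " => Cmd.asg
local notation "ρ" => Ex.reg
local notation "♯" => Ex.num

/-- Reverse the edge in the slot given by the registers `43`, `44`, covering it with the pebble in the
slot given by the registers `40`, `41`. -/
def slideEdgeCmd : Cmd :=
  45 ≔ .arr 0 (ρ 43) (ρ 44) ;;
  .emi (♯ 1) ;; .emi (.sub (ρ 45) (♯ 1)) ;; .emi (ρ 40) ;; .emi (ρ 41) ;;
  .sto 0 (ρ 40) (ρ 41) (ρ 45) ;; .sto 1 (ρ 40) (ρ 41) (ρ 43) ;; .sto 0 (ρ 43) (ρ 44) (♯ 0) ;;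
  40 ≔ ρ 43 ;; 41 ≔ ρ 44

theorem slideEdgeCmd_spec (hG : G.IsFor n m k ℓ) {σ : St} {y i u d : ℕ} (h40 : σ.r 40 = y)
    (h41 : σ.r 41 = i) (h43 : σ.r 43 = u) (h44 : σ.r 44 = d) (hy : y < n) (hi : i < k) (hu : u < n)
    (hd : d < k) {Q : St → Prop} (hQ : ∀ σ', Keeps 40 [0, 1] σ σ' →
      σ'.A 0 = upd (upd (σ.A 0) y i (σ.A 0 u d)) u d 0 → σ'.A 1 = upd (σ.A 1) y i u →
      σ'.r 40 = u → σ'.r 41 = d → σ'.o = σ.o ++ [1, σ.A 0 u d - 1, y, i] → σ'.t = σ.t + 10 → Q σ') :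
    slideEdgeCmd.wp G Q σ := by
  have hR := hG.rows
  have hW := hG.width
  simp only [slideEdgeCmd, Cmd.wp, Ex.ok, Ex.eval]
  simp [h40, h41, h43, h44]
  refine ⟨by omega, by omega, by omega, by omega, by omega, by omega, by omega, hQ _ (by simp [Keeps.refl]) ?_ ?_ ?_ ?_ ?_ ?_⟩ <;> simp

/-- One pebble-slide along the labeled edges. -/
def slideStep : Cmd :=
  42 ≔ .arr 9 (ρ 40) (ρ 41) ;;
  .ite (♯ 1) (ρ 42) (43 ≔ .sub (ρ 42) (♯ 2) ;; 44 ≔ ρ 41)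
    (43 ≔ .arr 11 (ρ 40) (♯ 0) ;; 44 ≔ .arr 11 (ρ 40) (♯ 1)) ;; slideEdgeCmd

/-- Bring a pebble from the vertex in the register `33` to the vertex in the register `12`. -/
def slide : Cmd :=
  40 ≔ ρ 33 ;; 41 ≔ ♯ 0 ;; .whl (♯ 0) (.arr 0 (ρ 40) (ρ 41)) (41 ≔ .add (ρ 41) (♯ 1)) ;;
  .whl (♯ 0) (.add (.sub (ρ 40) (ρ 12)) (.sub (ρ 12) (ρ 40))) slideStep

/-- The state of the slides: the pebble is in the slot `(y, i)`, and the slots labeled before are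
unchanged. -/
structure IsSliding (ends : Fin m → Sym2 (Fin n)) (ℓ : ℕ) (v w : Fin n)
    (c₀ : Config (Fin n) (Fin m) k) (σ σ' : St) (y i : ℕ) : Prop where
  keeps : Keeps 40 [0, 1] σ σ'
  vertex : σ'.r 40 = y
  color : σ'.r 41 = i
  vertex_lt : y < n
  color_lt : i < k
  free : σ'.A 0 y i = 0
  label : σ.A 9 y i ≠ 0
  same : ∀ z < n, ∀ j < k, σ.A 9 z j ≠ 0 → σ.A 10 z j < σ.A 10 y i →
    σ'.A 0 z j = σ.A 0 z j ∧ σ'.A 1 z j = σ.A 1 z j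
  position : ∃ (c : Config (Fin n) (Fin m) k) (mvs : List (Move (Fin n) (Fin m) k)),
    IsPosition ends ℓ c mvs σ' ∧ c.edges = c₀.edges ∧
      c.pebOn v w = c₀.pebOn v w + if y = v ∨ y = w then 1 else 0

/-- The pebble in the slot `(y, i)` moves to a slot `(u, d)` of smaller stamp, where the
configuration is still the one that was labeled. If the edge has color `i`, then `u` has no other
outgoing edge of color `i`, and `{u}` is a closed set as needed by `Config.IsValid.noCycleCreated`.
If the slot has the label `1`, the path edge is used. Then the closed set consists of the vertices
labeled in color `i` before `y`, which include `u` but not `y`. -/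
theorem IsSliding.slide {ends : Fin m → Sym2 (Fin n)} {v w : Fin n} {c₀ : Config (Fin n) (Fin m) k}
    {σ σ₁ : St} {r s y i u d : ℕ} (h : IsSliding ends ℓ v w c₀ σ σ₁ y i)
    (hL : IsLabel n k r (σ.A 0) (σ.A 1) (σ.A 9) (σ.A 10) (σ.A 11) s)
    (hstep : (σ.A 9 y i = u + 2 ∧ d = i) ∨
      (σ.A 9 y i = 1 ∧ y ≠ r ∧ u = σ.A 11 y 0 ∧ d = σ.A 11 y 1)) :
    u < n ∧ d < k ∧ 0 < σ₁.A 0 u d ∧ σ.A 10 u d < σ.A 10 y i ∧ ∀ σ₂ : St, Keeps 40 [0, 1] σ σ₂ →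
      σ₂.A 0 = upd (upd (σ₁.A 0) y i (σ₁.A 0 u d)) u d 0 → σ₂.A 1 = upd (σ₁.A 1) y i u →
      σ₂.r 40 = u → σ₂.r 41 = d → σ₂.o = σ₁.o ++ [1, σ₁.A 0 u d - 1, y, i] →
      IsSliding ends ℓ v w c₀ σ σ₂ u d := by
  have hy := h.vertex_lt
  have hi := h.color_lt
  have hpre : u < n ∧ d < k ∧ 0 < σ.A 0 u d ∧ σ.A 1 u d = y ∧ σ.A 9 u d ≠ 0 ∧
      σ.A 10 u d < σ.A 10 y i := by
    rcases hstep with ⟨h1, rfl⟩ | ⟨h1, hyr, rfl, rfl⟩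
    · obtain ⟨a1, a2, a3, a4, a5⟩ := hL.pred y hy d hi u h1
      exact ⟨a1, hi, a4, a5, a2, a3⟩
    · rcases hL.start y hy i hi h1 with h2 | ⟨a1, a2, a3, a4, a5, a6, -, -⟩
      · exact absurd h2 hyr
      · exact ⟨a1, a2, a3, a4, a5, a6⟩
  obtain ⟨hu, hd, hED, hHD, hlab, hlt⟩ := hpre
  obtain ⟨hs0, hs1⟩ := h.same u hu d hd hlab hlt
  rw [← hs0] at hED
  rw [← hs1] at hHD
  refine ⟨hu, hd, hED, hlt, fun σ₂ hk hA0 hA1 h40 h41 ho => ?_⟩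
  have hne : ¬ (u = y ∧ d = i) := by rintro ⟨rfl, rfl⟩; omega
  refine ⟨hk, h40, h41, hu, hd, by rw [hA0, upd_self], hlab, fun z hz j hj hzj hlt' => ?_, ?_⟩
  · have h2 : ¬ (z = y ∧ j = i) := by rintro ⟨rfl, rfl⟩; omega
    have h3 : ¬ (z = u ∧ j = d) := by rintro ⟨rfl, rfl⟩; omega
    rw [hA0, hA1, upd_of_ne h3, upd_of_ne h2, upd_of_ne h2]
    exact h.same z hz j hj hzj (by omega)
  · obtain ⟨c, mvs, hpos, hedges, hpeb⟩ := h.position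
    obtain ⟨e, he⟩ : ∃ e : Fin m, σ₁.A 0 u d = e + 1 :=
      ⟨⟨σ₁.A 0 u d - 1, by have := hpos.stored.le u hu d hd; omega⟩, by simp; omega⟩
    have hedge : c.edge e = some (⟨u, hu⟩, ⟨y, hy⟩, ⟨d, hd⟩) :=
      (hpos.stored.edge e ⟨u, hu⟩ ⟨y, hy⟩ ⟨d, hd⟩).2 ⟨he, hHD⟩
    have hfree : 0 < c.peb ⟨y, hy⟩ ⟨i, hi⟩ := hpos.stored.peb_pos.2 h.free
    have hvalid := hpos.isGood.valid
    have hno : NoCycleCreated ends c (c.slideEdge e ⟨u, hu⟩ ⟨y, hy⟩ ⟨i, hi⟩ ⟨d, hd⟩) := by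
      rcases hstep with ⟨h1, rfl⟩ | ⟨h1, hyr, rfl, rfl⟩
      · refine hvalid.noCycleCreated hedge hfree (S := fun z => z = ⟨u, hu⟩) ?_ rfl ?_
        · rintro f x z hf hx rfl
          exact absurd (hvalid.unique _ _ _ _ _ _ hx hedge) hf
        · intro h
          exact hne ⟨(Fin.ext_iff.1 h).symm, rfl⟩
      · rcases hL.start y hy i hi h1 with h2 | ⟨-, -, -, -, -, -, a1, a2⟩
        · exact absurd h2 hyr
        refine hvalid.noCycleCreated hedge hfree
          (S := fun z => σ.A 9 z i ≠ 0 ∧ σ.A 10 z i < σ.A 10 y i) ?_ ⟨a1, a2⟩ ?_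
        · rintro f x z hf hx ⟨b1, b2⟩
          obtain ⟨c1, c2⟩ := (hpos.stored.edge _ _ _ _).1 hx
          obtain ⟨d1, d2⟩ := h.same x x.2 i hi b1 b2
          have := hL.closed y hy i hi h1 x x.2 b1 b2 (by simp only at c1; omega)
          rwa [← d2, c2] at this
        · rintro ⟨-, h⟩
          exact lt_irrefl _ h
    refine ⟨_, _, hpos.step (.slide c e _ _ _ _ hedge hfree hno) ?_ ?_,
      (Config.edges_slideEdge hedge).trans hedges, ?_⟩
    · rw [hA0, hA1, he]
      exact hpos.stored.slideEdge hedge h.free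
    · rw [ho, he]; simp [encodeMove]
    · have := pebOn_slideEdge hvalid hedge hfree v w
      simp only [Config.slideEdge, Fin.ext_iff] at this
      rw [hpeb] at this
      omega

/-- Stamps decrease with each slide, so there are at most `n * k` slides, and a labeled slot without
a continuation must be at `r`. The pebble starts outside of `{v, w}` and ends inside, so the count
there grows by one. -/
theorem slide_spec (hG : G.IsFor n m k ℓ) {ends : Fin m → Sym2 (Fin n)} {v w : Fin n}
    {c₀ : Config (Fin n) (Fin m) k} {mvs : List (Move (Fin n) (Fin m) k)} {σ : St} {x r s : ℕ}
    (hp : IsPosition ends ℓ c₀ mvs σ) (h12 : σ.r 12 = r) (hrn : r < n)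
    (hr : r = v ∨ r = w) (h33 : σ.r 33 = x) (hx : x < n) (hxv : x ≠ v) (hxw : x ≠ w)
    (hfree : ∃ i < k, σ.A 0 x i = 0) (hlab : ∀ i < k, σ.A 9 x i ≠ 0)
    (hL : IsLabel n k r (σ.A 0) (σ.A 1) (σ.A 9) (σ.A 10) (σ.A 11) s)
    {Q : St → Prop} (hQ : ∀ σ' c' mvs', Keeps 40 [0, 1] σ σ' → IsPosition (k := k) ends ℓ c' mvs' σ' →
      c'.edges = c₀.edges → c'.pebOn v w = c₀.pebOn v w + 1 →
      σ'.t ≤ σ.t + 20 * ((n + 1) * (k + 1)) → Q σ') : slide.wp G Q σ := by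
  have hM := hG.numbers
  have hR := hG.rows
  have hW := hG.width
  refine ⟨trivial, trivial, fun σ₁ => ∃ i < k, IsPosition ends ℓ c₀ mvs σ₁ ∧ Keeps 40 [0, 1] σ σ₁ ∧
    σ₁.A 0 = σ.A 0 ∧ σ₁.A 1 = σ.A 1 ∧ σ₁.r 40 = x ∧ σ₁.r 41 = i ∧ (∃ j < k, i ≤ j ∧ σ.A 0 x j = 0) ∧
    σ₁.t ≤ σ.t + 2 + 2 * i, σ.t + 2 + 2 * k, ?_, ?_⟩
  · obtain ⟨j, hj, hj0⟩ := hfree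
    exact ⟨0, by omega, hp.congr rfl rfl rfl, by simp [Keeps.refl], rfl, rfl, by simp [Ex.eval, h33],
      by simp [Ex.eval], ⟨j, hj, by omega, hj0⟩, by simp⟩
  rintro σ₁ ⟨i, hik, hpos, hk, hA0, hA1, h40, h41, ⟨j, hj, hij, hj0⟩, ht⟩
  refine ⟨by omega, trivial, ⟨trivial, trivial, ?_, ?_⟩, fun hlt => ?_, fun hlt => ?_⟩
  · simp only [Ex.eval]; omega
  · simp only [Ex.eval]; omega
  · simp only [Ex.eval, hA0, h40, h41] at hlt
    have hne : i ≠ j := by rintro rfl; omega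
    refine ⟨⟨trivial, trivial, ?_⟩, i + 1, by omega, hpos.congr rfl rfl rfl, by simpa using hk, hA0, hA1,
      by simpa using h40, by simp [Ex.eval, h41], ⟨j, hj, by omega, hj0⟩, ?_⟩
    · simp [Ex.eval]; omega
    · simp; omega
  simp only [Ex.eval, hA0, h40, h41] at hlt
  refine ⟨fun σ₂ => ∃ y d, IsSliding ends ℓ v w c₀ σ σ₂ y d ∧
    σ₂.t + 18 * σ.A 10 y d ≤ σ.t + 3 + 2 * k + 18 * (n * k), σ.t + 3 + 2 * k + 18 * (n * k), ?_, ?_⟩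
  · have h10 := hL.stamp x hx i hik (hlab i hik)
    have := hL.le
    refine ⟨x, i, ⟨by simpa using hk, by simpa using h40, by simpa using h41, hx, hik, ?_,
      hlab i hik, ?_, c₀, mvs, hpos.congr rfl rfl rfl, rfl, ?_⟩, ?_⟩
    · simp [hA0]; omega
    · simp [hA0, hA1]
    · simp [hxv, hxw]
    · simp; omega
  · rintro σ₂ ⟨y, d, hS, ht⟩
    have hk := hS.keeps
    have h40 := hS.vertex
    have h41 := hS.color
    have hy := hS.vertex_lt
    have hd := hS.color_lt
    have hr12 := (hk.reg 12 (by norm_num)).trans h12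
    have hA9 := hk.arr 9 (by simp)
    have hA11 := hk.arr 11 (by simp)
    refine ⟨by omega, trivial, ⟨⟨trivial, trivial⟩, ⟨trivial, trivial⟩, ?_⟩, fun hlt => ?_, fun hlt => ?_⟩
    · simp [Ex.eval, h40, hr12]; omega
    · simp only [Ex.eval, h40, hr12] at hlt
      have hyr : y ≠ r := by rintro rfl; omega
      have hlab := hS.label
      have hend : ∀ u d' σ₃, (u < n ∧ d' < k ∧ 0 < σ₂.A 0 u d' ∧ σ.A 10 u d' < σ.A 10 y d ∧
          ∀ σ₃ : St, Keeps 40 [0, 1] σ σ₃ →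
            σ₃.A 0 = upd (upd (σ₂.A 0) y d (σ₂.A 0 u d')) u d' 0 → σ₃.A 1 = upd (σ₂.A 1) y d u →
            σ₃.r 40 = u → σ₃.r 41 = d' → σ₃.o = σ₂.o ++ [1, σ₂.A 0 u d' - 1, y, d] →
            IsSliding ends ℓ v w c₀ σ σ₃ u d') →
          Keeps 40 [0, 1] σ σ₃ → σ₃.r 40 = y → σ₃.r 41 = d → σ₃.r 43 = u → σ₃.r 44 = d' →
          σ₃.A 0 = σ₂.A 0 → σ₃.A 1 = σ₂.A 1 → σ₃.o = σ₂.o → σ₃.t ≤ σ₂.t + 5 →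
          slideEdgeCmd.wp G (fun σ₂ => ∃ y d, IsSliding ends ℓ v w c₀ σ σ₂ y d ∧
            σ₂.t + 18 * σ.A 10 y d ≤ σ.t + 3 + 2 * k + 18 * (n * k)) σ₃ := by
        rintro u d' σ₃ ⟨hu, hd', hED, hlt', hnext⟩ hk₃ h40₃ h41₃ h43₃ h44₃ h0₃ h1₃ ho₃ ht₃
        refine slideEdgeCmd_spec hG h40₃ h41₃ h43₃ h44₃ hy hd hu hd' ?_
        intro σ₄ hk₄ h0₄ h1₄ h40₄ h41₄ ho₄ ht₄
        rw [h0₃] at h0₄ ho₄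
        rw [h1₃] at h1₄
        rw [ho₃] at ho₄
        exact ⟨u, d', hnext σ₄ (hk₃.trans hk₄) h0₄ h1₄ h40₄ h41₄ ho₄, by omega⟩
      simp only [slideStep, Cmd.wp, Ex.ok, Ex.eval, St.tick_r, St.tick_A, h40, h41, hA9]
      refine ⟨⟨trivial, trivial, by omega, by omega⟩, trivial, trivial, fun h1 => ?_, fun h1 => ?_⟩
      · simp only [St.setr_r, if_true] at h1
        refine ⟨⟨trivial, trivial⟩, trivial, hend _ _ _ (hS.slide hL (u := σ.A 9 y d - 2) (d := d)
          (.inl ⟨by omega, rfl⟩)) ?_ ?_ ?_ ?_ ?_ ?_ ?_ ?_ ?_⟩ <;> simp [h40, h41, hk]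
      · simp only [St.setr_r, if_true] at h1
        simp [h40, hA11]
        refine ⟨⟨by omega, by omega⟩, ⟨by omega, by omega⟩, hend _ _ _ (hS.slide hL
          (.inr ⟨by omega, hyr, rfl, rfl⟩)) ?_ ?_ ?_ ?_ ?_ ?_ ?_ ?_ ?_⟩ <;> simp [h40, h41, hk]
    · simp only [Ex.eval, h40, hr12] at hlt
      obtain rfl : y = r := by omega
      obtain ⟨c', mvs', hpos', hedges, hpeb⟩ := hS.position
      refine hQ _ c' mvs' (by simpa using hk) (hpos'.congr rfl rfl rfl) hedges ?_ ?_
      · rw [hpeb, if_pos hr]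
      · simp only [St.tick_t]
        ring_nf at ht ⊢
        omega

end Slide
end PebbleGame

namespace PebbleGame

/-! ### Counting pebbles and choosing a color -/

section Count

variable {G : Env} {n m k ℓ : ℕ}

local infixr:60 " ;; " => Cmd.seq
local infix:70 " ≔ " => Cmd.asg
local notation "ρ" => Ex.reg
local notation "♯" => Ex.num

/-- Count the pebbles on the vertices in the registers `5`, `6` in the register `13`. -/
def countPebbles : Cmd :=
  13 ≔ ♯ 0 ;; .loop 14 0
    (.ite (.arr 0 (ρ 5) (ρ 14)) (♯ 1) (13 ≔ .add (ρ 13) (♯ 1)) .skip ;;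
      -- Since `v ≤ w`, this test excludes loops, whose pebbles must not be counted twice.
      .ite (ρ 5) (ρ 6) (.ite (.arr 0 (ρ 6) (ρ 14)) (♯ 1) (13 ≔ .add (ρ 13) (♯ 1)) .skip) .skip)

theorem IsStored.pebOn_eq {c : Config (Fin n) (Fin m) k} {ED HD : ℕ → ℕ → ℕ} (h : IsStored c ED HD)
    (v w : Fin n) : c.pebOn v w = ∑ i ∈ Finset.range k, ((if ED v i = 0 then 1 else 0) +
      if (v : ℕ) ≠ w ∧ ED w i = 0 then 1 else 0) := by
  rw [Config.pebOn, Finset.sum_comm, Finset.sum_range]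
  refine Finset.sum_congr rfl fun i _ => ?_
  by_cases hvw : v = w
  · subst hvw; simp [h.peb, Finset.sum_singleton, -Finset.sum_boole]
  · have : (v : ℕ) ≠ w := fun h => hvw (Fin.ext h)
    rw [Finset.sum_pair hvw]
    simp [h.peb, this]

theorem countPebbles_spec (hG : G.IsFor n m k ℓ) {c : Config (Fin n) (Fin m) k} {σ : St} {v w : Fin n}
    (hst : IsStored c (σ.A 0) (σ.A 1)) (h0 : σ.r 0 = k) (h5 : σ.r 5 = v) (h6 : σ.r 6 = w)
    (hvw : (v : ℕ) ≤ w) {Q : St → Prop} (hQ : ∀ σ', Keeps 13 [] σ σ' → σ'.o = σ.o →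
      σ'.r 13 = c.pebOn v w → σ'.t ≤ σ.t + 10 * (k + 1) → Q σ') : countPebbles.wp G Q σ := by
  have hM := hG.numbers
  have hR := hG.rows
  have hW := hG.width
  have hv := v.2
  have hw := w.2
  let f : ℕ → ℕ := fun i => (if σ.A 0 v i = 0 then 1 else 0) +
    if (v : ℕ) ≠ w ∧ σ.A 0 w i = 0 then 1 else 0
  have hf : ∀ i, f i = (if σ.A 0 v i = 0 then 1 else 0) +
    if (v : ℕ) ≠ w ∧ σ.A 0 w i = 0 then 1 else 0 := fun i => rfl
  have hle : ∀ j, ∑ i ∈ Finset.range j, f i ≤ 2 * j := by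
    intro j
    have : ∀ i ∈ Finset.range j, f i ≤ 2 := by
      intro i _; rw [hf]; split_ifs <;> omega
    simpa [mul_comm] using Finset.sum_le_card_nsmul _ _ _ this
  refine ⟨trivial, Cmd.wp_for k 6 (fun j σ' => Keeps 13 [] σ σ' ∧ σ'.o = σ.o ∧
    σ'.r 13 = ∑ i ∈ Finset.range j, f i)
    (by omega) (by simpa using h0) (by norm_num) ?_ ?_ ?_⟩
  · simp [Keeps.refl, Ex.eval]
  · rintro j hj σ₁ ⟨hk, ho, h13⟩ hr hb
    have hA0 := hk.arr 0 (by simp)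
    have h5' := (hk.reg 5 (by norm_num)).trans h5
    have h6' := (hk.reg 6 (by norm_num)).trans h6
    have := hle j
    have hfj := hf j
    simp only [Cmd.wp, Ex.ok, Ex.eval, Cmd.skip]
    simp [hA0, h5', h6', hr, hb, h13, hk, ho, Finset.sum_range_succ]
    rw [hfj]
    refine ⟨⟨by omega, by omega⟩, fun h1 => ⟨by omega, fun h2 => ⟨⟨by omega, by omega⟩, fun h3 =>
      ⟨by omega, ?_⟩, fun h3 => ?_⟩, fun h2 => ?_⟩, fun h1 => ⟨fun h2 =>
      ⟨⟨by omega, by omega⟩, fun h3 => ⟨by omega, ?_⟩, fun h3 => ?_⟩, fun h2 => ?_⟩⟩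
    all_goals split_ifs <;> omega
  · rintro σ₁ ⟨hk, ho, h13⟩ hr ht
    refine hQ _ (by simpa using hk) ho ?_ ?_
    · rw [hst.pebOn_eq]; exact h13
    · simp at ht ⊢; omega

/-- Find the color and the tail of an edge to be added. -/
def chooseColor : Cmd :=
  -- Register `51` holds the last common color plus one, or `0`. Registers `52` and `53` hold the
  -- last color present on the ends and an end where it is present.
  51 ≔ ♯ 0 ;; .loop 50 0
    (.ite (.arr 0 (ρ 5) (ρ 50)) (♯ 1)
      (52 ≔ ρ 50 ;; 53 ≔ ρ 5 ;;
        .ite (ρ 5) (ρ 6) (.ite (.arr 0 (ρ 6) (ρ 50)) (♯ 1) (51 ≔ .add (ρ 50) (♯ 1)) .skip) .skip)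
      (.ite (.arr 0 (ρ 6) (ρ 50)) (♯ 1) (52 ≔ ρ 50 ;; 53 ≔ ρ 6) .skip)) ;;
  .ite (♯ 0) (ρ 51) (52 ≔ .sub (ρ 51) (♯ 1) ;; 53 ≔ ρ 5) .skip

/-- The state of the choice of a color after `j` colors. -/
structure IsChoice (ED : ℕ → ℕ → ℕ) (k v w j : ℕ) (σ : St) : Prop where
  common : 0 < σ.r 51 → σ.r 51 ≤ j ∧ v < w ∧ ED v (σ.r 51 - 1) = 0 ∧ ED w (σ.r 51 - 1) = 0
  none : σ.r 51 = 0 → v < w → ∀ i < j, ED v i = 0 → ED w i ≠ 0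
  le : ∀ i < j, ED v i = 0 ∨ ED w i = 0 → i ≤ σ.r 52
  mem : (∃ i < j, ED v i = 0 ∨ ED w i = 0) →
    σ.r 52 < j ∧ (σ.r 53 = v ∨ σ.r 53 = w) ∧ ED (σ.r 53) (σ.r 52) = 0

theorem IsChoice.step {ED : ℕ → ℕ → ℕ} {v w j : ℕ} {σ σ' : St} (h : IsChoice ED k v w j σ)
    (hv : ED v j = 0 → σ'.r 52 = j ∧ σ'.r 53 = v ∧
      σ'.r 51 = if v < w ∧ ED w j = 0 then j + 1 else σ.r 51)
    (hw : ED v j ≠ 0 → ED w j = 0 → σ'.r 52 = j ∧ σ'.r 53 = w ∧ σ'.r 51 = σ.r 51)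
    (hn : ED v j ≠ 0 → ED w j ≠ 0 → σ'.r 52 = σ.r 52 ∧ σ'.r 53 = σ.r 53 ∧ σ'.r 51 = σ.r 51) :
    IsChoice ED k v w (j + 1) σ' := by
  obtain ⟨h1, h2, h3, h4⟩ := h
  have h51 : σ'.r 51 = if v < w ∧ ED v j = 0 ∧ ED w j = 0 then j + 1 else σ.r 51 := by
    by_cases a : ED v j = 0 <;> by_cases b : ED w j = 0 <;> simp_all
  have h52 : σ'.r 52 = if ED v j = 0 ∨ ED w j = 0 then j else σ.r 52 := by
    by_cases a : ED v j = 0 <;> by_cases b : ED w j = 0 <;> simp_all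
  refine ⟨fun hp => ?_, fun hz hvw i hi hi0 => ?_, fun i hi hi0 => ?_, fun ⟨i, hi, hi0⟩ => ?_⟩
  · rw [h51] at hp ⊢
    split_ifs at hp ⊢ with hif
    · exact ⟨le_rfl, hif.1, by simpa using hif.2.1, by simpa using hif.2.2⟩
    · obtain ⟨a1, a2⟩ := h1 hp
      exact ⟨by omega, a2⟩
  · rw [h51] at hz
    split_ifs at hz with hif
    rcases Nat.lt_succ_iff_lt_or_eq.1 hi with h | rfl
    · exact h2 hz hvw i h hi0
    · exact fun h => hif ⟨hvw, hi0, h⟩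
  · rw [h52]
    rcases Nat.lt_succ_iff_lt_or_eq.1 hi with h | rfl
    · split_ifs
      exacts [h.le, h3 i h hi0]
    · rw [if_pos hi0]
  · by_cases a : ED v j = 0
    · obtain ⟨b1, b2, -⟩ := hv a
      rw [b1, b2]
      exact ⟨by omega, .inl rfl, a⟩
    · by_cases b : ED w j = 0
      · obtain ⟨b1, b2, -⟩ := hw a b
        rw [b1, b2]
        exact ⟨by omega, .inr rfl, b⟩
      · obtain ⟨b1, b2, -⟩ := hn a b
        rw [b1, b2]
        have hij : i ≠ j := by rintro rfl; tauto
        obtain ⟨c1, c2⟩ := h4 ⟨i, by omega, hi0⟩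
        exact ⟨by omega, c2⟩

theorem chooseColor_spec (hG : G.IsFor n m k ℓ) {σ : St} {v w : ℕ}
    (h0 : σ.r 0 = k) (h5 : σ.r 5 = v) (h6 : σ.r 6 = w) (hv : v < n) (hw : w < n)
    (hpeb : ∃ i < k, σ.A 0 v i = 0 ∨ σ.A 0 w i = 0)
    {Q : St → Prop} (hQ : ∀ σ', Keeps 50 [] σ σ' → σ'.o = σ.o → σ'.r 52 < k →
      (σ'.r 53 = v ∨ σ'.r 53 = w) → σ.A 0 (σ'.r 53) (σ'.r 52) = 0 →
      ((v < w ∧ σ.A 0 v (σ'.r 52) = 0 ∧ σ.A 0 w (σ'.r 52) = 0) ∨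
        (v < w → ∀ i < k, σ.A 0 v i = 0 → σ.A 0 w i ≠ 0) ∧
          ∀ i < k, σ.A 0 v i = 0 ∨ σ.A 0 w i = 0 → i ≤ σ'.r 52) →
      σ'.t ≤ σ.t + 10 * (k + 1) → Q σ') : chooseColor.wp G Q σ := by
  have hM := hG.numbers
  have hR := hG.rows
  have hW := hG.width
  refine ⟨trivial, Cmd.wp_for k 7 (fun j σ' => Keeps 50 [] σ σ' ∧ σ'.o = σ.o ∧
    IsChoice (σ.A 0) k v w j σ') (by omega) (by simpa using h0) (by norm_num) ?_ ?_ ?_⟩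
  · refine ⟨by simp [Keeps.refl], rfl, ?_, ?_, ?_, ?_⟩ <;> simp [Ex.eval]
  · rintro j hj σ₁ ⟨hk, ho, hC⟩ hr hb
    have hA0 := hk.arr 0 (by simp)
    have h5' := (hk.reg 5 (by norm_num)).trans h5
    have h6' := (hk.reg 6 (by norm_num)).trans h6
    simp only [Cmd.wp, Ex.ok, Ex.eval, Cmd.skip, St.tick_r, St.tick_A, hr, h5', h6', hA0]
    refine ⟨⟨trivial, trivial, by omega, by omega⟩, trivial, fun h1 => ⟨trivial, trivial, ?_⟩,
      fun h1 => ⟨⟨trivial, trivial, by omega, by omega⟩, trivial, fun h2 => ⟨trivial, trivial, ?_⟩,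
        fun h2 => ⟨trivial, ?_⟩⟩⟩
    · simp only [St.setr_r, St.setr_A, St.tick_r, St.tick_A]
      norm_num [h5', h6', hr, hA0]
      refine ⟨fun h2 => ⟨⟨by omega, by omega⟩, fun h3 => ⟨by omega, hb, ⟨hk, ho, ?_⟩⟩,
        fun h3 => ⟨hb, hk, ho, ?_⟩⟩, fun h2 => ⟨hb, hk, ho, ?_⟩⟩
      all_goals
        refine hC.step (fun a => ?_) (fun a b => ?_) (fun a b => ?_) <;> simp <;> omega
    · refine ⟨by simp [hr], by simp [hb], ⟨by simpa using hk, ho, ?_⟩, by simp⟩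
      refine hC.step (fun a => ?_) (fun a b => ?_) (fun a b => ?_) <;> simp <;> omega
    · refine ⟨by simp [hr], by simp [hb], ⟨by simpa using hk, ho, ?_⟩, by simp⟩
      refine hC.step (fun a => ?_) (fun a b => ?_) (fun a b => ?_) <;> simp <;> omega
  · rintro σ₁ ⟨hk, ho, hC⟩ hr ht
    have h5' := (hk.reg 5 (by norm_num)).trans h5
    obtain ⟨hc1, hc2, hc3, hc4⟩ := hC
    refine ⟨trivial, trivial, fun h1 => ⟨⟨trivial, trivial⟩, trivial, ?_⟩, fun h1 => ⟨trivial, ?_⟩⟩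
    · simp only [Ex.eval, St.tick_r] at h1
      obtain ⟨a1, a2, a3, a4⟩ := hc1 h1
      refine hQ _ (by simpa using hk) ho ?_ ?_ ?_ (.inl ?_) ?_
      · simp [Ex.eval]; omega
      · simp [Ex.eval, h5']
      · simpa [Ex.eval, h5'] using a3
      · simpa [Ex.eval, h5'] using ⟨a2, a3, a4⟩
      · simp at ht ⊢; omega
    · simp only [Ex.eval, St.tick_r] at h1
      obtain ⟨a1, a2, a3⟩ := hc4 hpeb
      refine hQ _ (by simpa using hk) ho (by simpa using a1) (by simpa using a2) (by simpa using a3)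
        (.inr ⟨hc2 (by omega), by simpa using hc3⟩) ?_
      simp at ht ⊢; omega

end Count
end PebbleGame

namespace PebbleGame

/-! ### Adding an edge and gathering pebbles -/

section Attempt

variable {G : Env} {n m k ℓ : ℕ}

local infixr:60 " ;; " => Cmd.seq
local infix:70 " ≔ " => Cmd.asg
local notation "ρ" => Ex.reg
local notation "♯" => Ex.num

/-- Add the edge in the register `8`. -/
def addCmd : Cmd :=
  chooseColor ;; .emi (♯ 0) ;; .emi (ρ 8) ;; .emi (ρ 53) ;; .emi (ρ 52) ;;
  -- The head is `v + w` minus the tail, which is right for loops, too.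
  .sto 0 (ρ 53) (ρ 52) (.add (ρ 8) (♯ 1)) ;; .sto 1 (ρ 53) (ρ 52) (.sub (.add (ρ 5) (ρ 6)) (ρ 53))

theorem addCmd_spec (hG : G.IsFor n m k ℓ) {ends : Fin m → Sym2 (Fin n)} {v w : Fin n} {e : Fin m}
    {c : Config (Fin n) (Fin m) k} {mvs : List (Move (Fin n) (Fin m) k)} {σ : St}
    (hp : IsPosition ends ℓ c mvs σ) (h0 : σ.r 0 = k) (h5 : σ.r 5 = v) (h6 : σ.r 6 = w)
    (h8 : σ.r 8 = e) (hvw : (v : ℕ) ≤ w) (hends : ends e = s(v, w)) (hnew : c.edge e = none)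
    (hpeb : ℓ + 1 ≤ c.pebOn v w)
    {Q : St → Prop} (hQ : ∀ σ' c' mvs', Keeps 50 [0, 1] σ σ' → IsPosition (k := k) ends ℓ c' mvs' σ' →
      c'.edges = insert e c.edges → σ'.t ≤ σ.t + 20 * (k + 1) → Q σ') : addCmd.wp G Q σ := by
  have hM := hG.numbers
  have hR := hG.rows
  have hW := hG.width
  have hv := v.2
  have hw := w.2
  have hst := hp.stored
  have hex : ∃ i < k, σ.A 0 v i = 0 ∨ σ.A 0 w i = 0 := by
    by_contra! hno
    rw [hst.pebOn_eq, Finset.sum_eq_zero] at hpeb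
    · omega
    · intro i hi
      obtain ⟨h1, h2⟩ := hno i (Finset.mem_range.1 hi)
      simp [h1, h2]
  refine chooseColor_spec hG h0 h5 h6 v.2 w.2 hex ?_
  intro σ₁ hk ho hcol htail hfree hcan ht
  have hA0 := hk.arr 0 (by simp)
  have hA1 := hk.arr 1 (by simp)
  have h5' := (hk.reg 5 (by norm_num)).trans h5
  have h6' := (hk.reg 6 (by norm_num)).trans h6
  have h8' := (hk.reg 8 (by norm_num)).trans h8
  have hlt : σ₁.r 53 < n := by omega
  have hedge : ∀ x y : Fin n, σ₁.r 53 = x → (v : ℕ) + w - σ₁.r 53 = y →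
      (x = v ∧ y = w ∨ x = w ∧ y = v) →
      CanonicalStep ends ℓ c (.add e x ⟨σ₁.r 52, hcol⟩) (c.addEdge e x y ⟨σ₁.r 52, hcol⟩) := by
    intro x y hx hy hxy
    refine .add c e x y _ ?_ hnew ?_ ?_ ?_
    · rcases hxy with ⟨rfl, rfl⟩ | ⟨rfl, rfl⟩
      exacts [hends, hends.trans Sym2.eq_swap]
    · rcases hxy with ⟨rfl, rfl⟩ | ⟨rfl, rfl⟩
      · exact hpeb
      · rwa [Config.pebOn, Finset.pair_comm]
    · rw [hst.peb_pos, ← hx]; exact hfree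
    · have hne : ∀ a b : Fin n, (a : ℕ) < b → a ≠ b := fun a b h h' => by rw [h'] at h; omega
      have hne' : ∀ a b : Fin n, (a : ℕ) ≤ b → a ≠ b → (a : ℕ) < b := fun a b h h' =>
        lt_of_le_of_ne h fun h => h' (Fin.ext h)
      simp only [CanonicalColor, hst.peb_pos]
      rcases hcan with ⟨a1, a2, a3⟩ | ⟨a1, a2⟩
      · left
        rcases hxy with ⟨rfl, rfl⟩ | ⟨rfl, rfl⟩
        exacts [⟨hne _ _ a1, a2, a3⟩, ⟨(hne _ _ a1).symm, a3, a2⟩]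
      · right
        rcases hxy with ⟨rfl, rfl⟩ | ⟨rfl, rfl⟩
        · exact ⟨fun ⟨j, b1, b2, b3⟩ => a1 (hne' _ _ hvw b1) j j.2 b2 b3, fun j hj => a2 j j.2 hj⟩
        · exact ⟨fun ⟨j, b1, b2, b3⟩ => a1 (hne' _ _ hvw b1.symm) j j.2 b3 b2,
            fun j hj => a2 j j.2 hj.symm⟩
  obtain ⟨x, y, hx, hy, hxy⟩ : ∃ x y : Fin n, σ₁.r 53 = x ∧ (v : ℕ) + w - σ₁.r 53 = y ∧
      (x = v ∧ y = w ∨ x = w ∧ y = v) := by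
    rcases htail with h | h
    · exact ⟨v, w, h, by omega, .inl ⟨rfl, rfl⟩⟩
    · exact ⟨w, v, h, by omega, .inr ⟨rfl, rfl⟩⟩
  refine ⟨trivial, trivial, trivial, trivial, ⟨trivial, trivial, ?_, ?_, ⟨trivial, trivial, ?_⟩,
    ⟨trivial, trivial, ?_, ?_, ⟨⟨trivial, trivial, ?_⟩, trivial⟩, ?_⟩⟩⟩
  · simp only [Ex.eval, St.emit_r]; omega
  · simp only [Ex.eval, St.emit_r]; omega
  · simp only [Ex.eval, St.emit_r, h8']; omega
  · simp only [Ex.eval, St.emit_r, St.seta_r]; omega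
  · simp only [Ex.eval, St.emit_r, St.seta_r]; omega
  · simp only [Ex.eval, St.emit_r, St.seta_r]; omega
  refine hQ _ _ _ ?_ (hp.step (hedge x y hx hy hxy) ?_ ?_) (Config.edges_addEdge ..) ?_
  · simpa using hk.mono le_rfl (by simp)
  · have := hst.addEdge (y := y) (x := x) (i := ⟨σ₁.r 52, hcol⟩) hnew (by rw [← hx]; exact hfree)
    rw [← hx, ← hy] at this
    simpa [Ex.eval, hA0, hA1, h8', h5', h6'] using this
  · simp [Ex.eval, encodeMove, ho, h8', hx]
  · simp; omega

theorem IsStored.pebOn_le {c : Config (Fin n) (Fin m) k} {ED HD : ℕ → ℕ → ℕ} (h : IsStored c ED HD)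
    (v w : Fin n) : c.pebOn v w ≤ 2 * k := by
  rw [h.pebOn_eq]
  calc _ ≤ ∑ _i ∈ Finset.range k, 2 := Finset.sum_le_sum fun i _ => by split_ifs <;> omega
    _ = 2 * k := by simp [mul_comm]

/-- The unvisited vertices after a search that does not reach `v` and `w`. -/
def unvisited (n : ℕ) (TW : ℕ → ℕ → ℕ) : Finset (Fin n) := Finset.univ.filter fun x => TW x 0 = 0

theorem mem_unvisited {TW : ℕ → ℕ → ℕ} {x : Fin n} : x ∈ unvisited n TW ↔ TW x 0 = 0 := by
  simp [unvisited]

/-- No edge leads from an unvisited vertex to a visited one, and an unvisited vertex other than `v`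
and `w` has no pebble. -/
theorem IsSearchResult.card_unvisited {ends : Fin m → Sym2 (Fin n)} {v w : Fin n}
    {c : Config (Fin n) (Fin m) k} {ED HD TW RK : ℕ → ℕ → ℕ}
    (h : IsSearchResult n k v w ED HD TW RK) (hst : IsStored c ED HD) (hc : c.IsValid ends)
    (hv : TW v 0 = 0) (hw : TW w 0 = 0) :
    (spanned ends c.edges (unvisited n TW)).card + c.pebOn v w = k * (unvisited n TW).card := by
  rw [← card_pebbles_pair hc]
  refine card_spanned_of_closed hc (fun e x y i he hx => ?_) (fun x hx => ?_) (fun x hx i hi => ?_)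
  · obtain ⟨h1, h2⟩ := (hst.edge e x y i).1 he
    rw [mem_unvisited] at hx ⊢
    by_contra hy
    exact h.closed x x.2 i i.2 (by omega) (by rwa [h2]) hx
  · rw [mem_unvisited]
    rcases Finset.mem_insert.1 hx with rfl | hx
    · exact hv
    · rw [Finset.mem_singleton.1 hx]; exact hw
  · rw [mem_unvisited] at hx
    rw [hst.peb_ne_zero] at hi
    by_contra hxvw
    simp only [Finset.mem_insert, Finset.mem_singleton, not_or, Fin.ext_iff] at hxvw
    exact h.complete x x.2 hxvw.1 hxvw.2 ⟨i, i.2, hi⟩ hx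

/-- By `IsTightSet.closed`, no edge leaves `U`, and all its pebbles are on `v` and `w`. So from `U`
no pebble elsewhere can be reached; formally, this is an induction on the rank. -/
theorem IsSearchResult.subset_unvisited {ends : Fin m → Sym2 (Fin n)} {v w : Fin n}
    {c : Config (Fin n) (Fin m) k} {ED HD TW RK : ℕ → ℕ → ℕ}
    (h : IsSearchResult n k v w ED HD TW RK) (hst : IsStored c ED HD) (hc : c.IsValid ends)
    (hpeb : ℓ ≤ c.pebOn v w) {U : Finset (Fin n)} (hU : IsTightSet ends k ℓ c.edges U) (hv : v ∈ U)
    (hw : w ∈ U) : U ⊆ unvisited n TW := by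
  obtain ⟨h1, h2⟩ := hU.closed hc (U' := {v, w}) (by simp [Finset.insert_subset_iff, hv, hw])
    (by rwa [card_pebbles_pair hc])
  suffices ∀ q, ∀ x : Fin n, x ∈ U → RK x 0 < q → TW x 0 = 0 from
    fun x hx => mem_unvisited.2 (this _ x hx (Nat.lt_succ_self _))
  intro q
  induction q with
  | zero => intro x _ h; omega
  | succ q ih =>
    intro x hx hq
    obtain h0 | h0 | ⟨i, h0⟩ : TW x 0 = 0 ∨ TW x 0 = 1 ∨ ∃ i, TW x 0 = i + 2 := by
      rcases TW x 0 with _ | _ | i <;> simp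
    · exact h0
    · obtain ⟨a1, a2, i, hi, a3⟩ := h.source x x.2 h0
      have := h2 x hx ⟨i, hi⟩ (hst.peb_ne_zero.2 a3)
      simp only [Finset.mem_insert, Finset.mem_singleton, Fin.ext_iff] at this
      omega
    · obtain ⟨a1, a2, a3, a4, a5⟩ := h.toward x x.2 i h0
      have hle := hst.le x x.2 i a1
      have he : c.edge ⟨ED x i - 1, by omega⟩ = some (x, ⟨HD x i, a3⟩, ⟨i, a1⟩) := by
        rw [hst.edge]
        exact ⟨by simp; omega, rfl⟩
      exact absurd (ih _ (h1 _ _ _ _ he hx) (by simp; omega)) a4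

/-- Tightness follows from the count of pebbles. Maximality needs at least `ℓ` pebbles on `{v, w}`,
which sparsity gives for a set with two vertices; for a loop there may be fewer, as a vertex has at
most `k` pebbles. -/
theorem IsSearchResult.isTightSet {ends : Fin m → Sym2 (Fin n)} {v w : Fin n}
    {c : Config (Fin n) (Fin m) k} {ED HD TW RK : ℕ → ℕ → ℕ}
    (h : IsSearchResult n k v w ED HD TW RK) (hst : IsStored c ED HD) (hc : c.IsGood ends ℓ)
    (hv : TW v 0 = 0) (hw : TW w 0 = 0) (hpeb : c.pebOn v w ≤ ℓ) (hℓ : ℓ < 2 * k) :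
    IsTightSet ends k ℓ c.edges (unvisited n TW) ∧
      (v ≠ w → ∀ U, IsTightSet ends k ℓ c.edges U → v ∈ U → w ∈ U → U ⊆ unvisited n TW) := by
  have hcard := h.card_unvisited hst hc.valid hv hw
  refine ⟨by unfold IsTightSet; omega, fun hvw U hU hvU hwU => ?_⟩
  refine h.subset_unvisited hst hc.valid ?_ hU hvU hwU
  have h2 : 2 ≤ (unvisited n TW).card := by
    rw [← Finset.card_pair hvw]
    refine Finset.card_le_card ?_
    simp [Finset.insert_subset_iff, mem_unvisited, hv, hw]
  have := hc.sparse.card_le (U := unvisited n TW) (by nlinarith)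
  omega

/-- Bring a pebble to the vertex in the register `12`. -/
def bring : Cmd := label ;; slide

theorem bring_spec (hG : G.IsFor n m k ℓ) {ends : Fin m → Sym2 (Fin n)} {v w : Fin n}
    {c : Config (Fin n) (Fin m) k} {mvs : List (Move (Fin n) (Fin m) k)} {σ : St} {r : ℕ}
    (hp : IsPosition ends ℓ c mvs σ) (h0 : σ.r 0 = k) (h2 : σ.r 2 = n) (h12 : σ.r 12 = r)
    (hr : r = v ∨ r = w) (hS : IsSearchResult n k v w (σ.A 0) (σ.A 1) (σ.A 4) (σ.A 5))
    (hTr : σ.A 4 r 0 ≠ 0)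
    {Q : St → Prop} (hQ : ∀ σ' c' mvs', Keeps 20 [0, 1, 9, 10, 11] σ σ' →
      IsPosition (k := k) ends ℓ c' mvs' σ' → c'.edges = c.edges →
      c'.pebOn v w = c.pebOn v w + 1 → σ'.t ≤ σ.t + 80 * ((n + 1) * (k + 1)) → Q σ') :
    bring.wp G Q σ := by
  have hv := v.2
  have hw := w.2
  refine label_spec hG h0 h2 h12 (by omega) hp.stored.head hS hTr ?_
  intro σ₁ s hk₁ ho₁ hL hx hT1 hlab ht₁
  obtain ⟨a1, a2, a3⟩ := hS.source _ hx hT1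
  have hA0 := hk₁.arr 0 (by simp)
  have hA1 := hk₁.arr 1 (by simp)
  refine slide_spec hG (hp.congr hA0 hA1 ho₁) ((hk₁.reg 12 (by norm_num)).trans h12) (by omega) hr rfl
    hx a1 a2 (by rwa [hA0]) hlab (by rw [hA0, hA1]; exact hL) ?_
  intro σ₂ c' mvs' hk₂ hp' hedges hpeb ht₂
  exact hQ σ₂ c' mvs' ((hk₁.mono (by norm_num) (by simp)).trans (hk₂.mono (by norm_num) (by simp))) hp'
    hedges hpeb (by omega)

/-- Gather `ℓ + 1` pebbles on the vertices in the registers `5`, `6`, if possible. -/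
def gather : Cmd :=
  10 ≔ ♯ 1 ;; .whl (♯ 0) (ρ 10)
    (countPebbles ;; .ite (ρ 1) (ρ 13) (10 ≔ ♯ 0 ;; 11 ≔ ♯ 1)
      (search ;; .ite (♯ 0) (.arr 4 (ρ 5) (♯ 0)) (12 ≔ ρ 5 ;; bring)
        (.ite (♯ 0) (.arr 4 (ρ 6) (♯ 0)) (12 ≔ ρ 6 ;; bring) (10 ≔ ♯ 0 ;; 11 ≔ ♯ 0))))

/-- The state while pebbles are gathered. -/
structure IsGathering (ends : Fin m → Sym2 (Fin n)) (ℓ : ℕ) (v w : Fin n)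
    (c₀ : Config (Fin n) (Fin m) k) (σ σ' : St) (c : Config (Fin n) (Fin m) k)
    (mvs : List (Move (Fin n) (Fin m) k)) : Prop where
  keeps : Keeps 10 [0, 1, 4, 5, 6, 7, 8, 9, 10, 11] σ σ'
  position : IsPosition ends ℓ c mvs σ'
  edges : c.edges = c₀.edges

/-- Each round except the last brings a pebble to `{v, w}`, where at most `2 k` find room. A failure
means that the search has reached neither end. -/
theorem gather_spec (hG : G.IsFor n m k ℓ) {ends : Fin m → Sym2 (Fin n)} {v w : Fin n}
    {c₀ : Config (Fin n) (Fin m) k} {mvs₀ : List (Move (Fin n) (Fin m) k)} {σ : St}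
    (hp : IsPosition ends ℓ c₀ mvs₀ σ) (h0 : σ.r 0 = k) (h1 : σ.r 1 = ℓ) (h2 : σ.r 2 = n)
    (h5 : σ.r 5 = v) (h6 : σ.r 6 = w) (hvw : (v : ℕ) ≤ w)
    {Q : St → Prop} (hQ : ∀ σ' c mvs, IsGathering (k := k) ends ℓ v w c₀ σ σ' c mvs →
      (0 < σ'.r 11 → ℓ + 1 ≤ c.pebOn v w) →
      (σ'.r 11 = 0 → c.pebOn v w ≤ ℓ ∧ σ'.A 4 v 0 = 0 ∧ σ'.A 4 w 0 = 0 ∧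
        IsSearchResult n k v w (σ'.A 0) (σ'.A 1) (σ'.A 4) (σ'.A 5)) →
      σ'.t ≤ σ.t + 160 * ((n + 1) * (k + 1)) * (2 * k + 2) → Q σ') : gather.wp G Q σ := by
  have hM := hG.numbers
  have hR := hG.rows
  have hW := hG.width
  have hv := v.2
  have hw := w.2
  have hnk : 1 ≤ (n + 1) * (k + 1) := Nat.one_le_iff_ne_zero.2 (by positivity)
  have hk1 : k + 1 ≤ (n + 1) * (k + 1) := by nlinarith
  refine ⟨trivial, fun σ₁ => ∃ c mvs q, IsGathering (k := k) ends ℓ v w c₀ σ σ₁ c mvs ∧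
    (σ₁.r 10 = 0 → (0 < σ₁.r 11 → ℓ + 1 ≤ c.pebOn v w) ∧ (σ₁.r 11 = 0 → c.pebOn v w ≤ ℓ ∧
      σ₁.A 4 v 0 = 0 ∧ σ₁.A 4 w 0 = 0 ∧
        IsSearchResult n k v w (σ₁.A 0) (σ₁.A 1) (σ₁.A 4) (σ₁.A 5))) ∧
    -- Here `q` counts the rounds; the one that clears the flag in register `10` brings no pebble.
    q ≤ c.pebOn v w + (1 - σ₁.r 10) ∧ σ₁.t ≤ σ.t + 1 + 160 * ((n + 1) * (k + 1)) * q,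
    σ.t + 1 + 160 * ((n + 1) * (k + 1)) * (2 * k + 1), ?_, ?_⟩
  · exact ⟨c₀, mvs₀, 0, ⟨by simp [Keeps.refl], hp.congr rfl rfl rfl, rfl⟩, by simp [Ex.eval], by simp,
      by simp⟩
  rintro σ₁ ⟨c, mvs, q, ⟨hk, hp, hedges⟩, hend, hq, ht⟩
  have hpeb := hp.stored.pebOn_le v w
  have hmul : 160 * ((n + 1) * (k + 1)) * q ≤ 160 * ((n + 1) * (k + 1)) * (2 * k + 1) :=
    Nat.mul_le_mul_left _ (by omega)
  have hmul2 : 160 * ((n + 1) * (k + 1)) * (2 * k + 2) =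
    160 * ((n + 1) * (k + 1)) * (2 * k + 1) + 160 * ((n + 1) * (k + 1)) := by ring
  have hmulq : 160 * ((n + 1) * (k + 1)) * (q + 1) =
    160 * ((n + 1) * (k + 1)) * q + 160 * ((n + 1) * (k + 1)) := by ring
  refine ⟨by omega, trivial, trivial, fun hlt => ?_, fun hlt => ?_⟩
  · have hlt' : 0 < σ₁.r 10 := hlt
    refine countPebbles_spec hG (σ := σ₁.tick) (v := v) (w := w) hp.stored
      ((hk.reg 0 (by norm_num)).trans h0) ((hk.reg 5 (by norm_num)).trans h5)
      ((hk.reg 6 (by norm_num)).trans h6) hvw ?_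
    intro σ₂ hk₂ ho₂ h13 ht₂
    have hk₂' : Keeps 10 [0, 1, 4, 5, 6, 7, 8, 9, 10, 11] σ σ₂ :=
      hk.trans (Keeps.mono (σ₁ := σ₁) ⟨hk₂.1, hk₂.2⟩ (by norm_num) (by simp))
    have hp₂ : IsPosition ends ℓ c mvs σ₂ := hp.congr (hk₂.arr 0 (by simp)) (hk₂.arr 1 (by simp)) ho₂
    simp only [St.tick_t] at ht₂
    refine ⟨trivial, trivial, fun hlt => ⟨trivial, trivial, ?_⟩, fun hlt => ?_⟩
    · simp only [Ex.eval, h13, (hk₂'.reg 1 (by norm_num)).trans h1] at hlt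
      refine ⟨c, mvs, q + 1, ⟨by simpa using hk₂', hp₂.congr rfl rfl rfl, hedges⟩,
        fun _ => ⟨fun _ => hlt, by simp [Ex.eval]⟩, ?_, ?_⟩
      · simp [Ex.eval]; omega
      · simp; omega
    · simp only [Ex.eval, h13, (hk₂'.reg 1 (by norm_num)).trans h1] at hlt
      refine search_spec hG (σ := σ₂.tick) (v := v) (w := w) ((hk₂'.reg 0 (by norm_num)).trans h0)
        ((hk₂'.reg 2 (by norm_num)).trans h2) ((hk₂'.reg 5 (by norm_num)).trans h5)
        ((hk₂'.reg 6 (by norm_num)).trans h6) v.2 w.2 hp₂.stored.head ?_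
      intro σ₃ hk₃ ho₃ hS ht₃
      have hk₃' : Keeps 10 [0, 1, 4, 5, 6, 7, 8, 9, 10, 11] σ σ₃ :=
        hk₂'.trans (Keeps.mono (σ₁ := σ₂) ⟨hk₃.1, hk₃.2⟩ (by norm_num) (by simp))
      have hA0 := hk₃.arr 0 (by simp)
      have hA1 := hk₃.arr 1 (by simp)
      have hp₃ : IsPosition ends ℓ c mvs σ₃ := hp₂.congr hA0 hA1 ho₃
      have h5₃ := (hk₃'.reg 5 (by norm_num)).trans h5
      have h6₃ := (hk₃'.reg 6 (by norm_num)).trans h6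
      rw [← hA0, ← hA1] at hS
      have h10₃ : σ₃.r 10 ≠ 0 := by
        rw [hk₃.reg 10 (by norm_num), St.tick_r, hk₂.reg 10 (by norm_num)]
        exact hlt'.ne'
      simp only [St.tick_t] at ht₃
      have hbring : ∀ (σ₄ : St) (r : ℕ), (r = v ∨ r = w) → Keeps 10 [0, 1, 4, 5, 6, 7, 8, 9, 10, 11] σ σ₄ →
          IsPosition ends ℓ c mvs σ₄ → σ₄.r 12 = r → σ₄.A = σ₃.A → σ₃.A 4 r 0 ≠ 0 →
          σ₄.r 10 ≠ 0 → σ₄.t ≤ σ₃.t + 3 → bring.wp G (fun σ₁ => ∃ c mvs q,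
            IsGathering (k := k) ends ℓ v w c₀ σ σ₁ c mvs ∧
            (σ₁.r 10 = 0 → (0 < σ₁.r 11 → ℓ + 1 ≤ c.pebOn v w) ∧ (σ₁.r 11 = 0 → c.pebOn v w ≤ ℓ ∧
              σ₁.A 4 v 0 = 0 ∧ σ₁.A 4 w 0 = 0 ∧
              IsSearchResult n k v w (σ₁.A 0) (σ₁.A 1) (σ₁.A 4) (σ₁.A 5))) ∧
            q ≤ c.pebOn v w + (1 - σ₁.r 10) ∧ σ₁.t ≤ σ.t + 1 + 160 * ((n + 1) * (k + 1)) * q) σ₄ := by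
        intro σ₄ r hr hk₄ hp₄ h12 hA hT h10 ht₄
        refine bring_spec hG hp₄ ((hk₄.reg 0 (by norm_num)).trans h0)
          ((hk₄.reg 2 (by norm_num)).trans h2) h12 hr (by rw [hA]; exact hS) (by rw [hA]; exact hT) ?_
        intro σ₅ c' mvs' hk₅ hp₅ he₅ hpeb₅ ht₅
        have h10' := hk₅.reg 10 (by norm_num)
        refine ⟨c', mvs', q + 1, ⟨hk₄.trans (hk₅.mono (by norm_num) (by simp)), hp₅, he₅.trans hedges⟩,
          fun h => absurd (h10'.symm.trans h) h10, by omega, by omega⟩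
      refine ⟨trivial, ⟨trivial, trivial, ?_, ?_⟩, fun hT => ⟨trivial, ?_⟩, fun hT => ?_⟩
      · simp only [Ex.eval, h5₃]; omega
      · simp only [Ex.eval]; omega
      · simp only [Ex.eval, h5₃] at hT
        exact hbring _ v (.inl rfl) (by simpa using hk₃') (hp₃.congr rfl rfl rfl)
          (by simp [Ex.eval, h5₃]) rfl (by omega) (by simpa using h10₃) (by simp)
      · simp only [Ex.eval, h5₃] at hT
        refine ⟨trivial, ⟨trivial, trivial, ?_, ?_⟩, fun hT2 => ⟨trivial, ?_⟩, fun hT2 =>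
          ⟨trivial, trivial, ?_⟩⟩
        · simp only [Ex.eval, St.tick_r, h6₃]; omega
        · simp only [Ex.eval]; omega
        · simp only [Ex.eval, St.tick_r, h6₃] at hT2
          exact hbring _ w (.inr rfl) (by simpa using hk₃') (hp₃.congr rfl rfl rfl)
            (by simp [Ex.eval, h6₃]) rfl (by simp at hT2; omega) (by simpa using h10₃) (by simp)
        · simp only [Ex.eval, St.tick_r, h6₃, St.tick_A] at hT2
          refine ⟨c, mvs, q + 1, ⟨by simpa using hk₃', hp₃.congr rfl rfl rfl, hedges⟩,
            fun _ => ⟨by simp [Ex.eval], fun _ => ⟨by omega, ?_, ?_, hS⟩⟩, ?_, ?_⟩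
          · simpa using hT
          · simpa using hT2
          · simp [Ex.eval]; omega
          · simp; omega
  · simp only [Ex.eval] at hlt
    obtain ⟨a1, a2⟩ := hend (by omega)
    exact hQ _ c mvs ⟨by simpa using hk, hp.congr rfl rfl rfl, hedges⟩ a1 a2 (by simp; omega)

end Attempt
end PebbleGame

namespace PebbleGame

/-! ### One attempt to add an edge -/

section Attempt

variable {G : Env} {n m k ℓ : ℕ}

local infixr:60 " ;; " => Cmd.seq
local infix:70 " ≔ " => Cmd.asg
local notation "ρ" => Ex.reg
local notation "♯" => Ex.num

/-- Stamp the unvisited vertices. -/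
def stamp : Cmd :=
  .loop 14 2 (.ite (.arr 4 (ρ 14) (♯ 0)) (♯ 1) (.sto 3 (ρ 14) (♯ 0) (.add (ρ 5) (♯ 1))) .skip)

theorem stamp_spec (hG : G.IsFor n m k ℓ) {σ : St} {v : ℕ} (h2 : σ.r 2 = n) (h5 : σ.r 5 = v)
    (hv : v < n) {Q : St → Prop} (hQ : ∀ σ', Keeps 10 [3] σ σ' → σ'.o = σ.o →
      (∀ x < n, σ'.A 3 x 0 = if σ.A 4 x 0 = 0 then v + 1 else σ.A 3 x 0) →
      σ'.t ≤ σ.t + 10 * (n + 1) → Q σ') : stamp.wp G Q σ := by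
  have hM := hG.numbers
  have hR := hG.rows
  have hW := hG.width
  refine Cmd.wp_for n 3 (fun i σ' => Keeps 10 [3] σ σ' ∧ σ'.o = σ.o ∧
    ∀ x < n, σ'.A 3 x 0 = if x < i ∧ σ.A 4 x 0 = 0 then v + 1 else σ.A 3 x 0)
    (by omega) h2 (by norm_num) ?_ ?_ ?_
  · simp [Keeps.refl]
  · rintro i hi σ₁ ⟨hk, ho, hst⟩ hr hb
    have hA4 := hk.arr 4 (by simp)
    have h5' := (hk.reg 5 (by norm_num)).trans h5
    simp only [Cmd.wp, Cmd.skip, Ex.ok, Ex.eval, St.tick_r, St.tick_A, hr, hA4, h5']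
    refine ⟨⟨trivial, trivial, by omega, by omega⟩, trivial, fun h => ⟨trivial, trivial, by omega,
      by omega, ⟨trivial, trivial, by omega⟩, by simp [hr], by simp [hb], ⟨by simpa using hk, ho, ?_⟩,
      by simp⟩, fun h => ⟨trivial, by simp [hr], by simp [hb], ⟨by simpa using hk, ho, ?_⟩, by simp⟩⟩
    · intro x hx
      simp only [St.setr_A, St.seta_A, St.tick_A, if_true, upd_apply, and_true]
      by_cases hxi : x = i
      · subst hxi
        rw [if_pos rfl, if_pos ⟨by omega, by omega⟩]
      · rw [if_neg hxi, hst x hx]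
        have : x < i + 1 ↔ x < i := by omega
        simp only [this]
    · intro x hx
      simp only [St.setr_A, St.tick_A]
      rw [hst x hx]
      by_cases hxi : x = i
      · subst hxi
        rw [if_neg (by omega), if_neg (by omega)]
      · have : x < i + 1 ↔ x < i := by omega
        simp only [this]
  · rintro σ₁ ⟨hk, ho, hst⟩ hr ht
    refine hQ _ (by simpa using hk) ho (fun x hx => ?_) (by simp; omega)
    simp [hst x hx, hx]

/-- Try to add the edge in the register `8` with the ends in the registers `5`, `6`. -/
def attempt : Cmd := gather ;; .ite (♯ 0) (ρ 11) addCmd (.ite (ρ 5) (ρ 6) stamp .skip)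

/-- A bound on the time for an attempt to add an edge. -/
def attemptTime (n k : ℕ) : ℕ := 200 * ((n + 1) * (k + 1)) * (2 * k + 2)

/-- The stamps after an attempt that has failed. -/
def IsStamped (n v w : ℕ) (D : Finset (Fin n)) (ST ST' : ℕ → ℕ → ℕ) : Prop :=
  ∀ x : Fin n, ST' x 0 = if v < w ∧ x ∈ D then v + 1 else ST x 0

theorem attempt_spec (hG : G.IsFor n m k ℓ) {ends : Fin m → Sym2 (Fin n)} {v w : Fin n} {e : Fin m}
    {c : Config (Fin n) (Fin m) k} {mvs : List (Move (Fin n) (Fin m) k)} {σ : St}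
    (hp : IsPosition ends ℓ c mvs σ) (h0 : σ.r 0 = k) (h1 : σ.r 1 = ℓ) (h2 : σ.r 2 = n)
    (h5 : σ.r 5 = v) (h6 : σ.r 6 = w) (h8 : σ.r 8 = e) (hvw : (v : ℕ) ≤ w) (hends : ends e = s(v, w))
    (hnew : e ∉ c.edges) (hℓ : ℓ < 2 * k)
    {Q : St → Prop} (hQ : ∀ σ' c' mvs', Keeps 10 [0, 1, 3, 4, 5, 6, 7, 8, 9, 10, 11] σ σ' →
      IsPosition (k := k) ends ℓ c' mvs' σ' → (c'.edges = insert e c.edges ∧ σ'.A 3 = σ.A 3 ∨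
        c'.edges = c.edges ∧ ∃ D : Finset (Fin n), IsTightSet ends k ℓ c.edges D ∧ v ∈ D ∧ w ∈ D ∧
          (v ≠ w → ∀ U, IsTightSet ends k ℓ c.edges U → v ∈ U → w ∈ U → U ⊆ D) ∧
          IsStamped n v w D (σ.A 3) (σ'.A 3)) →
      σ'.t ≤ σ.t + attemptTime n k → Q σ') : attempt.wp G Q σ := by
  have hk1 : k + 1 ≤ (n + 1) * (k + 1) := by nlinarith
  have hn1 : n + 1 ≤ (n + 1) * (k + 1) := by nlinarith
  have htime : 160 * ((n + 1) * (k + 1)) * (2 * k + 2) + 40 * ((n + 1) * (k + 1)) ≤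
      attemptTime n k := by
    unfold attemptTime; nlinarith
  refine gather_spec hG hp h0 h1 h2 h5 h6 hvw ?_
  intro σ₁ c₁ mvs₁ ⟨hk₁, hp₁, hedges₁⟩ hyes hno ht₁
  have h5' := (hk₁.reg 5 (by norm_num)).trans h5
  have h6' := (hk₁.reg 6 (by norm_num)).trans h6
  have hA3 := hk₁.arr 3 (by simp)
  refine ⟨trivial, trivial, fun hlt => ?_, fun hlt => ?_⟩
  · simp only [Ex.eval] at hlt
    refine addCmd_spec hG (hp₁.congr rfl rfl rfl : IsPosition ends ℓ c₁ mvs₁ σ₁.tick)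
      ((hk₁.reg 0 (by norm_num)).trans h0) h5' h6' ((hk₁.reg 8 (by norm_num)).trans h8) hvw hends ?_
      (hyes hlt) ?_
    · rw [← hedges₁, Config.mem_edges_iff_ne, not_not] at hnew; exact hnew
    · intro σ₂ c₂ mvs₂ hk₂ hp₂ hedges₂ ht₂
      refine hQ σ₂ c₂ mvs₂ ((hk₁.mono le_rfl (by simp)).trans
        (Keeps.mono (σ₁ := σ₁) ⟨hk₂.1, hk₂.2⟩ (by norm_num) (by simp))) hp₂
        (.inl ⟨by rw [hedges₂, hedges₁], (hk₂.arr 3 (by simp)).trans hA3⟩) ?_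
      simp at ht₂; omega
  · simp only [Ex.eval] at hlt
    obtain ⟨hle, hTv, hTw, hS⟩ := hno (by omega)
    obtain ⟨ht1, ht2⟩ := hS.isTightSet hp₁.stored hp₁.isGood hTv hTw hle hℓ
    rw [hedges₁] at ht1 ht2
    have hD : ∀ ST', IsStamped n v w (unvisited n (σ₁.A 4)) (σ.A 3) ST' →
        c₁.edges = c.edges ∧ ∃ D : Finset (Fin n), IsTightSet ends k ℓ c.edges D ∧ v ∈ D ∧ w ∈ D ∧
          (v ≠ w → ∀ U, IsTightSet ends k ℓ c.edges U → v ∈ U → w ∈ U → U ⊆ D) ∧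
          IsStamped n v w D (σ.A 3) ST' := fun ST' h =>
      ⟨hedges₁, _, ht1, mem_unvisited.2 hTv, mem_unvisited.2 hTw, ht2, h⟩
    refine ⟨trivial, trivial, fun hlt => ?_, fun hlt => ⟨trivial, ?_⟩⟩
    · simp only [Ex.eval, St.tick_r, h5', h6'] at hlt
      refine stamp_spec hG (σ := σ₁.tick.tick) ((hk₁.reg 2 (by norm_num)).trans h2) h5' v.2 ?_
      intro σ₂ hk₂ ho₂ hst ht₂
      refine hQ σ₂ c₁ mvs₁ ((hk₁.mono le_rfl (by simp)).trans
        (Keeps.mono (σ₁ := σ₁) ⟨hk₂.1, hk₂.2⟩ (by norm_num) (by simp)))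
        (hp₁.congr (hk₂.arr 0 (by simp)) (hk₂.arr 1 (by simp)) ho₂) (.inr (hD _ fun x => ?_)) ?_
      · rw [hst x x.2]
        simp [hlt, mem_unvisited, hA3]
      · simp at ht₂; omega
    · simp only [Ex.eval, St.tick_r, h5', h6'] at hlt
      refine hQ _ c₁ mvs₁ (by simpa using hk₁.mono le_rfl (by simp)) (hp₁.congr rfl rfl rfl)
        (.inr (hD _ fun x => ?_)) (by simp; omega)
      simp [hlt, hA3]

end Attempt
end PebbleGame

namespace PebbleGame

open Finset

/-! ### Why few attempts suffice -/

section Scan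

variable {n k ℓ : ℕ} {E : Type*} {ends : E → Sym2 (Fin n)} {F : Finset E} {v w : Fin n}
  {S : Fin n → Prop}

/-- The stamps `S` for a vertex `v` are correct, and every tight set that contains `v` and
other vertices has an unstamped neighbor of `v` unless it is stamped. -/
structure IsScan (ends : E → Sym2 (Fin n)) (k ℓ : ℕ) (F : Finset E) (v : Fin n) (S : Fin n → Prop) :
    Prop where
  tight : ∀ x, S x → ∃ U, IsTightSet ends k ℓ F U ∧ v ∈ U ∧ x ∈ U
  grow : ∀ D, IsTightSet ends k ℓ F D → v ∈ D → 2 ≤ D.card →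
    (∀ x ∈ D, ∀ e ∈ F, ends e = s(v, x) → S x) → ∀ x ∈ D, S x

/-- A tight set with two or more vertices has an edge at `v`. Otherwise it could lose `v` without
losing an edge, while the sparsity bound would drop by `k > 0`; if no edge is spanned at all, then
`ℓ < 2 * k` gives the contradiction. -/
theorem IsSparse.isScan_empty (hF : IsSparse ends k ℓ F) (hℓ : ℓ < 2 * k) :
    IsScan ends k ℓ F v fun _ => False where
  tight _ h := h.elim
  grow D hD hv h2 hno x hx := by
    exfalso
    have hsub : spanned ends F D ⊆ spanned ends F (D.erase v) := by
      intro e he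
      obtain ⟨h1, h3⟩ := mem_spanned.1 he
      refine mem_spanned.2 ⟨h1, fun y hy => mem_erase.2 ⟨?_, h3 y hy⟩⟩
      rintro rfl
      obtain ⟨z, hz⟩ := hy
      exact hno z (h3 z (by rw [hz]; simp)) e h1 hz
    have hcard := card_le_card hsub
    have herase := card_erase_add_one hv
    unfold IsTightSet at hD
    have hk : k * D.card = k * (D.erase v).card + k := by rw [← herase]; ring
    rcases (spanned ends F (D.erase v)).eq_empty_or_nonempty with h0 | h0
    · rw [h0, card_empty] at hcard
      have : k * 2 ≤ k * D.card := Nat.mul_le_mul_left _ h2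
      omega
    · have := isSparse_iff.1 hF _ h0
      omega

/-- A set that contains `v` and `w` has `w` as an unstamped neighbor of `v`, and every other set
spans the same edges as before. So a success needs no new stamps. -/
theorem IsScan.insert [DecidableEq E] (h : IsScan ends k ℓ F v S) {e : E} (he : ends e = s(v, w))
    (hw : ¬ S w) : IsScan ends k ℓ (insert e F) v S where
  tight x hx := by
    obtain ⟨U, h1, h2⟩ := h.tight x hx
    exact ⟨U, h1.mono (subset_insert e F), h2⟩
  grow D hD hv h2 hn := by
    have hwD : w ∉ D := fun hwD => hw (hn w hwD e (mem_insert_self e F) he)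
    have hs : spanned ends (Insert.insert e F) D = spanned ends F D := by
      ext f
      rw [mem_spanned, mem_spanned, mem_insert]
      constructor
      · rintro ⟨rfl | h1, h3⟩
        · exact absurd (h3 w (by rw [he]; simp)) hwD
        · exact ⟨h1, h3⟩
      · exact fun h => ⟨.inr h.1, h.2⟩
    refine h.grow D (by unfold IsTightSet at hD ⊢; rwa [hs] at hD) hv h2 fun x hx f hf =>
      hn x hx f (mem_insert_of_mem hf)

/-- A tight set `U` through `v` may meet `D` in enough vertices for `U ∪ D` to be tight; then `U`
lies in `D` by maximality. Otherwise it meets `D` in `v` only, and stamping `D` changes nothing for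
the neighbors of `v` in `U`. The newly stamped neighbor pays for the attempt: without it, `w` would
have been stamped already. -/
theorem IsScan.stamp (h : IsScan ends k ℓ F v S) (hF : IsSparse ends k ℓ F) (hℓ : ℓ < 2 * k)
    {D : Finset (Fin n)} (hD : IsTightSet ends k ℓ F D) (hv : v ∈ D) (hw : w ∈ D) (hvw : v ≠ w)
    (hmax : ∀ U, IsTightSet ends k ℓ F U → v ∈ U → w ∈ U → U ⊆ D) (hS : ¬ S w) :
    IsScan ends k ℓ F v (fun x => S x ∨ x ∈ D) ∧ ∃ x ∈ D, ∃ e ∈ F, ends e = s(v, x) ∧ ¬ S x := by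
  have h2 : 2 ≤ D.card := by
    rw [← card_pair hvw]
    exact card_le_card (by simp [insert_subset_iff, hv, hw])
  refine ⟨⟨fun x hx => ?_, fun U hU hvU h2U hn x hx => ?_⟩, ?_⟩
  · rcases hx with hx | hx
    · exact h.tight x hx
    · exact ⟨D, hD, hv, hx⟩
  · by_cases hcard : ℓ ≤ k * (U ∩ D).card
    · exact .inr (hmax _ (hU.union hF hD hcard) (mem_union_left _ hvU) (mem_union_right _ hw)
        (mem_union_left _ hx))
    · have hv' : v ∈ U ∩ D := mem_inter.2 ⟨hvU, hv⟩
      have hone : (U ∩ D).card = 1 := by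
        have h1 := card_pos.2 ⟨v, hv'⟩
        by_contra hne
        have : k * 2 ≤ k * (U ∩ D).card := Nat.mul_le_mul_left _ (by omega)
        omega
      rw [hone, mul_one] at hcard
      refine .inl (h.grow U hU hvU h2U (fun y hy e he hye => ?_) x hx)
      rcases hn y hy e he hye with h' | h'
      · exact h'
      · obtain ⟨z, hz⟩ := card_eq_one.1 hone
        have hzv : v = z := by simpa [hz] using hv'
        have hyz : y = z := by
          have : y ∈ U ∩ D := mem_inter.2 ⟨hy, h'⟩
          simpa [hz] using this
        have hyv : y = v := hyz.trans hzv.symm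
        subst hyv
        -- In this case `k < ℓ`, so there is no loop at `v`.
        have := isSparse_iff.1 hF {y} ⟨e, mem_spanned.2 ⟨he, by simp [hye]⟩⟩
        simp at this
        omega
  · by_contra! hno
    exact hS (h.grow D hD hv h2 (fun x hx e he hxe => hno x hx e he hxe) w hw)

/-- The pairs `(u, x)` of neighbors with `u < v`, or with `u = v` and `x` stamped. -/
noncomputable def charged (ends : E → Sym2 (Fin n)) (F : Finset E) (v : ℕ) (S : Fin n → Prop) :
    Finset (Fin n × Fin n) :=
  open Classical in
  univ.filter fun p => (∃ e ∈ F, ends e = s(p.1, p.2)) ∧ ((p.1 : ℕ) < v ∨ (p.1 : ℕ) = v ∧ S p.2)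

theorem mem_charged {v : ℕ} {p : Fin n × Fin n} : p ∈ charged ends F v S ↔
    (∃ e ∈ F, ends e = s(p.1, p.2)) ∧ ((p.1 : ℕ) < v ∨ (p.1 : ℕ) = v ∧ S p.2) := by
  simp [charged]

/-- An edge gives at most two ordered pairs of neighbors. -/
theorem card_charged_le (v : ℕ) : (charged ends F v S).card ≤ 2 * F.card := by
  classical
  have hsub : charged ends F v S ⊆ F.biUnion fun e => univ.filter fun p => ends e = s(p.1, p.2) := by
    intro p hp
    obtain ⟨⟨e, he, h⟩, -⟩ := mem_charged.1 hp
    exact mem_biUnion.2 ⟨e, he, by simpa using h⟩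
  refine (card_le_card hsub).trans ?_
  rw [mul_comm]
  refine card_biUnion_le_card_mul _ _ _ fun e _ => ?_
  generalize ends e = q
  induction q with
  | _ a b =>
    refine (card_le_card (t := {(a, b), (b, a)}) fun p hp => ?_).trans card_le_two
    simp only [mem_filter, mem_univ, true_and, Sym2.eq_iff] at hp
    simp only [mem_insert, mem_singleton, Prod.ext_iff]
    rcases hp with ⟨h1, h2⟩ | ⟨h1, h2⟩
    · exact .inl ⟨h1.symm, h2.symm⟩
    · exact .inr ⟨h2.symm, h1.symm⟩

theorem charged_mono {v : ℕ} {F' : Finset E} (h : F ⊆ F') :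
    charged ends F v S ⊆ charged ends F' v S := by
  intro p hp
  obtain ⟨⟨e, he, h1⟩, h2⟩ := mem_charged.1 hp
  exact mem_charged.2 ⟨⟨e, h he, h1⟩, h2⟩

/-- When the scan of `v` is finished, its pairs stay charged whatever the stamps are, so the stamps
may be forgotten. -/
theorem charged_succ {v : ℕ} {S' : Fin n → Prop} :
    charged ends F v S ⊆ charged ends F (v + 1) S' := by
  intro p hp
  obtain ⟨h1, h2⟩ := mem_charged.1 hp
  exact mem_charged.2 ⟨h1, .inl (by omega)⟩

theorem card_charged_lt {S' : Fin n → Prop} (hS : ∀ x, S x → S' x) {e : E} (he : e ∈ F) {x : Fin n}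
    (hx : ends e = s(v, x)) (h : ¬ S x) (h' : S' x) :
    (charged ends F v S).card + 1 ≤ (charged ends F v S').card := by
  refine card_lt_card ⟨fun p hp => ?_, fun hsub => ?_⟩
  · obtain ⟨h1, h2⟩ := mem_charged.1 hp
    exact mem_charged.2 ⟨h1, h2.imp_right fun h => ⟨h.1, hS _ h.2⟩⟩
  · have hmem : (v, x) ∈ charged ends F v S' := mem_charged.2 ⟨⟨e, he, hx⟩, .inr ⟨rfl, h'⟩⟩
    have := (mem_charged.1 (hsub hmem)).2
    rcases this with h1 | h1
    · exact lt_irrefl _ h1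
    · exact h h1.2

theorem IsSparse.card_le_mul (hF : IsSparse ends k ℓ F) : F.card ≤ k * n := by
  rcases F.eq_empty_or_nonempty with rfl | h
  · simp
  · have := hF univ F ⟨Subset.rfl, fun _ _ _ _ => mem_univ _⟩ h
    simp at this
    omega

/-- A set of more than `2 k` parallel edges that belong to the sparse graph, or have their ends in a
tight set, includes an edge of the latter kind. -/
theorem IsSparse.exists_tight_of_parallel (hF : IsSparse ends k ℓ F) {P : Finset E}
    (hcard : 2 * k < P.card) (hP : ∀ e ∈ P, ends e = s(v, w))
    (h : ∀ e ∈ P, e ∈ F ∨ ∃ U, IsTightSet ends k ℓ F U ∧ v ∈ U ∧ w ∈ U) :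
    ∃ U, IsTightSet ends k ℓ F U ∧ v ∈ U ∧ w ∈ U := by
  by_contra hno
  -- Otherwise all of `P` belongs to `F`, but a sparse set has at most `2 k - ℓ` edges on two
  -- vertices.
  have hPF : P ⊆ F := fun e he => (h e he).resolve_right hno
  have := hF {v, w} P ⟨hPF, fun e he x hx => by
    rw [hP e he] at hx; simpa using hx⟩ (card_pos.1 (by omega))
  have h2 : k * ({v, w} : Finset (Fin n)).card ≤ k * 2 := Nat.mul_le_mul_left _ card_le_two
  omega

end Scan
end PebbleGame

namespace PebbleGame

/-! ### Reading the input and sorting the edges by their ends -/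

section Read

variable {G : Env} {n m k ℓ : ℕ}

local infixr:60 " ;; " => Cmd.seq
local infix:70 " ≔ " => Cmd.asg
local notation "ρ" => Ex.reg
local notation "♯" => Ex.num

theorem getD_encodeInput (k ℓ : ℕ) (edge : Fin m → Fin n × Fin n) (e : Fin m) :
    (encodeInput k ℓ edge).getD (4 + 2 * e) 0 = (edge e).1 ∧
      (encodeInput k ℓ edge).getD (5 + 2 * e) 0 = (edge e).2 := by
  have key : ∀ (L : List (Fin n × Fin n)) (i : ℕ) (hi : i < L.length),
      (L.flatMap fun p => [(p.1 : ℕ), (p.2 : ℕ)]).getD (2 * i) 0 = L[i].1 ∧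
      (L.flatMap fun p => [(p.1 : ℕ), (p.2 : ℕ)]).getD (2 * i + 1) 0 = L[i].2 := by
    intro L
    induction L with
    | nil => intro i hi; simp at hi
    | cons p L ih =>
      rintro (_ | i) hi
      · simp
      · have := ih i (by simpa using hi)
        simpa [mul_add, add_right_comm] using this
  have h := key (List.ofFn edge) e (by simp)
  simp only [List.getElem_ofFn] at h
  unfold encodeInput
  have h4 : 4 + 2 * (e : ℕ) = 2 * e + 4 := by ring
  have h5 : 5 + 2 * (e : ℕ) = 2 * e + 1 + 4 := by ring
  rw [h4, h5]
  simpa using h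

/-- The lists of parallel edges with numbers below `p`: the list for `v ≤ w` is in the row `v * n + w`
of the array, after its length. At most `2 k + 1` parallel edges are listed. -/
structure IsListed (ends : Fin m → Sym2 (Fin n)) (k : ℕ) (BK : ℕ → ℕ → ℕ) (p : ℕ) : Prop where
  le : ∀ v w : Fin n, (v : ℕ) ≤ w → BK (v * n + w) 0 ≤ 2 * k + 1
  entry : ∀ v w : Fin n, (v : ℕ) ≤ w → ∀ j < BK (v * n + w) 0, ∃ e : Fin m, (e : ℕ) < p ∧
    BK (v * n + w) (j + 1) = e ∧ ends e = s(v, w)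
  -- The order serves to show that the entries of a list are distinct edges.
  lt : ∀ v w : Fin n, (v : ℕ) ≤ w → ∀ j' < BK (v * n + w) 0, ∀ j < j',
    BK (v * n + w) (j + 1) < BK (v * n + w) (j' + 1)
  complete : ∀ v w : Fin n, (v : ℕ) ≤ w → ∀ e : Fin m, (e : ℕ) < p → ends e = s(v, w) →
    BK (v * n + w) 0 = 2 * k + 1 ∨ ∃ j < BK (v * n + w) 0, BK (v * n + w) (j + 1) = e

theorem row_inj {v w v' w' : Fin n} (h : (v : ℕ) * n + w = v' * n + w') : v = v' ∧ w = w' := by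
  have hn : 0 < n := v.pos
  have h1 : ((v : ℕ) * n + w) / n = v := by
    rw [mul_comm, Nat.mul_add_div hn, Nat.div_eq_of_lt w.2, add_zero]
  have h2 : ((v' : ℕ) * n + w') / n = v' := by
    rw [mul_comm, Nat.mul_add_div hn, Nat.div_eq_of_lt w'.2, add_zero]
  have hv : (v : ℕ) = v' := by rw [← h1, h, h2]
  rw [hv] at h
  exact ⟨Fin.ext hv, Fin.ext (by omega)⟩

theorem row_lt (v w : Fin n) : (v : ℕ) * n + w < n * n := by
  have h1 : ((v : ℕ) + 1) * n ≤ n * n := Nat.mul_le_mul_right _ v.2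
  have := w.2
  rw [add_mul, one_mul] at h1
  omega

theorem IsListed.skip {ends : Fin m → Sym2 (Fin n)} {BK : ℕ → ℕ → ℕ} {e : Fin m}
    (h : IsListed ends k BK e) {v w : Fin n} (hvw : (v : ℕ) ≤ w) (he : ends e = s(v, w))
    (hfull : BK (v * n + w) 0 = 2 * k + 1) : IsListed ends k BK (e + 1) where
  le := h.le
  entry a b hab j hj := by
    obtain ⟨f, h1, h2⟩ := h.entry a b hab j hj
    exact ⟨f, by omega, h2⟩
  lt := h.lt
  complete a b hab f hf hfab := by
    rcases Nat.lt_succ_iff_lt_or_eq.1 hf with h' | h'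
    · exact h.complete a b hab f h' hfab
    · have : f = e := Fin.ext h'
      subst this
      rw [he, Sym2.eq_iff] at hfab
      rcases hfab with ⟨rfl, rfl⟩ | ⟨rfl, rfl⟩
      · exact .inl hfull
      -- Swapped ends that are in increasing order both ways coincide, so the edge is a loop.
      · have : v = w := Fin.ext (by omega)
        subst this
        exact .inl hfull

theorem IsListed.insert {ends : Fin m → Sym2 (Fin n)} {BK : ℕ → ℕ → ℕ} {e : Fin m}
    (h : IsListed ends k BK e) {v w : Fin n} (hvw : (v : ℕ) ≤ w) (he : ends e = s(v, w))
    (hlt : BK (v * n + w) 0 < 2 * k + 1) : IsListed ends k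
      (upd (upd BK (v * n + w) (BK (v * n + w) 0 + 1) e) (v * n + w) 0 (BK (v * n + w) 0 + 1))
      (e + 1) := by
  set q := BK (v * n + w) 0 with hq
  set BK' := upd (upd BK (v * n + w) (q + 1) e) (v * n + w) 0 (q + 1) with hBK
  have hother : ∀ a b : Fin n, ¬ (a = v ∧ b = w) → ∀ j, BK' (a * n + b) j = BK (a * n + b) j := by
    intro a b hab j
    have : ¬ (a : ℕ) * n + b = v * n + w := fun h => hab (row_inj h)
    rw [hBK, upd_of_ne (fun h => this h.1), upd_of_ne (fun h => this h.1)]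
  have hzero : BK' (v * n + w) 0 = q + 1 := by rw [hBK, upd_self]
  have hnew : BK' (v * n + w) (q + 1) = e := by rw [hBK, upd_of_ne (by omega), upd_self]
  have hold : ∀ j < q, BK' (v * n + w) (j + 1) = BK (v * n + w) (j + 1) := by
    intro j hj
    rw [hBK, upd_of_ne (by omega), upd_of_ne (by omega)]
  refine ⟨fun a b hab => ?_, fun a b hab j hj => ?_, fun a b hab j' hj' j hj => ?_,
    fun a b hab f hf hfab => ?_⟩
  · by_cases h' : a = v ∧ b = w
    · rw [h'.1, h'.2, hzero]; omega
    · rw [hother a b h']; exact h.le a b hab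
  · by_cases h' : a = v ∧ b = w
    · obtain ⟨rfl, rfl⟩ := h'
      rw [hzero] at hj
      rcases Nat.lt_succ_iff_lt_or_eq.1 hj with hj | rfl
      · obtain ⟨f, h1, h2⟩ := h.entry a b hab j hj
        rw [hold j hj]
        exact ⟨f, by omega, h2⟩
      · exact ⟨e, by omega, hnew, he⟩
    · rw [hother a b h'] at hj ⊢
      obtain ⟨f, h1, h2⟩ := h.entry a b hab j hj
      exact ⟨f, by omega, h2⟩
  · by_cases h' : a = v ∧ b = w
    · obtain ⟨rfl, rfl⟩ := h'
      rw [hzero] at hj'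
      rcases Nat.lt_succ_iff_lt_or_eq.1 hj' with hj' | rfl
      · rw [hold j (by omega), hold j' hj']
        exact h.lt a b hab j' hj' j hj
      · rw [hold j hj, hnew]
        obtain ⟨f, h1, h2, -⟩ := h.entry a b hab j hj
        omega
    · rw [hother a b h'] at hj' ⊢
      rw [hother a b h']
      exact h.lt a b hab j' hj' j hj
  · have hfv : f ≠ e ∨ a = v ∧ b = w := by
      by_cases hfe : f = e
      · subst hfe
        rw [he, Sym2.eq_iff] at hfab
        rcases hfab with ⟨rfl, rfl⟩ | ⟨rfl, rfl⟩
        · exact .inr ⟨rfl, rfl⟩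
        · have : v = w := Fin.ext (by omega)
          subst this
          exact .inr ⟨rfl, rfl⟩
      · exact .inl hfe
    by_cases h' : a = v ∧ b = w
    · obtain ⟨rfl, rfl⟩ := h'
      right
      rw [hzero]
      by_cases hfe : f = e
      · subst hfe
        exact ⟨q, by omega, hnew⟩
      · have hlt' : (f : ℕ) < e := by
          have : (f : ℕ) ≠ e := fun h => hfe (Fin.ext h)
          omega
        rcases h.complete a b hab f hlt' hfab with h1 | ⟨j, hj, h1⟩
        · omega
        · exact ⟨j, by omega, by rw [hold j hj]; exact h1⟩
    · have hlt' : (f : ℕ) < e := by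
        have : (f : ℕ) ≠ e := fun h => hfv.resolve_right h' (Fin.ext h)
        omega
      simp only [hother a b h']
      exact h.complete a b hab f hlt' hfab

/-- Read the parameters and the edges. -/
def readInput : Cmd :=
  0 ≔ .inp (♯ 0) ;; 1 ≔ .inp (♯ 1) ;; 2 ≔ .inp (♯ 2) ;; 3 ≔ .inp (♯ 3) ;; .loop 8 3
    (10 ≔ .inp (.add (♯ 4) (.mul (♯ 2) (ρ 8))) ;; 11 ≔ .inp (.add (♯ 5) (.mul (♯ 2) (ρ 8))) ;;
      .ite (ρ 11) (ρ 10) (12 ≔ .add (.mul (ρ 11) (ρ 2)) (ρ 10)) (12 ≔ .add (.mul (ρ 10) (ρ 2)) (ρ 11)) ;;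
      13 ≔ .arr 2 (ρ 12) (♯ 0) ;;
      -- Edges beyond the first `2 k + 1` parallel ones are dropped, which
      -- `IsSparse.exists_tight_of_parallel` justifies.
      .ite (ρ 13) (.add (.mul (♯ 2) (ρ 0)) (♯ 1))
        (.sto 2 (ρ 12) (.add (ρ 13) (♯ 1)) (ρ 8) ;; .sto 2 (ρ 12) (♯ 0) (.add (ρ 13) (♯ 1))) .skip)

/-- The state with cleared memory. -/
def St.start : St := ⟨fun _ => 0, fun _ _ _ => 0, [], 0⟩

theorem readInput_spec {edge : Fin m → Fin n × Fin n} (hG : G.IsFor n m k ℓ)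
    (hinp : G.inp = encodeInput k ℓ edge) {Q : St → Prop} (hQ : ∀ σ, σ.r 0 = k → σ.r 1 = ℓ →
      σ.r 2 = n → σ.r 3 = m → (∀ a, a ≠ 2 → ∀ x j, σ.A a x j = 0) → σ.o = [] →
      IsListed (endsOf edge) k (σ.A 2) m → σ.t ≤ 10 * (m + 1) → Q σ) : readInput.wp G Q St.start := by
  have hM := hG.numbers
  have hR := hG.pairs
  have hW := hG.width
  refine ⟨trivial, trivial, trivial, trivial, Cmd.wp_for m 9 (fun p σ => σ.r 0 = k ∧ σ.r 1 = ℓ ∧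
    σ.r 2 = n ∧ σ.r 3 = m ∧ (∀ a, a ≠ 2 → ∀ x j, σ.A a x j = 0) ∧ σ.o = [] ∧ IsListed (endsOf edge) k (σ.A 2) p)
    (by omega) ?_ (by norm_num) ?_ ?_ ?_⟩
  · simp [Ex.eval, hinp, encodeInput]
  · simp [Ex.eval, hinp, encodeInput, St.start]
    exact ⟨by simp, by simp, by simp, by simp⟩
  · rintro p hp σ ⟨h0, h1, h2, h3, hA, ho, hL⟩ hr hb
    obtain ⟨e, rfl⟩ : ∃ e : Fin m, p = e := ⟨⟨p, hp⟩, rfl⟩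
    obtain ⟨he1, he2⟩ := getD_encodeInput k ℓ edge e
    have hends : endsOf edge e = s((edge e).1, (edge e).2) := rfl
    simp only [List.getD_eq_getElem?_getD] at he1 he2
    generalize (edge e).1 = x at he1 hends
    generalize (edge e).2 = y at he2 hends
    have key : ∀ (σ₁ : St) (v w : Fin n), (v : ℕ) ≤ w → endsOf edge e = s(v, w) →
        σ₁.r 12 = v * n + w → σ₁.r 0 = k → σ₁.r 1 = ℓ → σ₁.r 2 = n → σ₁.r 3 = m → σ₁.r 8 = e →
        σ₁.A = σ.A → σ₁.o = σ.o → σ₁.t ≤ σ.t + 5 → Cmd.wp G (13 ≔ .arr 2 (ρ 12) (♯ 0) ;;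
          .ite (ρ 13) (.add (.mul (♯ 2) (ρ 0)) (♯ 1)) (.sto 2 (ρ 12) (.add (ρ 13) (♯ 1)) (ρ 8) ;;
            .sto 2 (ρ 12) (♯ 0) (.add (ρ 13) (♯ 1))) .skip)
        (fun σ' => σ'.r 8 = e ∧ σ'.r 3 = m ∧ ((σ'.setr 8 (e + 1)).r 0 = k ∧
          (σ'.setr 8 (e + 1)).r 1 = ℓ ∧ (σ'.setr 8 (e + 1)).r 2 = n ∧ (σ'.setr 8 (e + 1)).r 3 = m ∧
          (∀ a, a ≠ 2 → ∀ x j, (σ'.setr 8 (e + 1)).A a x j = 0) ∧ (σ'.setr 8 (e + 1)).o = [] ∧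
          IsListed (endsOf edge) k ((σ'.setr 8 (e + 1)).A 2) (e + 1)) ∧ σ'.t ≤ σ.t + 9) σ₁ := by
      intro σ₁ v w hvw he h12 h0' h1' h2' h3' h8 hA' ho' ht
      have hrow := row_lt v w
      have hle := hL.le v w hvw
      rw [← hA'] at hA hL hle
      rw [← ho'] at ho
      simp only [Cmd.wp, Cmd.skip, Ex.ok, Ex.eval, h12]
      simp only [St.setr_r, St.setr_A, h0']
      norm_num [h8, h12]
      refine ⟨⟨by omega, by omega⟩, ⟨by omega, by omega⟩, fun hlt => ?_, fun hlt => ?_⟩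
      · simp [h0', h1', h2', h3', ho]
        refine ⟨by omega, by omega, by omega, by omega, by omega, by omega, ⟨fun a ha => ?_, ?_⟩, by omega⟩
        · rw [if_neg ha, if_neg ha]; exact hA a ha
        · exact hL.insert hvw he (by omega)
      · simp [h0', h1', h2', h3', ho]
        exact ⟨⟨hA, hL.skip hvw he (by omega)⟩, by omega⟩
    have hx := x.2
    have hy := y.2
    have hxy := row_lt x y
    have hyx := row_lt y x
    refine ⟨⟨trivial, ⟨trivial, trivial, ?_⟩, ?_⟩, ⟨trivial, ⟨trivial, trivial, ?_⟩, ?_⟩, trivial, trivial,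
      fun hlt => ⟨⟨⟨trivial, trivial, ?_⟩, trivial, ?_⟩, ?_⟩,
      fun hlt => ⟨⟨⟨trivial, trivial, ?_⟩, trivial, ?_⟩, ?_⟩⟩
    · simp [Ex.eval, hr]; omega
    · simp [Ex.eval, hr]; omega
    · simp [Ex.eval, hr]; omega
    · simp [Ex.eval, hr]; omega
    all_goals simp [Ex.eval, hr, hinp, he1, he2] at hlt
    · simp [Ex.eval, hr, hinp, he2, h2]; omega
    · simp [Ex.eval, hr, hinp, he1, he2, h2]; omega
    · refine key _ y x hlt.le (hends.trans Sym2.eq_swap) ?_ ?_ ?_ ?_ ?_ ?_ ?_ ?_ ?_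
      all_goals simp [Ex.eval, hr, hinp, he1, he2, h0, h1, h2, h3]
    · simp [Ex.eval, hr, hinp, he1, h2]; omega
    · simp [Ex.eval, hr, hinp, he1, he2, h2]; omega
    · refine key _ x y hlt hends ?_ ?_ ?_ ?_ ?_ ?_ ?_ ?_ ?_
      all_goals simp [Ex.eval, hr, hinp, he1, he2, h0, h1, h2, h3]
  · rintro σ ⟨h0, h1, h2, h3, hA, ho, hL⟩ hr ht
    refine hQ _ h0 h1 h2 h3 hA ho hL ?_
    simp [St.start] at ht ⊢
    omega

end Read
end PebbleGame

namespace PebbleGame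

/-! ### The scan of the lists and its amortized cost -/

section Pairs

variable {G : Env} {n m k ℓ : ℕ}

local infixr:60 " ;; " => Cmd.seq
local infix:70 " ≔ " => Cmd.asg
local notation "ρ" => Ex.reg
local notation "♯" => Ex.num

/-- The edge `e` is listed before the entry `s` of the list for `v` and `w`. -/
def IsBefore (n : ℕ) (BK : ℕ → ℕ → ℕ) (v w s e : ℕ) : Prop :=
  ∃ a b : Fin n, (a : ℕ) ≤ b ∧ ∃ j < BK (a * n + b) 0, BK (a * n + b) (j + 1) = e ∧
    ((a : ℕ) < v ∨ (a : ℕ) = v ∧ ((b : ℕ) < w ∨ (b : ℕ) = w ∧ j < s))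

theorem not_isBefore_zero {BK : ℕ → ℕ → ℕ} {e : ℕ} : ¬ IsBefore n BK 0 0 0 e := by
  rintro ⟨a, b, -, j, -, -, h⟩
  omega

theorem isBefore_succ {BK : ℕ → ℕ → ℕ} {v w : Fin n} {s e : ℕ} (hvw : (v : ℕ) ≤ w)
    (hs : s < BK (v * n + w) 0) :
    IsBefore n BK v w (s + 1) e ↔ IsBefore n BK v w s e ∨ BK (v * n + w) (s + 1) = e := by
  constructor
  · rintro ⟨a, b, hab, j, hj, he, h⟩
    by_cases hlast : (a : ℕ) = v ∧ (b : ℕ) = w ∧ j = s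
    · obtain ⟨h1, h2, rfl⟩ := hlast
      rw [h1, h2] at he
      exact .inr he
    · exact .inl ⟨a, b, hab, j, hj, he, by omega⟩
  · rintro (⟨a, b, hab, j, hj, he, h⟩ | he)
    · exact ⟨a, b, hab, j, hj, he, by omega⟩
    · exact ⟨v, w, hvw, s, hs, he, by omega⟩

/-- An edge determines its list, and the list has no repetitions. So the edge has not been added
earlier when its turn comes. -/
theorem IsListed.not_isBefore {ends : Fin m → Sym2 (Fin n)} {BK : ℕ → ℕ → ℕ} {p : ℕ}
    (h : IsListed ends k BK p) {v w : Fin n} {s : ℕ} (hvw : (v : ℕ) ≤ w) (hs : s < BK (v * n + w) 0) :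
    ¬ IsBefore n BK v w s (BK (v * n + w) (s + 1)) := by
  rintro ⟨a, b, hab, j, hj, he, hlt⟩
  obtain ⟨e, -, h1, h2⟩ := h.entry v w hvw s hs
  obtain ⟨f, -, h3, h4⟩ := h.entry a b hab j hj
  have hef : f = e := Fin.ext (by omega)
  subst hef
  have : a = v ∧ b = w := by
    rw [h4, Sym2.eq_iff] at h2
    rcases h2 with h2 | ⟨rfl, rfl⟩
    · exact h2
    · have : a = b := Fin.ext (by omega)
      exact ⟨this, this.symm⟩
  obtain ⟨rfl, rfl⟩ := this
  have := h.lt a b hab s hs j (by omega)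
  omega

theorem isBefore_pair {BK : ℕ → ℕ → ℕ} {v w : Fin n} {e : ℕ} :
    IsBefore n BK v w (BK (v * n + w) 0) e ↔ IsBefore n BK v (w + 1) 0 e := by
  constructor
  · rintro ⟨a, b, hab, j, hj, he, h⟩
    exact ⟨a, b, hab, j, hj, he, by omega⟩
  · rintro ⟨a, b, hab, j, hj, he, h⟩
    refine ⟨a, b, hab, j, hj, he, ?_⟩
    by_cases hlast : (a : ℕ) = v ∧ (b : ℕ) = w
    · obtain ⟨h1, h2⟩ := hlast
      rw [h1, h2] at hj
      omega
    · omega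

theorem isBefore_skip {BK : ℕ → ℕ → ℕ} {v w e : ℕ} (h : w < v) :
    IsBefore n BK v w 0 e ↔ IsBefore n BK v (w + 1) 0 e := by
  constructor <;> rintro ⟨a, b, hab, j, hj, he, h⟩ <;> exact ⟨a, b, hab, j, hj, he, by omega⟩

theorem isBefore_row {BK : ℕ → ℕ → ℕ} {v e : ℕ} :
    IsBefore n BK v n 0 e ↔ IsBefore n BK (v + 1) 0 0 e := by
  constructor <;> rintro ⟨a, b, hab, j, hj, he, h⟩ <;>
    exact ⟨a, b, hab, j, hj, he, by have := b.2; omega⟩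

/-- The state of the main loop at the vertex `v`, when the edges in `P` have been processed. At most `L`
attempts to add an edge are not charged to edges or neighbors, and the other steps have taken
time `O`. -/
structure IsScanState (ends : Fin m → Sym2 (Fin n)) (ℓ : ℕ) (BK : ℕ → ℕ → ℕ) (T v : ℕ) (P : ℕ → Prop)
    (L O : ℕ) (σ : St) (c : Config (Fin n) (Fin m) k) (mvs : List (Move (Fin n) (Fin m) k)) :
    Prop where
  r0 : σ.r 0 = k
  r1 : σ.r 1 = ℓ
  r2 : σ.r 2 = n
  lists : σ.A 2 = BK
  position : IsPosition ends ℓ c mvs σ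
  fresh : ∀ e ∈ c.edges, P (e : ℕ)
  done : ∀ e : Fin m, P e → e ∈ c.edges ∨
    ∃ U, IsTightSet ends k ℓ c.edges U ∧ ∀ x ∈ ends e, x ∈ U
  stamps : ∀ x : Fin n, σ.A 3 x 0 ≤ v + 1
  scan : ∀ v' : Fin n, (v' : ℕ) = v → IsScan ends k ℓ c.edges v' fun x => v < σ.A 3 x 0
  -- Here `a` bounds the number of attempts. Successes are charged to edges of `H`, failures with
  -- distinct ends to pairs of neighbors, and failed loops to `L`.
  budget : ∃ a ≤ c.edges.card + (charged ends c.edges v fun x => v < σ.A 3 x 0).card + L,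
    σ.t ≤ T + attemptTime n k * a + O

theorem IsScanState.congr {ends : Fin m → Sym2 (Fin n)} {BK : ℕ → ℕ → ℕ} {T v : ℕ} {P P' : ℕ → Prop}
    {L O L' O' d : ℕ} {σ σ' : St} {c : Config (Fin n) (Fin m) k}
    {mvs : List (Move (Fin n) (Fin m) k)} (h : IsScanState ends ℓ BK T v P L O σ c mvs)
    (h0 : σ'.r 0 = σ.r 0) (h1 : σ'.r 1 = σ.r 1) (h2 : σ'.r 2 = σ.r 2) (hA : σ'.A = σ.A)
    (ho : σ'.o = σ.o) (ht : σ'.t ≤ σ.t + d) (hP : ∀ e, P e ↔ P' e) (hL : L ≤ L') (hO : O + d ≤ O') :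
    IsScanState ends ℓ BK T v P' L' O' σ' c mvs := by
  refine ⟨h0.trans h.r0, h1.trans h.r1, h2.trans h.r2, by rw [hA]; exact h.lists,
    h.position.congr (by rw [hA]) (by rw [hA]) ho, fun e he => (hP e).1 (h.fresh e he),
    fun e he => h.done e ((hP e).2 he), by rw [hA]; exact h.stamps, by rw [hA]; exact h.scan, ?_⟩
  obtain ⟨a, ha, hta⟩ := h.budget
  rw [hA]
  exact ⟨a, by omega, by omega⟩

/-- Stamps do not exceed `v + 1`, so none of them is valid for the vertex `v + 1`. The scan starts
afresh without clearing the array. -/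
theorem IsScanState.next {ends : Fin m → Sym2 (Fin n)} {BK : ℕ → ℕ → ℕ} {T v : ℕ} {P P' : ℕ → Prop}
    {L O L' O' d : ℕ} {σ σ' : St} {c : Config (Fin n) (Fin m) k}
    {mvs : List (Move (Fin n) (Fin m) k)} (h : IsScanState ends ℓ BK T v P L O σ c mvs)
    (hℓ : ℓ < 2 * k)
    (h0 : σ'.r 0 = σ.r 0) (h1 : σ'.r 1 = σ.r 1) (h2 : σ'.r 2 = σ.r 2) (hA : σ'.A = σ.A)
    (ho : σ'.o = σ.o) (ht : σ'.t ≤ σ.t + d) (hP : ∀ e, P e ↔ P' e) (hL : L ≤ L') (hO : O + d ≤ O') :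
    IsScanState ends ℓ BK T (v + 1) P' L' O' σ' c mvs := by
  have hS : (fun x : Fin n => v + 1 < σ.A 3 x 0) = fun _ => False := by
    funext x
    have := h.stamps x
    simp; omega
  refine ⟨h0.trans h.r0, h1.trans h.r1, h2.trans h.r2, by rw [hA]; exact h.lists,
    h.position.congr (by rw [hA]) (by rw [hA]) ho, fun e he => (hP e).1 (h.fresh e he),
    fun e he => h.done e ((hP e).2 he), fun x => by rw [hA]; have := h.stamps x; omega,
    fun v' _ => by rw [hA, hS]; exact h.position.isGood.sparse.isScan_empty hℓ, ?_⟩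
  obtain ⟨a, ha, hta⟩ := h.budget
  have := Finset.card_le_card (charged_succ (ends := ends) (F := c.edges) (v := v)
    (S := fun x => v < σ.A 3 x 0) (S' := fun x => v + 1 < σ.A 3 x 0))
  rw [hA]
  exact ⟨a, by omega, by omega⟩

/-- The time for the steps of the main loop for a pair of vertices, without the attempts. -/
def pairTime (k : ℕ) : ℕ := 6 * (2 * k + 1) + 10

/-- A bound on the time for the main loop. -/
def scanTime (n k : ℕ) : ℕ :=
  attemptTime n k * (3 * (k * n) + (2 * k + 1) * (n + 1)) + (n + 1) * (n * pairTime k + 4)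

/-- The sparse graph `H` has at most `k n` edges and at most twice as many charged pairs, hence the
factor `3`. -/
theorem IsScanState.time_le {ends : Fin m → Sym2 (Fin n)} {BK : ℕ → ℕ → ℕ} {T v : ℕ} {P : ℕ → Prop}
    {L O : ℕ} {σ : St} {c : Config (Fin n) (Fin m) k}
    {mvs : List (Move (Fin n) (Fin m) k)} (h : IsScanState ends ℓ BK T v P L O σ c mvs)
    (hL : L ≤ (2 * k + 1) * (n + 1)) (hO : O ≤ (n + 1) * (n * pairTime k + 4)) :
    σ.t ≤ T + scanTime n k := by
  obtain ⟨a, ha, hta⟩ := h.budget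
  have h1 := h.position.isGood.sparse.card_le_mul
  have h2 := card_charged_le (ends := ends) (F := c.edges) (S := fun x => v < σ.A 3 x 0) v
  have h3 : attemptTime n k * a ≤ attemptTime n k * (3 * (k * n) + (2 * k + 1) * (n + 1)) :=
    Nat.mul_le_mul_left _ (by omega)
  unfold scanTime
  omega

/-- Try to add the next edge of a list, unless the second end is stamped. -/
def processEntry : Cmd :=
  .ite (ρ 5) (.arr 3 (ρ 6) (♯ 0)) .skip
    (8 ≔ .arr 2 (.add (.mul (ρ 5) (ρ 2)) (ρ 6)) (.add (ρ 7) (♯ 1)) ;; attempt)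

/-- If `w` is stamped, it shares a tight set with `v`, and the edge is rejected in constant time.
Otherwise the attempt is paid by the new edge, by a newly stamped neighbor of `v`, or, for a loop,
by the allowance `L`. -/
theorem processEntry_spec (hG : G.IsFor n m k ℓ) {ends : Fin m → Sym2 (Fin n)} {BK : ℕ → ℕ → ℕ}
    {T L O s : ℕ} {v w : Fin n} {σ : St} {c : Config (Fin n) (Fin m) k}
    {mvs : List (Move (Fin n) (Fin m) k)} (hℓ : ℓ < 2 * k) (hBK : IsListed ends k BK m)
    (h : IsScanState ends ℓ BK T v (IsBefore n BK v w s) L O σ c mvs)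
    (h5 : σ.r 5 = v) (h6 : σ.r 6 = w) (h7 : σ.r 7 = s) (hvw : (v : ℕ) ≤ w)
    (hs : s < BK (v * n + w) 0) {Q : St → Prop} (hQ : ∀ σ' c' mvs', (∀ i, 3 ≤ i → i < 8 → σ'.r i = σ.r i) →
      σ'.r 9 = σ.r 9 → IsScanState (k := k) ends ℓ BK T v (IsBefore n BK v w (s + 1))
        (L + if v = w then 1 else 0) (O + 2) σ' c' mvs' → Q σ') : processEntry.wp G Q σ := by
  have hM := hG.numbers
  have hR := hG.rows
  have hR2 := hG.pairs
  have hW := hG.width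
  have hrow := row_lt v w
  have hw := w.2
  have hle := hBK.le v w hvw
  obtain ⟨e, -, he, hends⟩ := hBK.entry v w hvw s hs
  have hbefore := fun f => isBefore_succ (e := f) hvw hs
  have hscan := h.scan v rfl
  refine ⟨trivial, ⟨trivial, trivial, ?_, ?_⟩, fun hlt => ⟨trivial, ?_⟩, fun hlt =>
    ⟨⟨⟨⟨trivial, trivial, ?_⟩, trivial, ?_⟩, ⟨trivial, trivial, ?_⟩, ?_, ?_⟩, ?_⟩⟩
  · simp only [Ex.eval]; omega
  · simp only [Ex.eval]; omega
  · simp only [Ex.eval, h5, h6] at hlt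
    obtain ⟨U, hU, hvU, hwU⟩ := hscan.tight w hlt
    have h' := h.congr (σ' := σ.tick.setr 98 0) (d := 2) (P' := IsBefore n BK v w s) (by simp)
      (by simp) (by simp) rfl rfl (by simp) (fun _ => .rfl) (Nat.le_add_right L (if v = w then 1 else 0))
      le_rfl
    refine hQ _ c mvs (fun i h1 h2 => by simp; omega) (by simp) ⟨h'.r0, h'.r1, h'.r2, h'.lists,
      h'.position, fun f hf => (hbefore f).2 (.inl (h'.fresh f hf)), fun f hf => ?_, h'.stamps, h'.scan,
      h'.budget⟩
    rcases (hbefore f).1 hf with hf | hf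
    · exact h'.done f hf
    · have : f = e := Fin.ext (by omega)
      subst this
      exact .inr ⟨U, hU, by simp [hends, hvU, hwU]⟩
  · simp [Ex.eval, h5, h.r2]; omega
  · simp [Ex.eval, h5, h6, h.r2]; omega
  · simp [Ex.eval, h7]; omega
  · simp [Ex.eval, h5, h6, h.r2]; omega
  · simp [Ex.eval, h7]; omega
  · simp only [Ex.eval, h5, h6] at hlt
    have hnew : e ∉ c.edges := fun h' => hBK.not_isBefore hvw hs (by rw [he]; exact h.fresh e h')
    have hval : (Ex.arr 2 (.add (.mul (ρ 5) (ρ 2)) (ρ 6)) (.add (ρ 7) (♯ 1))).eval G σ.tick = e := by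
      simp only [Ex.eval, St.tick_r, St.tick_A, h5, h6, h7, h.r2, h.lists, he]
    rw [hval]
    refine attempt_spec hG (σ := σ.tick.setr 8 e) (v := v) (w := w) (e := e) (c := c) (mvs := mvs)
      (h.position.congr rfl rfl rfl) (by simpa using h.r0) (by simpa using h.r1) (by simpa using h.r2)
      (by simpa using h5) (by simpa using h6) (by simp) hvw hends
      hnew hℓ ?_
    intro σ' c' mvs' hk hp hres ht
    have hreg : ∀ i, i < 8 → σ'.r i = σ.r i := fun i hi => by
      rw [hk.reg i (by omega)]; simp; omega
    refine hQ σ' c' mvs' (fun i _ hi => hreg i hi) (by rw [hk.reg 9 (by norm_num)]; simp) ?_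
    have hlists : σ'.A 2 = BK := (hk.arr 2 (by simp)).trans h.lists
    obtain ⟨a, ha, hta⟩ := h.budget
    have hmul : attemptTime n k * (a + 1) = attemptTime n k * a + attemptTime n k := by ring
    simp at ht
    rcases hres with ⟨hedges, hA3⟩ | ⟨hedges, D, hD, hvD, hwD, hmax, hst⟩
    · have hA3' : σ'.A 3 = σ.A 3 := hA3
      refine ⟨(hreg 0 (by norm_num)).trans h.r0, (hreg 1 (by norm_num)).trans h.r1,
        (hreg 2 (by norm_num)).trans h.r2, hlists, hp, fun f hf => ?_, fun f hf => ?_,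
        by rw [hA3']; exact h.stamps, fun v' hv' => ?_, a + 1, ?_, by omega⟩
      · rw [hedges, Finset.mem_insert] at hf
        rcases hf with rfl | hf
        · exact (hbefore _).2 (.inr he)
        · exact (hbefore _).2 (.inl (h.fresh f hf))
      · rw [hedges]
        rcases (hbefore f).1 hf with hf | hf
        · rcases h.done f hf with h1 | ⟨U, hU, h1⟩
          · exact .inl (Finset.mem_insert_of_mem h1)
          · exact .inr ⟨U, hU.mono (Finset.subset_insert _ _), h1⟩
        · have : f = e := Fin.ext (by omega)
          subst this
          exact .inl (Finset.mem_insert_self _ _)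
      · obtain rfl : v' = v := Fin.ext hv'
        rw [hA3', hedges]
        exact hscan.insert hends hlt
      · have h1 := Finset.card_le_card (charged_mono (ends := ends) (v := v)
          (S := fun x => (v : ℕ) < σ.A 3 x 0) (Finset.subset_insert e c.edges))
        rw [hA3', hedges, Finset.card_insert_of_notMem hnew]
        omega
    · have hst' : ∀ x : Fin n, σ'.A 3 x 0 = if (v : ℕ) < w ∧ x ∈ D then (v : ℕ) + 1 else σ.A 3 x 0 :=
        hst
      suffices hsb : (∀ v' : Fin n, (v' : ℕ) = v → IsScan ends k ℓ c.edges v' fun x => v < σ'.A 3 x 0) ∧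
          ∃ a ≤ c.edges.card + (charged ends c.edges v fun x => (v : ℕ) < σ'.A 3 x 0).card +
            (L + if v = w then 1 else 0), σ'.t ≤ T + attemptTime n k * a + (O + 2) by
        rw [← hedges] at hsb
        refine ⟨(hreg 0 (by norm_num)).trans h.r0, (hreg 1 (by norm_num)).trans h.r1,
          (hreg 2 (by norm_num)).trans h.r2, hlists, hp, fun f hf => ?_, fun f hf => ?_, fun x => ?_,
          hsb.1, hsb.2⟩
        · rw [hedges] at hf
          exact (hbefore _).2 (.inl (h.fresh f hf))
        · rw [hedges]
          rcases (hbefore f).1 hf with hf | hf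
          · exact h.done f hf
          · have : f = e := Fin.ext (by omega)
            subst this
            exact .inr ⟨D, hD, by simp [hends, hvD, hwD]⟩
        · rw [hst' x]
          split_ifs
          exacts [le_rfl, h.stamps x]
      · by_cases hvw' : v = w
        -- A failed loop writes no stamps.
        · have hS : (fun x : Fin n => (v : ℕ) < σ'.A 3 x 0) = fun x : Fin n => (v : ℕ) < σ.A 3 x 0 := by
            funext x
            rw [hst' x, if_neg]
            rintro ⟨h1, -⟩
            rw [hvw'] at h1
            omega
          rw [if_pos hvw', hS]
          exact ⟨h.scan, a + 1, by omega, by omega⟩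
        · have hvw'' : (v : ℕ) < w := lt_of_le_of_ne hvw fun h => hvw' (Fin.ext h)
          obtain ⟨h1, x, hx, f, hf, hfx, hnS⟩ :=
            hscan.stamp h.position.isGood.sparse hℓ hD hvD hwD hvw' (hmax hvw') hlt
          have hS : (fun x : Fin n => (v : ℕ) < σ'.A 3 x 0) =
              fun x : Fin n => (v : ℕ) < σ.A 3 x 0 ∨ x ∈ D := by
            funext x
            rw [hst' x]
            by_cases hxD : x ∈ D <;> simp [hxD, hvw'']
          rw [if_neg hvw', hS]
          refine ⟨fun v' hv' => by obtain rfl : v' = v := Fin.ext hv'; exact h1, a + 1, ?_, by omega⟩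
          have := card_charged_lt (v := v) (S := fun x => (v : ℕ) < σ.A 3 x 0)
            (S' := fun x => (v : ℕ) < σ.A 3 x 0 ∨ x ∈ D) (fun _ => .inl) hf hfx hnS (.inr hx)
          omega

end Pairs
end PebbleGame

namespace PebbleGame

/-! ### The main loop -/

section Main

variable {G : Env} {n m k ℓ : ℕ}

local infixr:60 " ;; " => Cmd.seq
local infix:70 " ≔ " => Cmd.asg
local notation "ρ" => Ex.reg
local notation "♯" => Ex.num

/-- The list of edges between two vertices `v ≤ w`. -/
def processPair : Cmd :=
  .ite (ρ 6) (ρ 5) .skip (9 ≔ .arr 2 (.add (.mul (ρ 5) (ρ 2)) (ρ 6)) (♯ 0) ;; .loop 7 9 processEntry)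

/-- All lists of edges, in lexicographic order of the ends. -/
def processPairs : Cmd := .loop 5 2 (.loop 6 2 processPair)

theorem processPair_spec (hG : G.IsFor n m k ℓ) {ends : Fin m → Sym2 (Fin n)} {BK : ℕ → ℕ → ℕ}
    {T O : ℕ} {v w : Fin n} {σ : St} {c : Config (Fin n) (Fin m) k}
    {mvs : List (Move (Fin n) (Fin m) k)} (hℓ : ℓ < 2 * k) (hBK : IsListed ends k BK m)
    (h : IsScanState ends ℓ BK T v (IsBefore n BK v w 0)
      ((2 * k + 1) * v + if (v : ℕ) < w then 2 * k + 1 else 0) O σ c mvs)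
    (hO : O + pairTime k ≤ (n + 1) * (n * pairTime k + 4) + 2) (h5 : σ.r 5 = v) (h6 : σ.r 6 = w)
    {Q : St → Prop} (hQ : ∀ (σ' : St) c' mvs', σ'.r 5 = (v : ℕ) → σ'.r 6 = (w : ℕ) →
      IsScanState (k := k) ends ℓ BK T v (IsBefore n BK v (w + 1) 0)
        ((2 * k + 1) * v + if (v : ℕ) < w + 1 then 2 * k + 1 else 0) (O + pairTime k - 2) σ' c' mvs' →
      Q σ') : processPair.wp G Q σ := by
  have hM := hG.numbers
  have hR := hG.rows
  have hR2 := hG.pairs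
  have hW := hG.width
  have hrow := row_lt v w
  have hw := w.2
  refine ⟨trivial, trivial, fun hlt => ⟨trivial, ?_⟩, fun hlt => ⟨⟨⟨⟨trivial, trivial, ?_⟩, trivial, ?_⟩,
    trivial, ?_, ?_⟩, ?_⟩⟩
  · simp only [Ex.eval, h5, h6] at hlt
    refine hQ (σ.tick.setr 98 0) c mvs (by simpa using h5) (by simpa using h6)
      (h.congr (d := 2) (by simp) (by simp) (by simp) rfl rfl (by simp) (fun _ => isBefore_skip hlt) ?_ ?_)
    · rw [if_neg (by omega), if_neg (by omega)]
    · unfold pairTime; omega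
  · simp [Ex.eval, h5, h.r2]; omega
  · simp [Ex.eval, h5, h6, h.r2]; omega
  · simp [Ex.eval, h5, h6, h.r2]; omega
  · simp only [Ex.eval]; omega
  · simp only [Ex.eval, h5, h6] at hlt
    have hvw : (v : ℕ) ≤ w := by omega
    have hle := hBK.le v w hvw
    have hval : (Ex.arr 2 (.add (.mul (ρ 5) (ρ 2)) (ρ 6)) (♯ 0)).eval G σ.tick = BK (v * n + w) 0 := by
      simp only [Ex.eval, St.tick_r, St.tick_A, h5, h6, h.r2, h.lists]
    rw [hval]
    set L := (2 * k + 1) * (v : ℕ) + if (v : ℕ) < w then 2 * k + 1 else 0 with hL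
    have hvn : (2 * k + 1) * ((v : ℕ) + 1) ≤ (2 * k + 1) * (n + 1) :=
      Nat.mul_le_mul_left _ (by have := v.2; omega)
    -- Loops at `v`, of which at most `2 k + 1` are listed, occur only for `w = v`. Their allowance
    -- is part of the bound once `w` has passed `v`.
    have hLs : ∀ s ≤ 2 * k + 1, (L + if v = w then s else 0) ≤
        (2 * k + 1) * v + if (v : ℕ) < w + 1 then 2 * k + 1 else 0 := by
      intro s hs
      rw [if_pos (show (v : ℕ) < w + 1 by omega), hL]
      by_cases hvw' : v = w
      · rw [if_pos hvw', if_neg (by rw [hvw']; omega)]; omega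
      · rw [if_neg hvw']; split_ifs <;> omega
    refine Cmd.wp_loop (BK (v * n + w) 0) (T + scanTime n k) (fun s σ₁ => σ₁.r 5 = v ∧ σ₁.r 6 = w ∧
      σ₁.r 9 = BK (v * n + w) 0 ∧ ∃ c mvs, IsScanState (k := k) ends ℓ BK T v (IsBefore n BK v w s)
        (L + if v = w then s else 0) (O + 3 + 4 * s) σ₁ c mvs) (by nlinarith) ?_ ?_ ?_ ?_
    · rintro s hs σ₁ ⟨-, -, h9, c, mvs, h₁⟩ h7
      refine ⟨h9, h₁.time_le ((hLs s (by omega)).trans ?_) ?_⟩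
      · rw [if_pos (by omega)]; rw [mul_add, mul_one] at hvn; exact hvn
      · unfold pairTime at hO ⊢; omega
    · refine ⟨by simpa using h5, by simpa using h6, by simp, c, mvs, h.congr (d := 3) (by simp) (by simp)
        (by simp) rfl rfl (by simp) (fun _ => .rfl) (Nat.le_add_right _ _) le_rfl⟩
    · rintro s hs σ₁ ⟨h5, h6, h9, c, mvs, h₁⟩ h7 -
      refine processEntry_spec hG (σ := σ₁.tick) hℓ hBK (h₁.congr (d := 1) rfl rfl rfl rfl rfl (by simp)
        (fun _ => .rfl) le_rfl le_rfl) h5 h6 h7 hvw hs ?_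
      intro σ' c' mvs' hreg h9' h'
      refine ⟨(hreg 7 (by norm_num) (by norm_num)).trans h7, ?_, ?_, ?_, c', mvs', ?_⟩
      · simpa [hreg 5 (by norm_num) (by norm_num)] using h5
      · simpa [hreg 6 (by norm_num) (by norm_num)] using h6
      · simpa [h9'] using h9
      · refine h'.congr (d := 1) (by simp) (by simp) (by simp) rfl rfl (by simp) (fun _ => .rfl) ?_ (by omega)
        split_ifs <;> omega
    · rintro σ₁ ⟨h5, h6, h9, c, mvs, h₁⟩ h7
      refine hQ σ₁.tick c mvs h5 h6 (h₁.congr (d := 1) rfl rfl rfl rfl rfl (by simp)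
        (fun _ => isBefore_pair) (hLs _ hle) ?_)
      unfold pairTime; omega

/-- A listed edge outside of `H` has its ends in a tight set, and
`IsSparse.exists_tight_of_parallel` extends this to the edges that were dropped. So
`IsSparse.isMaximumSparse` applies. -/
theorem processPairs_spec (hG : G.IsFor n m k ℓ) {ends : Fin m → Sym2 (Fin n)} {σ : St} (hℓ : ℓ < 2 * k)
    (h0 : σ.r 0 = k) (h1 : σ.r 1 = ℓ) (h2 : σ.r 2 = n) (hA : ∀ a, a ≠ 2 → ∀ x j, σ.A a x j = 0)
    (ho : σ.o = []) (hBK : IsListed ends k (σ.A 2) m) {Q : St → Prop}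
    (hQ : ∀ σ' c mvs, σ'.r 0 = k → σ'.r 2 = n → IsPosition (k := k) ends ℓ c mvs σ' →
      IsMaximumSparse ends k ℓ c.edges → σ'.t ≤ σ.t + scanTime n k + 1 → Q σ') :
    processPairs.wp G Q σ := by
  have hM := hG.numbers
  set X := n * pairTime k + 4 with hX
  have hsmall : ∀ v ≤ n, 1 + v * X ≤ (n + 1) * X := by
    intro v hv
    have := Nat.mul_le_mul_right X hv
    rw [add_mul, one_mul]
    omega
  have hnM : n ≤ G.M := by nlinarith
  refine Cmd.wp_loop n (σ.t + scanTime n k) (fun v σ₁ => ∃ c mvs, IsScanState (k := k) ends ℓ (σ.A 2) σ.t v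
    (IsBefore n (σ.A 2) v 0 0) ((2 * k + 1) * v) (1 + v * X) σ₁ c mvs) hnM ?_ ?_ ?_ ?_
  · rintro v hv σ₁ ⟨c, mvs, h⟩ -
    exact ⟨h.r2, h.time_le (Nat.mul_le_mul_left _ (by omega)) (hsmall v hv)⟩
  · have hgood := Config.isGood_initial (ends := ends) (ℓ := ℓ) (k := k)
    have hedges : (Config.initial (Fin n) (Fin m) k).edges = ∅ := by
      ext e; simp [Config.edges, Config.initial]
    refine ⟨Config.initial _ _ k, [], by simpa using h0, by simpa using h1, by simpa using h2, rfl,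
      ⟨isStored_initial fun x _ i _ => hA 0 (by norm_num) x i, rfl, by simpa using ho⟩, ?_, ?_, ?_, ?_, 0,
      Nat.zero_le _, by simp⟩
    · simp [hedges]
    · exact fun e he => (not_isBefore_zero he).elim
    · intro x; simp [hA 3]
    · intro v _
      simp only [St.setr_A, hA 3 (by norm_num), Nat.not_lt_zero]
      exact hgood.sparse.isScan_empty hℓ
  · rintro v hv σ₁ ⟨c, mvs, h⟩ h5 -
    obtain ⟨v, rfl⟩ : ∃ v' : Fin n, v = v' := ⟨⟨v, hv⟩, rfl⟩
    have hvX : ((v : ℕ) + 1) * X ≤ n * X := Nat.mul_le_mul_right X hv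
    have hnX : (n + 1) * (n * pairTime k + 4) = n * X + X := by ring
    rw [add_mul, one_mul] at hvX
    have hwn : ∀ w ≤ n, w * pairTime k + 4 ≤ X := fun w hw => by
      have := Nat.mul_le_mul_right (pairTime k) hw
      omega
    refine Cmd.wp_loop n (σ.t + scanTime n k) (fun w σ₂ => σ₂.r 5 = v ∧ ∃ c mvs,
      IsScanState (k := k) ends ℓ (σ.A 2) σ.t v (IsBefore n (σ.A 2) v w 0)
        ((2 * k + 1) * v + if (v : ℕ) < w then 2 * k + 1 else 0) (3 + v * X + w * pairTime k) σ₂ c mvs)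
      hnM ?_ ?_ ?_ ?_
    · rintro w hw σ₂ ⟨-, c, mvs, h⟩ -
      have := hwn w hw
      refine ⟨h.r2, h.time_le ?_ (by omega)⟩
      have : (2 * k + 1) * ((v : ℕ) + 1) ≤ (2 * k + 1) * (n + 1) := Nat.mul_le_mul_left _ (by omega)
      rw [mul_add, mul_one] at this
      split_ifs <;> omega
    · refine ⟨by simpa using h5, c, mvs, h.congr (d := 2) (by simp) (by simp) (by simp) rfl rfl (by simp)
        (fun _ => .rfl) (Nat.le_add_right _ _) (by omega)⟩
    · rintro w hw σ₂ ⟨h5, c, mvs, h⟩ h6 -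
      obtain ⟨w, rfl⟩ : ∃ w' : Fin n, w = w' := ⟨⟨w, hw⟩, rfl⟩
      have hw1 := hwn (w + 1) hw
      rw [add_mul, one_mul] at hw1
      refine processPair_spec hG (σ := σ₂.tick) (O := 4 + v * X + w * pairTime k) hℓ hBK
        (h.congr (d := 1) rfl rfl rfl rfl rfl (by simp) (fun _ => .rfl) le_rfl (by omega)) (by omega) h5 h6 ?_
      intro σ' c' mvs' h5' h6' h'
      refine ⟨h6', by simpa using h5', c', mvs', h'.congr (d := 1) (by simp) (by simp) (by simp) rfl rfl
        (by simp) (fun _ => .rfl) le_rfl ?_⟩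
      rw [add_mul, one_mul]
      unfold pairTime
      omega
    · rintro σ₂ ⟨h5, c, mvs, h⟩ -
      refine ⟨h5, c, mvs, h.next hℓ (d := 2) (by simp) (by simp) (by simp) rfl rfl (by simp)
        (fun _ => isBefore_row) ?_ ?_⟩
      · rw [if_pos v.2, mul_add, mul_one]
      · have := hwn n le_rfl
        rw [add_mul, one_mul]
        omega
  · rintro σ₁ ⟨c, mvs, h⟩ -
    have hgood := h.position.isGood
    have hend : ∀ v w : Fin n, (v : ℕ) ≤ w → ∀ j < σ.A 2 (v * n + w) 0, ∀ e : Fin m,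
        σ.A 2 (v * n + w) (j + 1) = e → e ∈ c.edges ∨
          ∃ U, IsTightSet ends k ℓ c.edges U ∧ ∀ x ∈ ends e, x ∈ U :=
      fun v w hvw j hj e he => h.done e ⟨v, w, hvw, j, hj, he, .inl v.2⟩
    refine hQ σ₁.tick c mvs h.r0 h.r2 (h.position.congr rfl rfl rfl) ?_ ?_
    · refine hgood.sparse.isMaximumSparse fun e he => ?_
      obtain ⟨v, w, hvw, hvwe⟩ : ∃ v w : Fin n, (v : ℕ) ≤ w ∧ ends e = s(v, w) := by
        induction hxy : ends e using Sym2.ind with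
        | _ x y =>
          rcases le_total (x : ℕ) y with hle | hle
          · exact ⟨x, y, hle, rfl⟩
          · exact ⟨y, x, hle, Sym2.eq_swap⟩
      -- A full list has more than `2 k` parallel edges, so one of them has its ends in a tight set,
      -- which then serves for `e`, too.
      rcases hBK.complete v w hvw e e.2 hvwe with hfull | ⟨j, hj, hje⟩
      · have hex : ∀ j : Fin (2 * k + 1), ∃ f : Fin m, σ.A 2 (v * n + w) (j + 1) = f ∧ ends f = s(v, w) := by
          intro j
          obtain ⟨f, -, hf⟩ := hBK.entry v w hvw j (by rw [hfull]; exact j.2)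
          exact ⟨f, hf⟩
        choose f hf hfe using hex
        have hinj : Function.Injective f := by
          have : ∀ i j : Fin (2 * k + 1), i < j → f i ≠ f j := fun i j hij heq => by
            have := hBK.lt v w hvw j (by rw [hfull]; exact j.2) i hij
            rw [hf, hf, heq] at this
            omega
          intro i j hij
          rcases lt_trichotomy i j with h' | h' | h'
          exacts [(this i j h' hij).elim, h', (this j i h' hij.symm).elim]
        obtain ⟨U, hU, hv, hw⟩ := hgood.sparse.exists_tight_of_parallel
          (P := Finset.univ.image f) (v := v) (w := w) (ℓ := ℓ) (k := k)
          (by rw [Finset.card_image_of_injective _ hinj]; simp)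
          (fun e he => by
            obtain ⟨j, -, rfl⟩ := Finset.mem_image.1 he
            exact hfe j)
          (fun e he => by
            obtain ⟨j, -, rfl⟩ := Finset.mem_image.1 he
            rcases hend v w hvw j (by rw [hfull]; exact j.2) _ (hf j) with h' | ⟨U, hU, hx⟩
            · exact .inl h'
            · rw [hfe j] at hx
              exact .inr ⟨U, hU, hx v (by simp), hx w (by simp)⟩)
        exact ⟨U, hU, by simp [hvwe, hv, hw]⟩
      · exact (hend v w hvw j hj e hje).resolve_left he
    · have := h.time_le (Nat.mul_le_mul_left _ (by omega)) (hsmall n le_rfl)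
      simp only [St.tick_t]
      omega

end Main
end PebbleGame

namespace PebbleGame

/-! ### Output of the final configuration -/

section Output

variable {G : Env} {n m k ℓ : ℕ}

local infixr:60 " ;; " => Cmd.seq
local infix:70 " ≔ " => Cmd.asg
local notation "ρ" => Ex.reg
local notation "♯" => Ex.num

/-- Run a command for all slots. -/
def forSlots (p : Cmd) : Cmd := .loop 5 2 (.loop 7 0 p)

/-- A bound on the time for a pass over all slots. -/
def slotTime (n k : ℕ) : ℕ := 2 + n * (7 * k + 4)

theorem forSlots_spec (hG : G.IsFor n m k ℓ) {p : Cmd} {f : ℕ → ℕ → List ℕ} {σ : St}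
    (h0 : σ.r 0 = k) (h2 : σ.r 2 = n) (hp : ∀ (σ₁ : St) (Q : St → Prop), σ₁.A = σ.A → σ₁.r 5 < n →
      σ₁.r 7 < k → (∀ σ' : St, (∀ i < 98, σ'.r i = σ₁.r i) → σ'.A = σ.A →
        σ'.o = σ₁.o ++ f (σ₁.r 5) (σ₁.r 7) → σ'.t ≤ σ₁.t + 5 → Q σ') → p.wp G Q σ₁)
    {Q : St → Prop} (hQ : ∀ σ' : St, σ'.r 0 = k → σ'.r 2 = n → σ'.A = σ.A →
      σ'.o = σ.o ++ (List.range n).flatMap (fun x => (List.range k).flatMap (f x)) →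
      σ'.t ≤ σ.t + slotTime n k → Q σ') : (forSlots p).wp G Q σ := by
  have hM := hG.numbers
  refine Cmd.wp_for n (7 * k + 3) (fun x σ₁ => σ₁.r 0 = k ∧ σ₁.r 2 = n ∧ σ₁.A = σ.A ∧
    σ₁.o = σ.o ++ (List.range x).flatMap (fun x => (List.range k).flatMap (f x)))
    (by nlinarith) h2 (by norm_num) ?_ ?_ ?_
  · simp [h0, h2]
  · rintro x hx σ₁ ⟨h0, h2, hA, ho⟩ h5 -
    refine Cmd.wp_for k 6 (fun i σ₂ => σ₂.r 0 = k ∧ σ₂.r 2 = n ∧ σ₂.r 5 = x ∧ σ₂.A = σ.A ∧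
      σ₂.o = σ₁.o ++ (List.range i).flatMap (f x)) (by nlinarith) h0 (by norm_num) ?_ ?_ ?_
    · simp [h0, h2, h5, hA]
    · rintro i hi σ₂ ⟨h0, h2, h5, hA, ho⟩ h7 -
      refine hp σ₂.tick _ hA (by simp only [St.tick_r]; omega) (by simp only [St.tick_r]; omega)
        fun σ' hr hA' ho' ht => ?_
      have h0' := hr 0 (by norm_num)
      have h2' := hr 2 (by norm_num)
      have h5' := hr 5 (by norm_num)
      have h7' := hr 7 (by norm_num)
      simp only [St.tick_r, St.tick_o, St.tick_t] at h0' h2' h5' h7' ho' ht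
      refine ⟨h7'.trans h7, h0'.trans h0, ⟨?_, ?_, ?_, hA', ?_⟩, by omega⟩
      · simpa [h0'] using h0
      · simpa [h2'] using h2
      · simpa [h5'] using h5
      · simp [ho', ho, h5, h7, List.range_succ]
    · rintro σ₂ ⟨h0, h2, h5, hA, ho'⟩ - ht
      simp only [St.tick_t] at ht
      refine ⟨h5, h2, ⟨by simpa using h0, by simpa using h2, hA, ?_⟩, by simp only [St.tick_t]; omega⟩
      simp [ho', ho, List.range_succ]
  · rintro σ₁ ⟨h0, h2, hA, ho⟩ - ht
    have : n * (7 * k + 3 + 1) = n * (7 * k + 4) := rfl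
    exact hQ _ h0 h2 hA ho (by unfold slotTime; simp only [St.tick_t]; omega)

/-- Output the final configuration. -/
def outputConfig : Cmd :=
  forSlots (.ite (♯ 0) (.arr 0 (ρ 5) (ρ 7))
    (.emi (♯ 2) ;; .emi (.sub (.arr 0 (ρ 5) (ρ 7)) (♯ 1)) ;; .emi (ρ 5) ;; .emi (ρ 7)) .skip) ;;
  forSlots (.ite (♯ 0) (.arr 0 (ρ 5) (ρ 7)) .skip
    (.emi (♯ 3) ;; .emi (ρ 5) ;; .emi (ρ 7) ;; .emi (♯ 0)))

theorem outputConfig_spec (hG : G.IsFor n m k ℓ) {σ : St} (h0 : σ.r 0 = k) (h2 : σ.r 2 = n)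
    {Q : St → Prop} (hQ : ∀ σ' : St, σ'.o = σ.o ++
      ((List.range n).flatMap (fun x => (List.range k).flatMap fun i =>
        if 0 < σ.A 0 x i then [2, σ.A 0 x i - 1, x, i] else []) ++
      (List.range n).flatMap (fun x => (List.range k).flatMap fun i =>
        if 0 < σ.A 0 x i then [] else [3, x, i, 0])) → σ'.t ≤ σ.t + 2 * slotTime n k → Q σ') :
    outputConfig.wp G Q σ := by
  have hR := hG.rows
  have hW := hG.width
  refine forSlots_spec (f := fun x i => if 0 < σ.A 0 x i then [2, σ.A 0 x i - 1, x, i] else []) hG h0 h2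
    ?_ fun σ' h0 h2 hA ho ht => forSlots_spec (f := fun x i => if 0 < σ.A 0 x i then [] else [3, x, i, 0])
      hG h0 h2 ?_ fun σ'' _ _ _ ho' ht' => hQ σ'' ?_ (by omega)
  rotate_left 2
  · rw [ho', ho, List.append_assoc]
  · intro σ₁ Q hA₁ h5 h7 hQ
    refine ⟨trivial, ⟨trivial, trivial, h5.trans_le hR, by simp only [Ex.eval]; omega⟩, fun hlt => ?_,
      fun hlt => ?_⟩
    · simp only [Ex.eval, hA₁] at hlt
      refine ⟨trivial, ⟨⟨trivial, trivial, h5.trans_le hR, by simp only [Ex.eval]; simp; omega⟩, trivial⟩,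
        trivial, trivial, hQ _ (fun _ _ => rfl) hA₁ ?_ le_rfl⟩
      rw [if_pos hlt]
      simp [Ex.eval, hA₁]
    · simp only [Ex.eval, hA₁] at hlt
      refine ⟨trivial, hQ _ (fun i hi => if_neg (by omega)) hA₁ ?_ (by simp)⟩
      rw [if_neg hlt]
      simp
  · intro σ₁ Q hA₁ h5 h7 hQ
    refine ⟨trivial, ⟨trivial, trivial, h5.trans_le hR, by simp only [Ex.eval]; omega⟩, fun hlt => ?_,
      fun hlt => ?_⟩
    · simp only [Ex.eval, hA₁, hA] at hlt
      refine ⟨trivial, hQ _ (fun i hi => if_neg (by omega)) hA₁ ?_ (by simp)⟩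
      rw [if_pos hlt]
      simp
    · simp only [Ex.eval, hA₁, hA] at hlt
      refine ⟨trivial, trivial, trivial, trivial, hQ _ (fun _ _ => rfl) hA₁ ?_ le_rfl⟩
      rw [if_neg hlt]
      simp [Ex.eval]

theorem flatMap_slots (f : ℕ → ℕ → List ℕ) : (List.range n).flatMap (fun x => (List.range k).flatMap (f x)) =
    (List.finRange n ×ˢ List.finRange k).flatMap fun p => f p.1 p.2 := by
  simp only [← List.map_coe_finRange_eq_range, List.flatMap_map]
  simp [SProd.sprod, List.product, List.flatMap_assoc, List.flatMap_map]

theorem flatMap_filterMap {α β γ : Type*} (g : α → Option β) (f : β → List γ) (l : List α) :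
    (l.filterMap g).flatMap f = l.flatMap fun a => (g a).elim [] f := by
  induction l with
  | nil => rfl
  | cons a l ih =>
    rw [List.filterMap_cons, List.flatMap_cons, ← ih]
    cases g a <;> simp

theorem IsStored.describesConfig {c : Config (Fin n) (Fin m) k} {ED HD : ℕ → ℕ → ℕ}
    (h : IsStored c ED HD) : DescribesConfig c
      ((List.range n).flatMap (fun x => (List.range k).flatMap fun i =>
        if 0 < ED x i then [2, ED x i - 1, x, i] else []) ++
      (List.range n).flatMap (fun x => (List.range k).flatMap fun i =>
        if 0 < ED x i then [] else [3, x, i, 0])) := by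
  -- Edges are listed by their slots. Distinct slots give distinct triples, so nothing is listed
  -- twice.
  let g : Fin n × Fin k → Option (Fin m × Fin n × Fin k) := fun p =>
    if hp : 0 < ED p.1 p.2 then some (⟨ED p.1 p.2 - 1, by have := h.le p.1 p.1.2 p.2 p.2.2; omega⟩, p)
    else none
  have hg : ∀ p q, g p = some q ↔ ED p.1 p.2 = q.1 + 1 ∧ p = q.2 := by
    rintro p ⟨e, q⟩
    simp only [g]
    split_ifs with hp
    · simp only [Option.some.injEq, Prod.mk.injEq, Fin.ext_iff]
      constructor <;> rintro ⟨h1, h2⟩ <;> exact ⟨by omega, h2⟩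
    · simp; omega
  have hmem : ∀ p : Fin n × Fin k, p ∈ List.finRange n ×ˢ List.finRange k := fun p =>
    List.mem_product.2 ⟨List.mem_finRange _, List.mem_finRange _⟩
  have hnodup : (List.finRange n ×ˢ List.finRange k).Nodup :=
    (List.nodup_finRange n).product (List.nodup_finRange k)
  refine ⟨(List.finRange n ×ˢ List.finRange k).filterMap g,
    (List.finRange n ×ˢ List.finRange k).filter fun p => ED p.1 p.2 = 0, ?_, ?_, ?_, ?_⟩
  · refine hnodup.filterMap fun p p' q hp hp' => ?_
    rw [Option.mem_def, hg] at hp hp'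
    exact hp.2.trans hp'.2.symm
  · intro e x i
    rw [List.mem_filterMap]
    simp only [hg, h.edge]
    constructor
    · rintro ⟨p, -, hp, rfl⟩
      exact ⟨⟨HD x i, h.head x x.2 i i.2 (by simp at hp; omega)⟩, hp, rfl⟩
    · rintro ⟨y, hy, -⟩
      exact ⟨(x, i), hmem _, hy, rfl⟩
  · intro x i
    rw [List.Nodup.count (hnodup.filter _), h.peb]
    simp
  · rw [flatMap_slots, flatMap_slots, flatMap_filterMap, ← List.filterMap_eq_filter, flatMap_filterMap]
    congr 2
    · funext p
      simp only [g]
      split_ifs <;> rfl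
    · funext p
      by_cases hp : ED p.1 p.2 = 0
      · simp [Option.guard, hp]
      · simp [Option.guard, hp, Nat.pos_of_ne_zero hp]

end Output
end PebbleGame

namespace PebbleGame

/-! ### The program and its resources -/

section Program

variable {n m k ℓ : ℕ}

local infixr:60 " ;; " => Cmd.seq

/-- The bounds for the program on the given input. -/
def pebbleEnv (n m k ℓ : ℕ) (edge : Fin m → Fin n × Fin n) : Env where
  inp := encodeInput k ℓ edge
  -- The first summand bounds the memory addresses, the second one the numbers computed from the
  -- parameters.
  M := 16 * ((n * n + n + 1) * (2 * k + 2)) + 16 * (n * n + n * k + n + k + ℓ + m + 1)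
  -- A list of parallel edges takes up to `2 k + 1` cells, and one more for its length.
  W := 2 * k + 2
  R := n * n + n + 1

theorem pebbleEnv_isFor (edge : Fin m → Fin n × Fin n) : (pebbleEnv n m k ℓ edge).IsFor n m k ℓ where
  large := by
    refine ⟨by simp only [pebbleEnv]; omega, Nat.le_add_right _ _, fun i => ?_⟩
    have key : ∀ x ∈ encodeInput k ℓ edge, x ≤ k + ℓ + n + m := by
      intro x hx
      simp only [encodeInput, List.mem_append, List.mem_cons, List.not_mem_nil, or_false,
        List.mem_flatMap] at hx
      rcases hx with (rfl | rfl | rfl | rfl) | ⟨p, -, rfl | rfl⟩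
      · omega
      · omega
      · omega
      · omega
      · have := p.1.2; omega
      · have := p.2.2; omega
    have h : (encodeInput k ℓ edge).getD i 0 ≤ k + ℓ + n + m := by
      rw [List.getD_eq_getElem?_getD]
      by_cases hi : i < (encodeInput k ℓ edge).length
      · rw [List.getElem?_eq_getElem hi]
        exact key _ (List.getElem_mem hi)
      · rw [List.getElem?_eq_none (by omega)]
        exact Nat.zero_le _
    refine h.trans ?_
    simp only [pebbleEnv]
    omega
  width := le_rfl
  rows := by simp only [pebbleEnv]; omega
  pairs := by simp only [pebbleEnv]; omega
  numbers := Nat.le_add_left _ _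

/-- Put the width of the arrays into its register. -/
def prologue : Prog :=
  -- The input begins with `k`, and the width is `2 k + 2`.
  .seq (.const 100 0) <| .seq (.input 100 100) <| .seq (.add 100 100 100) <|
    .seq (.const 101 2) (.add 99 100 101)

theorem prologue_spec (C : ℕ) (edge : Fin m → Fin n × Fin n) : ∃ s,
    Exec (encodeInput k ℓ edge) prologue State.start s ∧ Rep (pebbleEnv n m k ℓ edge) C 5 s St.start := by
  have hM : 2 * k + 2 ≤ (pebbleEnv n m k ℓ edge).M := by simp only [pebbleEnv]; omega
  refine ⟨_, .seq (.const ..) (.seq (.input ..) (.seq (.add ..) (.seq (.const ..) (.add ..)))),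
    ⟨?_, ?_, ?_, ?_, ?_, ?_, ?_⟩, rfl, ?_⟩
  · intro i hi
    simp only [State.setReg, State.tick, Function.update_apply]
    rw [if_neg (by omega), if_neg (by omega), if_neg (by omega), if_neg (by omega), if_neg (by omega)]
    rfl
  · simp [State.setReg, State.tick, State.start, pebbleEnv, encodeInput]
    omega
  · intro a ha x j hj
    rfl
  · exact Nat.zero_le _
  · simp [State.setReg, State.tick, State.start, encodeInput]
    omega
  · intro i
    simp only [State.setReg, State.tick, State.start, Function.update_apply]
    norm_num [encodeInput]
    split_ifs <;> omega
  · intro i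
    exact Nat.zero_le _
  · simp [State.setReg, State.tick, State.start]

/-- The main part of the program. -/
def buildAndOutput : Cmd := processPairs ;; outputConfig

/-- A program for the pebble game with colors. -/
def pebbleProgram : Prog := .seq prologue (.seq readInput.compile buildAndOutput.compile)

/-- A coefficient of the time for building and output. -/
def timeCoeff (k : ℕ) : ℕ :=
  400 * ((k + 1) * (k + 1)) * (5 * k + 1) + pairTime k + 4 + 1 + 2 * (7 * k + 6)

/-- For fixed `k` there are `O(n)` attempts of time `O(n)` and `O(n ^ 2)` other steps. The rest is
`(n + 1) ^ 2 ≤ 2 (n ^ 2 + 1)`. -/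
theorem scanTime_add_slotTime_le (n k : ℕ) :
    scanTime n k + 1 + 2 * slotTime n k ≤ 2 * timeCoeff k * (n ^ 2 + 1) := by
  have h1 : (n + 1) * (n + 1) ≤ 2 * (n ^ 2 + 1) := by
    zify
    nlinarith [sq_nonneg ((n : ℤ) - 1)]
  have h2 : attemptTime n k * (3 * (k * n) + (2 * k + 1) * (n + 1)) ≤
      400 * ((k + 1) * (k + 1)) * (5 * k + 1) * ((n + 1) * (n + 1)) := by
    have : 3 * (k * n) + (2 * k + 1) * (n + 1) ≤ (5 * k + 1) * (n + 1) := by nlinarith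
    calc attemptTime n k * (3 * (k * n) + (2 * k + 1) * (n + 1))
        ≤ attemptTime n k * ((5 * k + 1) * (n + 1)) := Nat.mul_le_mul_left _ this
      _ = _ := by unfold attemptTime; ring
  have h3 : (n + 1) * (n * pairTime k + 4) ≤ (pairTime k + 4) * ((n + 1) * (n + 1)) := by
    rw [show (pairTime k + 4) * ((n + 1) * (n + 1)) = (n + 1) * ((n + 1) * (pairTime k + 4)) by ring]
    exact Nat.mul_le_mul_left _ (by nlinarith)
  have h4 : slotTime n k ≤ (7 * k + 6) * ((n + 1) * (n + 1)) := by
    unfold slotTime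
    nlinarith [Nat.zero_le (k * n), Nat.zero_le (k * (n * n)), Nat.zero_le (n * n)]
  have h5 : 1 ≤ (n + 1) * (n + 1) := Nat.mul_pos (Nat.succ_pos _) (Nat.succ_pos _)
  calc scanTime n k + 1 + 2 * slotTime n k ≤ timeCoeff k * ((n + 1) * (n + 1)) := by
        unfold scanTime timeCoeff
        simp only [add_mul _ _ ((n + 1) * (n + 1)), mul_assoc 2 _ ((n + 1) * (n + 1))] at h3 h4 ⊢
        omega
    _ ≤ timeCoeff k * (2 * (n ^ 2 + 1)) := Nat.mul_le_mul_left _ h1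
    _ = _ := by ring

theorem pebbleProgram_spec (hℓ : ℓ < 2 * k) (edge : Fin m → Fin n × Fin n) : ∃ s,
    Exec (encodeInput k ℓ edge) pebbleProgram State.start s ∧
    s.time ≤ 60 * (10 * (m + 1) + 2 * timeCoeff k * (n ^ 2 + 1)) + 5 ∧
    s.space ≤ 16 * ((n * n + n + 1) * (2 * k + 2)) ∧ s.out.length ≤ 2 * timeCoeff k * (n ^ 2 + 1) ∧
    s.peak ≤ 16 * ((n * n + n + 1) * (2 * k + 2)) + 16 * (n * n + n * k + n + k + ℓ + m + 1) ∧
    ∃ (mvs : List (Move (Fin n) (Fin m) k)) (c : Config (Fin n) (Fin m) k) (out : List ℕ),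
      s.out = mvs.flatMap encodeMove ++ out ∧ DescribesConfig c out ∧
      IsCanonicalConstruction (endsOf edge) ℓ mvs c ∧
      IsMaximumSparse (endsOf edge) k ℓ c.edges := by
  have hG := pebbleEnv_isFor (k := k) (ℓ := ℓ) edge
  have hcoeff := scanTime_add_slotTime_le n k
  obtain ⟨s₀, hs₀, hrep₀⟩ := prologue_spec (k := k) (ℓ := ℓ) 60 edge
  -- The proof `rfl` evaluates the check that `60` units of machine time suffice for every
  -- elementary command.
  obtain ⟨s₁, σ₁, hs₁, hrep₁, -, h0, h1, h2, hA, ho, hBK, ht⟩ := Cmd.wp_sound hG.large readInput rfl hrep₀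
    (readInput_spec (Q := fun σ => σ.r 0 = k ∧ σ.r 1 = ℓ ∧ σ.r 2 = n ∧
      (∀ a, a ≠ 2 → ∀ x j, σ.A a x j = 0) ∧ σ.o = [] ∧ IsListed (endsOf edge) k (σ.A 2) m ∧
      σ.t ≤ 10 * (m + 1)) hG rfl
      fun σ h0 h1 h2 _ hA ho hBK ht => ⟨h0, h1, h2, hA, ho, hBK, ht⟩)
  -- Reading takes time of order `m`, so it is kept apart: nothing has been written by then, and
  -- afterwards the length of the output is bounded by the abstract time, which is of order `n ^ 2`.
  obtain ⟨s₂, σ₂, hs₂, hrep₂, hf, ht₂, mvs, c, out, hout, hdesc, hplay, hmax⟩ :=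
    Cmd.wp_sound hG.large buildAndOutput rfl hrep₁
    (processPairs_spec (ends := endsOf edge) (Q := outputConfig.wp (pebbleEnv n m k ℓ edge) fun σ =>
      σ.t ≤ σ₁.t + 2 * timeCoeff k * (n ^ 2 + 1) ∧
      ∃ (mvs : List (Move (Fin n) (Fin m) k)) (c : Config (Fin n) (Fin m) k) (out : List ℕ),
      σ.o = mvs.flatMap encodeMove ++ out ∧ DescribesConfig c out ∧
      IsCanonicalConstruction (endsOf edge) ℓ mvs c ∧ IsMaximumSparse (endsOf edge) k ℓ c.edges)
      hG hℓ h0 h1 h2 hA ho hBK fun σ c mvs h0 h2 hp hmax ht => outputConfig_spec hG h0 h2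
        fun σ' ho' ht' => ⟨by omega, mvs, c, _, by rw [ho', hp.out], hp.stored.describesConfig, hp.play, hmax⟩)
  refine ⟨s₂, .seq hs₀ (.seq hs₁ hs₂), ?_, hrep₂.core.space, ?_, hrep₂.core.peak, mvs, c, out,
    hrep₂.out.trans hout, hdesc, hplay, hmax⟩
  · have := hrep₂.time
    omega
  · have := hf.out
    rw [hrep₂.out]
    rw [ho, List.length_nil] at this
    omega

end Program
end PebbleGame

theorem mainTheorem7 :
    ∃ P : PebbleGame.Prog, ∀ k ℓ : ℕ, ℓ < 2 * k → ∃ K : ℕ,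
      ∀ (n m : ℕ) (edge : Fin m → Fin n × Fin n),
        ∃ s : PebbleGame.State,
          PebbleGame.Exec (PebbleGame.encodeInput k ℓ edge) P PebbleGame.State.start s ∧
          s.time ≤ K * (n ^ 2 + m + 1) ∧
          s.space + s.out.length ≤ K * (n ^ 2 + 1) ∧
          s.peak ≤ K * (n ^ 2 + m + 1) ∧
          ∃ (mvs : List (PebbleGame.Move (Fin n) (Fin m) k))
            (c : PebbleGame.Config (Fin n) (Fin m) k) (out : List ℕ),
            s.out = mvs.flatMap PebbleGame.encodeMove ++ out ∧
            PebbleGame.DescribesConfig c out ∧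
            PebbleGame.IsCanonicalConstruction (PebbleGame.endsOf edge) ℓ mvs c ∧
            PebbleGame.IsMaximumSparse (PebbleGame.endsOf edge) k ℓ c.edges ∧
            PebbleGame.IsPebbleDecomposition (PebbleGame.endsOf edge) c.edges k ℓ c.colorClass ∧
            (∀ i : Fin k, ((i : ℕ) < ℓ ∨ k ≤ ℓ) →
              PebbleGame.IsForest (PebbleGame.endsOf edge) (c.colorClass i)) ∧
            (PebbleGame.IsTight (PebbleGame.endsOf edge) k ℓ c.edges → ℓ ≤ k →
              PebbleGame.IsMapsAndTrees (PebbleGame.endsOf edge) c.edges k ℓ c.colorClass) ∧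
            (PebbleGame.IsTight (PebbleGame.endsOf edge) k ℓ c.edges → k ≤ ℓ →
              ∃ (color : Fin ℓ → Fin k) (T : Fin ℓ → Finset (Fin n)),
                (∀ j, T j ∈ PebbleGame.pieces (PebbleGame.endsOf edge) Finset.univ
                  (c.colorClass (color j))) ∧
                PebbleGame.IsProperTreeDecomposition (PebbleGame.endsOf edge) c.edges k ℓ T
                  (fun j => PebbleGame.spanned (PebbleGame.endsOf edge)
                    (c.colorClass (color j)) (T j))) := by
  -- The constant adds up the factors needed for time, space and the size of numbers, so that each
  -- bound follows by enlarging it.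
  refine ⟨PebbleGame.pebbleProgram, fun k ℓ hℓ => ⟨60 * (10 + 2 * PebbleGame.timeCoeff k) + 5 +
    32 * (2 * k + 2) + 16 * (2 * k + ℓ + 5), fun n m edge => ?_⟩⟩
  obtain ⟨s, hs, htime, hspace, hout, hpeak, mvs, c, out, ho, hdesc, hplay, hmax⟩ :=
    PebbleGame.pebbleProgram_spec hℓ edge
  have hgood : c.IsGood (PebbleGame.endsOf edge) ℓ := PebbleGame.Config.isGood_initial.play hplay
  have hn : n ≤ n ^ 2 := Nat.le_self_pow (by norm_num) n
  have hsq : n * n = n ^ 2 := (sq n).symm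
  have hR : 16 * ((n * n + n + 1) * (2 * k + 2)) ≤ 32 * (2 * k + 2) * (n ^ 2 + 1) := by
    rw [show 32 * (2 * k + 2) * (n ^ 2 + 1) = 16 * ((2 * (n ^ 2 + 1)) * (2 * k + 2)) by ring, hsq]
    gcongr
    omega
  refine ⟨s, hs, htime.trans ?_, (add_le_add hspace hout).trans ?_, hpeak.trans ?_, mvs, c, out, ho, hdesc,
    hplay, hmax, hgood.isPebbleDecomposition hℓ, hgood.forest, hgood.isMapsAndTrees,
    hgood.exists_isProperTreeDecomposition hℓ⟩
  · calc 60 * (10 * (m + 1) + 2 * PebbleGame.timeCoeff k * (n ^ 2 + 1)) + 5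
        ≤ 60 * (10 * (n ^ 2 + m + 1) + 2 * PebbleGame.timeCoeff k * (n ^ 2 + m + 1)) +
            5 * (n ^ 2 + m + 1) := by gcongr <;> omega
      _ = (60 * (10 + 2 * PebbleGame.timeCoeff k) + 5) * (n ^ 2 + m + 1) := by ring
      _ ≤ _ := Nat.mul_le_mul_right _ (by omega)
  · refine (Nat.add_le_add_right hR _).trans ?_
    rw [← add_mul]
    exact Nat.mul_le_mul_right _ (by omega)
  · calc _ ≤ 32 * (2 * k + 2) * (n ^ 2 + m + 1) + 16 * ((2 * k + ℓ + 5) * (n ^ 2 + m + 1)) := by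
          refine add_le_add (hR.trans (Nat.mul_le_mul_left _ (by omega))) (Nat.mul_le_mul_left _ ?_)
          rw [hsq]
          nlinarith [Nat.zero_le (k * n ^ 2), Nat.zero_le (k * m), Nat.zero_le (ℓ * n ^ 2),
            Nat.zero_le (ℓ * m), Nat.mul_le_mul_left k hn]
      _ = (32 * (2 * k + 2) + 16 * (2 * k + ℓ + 5)) * (n ^ 2 + m + 1) := by ring
      _ ≤ _ := Nat.mul_le_mul_right _ (by omega)
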